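/- **Setting.** Let $0<\alpha\le 1$ and let $\mathcal A$ be a finite or countable alphabet with a transition relation; $\Sigma^n$ is the set of admissible words of length $n$ and $\Sigma^{\mathbb N}$ the set of admissible sequences. Let $I_a\subset[0,1]$, $a\in\mathcal A$, be non-empty open intervals (overlaps are allowed) and for each admissible pair $ab$ let $g_{ab}:I_b\to I_a$ be differentiable, such that (1) there is $\kappa_+<1$ with $|g_{ab}'|\le\kappa_+$ for all $ab$, and for each $ab$ there is $\kappa_-(ab)\in(0,1)$ with $|g_{ab}'|\ge\kappa_-(ab)$; (2) there is $C$ with $\big|\log|g_{ab}'(x)|-\log|g_{ab}'(y)|\big|\le C|x-y|^\alpha$ for all $ab$ and $x,y\in I_b$. For a word $\mathbf a=a_1\dots a_n$ put $b(\mathbf a)=a_n$, $g_{\mathbf a}=g_{a_1a_2}\circ\dots\circ g_{a_{n-1}a_n}:I_{a_n}\to I_{a_1}$ (the identity if $n=1$) and $I_{\mathbf a}=g_{\mathbf a}(I_{a_n})$. Let $F=\bigcap_{n\ge1}\bigcup_{\mathbf a\in\Sigma^n}\overline{I_{\mathbf a}}$ be the attractor, $\pi:\Sigma^{\mathbb N}\to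 F$ the coding map and $X_{\mathbf a}(x,y)=-\log|g_{\mathbf a}'(x)|+\log|g_{\mathbf a}'(y)|$. Let $\phi:\Sigma^{\mathbb N}\to(-\infty,0)$ have summable variations and be normalised, $\sum_{a:\,az_0\text{ admissible}}e^{\phi(az)}=1$ for all $z\in\Sigma^{\mathbb N}$. Let $\nu$ be a probability measure on $\Sigma^{\mathbb N}$ with $\int f\,d\nu=\sum_a\int_{\{z:\,az_0\text{ admissible}\}}e^{\phi(az)}f(az)\,d\nu(z)$ for all measurable $f\ge0$, and suppose that the Gibbs measure $\mu=\pi_*\nu$ has no atoms. **Conditions.** *Light tail:* for some $\gamma_0>0$, $\sum_{a}\ \sup\{e^{\phi(az)}|g_{az_0}'(x)|^{-\gamma_0}: z\in\Sigma^{\mathbb N},\ az_0\text{ admissible},\ x\in I_{z_0}\}<\infty$. *(UNI):* there is $c_0>0$ such that for infinitely many $N$ and every $c\in\mathcal A$ there are $\mathbf a,\mathbf b\in\Sigma^N$ with $b(\mathbf a)=b(\mathbf b)=c$ and $|X_{\mathbf a}(x,y)-X_{\mathbf b}(x,y)|\ge c_0|x-y|^\alpha$ for all $x\ne y$ in $F\cap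 I_c$. *(MNL):* with $\delta=\dim_HF$, (i) the functions $\log|g_{ab}'|$ are $\delta$-Hölder, with a uniform constant; (ii) $\mu$ is the equilibrium state of the geometric potential $\delta\log|g'|$, in the sense that $\phi(z)=\delta\log|g_{z_0z_1}'(\pi(z_1z_2\dots))|+u(z)-u(z_1z_2\dots)-P$ on $\Sigma^{\mathbb N}$ with $u$ bounded and $P$ constant, where $P=0$ if the IFS has overlaps; (iii) there is $C>0$ such that for every $N\ge1$ and $c\in\mathcal A$ there are two words $\mathbf a,\mathbf b\in\Sigma^{N+1}$ (each a composition of $N$ branches) with $b(\mathbf a)=b(\mathbf b)=c$ and $$\mu\{x\in I_c:\ X_{\mathbf a}(x,x_0)-X_{\mathbf b}(x,x_0)\in J\}\le C|J|\quad\text{for all }x_0\in F\cap I_c\text{ and all compact intervals }J.$$ For $\mathbf a,\mathbf b\in\Sigma^n$ and $x,y$ in the domains of $g_{\mathbf a},g_{\mathbf b}$ let $$\Delta_n(\mathbf a,\mathbf b;x,y)=\big(\log|g_{\mathbf a}'(x)|-\log|g_{\mathbf b}'(x)|\big)-\big(\log|g_{\mathbf a}'(y)|-\log|g_{\mathbf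 b}'(y)|\big).$$ *(QNL) for weights* $(m_{\mathbf a})$: there are $\rho,\Theta\in(0,1)$ and $C>0$ such that for all $n\ge1$, all choices of reference points $x_{\mathbf c}\in I_{\mathbf c}$ ($\mathbf c\in\Sigma^n$) and all compact intervals $J$, $$\sum m_{\mathbf a}m_{\mathbf b}m_{\mathbf c}m_{\mathbf d}\,\mathbf 1_J\big(\Delta_n(\mathbf a,\mathbf b;x_{\mathbf c},x_{\mathbf d})\big)\le C\big(|J|^\Theta+\rho^n\big),$$ where the sum is over all $\mathbf a,\mathbf b,\mathbf c,\mathbf d\in\Sigma^n$ such that $g_{\mathbf a}$ and $g_{\mathbf b}$ can be evaluated at $x_{\mathbf c}$ and at $x_{\mathbf d}$. Here $g_{\mathbf a}$, $\mathbf a=a_1\dots a_n$, can be evaluated at $x_{\mathbf c}$, $\mathbf c=c_1\dots c_n$, if $x_{\mathbf c}\in I_{a_n}$, $a_1\dots a_{n-1}c_1$ is admissible and $g_{\mathbf a}=g_{a_1\dots a_{n-1}c_1}$ on $I_{a_n}\cap I_{c_1}$. **Theorem.** Suppose that either $\mathcal A$ is finite or $\phi$ has a light tail, and (UNI) holds;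 or that $\mathcal A$ is finite and (MNL) holds. Then (QNL) holds for the weights $m_{\mathbf a}=\nu([\mathbf a])$, the $\nu$-masses of the cylinders $[\mathbf a]\subset\Sigma^{\mathbb N}$. If the IFS has no overlaps (the intervals $I_{\mathbf a}$, $\mathbf a\in\Sigma^n$, are pairwise disjoint for each $n$), then (QNL) also holds for the weights $m_{\mathbf a}=\mu(I_{\mathbf a})$. -/

import Mathlib

open MeasureTheory Filter Topology Set
open scoped ENNReal

noncomputable section

/-- A `C^{1+α}` (graph-directed Markov) iterated function system over the alphabet `𝒜`, with
transition relation `adm`, vertex intervals `I_a = (l a, r a) ⊆ [0,1]` (which may overlap in any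
way) and, for each admissible pair `ab`, a contraction `g a b : I_b → I_a`. The values of `g a b`
outside `I_b`, or for non-admissible `ab`, play no role. The derivatives do not vanish, so every
`g a b` is a diffeomorphism onto its image, and the distortion bound makes `log |g_{ab}'|`
`α`-Hölder, so that `g a b` is of class `C^{1+α}`. -/
structure MarkovIFS (𝒜 : Type*) (α : ℝ) where
  adm : 𝒜 → 𝒜 → Prop
  l : 𝒜 → ℝ
  r : 𝒜 → ℝ
  l_nonneg : ∀ a, 0 ≤ l a
  l_lt_r : ∀ a, l a < r a
  r_le_one : ∀ a, r a ≤ 1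
  g : 𝒜 → 𝒜 → ℝ → ℝ
  mapsTo : ∀ a b, adm a b → MapsTo (g a b) (Ioo (l b) (r b)) (Ioo (l a) (r a))
  differentiableOn : ∀ a b, adm a b → DifferentiableOn ℝ (g a b) (Ioo (l b) (r b))
  /-- uniform `κ₊`-contraction -/
  upper_contraction : ∃ κ : ℝ, 0 < κ ∧ κ < 1 ∧
    ∀ a b, adm a b → ∀ x ∈ Ioo (l b) (r b), |deriv (g a b) x| ≤ κ
  /-- the lower bounds `κ₋(ab)` -/
  lower_contraction : ∀ a b, adm a b → ∃ κ : ℝ, 0 < κ ∧ κ < 1 ∧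
    ∀ x ∈ Ioo (l b) (r b), κ ≤ |deriv (g a b) x|
  /-- bounded `(C,α)`-distortion -/
  distortion : ∃ C : ℝ, 0 < C ∧ ∀ a b, adm a b →
    ∀ x ∈ Ioo (l b) (r b), ∀ y ∈ Ioo (l b) (r b),
      |(Real.log |deriv (g a b) x| - Real.log |deriv (g a b) y|)| ≤ C * |x - y| ^ α

namespace MarkovIFS

variable {𝒜 : Type*} {α : ℝ} (Φ : MarkovIFS 𝒜 α)

/-- The open interval `I_a`. -/
def I (a : 𝒜) : Set ℝ := Ioo (Φ.l a) (Φ.r a)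

/-- `Σ^n`: the admissible words of length `n`. -/
def Words (n : ℕ) : Type _ := {w : List 𝒜 // w.length = n ∧ w.IsChain Φ.adm}

/-- `g_{a₁…aₙ} = g_{a₁a₂} ∘ ⋯ ∘ g_{aₙ₋₁aₙ}`; a one-letter word acts as the identity. -/
def gWord : List 𝒜 → ℝ → ℝ
  | [] => id
  | [_] => id
  | a :: b :: w => Φ.g a b ∘ gWord (b :: w)

/-- The domain `I_{b(a)}` of `g_a`, where `b(a)` is the last letter of the word. -/
def dom (w : List 𝒜) : Set ℝ := {x | ∃ c ∈ w.getLast?, x ∈ Φ.I c}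

/-- `I_a = g_a(I_{b(a)})` for a word `a`. -/
def cylInterval (w : List 𝒜) : Set ℝ := Φ.gWord w '' Φ.dom w

/-- The attractor `F = ⋂_{n ≥ 1} ⋃_{a ∈ Σ^n} closure I_a`. -/
def attractor : Set ℝ :=
  ⋂ n : ℕ, ⋂ _ : 1 ≤ n, ⋃ w : Φ.Words n, closure (Φ.cylInterval w.1)

/-- `τ(g_a(x)) = -log |g_a'(x)|`. -/
def tau (w : List 𝒜) (x : ℝ) : ℝ := -Real.log |deriv (Φ.gWord w) x|

/-- The fluctuation `X_a(x,y) = τ(g_a(x)) - τ(g_a(y))`. -/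
def X (w : List 𝒜) (x y : ℝ) : ℝ := Φ.tau w x - Φ.tau w y

/-- `Δ_n((a,x),(b,y)) = (log|g_a'(x)| - log|g_b'(x)|) - (log|g_a'(y)| - log|g_b'(y)|)`. -/
def Delta (a b : List 𝒜) (x y : ℝ) : ℝ :=
  (Real.log |deriv (Φ.gWord a) x| - Real.log |deriv (Φ.gWord b) x|)
    - (Real.log |deriv (Φ.gWord a) y| - Real.log |deriv (Φ.gWord b) y|)

/-- The IFS has no overlaps: distinct words of the same length have disjoint intervals. -/
def NoOverlap : Prop :=
  ∀ n : ℕ, ∀ a b : Φ.Words n, a ≠ b → Disjoint (Φ.cylInterval a.1) (Φ.cylInterval b.1)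

/-- The one-sided shift space `Σ^ℕ`, as a subset of all sequences. -/
def shiftSpace : Set (ℕ → 𝒜) := {z | ∀ j, Φ.adm (z j) (z (j + 1))}

end MarkovIFS

/-- The sequence `a z₀ z₁ z₂ …`. -/
def consSeq {𝒜 : Type*} (a : 𝒜) (z : ℕ → 𝒜) : ℕ → 𝒜
  | 0 => a
  | n + 1 => z n

/-- The left shift. -/
def shiftSeq {𝒜 : Type*} (z : ℕ → 𝒜) : ℕ → 𝒜 := fun n => z (n + 1)

/-- The cylinder `[a]` of sequences that start with the word `a`. -/
def cyl {𝒜 : Type*} (w : List 𝒜) : Set (ℕ → 𝒜) := {z | ∀ i : Fin w.length, z i = w.get i}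

namespace MarkovIFS

variable {𝒜 : Type*} {α : ℝ} (Φ : MarkovIFS 𝒜 α)

/-- The coding map `π(z) = lim_n g_{z₀…zₙ}(m_{zₙ})`, `m_a` the midpoint of `I_a`. On `Σ^ℕ` the
limit exists, and it is the only point of `⋂_n closure I_{z₀…zₙ}`. -/
def coding (z : ℕ → 𝒜) : ℝ :=
  limUnder atTop fun n : ℕ =>
    Φ.gWord (List.ofFn fun i : Fin (n + 1) => z i) ((Φ.l (z n) + Φ.r (z n)) / 2)

/-- The potential `φ` (a function on `Σ^ℕ`; a potential on `F` is composed with the coding map)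
has summable variations. -/
def SummableVariations (φ : (ℕ → 𝒜) → ℝ) : Prop :=
  ∃ v : ℕ → ℝ, Summable v ∧ ∀ n, 2 ≤ n → ∀ z ∈ Φ.shiftSpace, ∀ z' ∈ Φ.shiftSpace,
    (∀ i < n, z i = z' i) → |φ z - φ z'| ≤ v n

/-- `φ` is normalised: `φ < 0` and `ℒ_φ 1 = 1`. -/
def IsNormalized (φ : (ℕ → 𝒜) → ℝ) : Prop :=
  ∀ z ∈ Φ.shiftSpace, φ z < 0 ∧
    HasSum (fun a : {a : 𝒜 // Φ.adm a (z 0)} => Real.exp (φ (consSeq a.1 z))) 1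

/-- The measure `ν` lives on `Σ^ℕ` and satisfies `φ`-conformality
`∫ f dν = ∑_{ab} ∫_{[b]} e^{φ(az)} f(az) dν(z)`. -/
structure IsGibbs [MeasurableSpace 𝒜] (φ : (ℕ → 𝒜) → ℝ) (ν : Measure (ℕ → 𝒜)) : Prop where
  supported : ∀ᵐ z ∂ν, z ∈ Φ.shiftSpace
  conformal : ∀ f : (ℕ → 𝒜) → ℝ≥0∞, Measurable f →
    ∫⁻ z, f z ∂ν =
      ∑' a : 𝒜, ∫⁻ z in {z | Φ.adm a (z 0)},
        ENNReal.ofReal (Real.exp (φ (consSeq a z))) * f (consSeq a z) ∂ν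

/-- The Gibbs measure `μ` on the attractor: the projection of the symbolic one. -/
def proj [MeasurableSpace 𝒜] (ν : Measure (ℕ → 𝒜)) : Measure ℝ := ν.map Φ.coding

/-- Light tail: `∑_a sup_{b : ab admissible} sup e^{φ} |g_{ab}'|^{-γ₀} < ∞` for some `γ₀ > 0`. -/
def LightTail (φ : (ℕ → 𝒜) → ℝ) : Prop :=
  ∃ γ₀ : ℝ, 0 < γ₀ ∧ ∃ q : 𝒜 → ℝ, Summable q ∧
    ∀ a, ∀ z ∈ Φ.shiftSpace, Φ.adm a (z 0) → ∀ x ∈ Φ.I (z 0),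
      Real.exp (φ (consSeq a z)) * |deriv (Φ.g a (z 0)) x| ^ (-γ₀) ≤ q a

/-- `(c₀,α)`-Uniform Non-Integrability (for some `c₀ > 0`). -/
def UNI : Prop :=
  ∃ c₀ : ℝ, 0 < c₀ ∧ ∃ᶠ N : ℕ in atTop, ∀ c : 𝒜, ∃ a b : Φ.Words N,
    a.1.getLast? = some c ∧ b.1.getLast? = some c ∧
    ∀ x ∈ Φ.attractor ∩ Φ.I c, ∀ y ∈ Φ.attractor ∩ Φ.I c, x ≠ y →
      c₀ * |x - y| ^ α ≤ |Φ.X a.1 x y - Φ.X b.1 x y|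

/-- `δ = dim_H F`. -/
def dim : ℝ := (dimH Φ.attractor).toReal

/-- The continuous extension of `log |g_{ab}'|` from `I_b` to the closure of `I_b`. -/
def logDeriv (a b : 𝒜) (x : ℝ) : ℝ :=
  limUnder (𝓝[Φ.I b] x) fun y => Real.log |deriv (Φ.g a b) y|

/-- The normalised potential `φ` is cohomologous, up to the constant `P` (the pressure), to the
geometric potential `δ log |g'|` with `δ = dim_H F`; that is, the Gibbs measure of `φ` is the
equilibrium state of the geometric potential. -/
def IsGeometric (φ : (ℕ → 𝒜) → ℝ) (P : ℝ) : Prop :=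
  ∃ u : (ℕ → 𝒜) → ℝ, ∃ B : ℝ, ∀ z ∈ Φ.shiftSpace, |u z| ≤ B ∧
    φ z = Φ.dim * Φ.logDeriv (z 0) (z 1) (Φ.coding (shiftSeq z)) + u z - u (shiftSeq z) - P

/-- Measure Non-Linearity: with `δ = dim_H F`, the roof function is `δ`-Hölder, `μ` is the
equilibrium state of the geometric potential (of pressure zero if the IFS has overlaps), and for
every `N ≥ 1` and every last letter `c` there are two words, each a composition of `N` branches,
for which the push-forward of `μ` under `X_a(·,x₀) - X_b(·,x₀)` has density at most `C`. -/
def MNL [MeasurableSpace 𝒜] (φ : (ℕ → 𝒜) → ℝ) (ν : Measure (ℕ → 𝒜)) : Prop :=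
  (∃ C : ℝ, ∀ a b, Φ.adm a b → ∀ x ∈ Φ.I b, ∀ y ∈ Φ.I b,
      |(Real.log |deriv (Φ.g a b) x| - Real.log |deriv (Φ.g a b) y|)| ≤ C * |x - y| ^ Φ.dim) ∧
  (∃ P : ℝ, Φ.IsGeometric φ P ∧ (P = 0 ∨ Φ.NoOverlap)) ∧
  ∃ C : ℝ, 0 < C ∧ ∀ N : ℕ, 1 ≤ N → ∀ c : 𝒜, ∃ a b : Φ.Words (N + 1),
    a.1.getLast? = some c ∧ b.1.getLast? = some c ∧
    ∀ x₀ ∈ Φ.attractor ∩ Φ.I c, ∀ s t : ℝ, s ≤ t →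
      Φ.proj ν {x | x ∈ Φ.I c ∧ Φ.X a.1 x x₀ - Φ.X b.1 x x₀ ∈ Icc s t}
        ≤ ENNReal.ofReal (C * (t - s))

/-- `g_a` can be evaluated at the point `x` of `I_c`: `x` lies in the domain `I_{b(a)}` of `g_a`,
and after replacing the last letter of `a` by the first letter of `c` the word is still admissible
and still represents the same map. If `b(a)` is the first letter of `c`, or if the branches are
restrictions `g_{ab} = g_a|_{I_b}` of maps `g_a` and all transitions are allowed, then this just
says that `x ∈ I_{b(a)}`. -/
def Acts (a c : List 𝒜) (x : ℝ) : Prop :=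
  ∃ e ∈ a.getLast?, ∃ f ∈ c.head?, x ∈ Φ.I e ∧ (a.dropLast ++ [f]).IsChain Φ.adm ∧
    EqOn (Φ.gWord a) (Φ.gWord (a.dropLast ++ [f])) (Φ.I e ∩ Φ.I f)

open Classical in
/-- Quantitative Non-Linearity with respect to the weights `m(a)`, `a ∈ Σ^n`. The sum is over all
quadruples of words of length `n` for which `Δ_n` is defined; `x_c ∈ I_c` are arbitrary reference
points (such as the centres), and the constants do not depend on their choice. -/
def QNL (m : List 𝒜 → ℝ≥0∞) : Prop :=
  ∃ ρ Θ C : ℝ, 0 < ρ ∧ ρ < 1 ∧ 0 < Θ ∧ Θ < 1 ∧ 0 < C ∧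
    ∀ n : ℕ, 1 ≤ n → ∀ x : Φ.Words n → ℝ, (∀ c, x c ∈ Φ.cylInterval c.1) →
      ∀ s t : ℝ, s ≤ t →
        (∑' (a : Φ.Words n) (b : Φ.Words n) (c : Φ.Words n) (d : Φ.Words n),
          if (Φ.Acts a.1 c.1 (x c) ∧ Φ.Acts a.1 d.1 (x d) ∧
              Φ.Acts b.1 c.1 (x c) ∧ Φ.Acts b.1 d.1 (x d)) ∧
              Φ.Delta a.1 b.1 (x c) (x d) ∈ Icc s t
          then m a.1 * m b.1 * m c.1 * m d.1 else 0)
        ≤ ENNReal.ofReal (C * ((t - s) ^ Θ + ρ ^ n))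

end MarkovIFS

end

/-! Over a base sequence `y`, the words of length `m` carry the weights exp(S_m φ) (`W`), which sum
to 1 by normalisation: they describe a random inverse branch. Up to terms exponentially small in
`n`, the sum in (QNL) is the probability that the fluctuation of log|g_a'| between two independent
`ν`-random points falls into a window of length |J|; the second word `b` only moves that window. So
it suffices to bound the Lévy concentration function of the fluctuation, averaged over pairs of
points (`qnl_of_lintegral_avgConc_le`). Reference points are exchanged for coded points by bounded
distortion. With overlaps, the last letter `e` of a word need not be the first letter of the
sequence coding the point; `Acts` carries the branch over, unless the point is close to an end point
of I_e. That event is rare because `μ` is Hölder regular (`Tail.frostman`), which follows from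
self-similarity, the absence of atoms and the light tail through a renewal inequality for truncated
Hölder constants.

Under (UNI), concentration is bounded pointwise by a tree recursion (`UNI.exists_conc_le`). Over
each base letter, two blocks of some fixed length have fluctuations c₀|x-y|^α apart, whereas
everything prefixed to a block changes the fluctuation by a small fraction of |x-y|^α. A window much
shorter than |x-y|^α is therefore missed by at least one of the two subtrees, and a fixed proportion
of the mass is lost at every block, until the images of the two points are so close that the window
is no longer short. Hölder regularity of `μ` takes care of pairs that are close from the start.

Under (MNL), the characteristic function of the fluctuation is shown to decay in mean square
(`Regular.exists_lintegral_norm_psi_sq_le`), by a Dolgopyat-type argument in which scales are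
measured by mass instead of length. The geometric potential gives diam^δ ≤ const · mass for
cylinders, provided that its pressure is not positive; without overlaps this sign comes from the
mass distribution principle (`NoOverlap.pressure_nonpos`). A δ-Hölder phase at effective frequency
`X` thus varies by O(1) on cylinders of mass 1/X. By the density bound in (MNL), the two
distinguished branches are in phase on at most half of such a cylinder. On the other half there is
cancellation, so a majorant that is constant on stopping cylinders loses a fixed factor in L²
(`exists_improved_majorant`, `Regular.exists_majorant_step`). Iterating over about log|b| blocks
gives polynomial decay in `b`, and Gaussian smoothing turns this into a bound for the averaged
concentration function.

Without overlaps π(z) lies almost surely in exactly one I_a with `a` of length `n`, the one of its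
own prefix, so that μ(I_a) = ν([a]) and the second assertion follows from the first. -/

/-! ### Words and sequences -/

section Symbolic

variable {𝒜 : Type*}

/-- The sequence `w z₀ z₁ …`. -/
def app : List 𝒜 → (ℕ → 𝒜) → (ℕ → 𝒜)
  | [], z => z
  | a :: w, z => consSeq a (app w z)

/-- Words of length `m`. -/
abbrev Vec (𝒜 : Type*) (m : ℕ) : Type _ := {w : List 𝒜 // w.length = m}

@[simp] lemma app_nil (z : ℕ → 𝒜) : app [] z = z := rfl

@[simp] lemma app_cons (a : 𝒜) (w : List 𝒜) (z : ℕ → 𝒜) : app (a :: w) z = consSeq a (app w z) := rfl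

lemma app_append (u v : List 𝒜) (z : ℕ → 𝒜) : app (u ++ v) z = app u (app v z) := by
  induction u with
  | nil => rfl
  | cons a u ih => simp [ih]

@[simp] lemma consSeq_zero (a : 𝒜) (z : ℕ → 𝒜) : consSeq a z 0 = a := rfl

@[simp] lemma consSeq_succ (a : 𝒜) (z : ℕ → 𝒜) (n : ℕ) : consSeq a z (n + 1) = z n := rfl

@[simp] lemma shiftSeq_consSeq (a : 𝒜) (z : ℕ → 𝒜) : shiftSeq (consSeq a z) = z := rfl

lemma consSeq_shiftSeq (z : ℕ → 𝒜) : consSeq (z 0) (shiftSeq z) = z := by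
  funext n; cases n <;> rfl

@[simp] lemma shiftSeq_apply (z : ℕ → 𝒜) (n : ℕ) : shiftSeq z n = z (n + 1) := rfl

lemma app_zero (w : List 𝒜) (z : ℕ → 𝒜) : app w z 0 = w.headD (z 0) := by
  cases w <;> rfl

@[simp] lemma cyl_nil : cyl ([] : List 𝒜) = univ := by
  ext z; simp [cyl]

lemma mem_cyl_cons {a : 𝒜} {w : List 𝒜} {z : ℕ → 𝒜} :
    z ∈ cyl (a :: w) ↔ z 0 = a ∧ shiftSeq z ∈ cyl w := by
  simp only [cyl, mem_ofPred_eq, List.length_cons]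
  rw [Fin.forall_fin_succ]
  simp

@[simp] lemma consSeq_mem_cyl_cons {a b : 𝒜} {w : List 𝒜} {z : ℕ → 𝒜} :
    consSeq b z ∈ cyl (a :: w) ↔ b = a ∧ z ∈ cyl w := by
  rw [mem_cyl_cons]; simp

lemma mem_cyl_singleton {a : 𝒜} {z : ℕ → 𝒜} : z ∈ cyl [a] ↔ z 0 = a := by
  rw [mem_cyl_cons]; simp

lemma app_mem_cyl_append {u v : List 𝒜} {z : ℕ → 𝒜} : app u z ∈ cyl (u ++ v) ↔ z ∈ cyl v := by
  induction u with
  | nil => simp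
  | cons a u ih => simpa using ih

lemma cyl_append_subset (u v : List 𝒜) : cyl (u ++ v) ⊆ cyl u := by
  induction u with
  | nil => simp
  | cons a u ih =>
    intro z hz
    rw [List.cons_append, mem_cyl_cons] at hz
    exact mem_cyl_cons.2 ⟨hz.1, ih hz.2⟩

lemma exists_app_of_mem_cyl {w : List 𝒜} {z : ℕ → 𝒜} (h : z ∈ cyl w) :
    z = app w (fun i => z (i + w.length)) := by
  induction w generalizing z with
  | nil => rfl
  | cons a w ih =>
    rw [mem_cyl_cons] at h
    have := ih h.2
    rw [app_cons]
    conv_lhs => rw [← consSeq_shiftSeq z, h.1, this]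
    congr 1
    
/-- The first `n` letters of a sequence. -/
def pre : ℕ → (ℕ → 𝒜) → List 𝒜
  | 0, _ => []
  | n + 1, z => z 0 :: pre n (shiftSeq z)

@[simp] lemma length_pre (n : ℕ) (z : ℕ → 𝒜) : (pre n z).length = n := by
  induction n generalizing z with
  | zero => rfl
  | succ n ih => simp [pre, ih]

lemma mem_cyl_pre (n : ℕ) (z : ℕ → 𝒜) : z ∈ cyl (pre n z) := by
  induction n generalizing z with
  | zero => simp [pre]
  | succ n ih => exact mem_cyl_cons.2 ⟨rfl, ih _⟩

lemma mem_cyl_iff_pre {w : List 𝒜} {z : ℕ → 𝒜} : z ∈ cyl w ↔ pre w.length z = w := by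
  induction w generalizing z with
  | nil => simp [pre]
  | cons a w ih => rw [mem_cyl_cons, ih]; simp [pre]

lemma app_pre (n : ℕ) (z : ℕ → 𝒜) : app (pre n z) (fun i => z (i + n)) = z := by
  have := exists_app_of_mem_cyl (mem_cyl_pre n z)
  rw [length_pre] at this
  exact this.symm

lemma pre_succ_eq_append (n : ℕ) (z : ℕ → 𝒜) : pre (n + 1) z = pre n z ++ [z n] := by
  induction n generalizing z with
  | zero => rfl
  | succ n ih =>
    conv_lhs => rw [pre, ih]
    rfl

lemma ofFn_eq_pre (n : ℕ) (z : ℕ → 𝒜) : (List.ofFn fun i : Fin n => z i) = pre n z := by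
  induction n generalizing z with
  | zero => rfl
  | succ n ih => rw [List.ofFn_succ, pre, ← ih]; rfl

lemma pre_congr {n : ℕ} {z z' : ℕ → 𝒜} (h : pre n z = pre n z') {k : ℕ} (hk : k ≤ n) :
    pre k z = pre k z' := by
  induction k generalizing n z z' with
  | zero => rfl
  | succ k ih =>
    obtain ⟨n, rfl⟩ := Nat.exists_eq_add_of_le' (Nat.lt_of_lt_of_le (Nat.succ_pos k) hk)
    simp only [pre, List.cons.injEq] at h ⊢
    exact ⟨h.1, ih h.2 (by omega)⟩

lemma apply_eq_of_pre {n : ℕ} {z z' : ℕ → 𝒜} (h : pre n z = pre n z') {i : ℕ} (hi : i < n) :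
    z i = z' i := by
  have h1 := pre_congr h (show i + 1 ≤ n from hi)
  rw [pre_succ_eq_append, pre_succ_eq_append] at h1
  simpa using (List.append_inj' h1 rfl).2

lemma pre_app_add (w : List 𝒜) (z : ℕ → 𝒜) (n : ℕ) :
    pre (n + w.length) (app w z) = w ++ pre n z := by
  induction w with
  | nil => rfl
  | cons a w ih =>
    rw [List.length_cons, ← add_assoc, pre, app_cons, shiftSeq_consSeq, ih]; rfl

/-- Splitting a word of length `m + k` into its first `m` and its last `k` letters. -/
def vecSplit (m k : ℕ) : Vec 𝒜 k × Vec 𝒜 m ≃ Vec 𝒜 (m + k) where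
  toFun p := ⟨p.2.1 ++ p.1.1, by simp [p.1.2, p.2.2]⟩
  invFun w := (⟨w.1.drop m, by simp [w.2]⟩, ⟨w.1.take m, by simp [w.2]⟩)
  left_inv := by
    rintro ⟨⟨u, hu⟩, ⟨v, hv⟩⟩
    subst hv
    simp
  right_inv := by
    rintro ⟨w, hw⟩
    simp

/-- The outer sum runs over the letters next to the base sequence, that is, over the part of the
inverse branch that is applied first. The recursions below condition on this block. -/
lemma tsum_vec_add (m k : ℕ) (F : List 𝒜 → ℝ≥0∞) :
    ∑' w : Vec 𝒜 (m + k), F w.1 = ∑' u : Vec 𝒜 k, ∑' v : Vec 𝒜 m, F (v.1 ++ u.1) := by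
  rw [← (vecSplit m k).tsum_eq]
  exact ENNReal.tsum_prod (f := fun (u : Vec 𝒜 k) (v : Vec 𝒜 m) => F (v.1 ++ u.1))

lemma tsum_vec_zero (F : List 𝒜 → ℝ≥0∞) : ∑' w : Vec 𝒜 0, F w.1 = F [] := by
  have : ∀ w : Vec 𝒜 0, w.1 = [] := fun w => List.length_eq_zero_iff.1 w.2
  let : Unique (Vec 𝒜 0) := ⟨⟨⟨[], rfl⟩⟩, fun w => Subtype.ext (this w)⟩
  rw [tsum_eq_single default (fun b hb => absurd (Subsingleton.elim _ _) hb)]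
  rfl

/-- One-letter words. -/
def vecOne : 𝒜 ≃ Vec 𝒜 1 where
  toFun a := ⟨[a], rfl⟩
  invFun w := w.1.head (by intro h; have := w.2; simp [h] at this)
  left_inv _ := rfl
  right_inv := by
    rintro ⟨w, hw⟩
    obtain ⟨a, rfl⟩ := List.length_eq_one_iff.1 hw
    rfl

lemma tsum_vec_one (F : List 𝒜 → ℝ≥0∞) : ∑' w : Vec 𝒜 1, F w.1 = ∑' a, F [a] := by
  rw [← vecOne.tsum_eq]; rfl

lemma tsum_vec_succ (m : ℕ) (F : List 𝒜 → ℝ≥0∞) :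
    ∑' w : Vec 𝒜 (m + 1), F w.1 = ∑' a, ∑' v : Vec 𝒜 m, F (v.1 ++ [a]) := by
  rw [tsum_vec_add, tsum_vec_one (fun u => ∑' v : Vec 𝒜 m, F (v.1 ++ u))]

lemma tsum_vec_succ' (m : ℕ) (F : List 𝒜 → ℝ≥0∞) :
    ∑' w : Vec 𝒜 (1 + m), F w.1 = ∑' v : Vec 𝒜 m, ∑' a, F (a :: v.1) := by
  rw [tsum_vec_add]
  refine tsum_congr fun v => ?_
  rw [tsum_vec_one (fun u => F (u ++ v.1))]; rfl

lemma iUnion_cyl_vec (m : ℕ) : (⋃ w : Vec 𝒜 m, cyl w.1) = univ :=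
  eq_univ_of_forall fun z => mem_iUnion.2 ⟨⟨pre m z, length_pre m z⟩, mem_cyl_pre m z⟩

lemma disjoint_cyl_vec (m : ℕ) : Pairwise (Function.onFun Disjoint fun w : Vec 𝒜 m => cyl w.1) := by
  intro u v huv
  refine Set.disjoint_left.2 fun z hu hv => huv (Subtype.ext ?_)
  rw [mem_cyl_iff_pre] at hu hv
  rw [← hu, ← hv, u.2, v.2]

variable [MeasurableSpace 𝒜]

lemma measurable_consSeq (a : 𝒜) : Measurable (consSeq a) := by
  refine measurable_pi_lambda _ fun n => ?_
  cases n with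
  | zero => exact measurable_const
  | succ n => exact measurable_pi_apply n

lemma measurable_shiftSeq : Measurable (shiftSeq : (ℕ → 𝒜) → (ℕ → 𝒜)) :=
  measurable_pi_lambda _ fun n => measurable_pi_apply (n + 1)

lemma measurable_app (w : List 𝒜) : Measurable (app w) := by
  induction w with
  | nil => exact measurable_id
  | cons a w ih => exact (measurable_consSeq a).comp ih

variable [DiscreteMeasurableSpace 𝒜]

lemma measurableSet_cyl (w : List 𝒜) : MeasurableSet (cyl w) := by
  have : cyl w = ⋂ i : Fin w.length, (fun z : ℕ → 𝒜 => z i) ⁻¹' {w.get i} := by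
    ext z; simp [cyl]
  rw [this]
  exact MeasurableSet.iInter fun i => measurable_pi_apply _ (MeasurableSet.of_discrete)

variable [Countable 𝒜]

/-- Any preimage is a union of cylinders of length `n`, and there are only countably many of these.
-/
lemma measurable_of_pre (n : ℕ) {β : Type*} [MeasurableSpace β] (F : List 𝒜 → β) :
    Measurable fun z : ℕ → 𝒜 => F (pre n z) := by
  intro s _
  have : (fun z : ℕ → 𝒜 => F (pre n z)) ⁻¹' s = ⋃ w : {w : Vec 𝒜 n // F w.1 ∈ s}, cyl w.1.1 := by
    ext z
    simp only [mem_preimage, mem_iUnion]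
    constructor
    · intro h
      exact ⟨⟨⟨pre n z, length_pre n z⟩, h⟩, mem_cyl_pre n z⟩
    · rintro ⟨⟨⟨w, hw⟩, hF⟩, hz⟩
      rw [mem_cyl_iff_pre] at hz
      subst hw
      rw [hz]; exact hF
  rw [this]
  exact MeasurableSet.iUnion fun w => measurableSet_cyl _

/-- Only the domain of integration is split, so `f` need not be measurable. This matters for
integrands such as `avgConc`, which contain a supremum over an uncountable family of windows. -/
lemma lintegral_eq_tsum_cyl (ν : Measure (ℕ → 𝒜)) (m : ℕ) (f : (ℕ → 𝒜) → ℝ≥0∞) :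
    ∫⁻ z, f z ∂ν = ∑' w : Vec 𝒜 m, ∫⁻ z in cyl w.1, f z ∂ν := by
  rw [← lintegral_iUnion (fun w => measurableSet_cyl _) (disjoint_cyl_vec m), iUnion_cyl_vec,
    Measure.restrict_univ]

lemma lintegral_eq_tsum_letter (ν : Measure (ℕ → 𝒜)) (f : (ℕ → 𝒜) → ℝ≥0∞) :
    ∫⁻ z, f z ∂ν = ∑' a, ∫⁻ z in cyl [a], f z ∂ν := by
  rw [lintegral_eq_tsum_cyl ν 1, tsum_vec_one (fun w => ∫⁻ z in cyl w, f z ∂ν)]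

end Symbolic

/-! ### Transfer weights and conformality -/

namespace MarkovIFS

variable {𝒜 : Type*} {α : ℝ} (Φ : MarkovIFS 𝒜 α)

lemma consSeq_mem_shiftSpace {a : 𝒜} {z : ℕ → 𝒜} :
    consSeq a z ∈ Φ.shiftSpace ↔ Φ.adm a (z 0) ∧ z ∈ Φ.shiftSpace := by
  constructor
  · intro h
    exact ⟨h 0, fun j => h (j + 1)⟩
  · rintro ⟨h0, h⟩ j
    cases j with
    | zero => exact h0
    | succ j => exact h j

/-- The word `w` can be prepended to the letter `c`. -/
def AdmW : List 𝒜 → 𝒜 → Prop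
  | [], _ => True
  | a :: w, c => Φ.adm a (w.headD c) ∧ AdmW w c

lemma app_mem_shiftSpace {w : List 𝒜} {z : ℕ → 𝒜} :
    app w z ∈ Φ.shiftSpace ↔ Φ.AdmW w (z 0) ∧ z ∈ Φ.shiftSpace := by
  induction w with
  | nil => simp [AdmW]
  | cons a w ih => rw [app_cons, consSeq_mem_shiftSpace, ih, AdmW, app_zero, and_assoc]

lemma admW_append {u v : List 𝒜} {c : 𝒜} :
    Φ.AdmW (u ++ v) c ↔ Φ.AdmW u (v.headD c) ∧ Φ.AdmW v c := by
  induction u with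
  | nil => simp [AdmW]
  | cons a u ih =>
    have : (u ++ v).headD c = u.headD (v.headD c) := by cases u <;> rfl
    rw [List.cons_append, AdmW, AdmW, ih, this, and_assoc]

lemma isChain_append_singleton {w : List 𝒜} {c : 𝒜} :
    (w ++ [c]).IsChain Φ.adm ↔ Φ.AdmW w c := by
  induction w with
  | nil => simp [AdmW]
  | cons a w ih =>
    rw [AdmW, ← ih]
    cases w with
    | nil => simp
    | cons b w => simp [List.isChain_cons_cons]

/-- `e^φ` on the shift space, and `0` elsewhere. -/
noncomputable def om (φ : (ℕ → 𝒜) → ℝ) : (ℕ → 𝒜) → ℝ≥0∞ :=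
  Φ.shiftSpace.indicator fun z => ENNReal.ofReal (Real.exp (φ z))

/-- `exp (S_{|w|} φ (w z))`, or `0` if `w z` is not admissible. -/
noncomputable def W (φ : (ℕ → 𝒜) → ℝ) : List 𝒜 → (ℕ → 𝒜) → ℝ≥0∞
  | [], _ => 1
  | a :: w, z => Φ.om φ (app (a :: w) z) * W φ w z

variable {φ : (ℕ → 𝒜) → ℝ}

lemma om_of_mem {z : ℕ → 𝒜} (h : z ∈ Φ.shiftSpace) :
    Φ.om φ z = ENNReal.ofReal (Real.exp (φ z)) := indicator_of_mem h _

lemma om_of_notMem {z : ℕ → 𝒜} (h : z ∉ Φ.shiftSpace) : Φ.om φ z = 0 := indicator_of_notMem h _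

lemma om_ne_zero {z : ℕ → 𝒜} : Φ.om φ z ≠ 0 ↔ z ∈ Φ.shiftSpace := by
  refine ⟨fun h => by_contra fun h' => h (Φ.om_of_notMem h'), fun h => ?_⟩
  rw [Φ.om_of_mem h]
  simp [Real.exp_pos]

lemma om_ne_top {z : ℕ → 𝒜} : Φ.om φ z ≠ ∞ := by
  by_cases h : z ∈ Φ.shiftSpace
  · rw [Φ.om_of_mem h]; simp
  · rw [Φ.om_of_notMem h]; simp

lemma W_append (u v : List 𝒜) (z : ℕ → 𝒜) : Φ.W φ (u ++ v) z = Φ.W φ u (app v z) * Φ.W φ v z := by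
  induction u with
  | nil => simp [W]
  | cons a u ih => rw [List.cons_append, W, W, ih, app_cons, app_cons, app_append, mul_assoc]

lemma W_ne_zero {w : List 𝒜} {z : ℕ → 𝒜} (hz : z ∈ Φ.shiftSpace) :
    Φ.W φ w z ≠ 0 ↔ app w z ∈ Φ.shiftSpace := by
  induction w with
  | nil => simpa [W] using hz
  | cons a w ih =>
    rw [W, mul_ne_zero_iff, om_ne_zero, ih, and_iff_left_iff_imp]
    intro h
    exact (Φ.consSeq_mem_shiftSpace.1 h).2

lemma W_ne_top {w : List 𝒜} {z : ℕ → 𝒜} : Φ.W φ w z ≠ ∞ := by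
  induction w with
  | nil => simp [W]
  | cons a w ih => exact ENNReal.mul_ne_top Φ.om_ne_top ih

lemma W_singleton (a : 𝒜) (z : ℕ → 𝒜) : Φ.W φ [a] z = Φ.om φ (consSeq a z) := by
  simp [W]

section norm

variable (hnorm : Φ.IsNormalized φ)
include hnorm

lemma om_le_one (z : ℕ → 𝒜) : Φ.om φ z ≤ 1 := by
  by_cases h : z ∈ Φ.shiftSpace
  · rw [Φ.om_of_mem h]
    exact ENNReal.ofReal_le_one.2 (Real.exp_le_one_iff.2 (hnorm z h).1.le)
  · rw [Φ.om_of_notMem h]; exact zero_le_one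

lemma tsum_om {z : ℕ → 𝒜} (hz : z ∈ Φ.shiftSpace) : ∑' a, Φ.om φ (consSeq a z) = 1 := by
  have h := (hnorm z hz).2
  have h1 : ∑' a : {a : 𝒜 // Φ.adm a (z 0)}, ENNReal.ofReal (Real.exp (φ (consSeq a.1 z))) = 1 := by
    rw [← ENNReal.ofReal_tsum_of_nonneg (fun _ => (Real.exp_pos _).le) h.summable, h.tsum_eq,
      ENNReal.ofReal_one]
  rw [← h1]
  refine Eq.trans ?_
    (tsum_subtype {a | Φ.adm a (z 0)} fun a => ENNReal.ofReal (Real.exp (φ (consSeq a z)))).symm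
  refine tsum_congr fun a => ?_
  by_cases ha : Φ.adm a (z 0)
  · rw [Φ.om_of_mem (Φ.consSeq_mem_shiftSpace.2 ⟨ha, hz⟩), indicator_of_mem (by exact ha)]
  · rw [Φ.om_of_notMem (fun h => ha (Φ.consSeq_mem_shiftSpace.1 h).1),
      indicator_of_notMem (by exact ha)]

/-- The transfer operator fixes the constant 1, hence so do its powers. This is what makes the
weights of the words of length `m` over `z` a probability vector. -/
lemma tsum_W {z : ℕ → 𝒜} (hz : z ∈ Φ.shiftSpace) (m : ℕ) : ∑' w : Vec 𝒜 m, Φ.W φ w.1 z = 1 := by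
  induction m generalizing z with
  | zero => rw [tsum_vec_zero (fun w => Φ.W φ w z)]; rfl
  | succ m ih =>
    rw [tsum_vec_succ m (fun w => Φ.W φ w z), ← Φ.tsum_om hnorm hz]
    refine tsum_congr fun a => ?_
    simp only [W_append, W_singleton, app_cons, app_nil]
    rw [ENNReal.tsum_mul_right]
    by_cases h : consSeq a z ∈ Φ.shiftSpace
    · rw [ih h, one_mul]
    · rw [Φ.om_of_notMem h, mul_zero]

end norm

lemma measurableSet_shiftSpace [MeasurableSpace 𝒜] [DiscreteMeasurableSpace 𝒜] [Countable 𝒜] :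
    MeasurableSet Φ.shiftSpace := by
  have : Φ.shiftSpace = ⋂ j : ℕ, {z : ℕ → 𝒜 | Φ.adm (z j) (z (j + 1))} := by
    ext z; simp [shiftSpace]
  rw [this]
  refine MeasurableSet.iInter fun j => ?_
  have h2 : Measurable fun z : ℕ → 𝒜 => (z j, z (j + 1)) :=
    (measurable_pi_apply j).prodMk (measurable_pi_apply (j + 1))
  exact h2 (MeasurableSet.of_discrete (s := {p : 𝒜 × 𝒜 | Φ.adm p.1 p.2}))

section distortion

variable (hvar : Φ.SummableVariations φ)
include hvar

/-- Bounded distortion of the weights. -/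
lemma exists_W_distortion : ∃ C₀ : ℝ, 1 ≤ C₀ ∧ ∀ w : List 𝒜, ∀ z ∈ Φ.shiftSpace,
    ∀ z' ∈ Φ.shiftSpace, z 0 = z' 0 → Φ.W φ w z ≤ ENNReal.ofReal C₀ * Φ.W φ w z' := by
  obtain ⟨v, hv, h⟩ := hvar
  have key : ∀ w : List 𝒜, ∀ z ∈ Φ.shiftSpace, ∀ z' ∈ Φ.shiftSpace, z 0 = z' 0 →
      Φ.W φ w z ≤ ENNReal.ofReal (Real.exp (∑ i ∈ Finset.range w.length, |v (i + 2)|)) *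
        Φ.W φ w z' := by
    intro w z hz z' hz' h0
    induction w with
    | nil => simp [W]
    | cons a w ih =>
      rw [W, W]
      by_cases hw : app (a :: w) z ∈ Φ.shiftSpace
      · have hw' : app (a :: w) z' ∈ Φ.shiftSpace := by
          rw [app_mem_shiftSpace] at hw ⊢
          exact ⟨h0 ▸ hw.1, hz'⟩
        -- The common letters are `a`, those of `w`, and the base letter. The number of common
        -- letters is thus at least 2, where the variations begin to be controlled.
        have h2 : pre (w.length + 2) (app (a :: w) z) = pre (w.length + 2) (app (a :: w) z') := by
          have e := pre_app_add (a :: w) z 1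
          have e' := pre_app_add (a :: w) z' 1
          rw [List.length_cons, show 1 + (w.length + 1) = w.length + 2 by ring] at e e'
          rw [e, e']; simp [pre, h0]
        have h1 := h (w.length + 2) (by omega) _ hw _ hw' (fun i hi => apply_eq_of_pre h2 hi)
        rw [Φ.om_of_mem hw, Φ.om_of_mem hw', List.length_cons, Finset.sum_range_succ, Real.exp_add,
          ENNReal.ofReal_mul (Real.exp_pos _).le, mul_comm (ENNReal.ofReal (Real.exp (∑ _ ∈ _, _))),
          mul_mul_mul_comm _ _ _ (Φ.W φ w z')] 
        refine mul_le_mul' ?_ ih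
        rw [← ENNReal.ofReal_mul (Real.exp_pos _).le, ← Real.exp_add]
        refine ENNReal.ofReal_le_ofReal (Real.exp_le_exp.2 ?_)
        linarith [le_abs_self (φ (app (a :: w) z) - φ (app (a :: w) z')), le_abs_self (v (w.length + 2))]
      · rw [Φ.om_of_notMem hw]; simp
  have hs : Summable fun i => |v (i + 2)| := (summable_nat_add_iff 2).2 hv.abs
  refine ⟨Real.exp (∑' i, |v (i + 2)|), Real.one_le_exp (tsum_nonneg fun _ => abs_nonneg _),
    fun w z hz z' hz' h0 => (key w z hz z' hz' h0).trans ?_⟩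
  gcongr
  exact hs.sum_le_tsum _ fun _ _ => abs_nonneg _

variable [MeasurableSpace 𝒜] [DiscreteMeasurableSpace 𝒜] [Countable 𝒜]

/-- Measurability of the potential is not a hypothesis. Summable variations make it, on the shift
space, a limit of functions of finitely many letters, obtained by sampling it once in every
non-empty cylinder. -/
lemma measurable_om : Measurable (Φ.om φ) := by
  classical
  obtain ⟨v, hv, h⟩ := hvar
  let rep : List 𝒜 → ℝ := fun w =>
    if hw : ∃ z ∈ Φ.shiftSpace, z ∈ cyl w then φ hw.choose else 0
  have hS := Φ.measurableSet_shiftSpace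
  have hφ : Measurable (Φ.shiftSpace.indicator φ) := by
    refine measurable_of_tendsto_metrizable
      (f := fun n => Φ.shiftSpace.indicator fun z => rep (pre n z))
      (fun n => (measurable_of_pre n rep).indicator hS) ?_
    rw [tendsto_pi_nhds]
    intro z
    by_cases hz : z ∈ Φ.shiftSpace
    · simp only [indicator_of_mem hz]
      rw [tendsto_iff_dist_tendsto_zero]
      refine squeeze_zero' (Eventually.of_forall fun _ => dist_nonneg) ?_ hv.tendsto_atTop_zero
      filter_upwards [eventually_ge_atTop 2] with n hn
      have hw : ∃ y ∈ Φ.shiftSpace, y ∈ cyl (pre n z) := ⟨z, hz, mem_cyl_pre n z⟩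
      have e : rep (pre n z) = φ hw.choose := dif_pos hw
      rw [e, Real.dist_eq]
      have h1 := mem_cyl_iff_pre.1 hw.choose_spec.2
      rw [length_pre] at h1
      exact h n hn _ hw.choose_spec.1 _ hz fun i hi => apply_eq_of_pre h1 hi
    · simp only [indicator_of_notMem hz]
      exact tendsto_const_nhds
  have : Φ.om φ = Φ.shiftSpace.indicator fun z =>
      ENNReal.ofReal (Real.exp (Φ.shiftSpace.indicator φ z)) := by
    funext z
    by_cases hz : z ∈ Φ.shiftSpace
    · rw [Φ.om_of_mem hz, indicator_of_mem hz, indicator_of_mem hz]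
    · rw [Φ.om_of_notMem hz, indicator_of_notMem hz]
  rw [this]
  exact (ENNReal.measurable_ofReal.comp (Real.measurable_exp.comp hφ)).indicator hS

lemma measurable_W (w : List 𝒜) : Measurable (Φ.W φ w) := by
  induction w with
  | nil => exact measurable_const
  | cons a w ih => exact ((Φ.measurable_om hvar).comp (measurable_app (a :: w))).mul ih

variable {ν : Measure (ℕ → 𝒜)} (hν : Φ.IsGibbs φ ν)
include hν

lemma conformal_letters {f : (ℕ → 𝒜) → ℝ≥0∞} (hf : Measurable f) :
    ∫⁻ z, f z ∂ν = ∑' a, ∫⁻ z, Φ.om φ (consSeq a z) * f (consSeq a z) ∂ν := by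
  rw [hν.conformal f hf]
  refine tsum_congr fun a => ?_
  have hA : MeasurableSet {z : ℕ → 𝒜 | Φ.adm a (z 0)} :=
    measurable_pi_apply 0 (MeasurableSet.of_discrete (s := {b | Φ.adm a b}))
  rw [← lintegral_indicator hA]
  refine lintegral_congr_ae ?_
  filter_upwards [hν.supported] with z hz
  by_cases h : Φ.adm a (z 0)
  · rw [indicator_of_mem (by exact h), Φ.om_of_mem (Φ.consSeq_mem_shiftSpace.2 ⟨h, hz⟩)]
  · rw [indicator_of_notMem (by exact h),
      Φ.om_of_notMem fun h' => h (Φ.consSeq_mem_shiftSpace.1 h').1, zero_mul]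

/-- Conformality for a word. -/
lemma conformal_word {f : (ℕ → 𝒜) → ℝ≥0∞} (hf : Measurable f) (w : List 𝒜) :
    ∫⁻ z in cyl w, f z ∂ν = ∫⁻ z, Φ.W φ w z * f (app w z) ∂ν := by
  induction w generalizing f with
  | nil => simp [W]
  | cons a w ih =>
    rw [← lintegral_indicator (measurableSet_cyl _), Φ.conformal_letters hvar hν
      (hf.indicator (measurableSet_cyl _)), tsum_eq_single a]
    · have h1 : ∀ z, Φ.om φ (consSeq a z) * (cyl (a :: w)).indicator f (consSeq a z) =
          (cyl w).indicator (fun z => Φ.om φ (consSeq a z) * f (consSeq a z)) z := by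
        intro z
        by_cases hz : z ∈ cyl w
        · rw [indicator_of_mem hz, indicator_of_mem (by simpa using hz)]
        · rw [indicator_of_notMem hz, indicator_of_notMem (by simpa using hz), mul_zero]
      simp_rw [h1]
      rw [lintegral_indicator (measurableSet_cyl _), ih]
      · refine lintegral_congr fun z => ?_
        rw [W, app_cons]; ring
      · exact ((Φ.measurable_om hvar).comp (measurable_consSeq a)).mul (hf.comp (measurable_consSeq a))
    · intro b hb
      have h1 : ∀ z, Φ.om φ (consSeq b z) * (cyl (a :: w)).indicator f (consSeq b z) = 0 := by
        intro z
        rw [indicator_of_notMem (by simp [hb]), mul_zero]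
      simp [h1]

lemma conformal_vec {f : (ℕ → 𝒜) → ℝ≥0∞} (hf : Measurable f) (m : ℕ) :
    ∫⁻ z, f z ∂ν = ∑' w : Vec 𝒜 m, ∫⁻ z, Φ.W φ w.1 z * f (app w.1 z) ∂ν := by
  rw [lintegral_eq_tsum_cyl ν m]
  exact tsum_congr fun w => Φ.conformal_word hvar hν hf w.1

lemma measure_cyl_append (u v : List 𝒜) : ν (cyl (u ++ v)) = ∫⁻ z in cyl v, Φ.W φ u z ∂ν := by
  have h := Φ.conformal_word hvar hν (f := (cyl (u ++ v)).indicator 1)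
    (measurable_one.indicator (measurableSet_cyl _)) u
  rw [lintegral_indicator_one (measurableSet_cyl _), Measure.restrict_apply (measurableSet_cyl _),
    inter_eq_self_of_subset_left (cyl_append_subset u v)] at h
  rw [h, ← lintegral_indicator (measurableSet_cyl _)]
  refine lintegral_congr fun z => ?_
  by_cases hz : z ∈ cyl v
  · rw [indicator_of_mem hz, indicator_of_mem (app_mem_cyl_append.2 hz)]; simp
  · rw [indicator_of_notMem hz, indicator_of_notMem (fun h => hz (app_mem_cyl_append.1 h)), mul_zero]

/-- The shift is non-singular: by conformality, the preimage of a null set is cut into pieces which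
are images of null sets under prefixing a letter, with bounded density. -/
lemma ae_shiftSeq {p : (ℕ → 𝒜) → Prop} (h : ∀ᵐ z ∂ν, p z) : ∀ᵐ z ∂ν, p (shiftSeq z) := by
  rw [ae_iff] at h
  obtain ⟨A, hA, hAm, hA0⟩ := exists_measurable_superset_of_null h
  have h1 := Φ.conformal_letters hvar hν (f := fun z => A.indicator 1 (shiftSeq z))
    ((measurable_one.indicator hAm).comp measurable_shiftSeq)
  have h2 : ∀ᵐ z ∂ν, z ∉ A := measure_eq_zero_iff_ae_notMem.1 hA0
  have h3 : ∫⁻ z, A.indicator 1 (shiftSeq z) ∂ν = 0 := by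
    rw [h1, ENNReal.tsum_eq_zero]
    intro a
    refine lintegral_eq_zero_of_ae_eq_zero ?_
    filter_upwards [h2] with z hz
    simp [hz]
  have h3 := (lintegral_eq_zero_iff
    ((measurable_one.indicator hAm).comp measurable_shiftSeq : Measurable
      fun z => A.indicator (1 : (ℕ → 𝒜) → ℝ≥0∞) (shiftSeq z))).1 h3
  filter_upwards [h3] with z hz
  by_contra hp
  have : shiftSeq z ∈ A := hA hp
  simp [this] at hz

end distortion

end MarkovIFS

/-! ### Geometry of the branches and the coding map -/

namespace MarkovIFS

variable {𝒜 : Type*} {α : ℝ} (Φ : MarkovIFS 𝒜 α)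

/-- The branch of the word `w c`. -/
noncomputable def G : List 𝒜 → 𝒜 → ℝ → ℝ
  | [], _ => id
  | a :: w, c => Φ.g a (w.headD c) ∘ G w c

/-- `-log` of the derivative of the branch of `w c`, by the chain rule. -/
noncomputable def ta : List 𝒜 → 𝒜 → ℝ → ℝ
  | [], _, _ => 0
  | a :: w, c, x => -Real.log |deriv (Φ.g a (w.headD c)) (Φ.G w c x)| + ta w c x

lemma gWord_append_singleton (w : List 𝒜) (c : 𝒜) : Φ.gWord (w ++ [c]) = Φ.G w c := by
  induction w with
  | nil => rfl
  | cons a w ih =>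
    rw [G, ← ih]
    cases w <;> rfl

lemma headD_append (u v : List 𝒜) (c : 𝒜) : (u ++ v).headD c = u.headD (v.headD c) := by
  cases u <;> rfl

lemma G_append (u v : List 𝒜) (c : 𝒜) (x : ℝ) :
    Φ.G (u ++ v) c x = Φ.G u (v.headD c) (Φ.G v c x) := by
  induction u with
  | nil => rfl
  | cons a u ih => rw [List.cons_append, G, G, headD_append, Function.comp, ih]; rfl

lemma ta_append (u v : List 𝒜) (c : 𝒜) (x : ℝ) :
    Φ.ta (u ++ v) c x = Φ.ta u (v.headD c) (Φ.G v c x) + Φ.ta v c x := by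
  induction u with
  | nil => simp [ta]
  | cons a u ih => rw [List.cons_append, ta, ta, headD_append, ih, G_append, add_assoc]

lemma dom_append_singleton (w : List 𝒜) (c : 𝒜) : Φ.dom (w ++ [c]) = Φ.I c := by
  ext x; simp [dom]

lemma abs_deriv_pos {a b : 𝒜} (h : Φ.adm a b) {x : ℝ} (hx : x ∈ Φ.I b) :
    0 < |deriv (Φ.g a b) x| := by
  obtain ⟨κ, h0, -, h2⟩ := Φ.lower_contraction a b h
  exact h0.trans_le (h2 x hx)

lemma hasDerivAt_g {a b : 𝒜} (h : Φ.adm a b) {x : ℝ} (hx : x ∈ Φ.I b) :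
    HasDerivAt (Φ.g a b) (deriv (Φ.g a b) x) x :=
  ((Φ.differentiableOn a b h).differentiableAt (isOpen_Ioo.mem_nhds hx)).hasDerivAt

lemma G_mem {w : List 𝒜} {c : 𝒜} (h : Φ.AdmW w c) {x : ℝ} (hx : x ∈ Φ.I c) :
    Φ.G w c x ∈ Φ.I (w.headD c) := by
  induction w with
  | nil => exact hx
  | cons a w ih => exact Φ.mapsTo _ _ h.1 (ih h.2)

lemma hasDerivAt_G {w : List 𝒜} {c : 𝒜} (h : Φ.AdmW w c) {x : ℝ} (hx : x ∈ Φ.I c) :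
    HasDerivAt (Φ.G w c) (deriv (Φ.G w c) x) x ∧ |deriv (Φ.G w c) x| = Real.exp (-Φ.ta w c x) := by
  induction w with
  | nil => simp only [G, ta]; simp [hasDerivAt_id]
  | cons a w ih =>
    obtain ⟨h1, h2⟩ := ih h.2
    have h3 := (Φ.hasDerivAt_g h.1 (Φ.G_mem h.2 hx)).comp x h1
    have h4 : HasDerivAt (Φ.G (a :: w) c) _ x := h3
    refine ⟨h4.differentiableAt.hasDerivAt, ?_⟩
    rw [h4.deriv, abs_mul, h2, ta, neg_add, Real.exp_add, neg_neg,
      Real.exp_log (Φ.abs_deriv_pos h.1 (Φ.G_mem h.2 hx))]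

lemma continuousOn_G {w : List 𝒜} {c : 𝒜} (h : Φ.AdmW w c) : ContinuousOn (Φ.G w c) (Φ.I c) :=
  fun _ hx => (Φ.hasDerivAt_G h hx).1.continuousAt.continuousWithinAt

lemma tau_eq_ta {w : List 𝒜} {c : 𝒜} (h : Φ.AdmW w c) {x : ℝ} (hx : x ∈ Φ.I c) :
    Φ.tau (w ++ [c]) x = Φ.ta w c x := by
  rw [tau, gWord_append_singleton, (Φ.hasDerivAt_G h hx).2, Real.log_exp, neg_neg]

lemma exists_abs_G_sub {w : List 𝒜} {c : 𝒜} (h : Φ.AdmW w c) {x y : ℝ} (hx : x ∈ Φ.I c)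
    (hy : y ∈ Φ.I c) :
    ∃ ξ ∈ Φ.I c, |Φ.G w c x - Φ.G w c y| = Real.exp (-Φ.ta w c ξ) * |x - y| := by
  wlog hxy : x < y generalizing x y
  · rcases eq_or_lt_of_le (not_lt.1 hxy) with rfl | hlt
    · exact ⟨y, hy, by simp⟩
    · obtain ⟨ξ, h1, h2⟩ := this hy hx hlt
      exact ⟨ξ, h1, by rw [abs_sub_comm, h2, abs_sub_comm x]⟩
  have hsub : Icc x y ⊆ Φ.I c := Icc_subset_Ioo hx.1 hy.2
  obtain ⟨ξ, h1, h2⟩ := exists_hasDerivAt_eq_slope (Φ.G w c) (deriv (Φ.G w c)) hxy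
    ((Φ.continuousOn_G h).mono hsub) (fun t ht => (Φ.hasDerivAt_G h (hsub (Ioo_subset_Icc_self ht))).1)
  have hξ := hsub (Ioo_subset_Icc_self h1)
  refine ⟨ξ, hξ, ?_⟩
  rw [← (Φ.hasDerivAt_G h hξ).2, ← abs_mul, h2, div_mul_eq_mul_div, abs_sub_comm,
    ← neg_sub y x, mul_neg, neg_div, abs_neg, mul_div_cancel_right₀ _ (sub_pos.2 hxy).ne']

/-- `κ` is a uniform contraction rate. -/
def Contr (κ : ℝ) : Prop :=
  0 < κ ∧ κ < 1 ∧ ∀ a b, Φ.adm a b → ∀ x ∈ Φ.I b, |deriv (Φ.g a b) x| ≤ κ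

lemma exists_contr : ∃ κ, Φ.Contr κ := Φ.upper_contraction

/-- The functions `log |g_{ab}'|` are uniformly `β`-Hölder. -/
def Dist (β C : ℝ) : Prop :=
  0 ≤ C ∧ ∀ a b, Φ.adm a b → ∀ x ∈ Φ.I b, ∀ y ∈ Φ.I b,
    |(Real.log |deriv (Φ.g a b) x| - Real.log |deriv (Φ.g a b) y|)| ≤ C * |x - y| ^ β

lemma exists_dist : ∃ C, Φ.Dist α C := by
  obtain ⟨C, h0, h⟩ := Φ.distortion
  exact ⟨C, h0.le, h⟩

variable {Φ}

lemma Contr.exp_neg_ta_le {κ : ℝ} (hκ : Φ.Contr κ) {w : List 𝒜} {c : 𝒜} (h : Φ.AdmW w c) {x : ℝ}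
    (hx : x ∈ Φ.I c) : Real.exp (-Φ.ta w c x) ≤ κ ^ w.length := by
  induction w with
  | nil => simp [ta]
  | cons a w ih =>
    have hm := Φ.G_mem h.2 hx
    rw [ta, neg_add, Real.exp_add, neg_neg, Real.exp_log (Φ.abs_deriv_pos h.1 hm), List.length_cons,
      pow_succ']
    exact mul_le_mul (hκ.2.2 _ _ h.1 _ hm) (ih h.2) (Real.exp_pos _).le hκ.1.le

lemma Contr.abs_G_sub_le {κ : ℝ} (hκ : Φ.Contr κ) {w : List 𝒜} {c : 𝒜} (h : Φ.AdmW w c) {x y : ℝ}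
    (hx : x ∈ Φ.I c) (hy : y ∈ Φ.I c) : |Φ.G w c x - Φ.G w c y| ≤ κ ^ w.length * |x - y| := by
  obtain ⟨ξ, h1, h2⟩ := Φ.exists_abs_G_sub h hx hy
  rw [h2]
  exact mul_le_mul_of_nonneg_right (hκ.exp_neg_ta_le h h1) (abs_nonneg _)

/-- Bounded distortion along words. -/
lemma Dist.abs_ta_sub_le {κ β C : ℝ} (hκ : Φ.Contr κ) (hβ : 0 < β) (hC : Φ.Dist β C) {w : List 𝒜}
    {c : 𝒜} (h : Φ.AdmW w c) {x y : ℝ} (hx : x ∈ Φ.I c) (hy : y ∈ Φ.I c) :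
    |Φ.ta w c x - Φ.ta w c y| ≤ C / (1 - κ ^ β) * |x - y| ^ β := by
  have hq0 : 0 ≤ κ ^ β := Real.rpow_nonneg hκ.1.le _
  have hq1 : κ ^ β < 1 := Real.rpow_lt_one hκ.1.le hκ.2.1 hβ
  have key : |Φ.ta w c x - Φ.ta w c y| ≤
      (∑ i ∈ Finset.range w.length, (κ ^ β) ^ i) * C * |x - y| ^ β := by
    induction w with
    | nil => simp [ta]
    | cons a w ih =>
      have h1 := hC.2 _ _ h.1 _ (Φ.G_mem h.2 hx) _ (Φ.G_mem h.2 hy)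
      have h2 : |Φ.G w c x - Φ.G w c y| ^ β ≤ (κ ^ β) ^ w.length * |x - y| ^ β := by
        refine (Real.rpow_le_rpow (abs_nonneg _) (hκ.abs_G_sub_le h.2 hx hy) hβ.le).trans_eq ?_
        rw [Real.mul_rpow (pow_nonneg hκ.1.le _) (abs_nonneg _), ← Real.rpow_natCast,
          ← Real.rpow_natCast, ← Real.rpow_mul hκ.1.le, ← Real.rpow_mul hκ.1.le, mul_comm β]
      rw [ta, ta, List.length_cons, Finset.sum_range_succ]
      have h3 := ih h.2
      have h4 := mul_le_mul_of_nonneg_left h2 hC.1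
      rw [abs_le] at h1 h3 ⊢
      constructor <;> nlinarith
  refine key.trans ?_
  have hs : ∑ i ∈ Finset.range w.length, (κ ^ β) ^ i ≤ (1 - κ ^ β)⁻¹ :=
    geom_sum_lt_top_aux hq0 hq1 _
  rw [div_eq_inv_mul]
  gcongr
  exact hC.1
where
  geom_sum_lt_top_aux {q : ℝ} (h0 : 0 ≤ q) (h1 : q < 1) (n : ℕ) :
      ∑ i ∈ Finset.range n, q ^ i ≤ (1 - q)⁻¹ := by
    rw [← tsum_geometric_of_lt_one h0 h1]
    exact (summable_geometric_of_lt_one h0 h1).sum_le_tsum _ fun _ _ => pow_nonneg h0 _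

variable (Φ)

lemma I_subset (a : 𝒜) : Φ.I a ⊆ Icc 0 1 :=
  fun _ hx => ⟨(Φ.l_nonneg a).trans hx.1.le, hx.2.le.trans (Φ.r_le_one a)⟩

variable {Φ} in
lemma abs_sub_le_one {a : 𝒜} {x y : ℝ} (hx : x ∈ Φ.I a) (hy : y ∈ Φ.I a) : |x - y| ≤ 1 := by
  have h1 := Φ.I_subset a hx
  have h2 := Φ.I_subset a hy
  rw [abs_le]; constructor <;> linarith [h1.1, h1.2, h2.1, h2.2]

/-- The infimum of `|g_{ab}'|`. -/
noncomputable def ell1 (a b : 𝒜) : ℝ := sInf ((fun x => |deriv (Φ.g a b) x|) '' Φ.I b)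

/-- A lower bound for the derivative of the branch of `w c`. -/
noncomputable def ell : List 𝒜 → 𝒜 → ℝ
  | [], _ => 1
  | a :: w, c => Φ.ell1 a (w.headD c) * ell w c

lemma I_nonempty (a : 𝒜) : (Φ.I a).Nonempty := nonempty_Ioo.2 (Φ.l_lt_r a)

lemma ell1_pos {a b : 𝒜} (h : Φ.adm a b) : 0 < Φ.ell1 a b := by
  obtain ⟨κ, h0, -, h2⟩ := Φ.lower_contraction a b h
  refine h0.trans_le (le_csInf ((Φ.I_nonempty b).image _) ?_)
  rintro _ ⟨x, hx, rfl⟩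
  exact h2 x hx

lemma ell1_le {a b : 𝒜} {x : ℝ} (hx : x ∈ Φ.I b) : Φ.ell1 a b ≤ |deriv (Φ.g a b) x| :=
  csInf_le ⟨0, by rintro _ ⟨x, -, rfl⟩; exact abs_nonneg _⟩ (mem_image_of_mem _ hx)

lemma ell_pos {w : List 𝒜} {c : 𝒜} (h : Φ.AdmW w c) : 0 < Φ.ell w c := by
  induction w with
  | nil => exact one_pos
  | cons a w ih => exact mul_pos (Φ.ell1_pos h.1) (ih h.2)

lemma ell_le {w : List 𝒜} {c : 𝒜} (h : Φ.AdmW w c) {x : ℝ} (hx : x ∈ Φ.I c) :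
    Φ.ell w c ≤ Real.exp (-Φ.ta w c x) := by
  induction w with
  | nil => simp [ta, ell]
  | cons a w ih =>
    have hm := Φ.G_mem h.2 hx
    rw [ta, neg_add, Real.exp_add, neg_neg, Real.exp_log (Φ.abs_deriv_pos h.1 hm), ell]
    exact mul_le_mul (Φ.ell1_le hm) (ih h.2) (Φ.ell_pos h.2).le (abs_nonneg _)

lemma ell_le_one {w : List 𝒜} {c : 𝒜} (h : Φ.AdmW w c) : Φ.ell w c ≤ 1 := by
  obtain ⟨κ, hκ⟩ := Φ.exists_contr
  obtain ⟨x, hx⟩ := Φ.I_nonempty c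
  exact (Φ.ell_le h hx).trans ((hκ.exp_neg_ta_le h hx).trans (pow_le_one₀ hκ.1.le hκ.2.1.le))

lemma ell_mul_le {w : List 𝒜} {c : 𝒜} (h : Φ.AdmW w c) {x y : ℝ} (hx : x ∈ Φ.I c)
    (hy : y ∈ Φ.I c) : Φ.ell w c * |x - y| ≤ |Φ.G w c x - Φ.G w c y| := by
  obtain ⟨ξ, h1, h2⟩ := Φ.exists_abs_G_sub h hx hy
  rw [h2]
  exact mul_le_mul_of_nonneg_right (Φ.ell_le h h1) (abs_nonneg _)

lemma G_injOn {w : List 𝒜} {c : 𝒜} (h : Φ.AdmW w c) : InjOn (Φ.G w c) (Φ.I c) := by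
  intro x hx y hy hxy
  have h1 := Φ.ell_mul_le h hx hy
  rw [hxy, sub_self, abs_zero] at h1
  have h2 := Φ.ell_pos h
  have h3 : |x - y| ≤ 0 := by by_contra h4; push Not at h4; nlinarith
  exact sub_eq_zero.1 (abs_nonpos_iff.1 h3)

/-! #### The coding map -/

variable {Φ} in
lemma admW_pre {z : ℕ → 𝒜} (hz : z ∈ Φ.shiftSpace) (n : ℕ) : Φ.AdmW (pre n z) (z n) := by
  rw [← app_pre n z, app_mem_shiftSpace] at hz
  simpa using hz.1

lemma pre_add (n k : ℕ) (z : ℕ → 𝒜) : pre (n + k) z = pre n z ++ pre k fun i => z (i + n) := by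
  have h := pre_app_add (pre n z) (fun i => z (i + n)) k
  rwa [app_pre, length_pre, add_comm] at h

lemma shift_mem_shiftSpace {z : ℕ → 𝒜} (hz : z ∈ Φ.shiftSpace) (n : ℕ) :
    (fun i => z (i + n)) ∈ Φ.shiftSpace := by
  rw [← app_pre n z, app_mem_shiftSpace] at hz
  exact hz.2

/-- The approximations of the coding map. -/
noncomputable def approx (n : ℕ) (z : ℕ → 𝒜) : ℝ := Φ.G (pre n z) (z n) ((Φ.l (z n) + Φ.r (z n)) / 2)

lemma mid_mem (a : 𝒜) : (Φ.l a + Φ.r a) / 2 ∈ Φ.I a := by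
  have := Φ.l_lt_r a
  constructor <;> linarith

lemma coding_eq (z : ℕ → 𝒜) : Φ.coding z = limUnder atTop fun n => Φ.approx n z := by
  unfold coding approx
  congr 1
  funext n
  rw [ofFn_eq_pre (n + 1) z, pre_succ_eq_append, gWord_append_singleton]

lemma approx_add {z : ℕ → 𝒜} (hz : z ∈ Φ.shiftSpace) (n k : ℕ) :
    ∃ y ∈ Φ.I (z n), Φ.approx (n + k) z = Φ.G (pre n z) (z n) y := by
  have hz' := Φ.shift_mem_shiftSpace hz n
  have h1 := admW_pre hz' k
  rw [show k + n = n + k by ring] at h1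
  have h2 : (pre k fun i => z (i + n)).headD (z (n + k)) = z n := by
    cases k with
    | zero => rfl
    | succ k => simp [pre]
  refine ⟨Φ.G (pre k fun i => z (i + n)) (z (n + k)) ((Φ.l (z (n + k)) + Φ.r (z (n + k))) / 2), ?_, ?_⟩
  rotate_left
  · rw [approx, pre_add, G_append, h2]
  · have := Φ.G_mem h1 (Φ.mid_mem _)
    rwa [h2] at this

lemma abs_approx_sub_le {κ : ℝ} (hκ : Φ.Contr κ) {z : ℕ → 𝒜} (hz : z ∈ Φ.shiftSpace) {n m : ℕ}
    (h : n ≤ m) {x : ℝ} (hx : x ∈ Φ.I (z n)) :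
    |Φ.approx m z - Φ.G (pre n z) (z n) x| ≤ κ ^ n := by
  obtain ⟨k, rfl⟩ := Nat.exists_eq_add_of_le h
  obtain ⟨y, hy, h1⟩ := Φ.approx_add hz n k
  rw [h1]
  have h2 := hκ.abs_G_sub_le (admW_pre hz n) hy hx
  rw [length_pre] at h2
  exact h2.trans (mul_le_of_le_one_right (pow_nonneg hκ.1.le _) (abs_sub_le_one hy hx))

lemma tendsto_approx {z : ℕ → 𝒜} (hz : z ∈ Φ.shiftSpace) :
    Tendsto (fun n => Φ.approx n z) atTop (𝓝 (Φ.coding z)) := by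
  obtain ⟨κ, hκ⟩ := Φ.exists_contr
  have hc : CauchySeq fun n => Φ.approx n z := by
    refine cauchySeq_of_le_geometric κ 1 hκ.2.1 fun n => ?_
    rw [dist_comm, Real.dist_eq, one_mul]
    exact Φ.abs_approx_sub_le hκ hz (Nat.le_succ n) (Φ.mid_mem _)
  rw [coding_eq]
  exact hc.tendsto_limUnder

lemma abs_coding_sub_le {κ : ℝ} (hκ : Φ.Contr κ) {z : ℕ → 𝒜} (hz : z ∈ Φ.shiftSpace) (n : ℕ)
    {x : ℝ} (hx : x ∈ Φ.I (z n)) : |Φ.coding z - Φ.G (pre n z) (z n) x| ≤ κ ^ n := by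
  refine le_of_tendsto ((Φ.tendsto_approx hz).sub_const _).abs ?_
  filter_upwards [eventually_ge_atTop n] with m hm
  exact Φ.abs_approx_sub_le hκ hz hm hx

lemma coding_mem_closure {z : ℕ → 𝒜} (hz : z ∈ Φ.shiftSpace) (n : ℕ) :
    Φ.coding z ∈ closure (Φ.cylInterval (pre (n + 1) z)) := by
  refine mem_closure_of_tendsto (Φ.tendsto_approx hz) ?_
  filter_upwards [eventually_ge_atTop n] with m hm
  obtain ⟨k, rfl⟩ := Nat.exists_eq_add_of_le hm
  obtain ⟨y, hy, h1⟩ := Φ.approx_add hz n k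
  rw [h1, cylInterval, pre_succ_eq_append, gWord_append_singleton, dom_append_singleton]
  exact mem_image_of_mem _ hy

lemma coding_mem_attractor {z : ℕ → 𝒜} (hz : z ∈ Φ.shiftSpace) : Φ.coding z ∈ Φ.attractor := by
  refine mem_iInter₂.2 fun n hn => ?_
  obtain ⟨n, rfl⟩ := Nat.exists_eq_add_of_le' hn
  refine mem_iUnion.2 ⟨⟨pre (n + 1) z, length_pre _ _, ?_⟩, Φ.coding_mem_closure hz n⟩
  rw [pre_succ_eq_append, isChain_append_singleton]
  exact admW_pre hz n

lemma coding_mem_Icc {z : ℕ → 𝒜} (hz : z ∈ Φ.shiftSpace) :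
    Φ.coding z ∈ Icc (Φ.l (z 0)) (Φ.r (z 0)) := by
  have h := Φ.coding_mem_closure hz 0
  have : Φ.cylInterval (pre (0 + 1) z) = Φ.I (z 0) := by
    rw [cylInterval, pre_succ_eq_append, gWord_append_singleton, dom_append_singleton]
    simp [pre, G]
  rwa [this, I, closure_Ioo (Φ.l_lt_r _).ne] at h

/-- Admissible sequences that code an interior point of their first vertex interval. -/
def Good (z : ℕ → 𝒜) : Prop := z ∈ Φ.shiftSpace ∧ Φ.coding z ∈ Φ.I (z 0)

/-- Passing to the limit in the approximations needs continuity of the branch at π(z). This is why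
`Good` asks for an interior point: the values of a branch at the end points of its interval are
arbitrary. -/
lemma coding_consSeq {a : 𝒜} {z : ℕ → 𝒜} (hz : Φ.Good z) (h : consSeq a z ∈ Φ.shiftSpace) :
    Φ.coding (consSeq a z) = Φ.g a (z 0) (Φ.coding z) := by
  have h1 := (tendsto_add_atTop_iff_nat 1).2 (Φ.tendsto_approx h)
  have h2 := ((Φ.hasDerivAt_g (Φ.consSeq_mem_shiftSpace.1 h).1 hz.2).continuousAt.tendsto).comp
    (Φ.tendsto_approx hz.1)
  refine tendsto_nhds_unique h1 (h2.congr fun n => ?_)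
  have h3 : (pre n z).headD (z n) = z 0 := by cases n <;> rfl
  simp only [Function.comp, approx, pre, consSeq_zero, shiftSeq_consSeq, consSeq_succ, G, h3]

lemma Good.app {z : ℕ → 𝒜} (hz : Φ.Good z) {w : List 𝒜} (h : app w z ∈ Φ.shiftSpace) :
    Φ.Good (app w z) ∧ Φ.coding (_root_.app w z) = Φ.G w (z 0) (Φ.coding z) := by
  induction w with
  | nil => exact ⟨hz, rfl⟩
  | cons a w ih =>
    obtain ⟨h1, h2⟩ := ih (Φ.consSeq_mem_shiftSpace.1 h).2
    have h3 := Φ.coding_consSeq h1 h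
    have h4 := (Φ.app_mem_shiftSpace.1 h).1
    have h5 : Φ.coding (_root_.app (a :: w) z) = Φ.G (a :: w) (z 0) (Φ.coding z) := by
      rw [app_cons, h3, h2, app_zero]; rfl
    refine ⟨⟨h, ?_⟩, h5⟩
    rw [h5, app_zero]
    exact Φ.G_mem h4 hz.2

/-- The coding map on the shift space, extended by zero. -/
noncomputable def cod : (ℕ → 𝒜) → ℝ := Φ.shiftSpace.indicator Φ.coding

lemma cod_of_mem {z : ℕ → 𝒜} (hz : z ∈ Φ.shiftSpace) : Φ.cod z = Φ.coding z := indicator_of_mem hz _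

variable [MeasurableSpace 𝒜] [DiscreteMeasurableSpace 𝒜] [Countable 𝒜]

lemma measurable_cod : Measurable Φ.cod := by
  have hS := Φ.measurableSet_shiftSpace
  have hap : ∀ n, Measurable (Φ.approx n) := by
    intro n
    classical
    let F : List 𝒜 → ℝ := fun w => if h : w ≠ [] then Φ.G w.dropLast (w.getLast h)
        ((Φ.l (w.getLast h) + Φ.r (w.getLast h)) / 2) else 0
    have : Φ.approx n = fun z => F (pre (n + 1) z) := by
      funext z
      simp only [F, pre_succ_eq_append]
      rw [dif_pos (by simp)]
      simp [approx]
    rw [this]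
    exact measurable_of_pre (n + 1) F
  refine measurable_of_tendsto_metrizable (f := fun n => Φ.shiftSpace.indicator (Φ.approx n))
    (fun n => (hap n).indicator hS) ?_
  rw [tendsto_pi_nhds]
  intro z
  by_cases hz : z ∈ Φ.shiftSpace
  · simp only [indicator_of_mem hz, cod]
    exact Φ.tendsto_approx hz
  · simp only [indicator_of_notMem hz, cod]
    exact tendsto_const_nhds

variable {φ : (ℕ → 𝒜) → ℝ} {ν : Measure (ℕ → 𝒜)} (hν : Φ.IsGibbs φ ν)
include hν

lemma proj_apply {s : Set ℝ} (hs : MeasurableSet s) : Φ.proj ν s = ν {z | Φ.cod z ∈ s} := by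
  have h : Φ.coding =ᵐ[ν] Φ.cod := by
    filter_upwards [hν.supported] with z hz
    rw [Φ.cod_of_mem hz]
  rw [proj, Measure.map_congr h, Measure.map_apply Φ.measurable_cod hs]
  rfl

/-- A bad sequence codes one of the countably many end points, and each of these is a null set
because there are no atoms. -/
lemma ae_good (hatoms : ∀ x : ℝ, Φ.proj ν {x} = 0) : ∀ᵐ z ∂ν, Φ.Good z := by
  have h : ∀ x : ℝ, ∀ᵐ z ∂ν, Φ.cod z ≠ x := by
    intro x
    have := hatoms x
    rw [Φ.proj_apply hν (measurableSet_singleton x)] at this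
    rw [ae_iff]
    simpa using this
  have h1 : ∀ᵐ z ∂ν, ∀ a, Φ.cod z ≠ Φ.l a := ae_all_iff.2 fun a => h _
  have h2 : ∀ᵐ z ∂ν, ∀ a, Φ.cod z ≠ Φ.r a := ae_all_iff.2 fun a => h _
  filter_upwards [h1, h2, hν.supported] with z h1 h2 hz
  have h3 := Φ.coding_mem_Icc hz
  rw [Φ.cod_of_mem hz] at h1 h2
  exact ⟨hz, lt_of_le_of_ne h3.1 (h1 _).symm, lt_of_le_of_ne h3.2 (h2 _)⟩

end MarkovIFS

/-! ### Hölder regularity of the Gibbs measure -/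

/-- Closed balls shrinking to a point have masses tending to 0; a Lebesgue number of the resulting
cover of [0,1] makes the radius uniform. -/
lemma exists_measure_Icc_le_of_noAtoms (m : Measure ℝ) [IsFiniteMeasure m] (h0 : ∀ x, m {x} = 0)
    (h1 : m (Icc 0 1)ᶜ = 0) {ε : ℝ≥0∞} (hε : 0 < ε) :
    ∃ r : ℝ, 0 < r ∧ ∀ s t : ℝ, t - s ≤ r → m (Icc s t) ≤ ε := by
  have hloc : ∀ x : ℝ, ∃ r : ℝ, 0 < r ∧ m (Metric.ball x r) ≤ ε := by
    intro x
    have ht := tendsto_measure_cthickening_of_isCompact (μ := m) (s := {x})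
      isCompact_singleton
    rw [h0 x] at ht
    obtain ⟨r, hr0, hr⟩ := Metric.eventually_nhds_iff_ball.1 (ht.eventually_le_const hε)
    refine ⟨r / 2, half_pos hr0, (measure_mono ?_).trans (hr (r / 2) ?_)⟩
    · rw [Metric.cthickening_singleton x (half_pos hr0).le]
      exact Metric.ball_subset_closedBall
    · rw [Metric.mem_ball, Real.dist_eq, sub_zero, abs_of_pos (half_pos hr0)]; linarith
  choose r hr0 hr using hloc
  obtain ⟨δ, hδ, h2⟩ := lebesgue_number_lemma_of_metric (s := Icc (0 : ℝ) 1)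
    (c := fun x => Metric.ball x (r x)) isCompact_Icc (fun _ => Metric.isOpen_ball)
    (fun x _ => mem_iUnion.2 ⟨x, Metric.mem_ball_self (hr0 x)⟩)
  refine ⟨δ / 2, half_pos hδ, fun s t hst => ?_⟩
  by_cases hne : (Icc s t ∩ Icc 0 1).Nonempty
  · obtain ⟨y, hy, hy1⟩ := hne
    obtain ⟨x, hx⟩ := h2 y hy1
    refine (measure_mono fun u hu => hx ?_).trans (hr x)
    rw [Metric.mem_ball, Real.dist_eq, abs_lt]
    constructor <;> linarith [hy.1, hy.2, hu.1, hu.2]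
  · have : Icc s t ⊆ (Icc 0 1)ᶜ := fun u hu hu1 => hne ⟨u, hu, hu1⟩
    rw [measure_mono_null this h1]
    exact zero_le

/-- It serves to enclose the preimage of an interval under a branch, about which only the distances
of its points are known. -/
lemma exists_Icc_of_pairwise {A : Set ℝ} {D : ℝ} (hD : 0 ≤ D)
    (h : ∀ x ∈ A, ∀ y ∈ A, |x - y| ≤ D) : ∃ s t : ℝ, s ≤ t ∧ t - s ≤ D ∧ A ⊆ Icc s t := by
  rcases A.eq_empty_or_nonempty with rfl | ⟨x, hx⟩
  · exact ⟨0, 0, le_rfl, by simpa, by simp⟩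
  have hA : ∀ y ∈ A, ∀ u ∈ A, y ≤ u + D := fun y hy u hu => by
    linarith [le_abs_self (y - u), h y hy u hu]
  have hb : BddBelow A := ⟨x - D, fun u hu => by linarith [hA x hx u hu]⟩
  have ha : BddAbove A := ⟨x + D, fun u hu => hA u hu x hx⟩
  refine ⟨sInf A, sSup A, (csInf_le hb hx).trans (le_csSup ha hx), ?_,
    fun y hy => ⟨csInf_le hb hy, le_csSup ha hy⟩⟩
  rw [sub_le_iff_le_add]
  refine csSup_le ⟨x, hx⟩ fun y hy => ?_
  rw [← sub_le_iff_le_add']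
  exact le_csInf ⟨x, hx⟩ fun u hu => by linarith [hA y hy u hu]

/-- Bernoulli's inequality for the exponent θ/γ ≤ 1. It shows that a moment of order θ costs little
more than 1 when θ is small and the moment of order γ is finite. -/
lemma rpow_neg_le_one_add {x γ θ : ℝ} (hx : 0 < x) (hγ : 0 < γ) (hθ : 0 ≤ θ) (hθγ : θ ≤ γ) :
    x ^ (-θ) ≤ 1 + θ / γ * x ^ (-γ) := by
  have h1 : x ^ (-θ) = (1 + (x ^ (-γ) - 1)) ^ (θ / γ) := by
    rw [add_sub_cancel, ← Real.rpow_mul hx.le]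
    congr 1
    field_simp
  have h2 : (1 + (x ^ (-γ) - 1)) ^ (θ / γ) ≤ 1 + θ / γ * (x ^ (-γ) - 1) :=
    rpow_one_add_le_one_add_mul_self (by linarith [Real.rpow_pos_of_pos hx (-γ)])
      (by positivity) ((div_le_one hγ).2 hθγ)
  rw [h1]
  have : 0 ≤ θ / γ := by positivity
  linarith

namespace MarkovIFS

variable {𝒜 : Type*} {α : ℝ} (Φ : MarkovIFS 𝒜 α) {φ : (ℕ → 𝒜) → ℝ}

/-- A form of the light tail condition. -/
def Tail (φ : (ℕ → 𝒜) → ℝ) (γ : ℝ) (q : 𝒜 → ℝ≥0∞) : Prop :=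
  0 < γ ∧ ∑' a, q a ≠ ∞ ∧
    ∀ a z, Φ.om φ (consSeq a z) * ENNReal.ofReal (Φ.ell1 a (z 0) ^ (-γ)) ≤ q a

/-- Solved for the derivative, the pointwise condition becomes a lower bound that does not depend on
the point. It therefore passes to the infimum `ell1`, and then the condition is recovered with
`ell1` in place of |g'|. -/
lemma LightTail.exists_tail (h : Φ.LightTail φ) : ∃ γ q, Φ.Tail φ γ q := by
  obtain ⟨γ, hγ, q, hq, h⟩ := h
  refine ⟨γ, fun a => ENNReal.ofReal |q a|, hγ, hq.abs.tsum_ofReal_ne_top, fun a z => ?_⟩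
  by_cases hz : consSeq a z ∈ Φ.shiftSpace
  · obtain ⟨ha, hz'⟩ := Φ.consSeq_mem_shiftSpace.1 hz
    rw [Φ.om_of_mem hz, ← ENNReal.ofReal_mul (Real.exp_pos _).le]
    refine ENNReal.ofReal_le_ofReal (le_trans ?_ (le_abs_self (q a)))
    set e := Real.exp (φ (consSeq a z)) with he
    have he0 : 0 < e := Real.exp_pos _
    have hx := h a z hz' ha
    have hq0 : 0 < q a := by
      obtain ⟨x, hxI⟩ := Φ.I_nonempty (z 0)
      exact lt_of_lt_of_le (mul_pos he0 (Real.rpow_pos_of_pos (Φ.abs_deriv_pos ha hxI) _)) (hx x hxI)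
    have hlow : (q a / e) ^ (-γ⁻¹) ≤ Φ.ell1 a (z 0) := by
      refine le_csInf ((Φ.I_nonempty _).image _) ?_
      rintro _ ⟨x, hxI, rfl⟩
      have hd := Φ.abs_deriv_pos ha hxI
      have h1 : |deriv (Φ.g a (z 0)) x| ^ (-γ) ≤ q a / e := by
        rw [le_div_iff₀' he0]; exact hx x hxI
      have h2 := Real.rpow_le_rpow_of_nonpos (Real.rpow_pos_of_pos hd _) h1
        (z := -γ⁻¹) (by simpa using hγ.le)
      rwa [← Real.rpow_mul hd.le, neg_mul_neg, mul_inv_cancel₀ hγ.ne', Real.rpow_one] at h2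
    have h3 := Real.rpow_le_rpow_of_nonpos (Real.rpow_pos_of_pos (div_pos hq0 he0) _) hlow
      (z := -γ) (by simpa using hγ.le)
    rw [← Real.rpow_mul (div_pos hq0 he0).le, neg_mul_neg, inv_mul_cancel₀ hγ.ne', Real.rpow_one,
      le_div_iff₀' he0] at h3
    exact h3
  · rw [Φ.om_of_notMem hz, zero_mul]; exact zero_le

lemma exists_tail_of_finite [Finite 𝒜] (hnorm : Φ.IsNormalized φ) : ∃ γ q, Φ.Tail φ γ q := by
  have := Fintype.ofFinite 𝒜
  refine ⟨1, fun a => ∑ b, ENNReal.ofReal (Φ.ell1 a b ^ (-1 : ℝ)), one_pos, ?_, fun a z => ?_⟩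
  · rw [tsum_fintype]
    exact ENNReal.sum_ne_top.2 fun a _ => ENNReal.sum_ne_top.2 fun b _ => ENNReal.ofReal_ne_top
  · refine (mul_le_mul_left (Φ.om_le_one hnorm _) _).trans ?_
    rw [one_mul]
    exact Finset.single_le_sum (f := fun b => ENNReal.ofReal (Φ.ell1 a b ^ (-1 : ℝ)))
      (fun _ _ => zero_le) (Finset.mem_univ (z 0))

-- Both factors are multiplicative along the word, so the outermost letter can be peeled off, and it
-- contributes at most `q a` whatever follows it.
variable {Φ} in
lemma Tail.tsum_W_mul_le {γ : ℝ} {q : 𝒜 → ℝ≥0∞} (hT : Φ.Tail φ γ q) (z : ℕ → 𝒜) (m : ℕ) :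
    ∑' w : Vec 𝒜 m, Φ.W φ w.1 z * ENNReal.ofReal (Φ.ell w.1 (z 0) ^ (-γ)) ≤ (∑' a, q a) ^ m := by
  induction m with
  | zero => 
    rw [tsum_vec_zero (fun w => Φ.W φ w z * ENNReal.ofReal (Φ.ell w (z 0) ^ (-γ)))]
    simp [W, ell]
  | succ m ih =>
    rw [add_comm m 1,
      tsum_vec_succ' m (fun w => Φ.W φ w z * ENNReal.ofReal (Φ.ell w (z 0) ^ (-γ)))]
    calc _ ≤ ∑' v : Vec 𝒜 m, ∑' a, q a *
          (Φ.W φ v.1 z * ENNReal.ofReal (Φ.ell v.1 (z 0) ^ (-γ))) := by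
          refine ENNReal.tsum_le_tsum fun v => ENNReal.tsum_le_tsum fun a => ?_
          by_cases h : app (a :: v.1) z ∈ Φ.shiftSpace
          · have h1 := (Φ.app_mem_shiftSpace.1 h).1
            rw [ell, Real.mul_rpow (Φ.ell1_pos h1.1).le (Φ.ell_pos h1.2).le,
              ENNReal.ofReal_mul (Real.rpow_nonneg (Φ.ell1_pos h1.1).le _), W, mul_mul_mul_comm]
            refine mul_le_mul_left ?_ _
            have := hT.2.2 a (app v.1 z)
            rwa [app_zero] at this
          · rw [W, Φ.om_of_notMem h]; simp
      _ = (∑' a, q a) * ∑' v : Vec 𝒜 m, Φ.W φ v.1 z * ENNReal.ofReal (Φ.ell v.1 (z 0) ^ (-γ)) := by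
          simp_rw [ENNReal.tsum_mul_right]
          rw [ENNReal.tsum_mul_left]
      _ ≤ _ := by rw [add_comm, pow_succ']; gcongr

/-- The supremum of the weight of `w` over the sequences that start with `c`. -/
noncomputable def Wb (φ : (ℕ → 𝒜) → ℝ) (w : List 𝒜) (c : 𝒜) : ℝ≥0∞ :=
  ⨆ (z : ℕ → 𝒜) (_ : z ∈ Φ.shiftSpace ∧ z 0 = c), Φ.W φ w z

lemma le_Wb {w : List 𝒜} {z : ℕ → 𝒜} (hz : z ∈ Φ.shiftSpace) : Φ.W φ w z ≤ Φ.Wb φ w (z 0) :=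
  le_iSup₂ (f := fun (y : ℕ → 𝒜) (_ : y ∈ Φ.shiftSpace ∧ y 0 = z 0) => Φ.W φ w y) z ⟨hz, rfl⟩

lemma abs_coding_sub_le_of_pre {κ : ℝ} (hκ : Φ.Contr κ) {z y : ℕ → 𝒜} (hz : z ∈ Φ.shiftSpace)
    (hy : y ∈ Φ.shiftSpace) {n : ℕ} (h : pre (n + 1) z = pre (n + 1) y) :
    |Φ.coding z - Φ.coding y| ≤ 2 * κ ^ n := by
  have h1 := Φ.abs_coding_sub_le hκ hz n (Φ.mid_mem _)
  have h2 := Φ.abs_coding_sub_le hκ hy n (Φ.mid_mem _)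
  rw [← pre_congr h n.le_succ, ← apply_eq_of_pre h n.lt_succ_self] at h2
  rw [abs_le] at *
  constructor <;> linarith

section frostman

variable [MeasurableSpace 𝒜] [DiscreteMeasurableSpace 𝒜] [Countable 𝒜] {ν : Measure (ℕ → 𝒜)}

/-- The truncated Hölder constant of the projection of `ν` restricted to `[c]`. -/
noncomputable def hold (ν : Measure (ℕ → 𝒜)) (θ ρ : ℝ) (c : 𝒜) : ℝ≥0∞ :=
  ⨆ (s : ℝ) (t : ℝ) (_ : s ≤ t),
    ν (cyl [c] ∩ {z | Φ.cod z ∈ Icc s t}) / ENNReal.ofReal (max (t - s) ρ ^ θ)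

lemma measurableSet_cod (s t : ℝ) : MeasurableSet {z | Φ.cod z ∈ Icc s t} :=
  Φ.measurable_cod measurableSet_Icc

lemma measure_le_hold {θ ρ : ℝ} (hρ : 0 < ρ) (c : 𝒜) {s t : ℝ} (hst : s ≤ t) :
    ν (cyl [c] ∩ {z | Φ.cod z ∈ Icc s t}) ≤
      ENNReal.ofReal (max (t - s) ρ ^ θ) * Φ.hold ν θ ρ c := by
  have h0 : 0 < max (t - s) ρ ^ θ := Real.rpow_pos_of_pos (lt_max_of_lt_right hρ) _
  rw [mul_comm, ← ENNReal.div_le_iff (by simpa using h0) ENNReal.ofReal_ne_top]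
  exact le_iSup_of_le s (le_iSup_of_le t (le_iSup_of_le hst le_rfl))

lemma hold_le {θ ρ : ℝ} (hρ : 0 < ρ) (c : 𝒜) {B : ℝ≥0∞}
    (h : ∀ s t : ℝ, s ≤ t → ν (cyl [c] ∩ {z | Φ.cod z ∈ Icc s t}) ≤
      ENNReal.ofReal (max (t - s) ρ ^ θ) * B) : Φ.hold ν θ ρ c ≤ B := by
  refine iSup_le fun s => iSup_le fun t => iSup_le fun hst => ?_
  have h0 : 0 < max (t - s) ρ ^ θ := Real.rpow_pos_of_pos (lt_max_of_lt_right hρ) _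
  rw [ENNReal.div_le_iff (by simpa using h0) ENNReal.ofReal_ne_top, mul_comm]
  exact h s t hst

/-- The truncation at `ρ` keeps the denominators above ρ^θ. Finiteness here is what later allows a
fraction of this sum to be subtracted from both sides of the renewal inequality; the final bound
does not depend on `ρ`. -/
lemma tsum_hold_ne_top [IsProbabilityMeasure ν] {θ ρ : ℝ} (hρ : 0 < ρ) (hθ : 0 < θ) :
    ∑' c, Φ.hold ν θ ρ c ≠ ∞ := by
  have h0 : 0 < ρ ^ θ := Real.rpow_pos_of_pos hρ _
  have h1 : ∀ c, Φ.hold ν θ ρ c ≤ (ENNReal.ofReal (ρ ^ θ))⁻¹ * ν (cyl [c]) := by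
    intro c
    refine Φ.hold_le hρ c fun s t hst => (measure_mono inter_subset_left).trans ?_
    rw [← mul_assoc]
    refine le_mul_of_one_le_left zero_le ?_
    rw [← div_eq_mul_inv, ENNReal.le_div_iff_mul_le (by simp [h0]) (by simp), one_mul]
    exact ENNReal.ofReal_le_ofReal (Real.rpow_le_rpow hρ.le (le_max_right _ _) hθ.le)
  refine ne_top_of_le_ne_top ?_ (ENNReal.tsum_le_tsum h1)
  rw [ENNReal.tsum_mul_left]
  refine ENNReal.mul_ne_top (by simp [h0]) ?_
  have := lintegral_eq_tsum_letter ν 1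
  simp only [Pi.one_apply, lintegral_one, measure_univ, Measure.restrict_apply_univ] at this
  rw [← this]; simp

variable (hgood : ∀ᵐ z ∂ν, Φ.Good z)
include hgood

/-- The branch of `w c` contracts by at least the factor `ell w c` from below, so the preimage of
[s,t] lies in an interval of length at most (t-s)/`ell w c`. As `ell` is at most 1, the truncation
level grows no faster than this length. -/
lemma lintegral_W_le_hold {θ ρ : ℝ} (hθ : 0 ≤ θ) (hρ : 0 < ρ) (w : List 𝒜) (c : 𝒜) {s t : ℝ}
    (hst : s ≤ t) :
    ∫⁻ z in cyl [c], Φ.W φ w z * {z | Φ.cod z ∈ Icc s t}.indicator 1 (app w z) ∂ν ≤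
      ENNReal.ofReal (max (t - s) ρ ^ θ) *
        (Φ.Wb φ w c * ENNReal.ofReal (Φ.ell w c ^ (-θ)) * Φ.hold ν θ ρ c) := by
  by_cases hA : Φ.AdmW w c
  · have hl := Φ.ell_pos hA
    have hl1 := Φ.ell_le_one hA
    let Z : Set (ℕ → 𝒜) := {z | Φ.Good z ∧ z 0 = c ∧ Φ.cod (app w z) ∈ Icc s t}
    obtain ⟨s', t', h1, h2, h3⟩ := exists_Icc_of_pairwise (A := Φ.cod '' Z) (D := (t - s) / Φ.ell w c)
      (div_nonneg (sub_nonneg.2 hst) hl.le) (by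
        rintro _ ⟨x, ⟨hx, hx0, hxJ⟩, rfl⟩ _ ⟨y, ⟨hy, hy0, hyJ⟩, rfl⟩
        have hxS : app w x ∈ Φ.shiftSpace := Φ.app_mem_shiftSpace.2 ⟨hx0 ▸ hA, hx.1⟩
        have hyS : app w y ∈ Φ.shiftSpace := Φ.app_mem_shiftSpace.2 ⟨hy0 ▸ hA, hy.1⟩
        rw [Φ.cod_of_mem hxS, (hx.app Φ hxS).2, hx0] at hxJ
        rw [Φ.cod_of_mem hyS, (hy.app Φ hyS).2, hy0] at hyJ
        rw [Φ.cod_of_mem hx.1, Φ.cod_of_mem hy.1, le_div_iff₀' hl]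
        refine (Φ.ell_mul_le hA (hx0 ▸ hx.2) (hy0 ▸ hy.2)).trans ?_
        rw [abs_le]; constructor <;> linarith [hxJ.1, hxJ.2, hyJ.1, hyJ.2])
    have h4 : ∀ᵐ z ∂ν.restrict (cyl [c]), Φ.W φ w z * {z | Φ.cod z ∈ Icc s t}.indicator 1 (app w z) ≤
        Φ.Wb φ w c * {z | Φ.cod z ∈ Icc s' t'}.indicator 1 z := by
      filter_upwards [ae_restrict_of_ae hgood, ae_restrict_mem (measurableSet_cyl [c])] with z hz hzc
      rw [mem_cyl_singleton] at hzc
      by_cases hJ : Φ.cod (app w z) ∈ Icc s t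
      · rw [indicator_of_mem (by exact hJ), indicator_of_mem (by exact h3 ⟨z, ⟨hz, hzc, hJ⟩, rfl⟩)]
        rw [Pi.one_apply, Pi.one_apply, mul_one, mul_one, ← hzc]
        exact Φ.le_Wb hz.1
      · rw [indicator_of_notMem (by exact hJ), mul_zero]; exact zero_le
    refine (lintegral_mono_ae h4).trans ?_
    rw [lintegral_const_mul _ (measurable_one.indicator (Φ.measurableSet_cod _ _)),
      lintegral_indicator_one (Φ.measurableSet_cod _ _),
      Measure.restrict_apply (Φ.measurableSet_cod _ _), inter_comm]
    calc _ ≤ Φ.Wb φ w c * (ENNReal.ofReal (max (t' - s') ρ ^ θ) * Φ.hold ν θ ρ c) := by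
          gcongr; exact Φ.measure_le_hold hρ c h1
      _ ≤ Φ.Wb φ w c * (ENNReal.ofReal (max (t - s) ρ ^ θ * Φ.ell w c ^ (-θ)) * Φ.hold ν θ ρ c) := by
          gcongr
          rw [Real.rpow_neg hl.le, ← div_eq_mul_inv,
            ← Real.div_rpow (le_max_of_le_right hρ.le) hl.le]
          refine Real.rpow_le_rpow (le_max_of_le_right hρ.le) (max_le ?_ ?_) hθ
          · refine h2.trans ?_
            gcongr
            exact le_max_left _ _
          · rw [le_div_iff₀ hl]
            exact (mul_le_of_le_one_right hρ.le hl1).trans (le_max_right _ _)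
      _ = _ := by
          rw [ENNReal.ofReal_mul (Real.rpow_nonneg (le_max_of_le_right hρ.le) _)]; ring
  · have h4 : ∀ᵐ z ∂ν.restrict (cyl [c]),
        Φ.W φ w z * {z | Φ.cod z ∈ Icc s t}.indicator 1 (app w z) = 0 := by
      filter_upwards [ae_restrict_of_ae hgood, ae_restrict_mem (measurableSet_cyl [c])] with z hz hzc
      rw [mem_cyl_singleton] at hzc
      have : Φ.W φ w z = 0 := by
        by_contra h
        rw [← ne_eq, Φ.W_ne_zero hz.1, Φ.app_mem_shiftSpace, hzc] at h
        exact hA h.1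
      rw [this, zero_mul]
    rw [lintegral_eq_zero_of_ae_eq_zero h4]
    exact zero_le

end frostman

end MarkovIFS

/-! ### Renewal inequality for the truncated Hölder constants -/

namespace MarkovIFS

variable {𝒜 : Type*} {α : ℝ} (Φ : MarkovIFS 𝒜 α) {φ : (ℕ → 𝒜) → ℝ}

lemma ell_rpow_neg_mono {w : List 𝒜} {c : 𝒜} (h : Φ.AdmW w c) {θ γ : ℝ} (hθγ : θ ≤ γ) :
    Φ.ell w c ^ (-θ) ≤ Φ.ell w c ^ (-γ) :=
  Real.rpow_le_rpow_of_exponent_ge (Φ.ell_pos h) (Φ.ell_le_one h) (neg_le_neg hθγ)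

lemma Wb_le {C₀ : ℝ≥0∞} (hC₀ : ∀ w : List 𝒜, ∀ z ∈ Φ.shiftSpace, ∀ z' ∈ Φ.shiftSpace,
    z 0 = z' 0 → Φ.W φ w z ≤ C₀ * Φ.W φ w z') {w : List 𝒜} {z : ℕ → 𝒜} (hz : z ∈ Φ.shiftSpace) :
    Φ.Wb φ w (z 0) ≤ C₀ * Φ.W φ w z :=
  iSup₂_le fun y hy => hC₀ w y hy.1 z hz hy.2

variable [MeasurableSpace 𝒜] [DiscreteMeasurableSpace 𝒜] [Countable 𝒜] {ν : Measure (ℕ → 𝒜)}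

lemma measure_letter_inter (hvar : Φ.SummableVariations φ) (hν : Φ.IsGibbs φ ν) (a : 𝒜) (s t : ℝ) :
    ν (cyl [a] ∩ {z | Φ.cod z ∈ Icc s t}) =
      ∑' c, ∫⁻ z in cyl [c], Φ.W φ [a] z * {z | Φ.cod z ∈ Icc s t}.indicator 1 (app [a] z) ∂ν := by
  rw [← lintegral_eq_tsum_letter, ← Φ.conformal_word hvar hν
    (measurable_one.indicator (Φ.measurableSet_cod s t)) [a],
    lintegral_indicator_one (Φ.measurableSet_cod s t), Measure.restrict_apply
    (Φ.measurableSet_cod s t), inter_comm]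

lemma measure_cod_eq_tsum (hvar : Φ.SummableVariations φ) (hν : Φ.IsGibbs φ ν) (k : ℕ) (s t : ℝ) :
    ν {z | Φ.cod z ∈ Icc s t} = ∑' c, ∑' w : Vec 𝒜 k,
      ∫⁻ z in cyl [c], Φ.W φ w.1 z * {z | Φ.cod z ∈ Icc s t}.indicator 1 (app w.1 z) ∂ν := by
  rw [← lintegral_indicator_one (Φ.measurableSet_cod s t), Φ.conformal_vec hvar hν
    (measurable_one.indicator (Φ.measurableSet_cod s t)) k, ENNReal.tsum_comm]
  exact tsum_congr fun w => lintegral_eq_tsum_letter _ _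

/-- Self-similarity at depth one: the part of the measure in `[a]` is a sum of images under the
branches of `a`, whose weights times `ell1`^(-θ) are at most `q a`. Letters far out in the alphabet
thus have small Hölder constants relative to the total. -/
lemma Tail.hold_le_mul {γ : ℝ} {q : 𝒜 → ℝ≥0∞} (hT : Φ.Tail φ γ q)
    (hvar : Φ.SummableVariations φ) (hν : Φ.IsGibbs φ ν)
    (hgood : ∀ᵐ z ∂ν, Φ.Good z) {θ ρ : ℝ} (hθ : 0 ≤ θ) (hθγ : θ ≤ γ) (hρ : 0 < ρ) (a : 𝒜) :
    Φ.hold ν θ ρ a ≤ q a * ∑' c, Φ.hold ν θ ρ c := by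
  refine Φ.hold_le hρ a fun s t hst => ?_
  rw [Φ.measure_letter_inter hvar hν]
  refine (ENNReal.tsum_le_tsum fun c => Φ.lintegral_W_le_hold hgood hθ hρ [a] c hst).trans ?_
  rw [ENNReal.tsum_mul_left]
  gcongr
  rw [← ENNReal.tsum_mul_left]
  refine ENNReal.tsum_le_tsum fun c => ?_
  gcongr
  rw [Wb]
  simp_rw [ENNReal.iSup_mul]
  refine iSup₂_le fun z hz => ?_
  refine le_trans ?_ (hT.2.2 a z)
  rw [W_singleton]
  by_cases h : consSeq a z ∈ Φ.shiftSpace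
  · gcongr
    have h1 := (Φ.consSeq_mem_shiftSpace.1 h).1
    have h2 := Φ.ell_rpow_neg_mono (w := [a]) (c := z 0) ⟨h1, trivial⟩ hθγ
    simpa [ell, hz.2] using h2
  · rw [Φ.om_of_notMem h, zero_mul, zero_mul]

lemma measure_cyl_mul_le {C₀ : ℝ≥0∞} (hC₀ : ∀ w : List 𝒜, ∀ z ∈ Φ.shiftSpace, ∀ z' ∈ Φ.shiftSpace,
    z 0 = z' 0 → Φ.W φ w z ≤ C₀ * Φ.W φ w z') (hvar : Φ.SummableVariations φ)
    (hν : Φ.IsGibbs φ ν) (w : List 𝒜) (c : 𝒜) :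
    Φ.Wb φ w c * ν (cyl [c]) ≤ C₀ * ν (cyl (w ++ [c])) := by
  rw [Φ.measure_cyl_append hvar hν, ← setLIntegral_const, ← lintegral_const_mul _ (Φ.measurable_W hvar w)]
  refine lintegral_mono_ae ?_
  filter_upwards [ae_restrict_of_ae hν.supported, ae_restrict_mem (measurableSet_cyl [c])] with z hz hzc
  rw [mem_cyl_singleton] at hzc
  rw [← hzc]
  exact Φ.Wb_le hC₀ hz

lemma measure_cyl_le {C₀ : ℝ≥0∞} (hC₀ : ∀ w : List 𝒜, ∀ z ∈ Φ.shiftSpace, ∀ z' ∈ Φ.shiftSpace,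
    z 0 = z' 0 → Φ.W φ w z ≤ C₀ * Φ.W φ w z') (hvar : Φ.SummableVariations φ)
    (hν : Φ.IsGibbs φ ν) (w : List 𝒜) {z : ℕ → 𝒜} (hz : z ∈ Φ.shiftSpace) :
    ν (cyl (w ++ [z 0])) ≤ C₀ * Φ.W φ w z * ν (cyl [z 0]) := by
  rw [Φ.measure_cyl_append hvar hν, ← setLIntegral_const]
  refine lintegral_mono_ae ?_
  filter_upwards [ae_restrict_of_ae hν.supported, ae_restrict_mem (measurableSet_cyl [z 0])]
    with y hy hyc
  rw [mem_cyl_singleton] at hyc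
  exact hC₀ w y hy z hz hyc

open Classical in
/-- Inverse branches whose image meets a short interval carry little mass. -/
lemma tsum_Wb_le {C₀ : ℝ≥0∞} (hC₀1 : C₀ ≠ ∞) (hC₀ : ∀ w : List 𝒜, ∀ z ∈ Φ.shiftSpace,
    ∀ z' ∈ Φ.shiftSpace, z 0 = z' 0 → Φ.W φ w z ≤ C₀ * Φ.W φ w z')
    (hvar : Φ.SummableVariations φ) (hν : Φ.IsGibbs φ ν) [IsProbabilityMeasure ν]
    {κ : ℝ} (hκ : Φ.Contr κ) (k : ℕ) (s t : ℝ) (c : 𝒜) :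
    (∑' w : Vec 𝒜 k, if ∃ z, Φ.Good z ∧ z 0 = c ∧ app w.1 z ∈ Φ.shiftSpace ∧
        Φ.cod (app w.1 z) ∈ Icc s t then Φ.Wb φ w.1 c else 0) * ν (cyl [c]) ≤
      C₀ * ν {z | Φ.cod z ∈ Icc (s - 2 * κ ^ k) (t + 2 * κ ^ k)} := by
  rw [← ENNReal.tsum_mul_right]
  calc _ ≤ ∑' w : Vec 𝒜 k, C₀ * ∫⁻ z in cyl w.1,
        {z | Φ.cod z ∈ Icc (s - 2 * κ ^ k) (t + 2 * κ ^ k)}.indicator 1 z ∂ν := by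
        refine ENNReal.tsum_le_tsum fun w => ?_
        split_ifs with h
        · refine (Φ.measure_cyl_mul_le hC₀ hvar hν w.1 c).trans ?_
          gcongr
          rw [lintegral_indicator_one (Φ.measurableSet_cod _ _),
            Measure.restrict_apply (Φ.measurableSet_cod _ _)]
          refine measure_mono_ae ?_
          filter_upwards [hν.supported] with y hy
          obtain ⟨z, hz, hzc, hwz, hzJ⟩ := h
          intro hyw
          refine ⟨?_, cyl_append_subset _ _ hyw⟩
          rw [Φ.cod_of_mem hwz] at hzJ
          have h1 : pre (k + 1) (app w.1 z) = w.1 ++ [c] := by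
            have := pre_app_add w.1 z 1
            rw [w.2, add_comm] at this
            rw [this]; simp [pre, hzc]
          have h2 : pre (k + 1) y = w.1 ++ [c] := by
            have h3 := mem_cyl_iff_pre.1 (show y ∈ cyl (w.1 ++ [c]) from hyw)
            rwa [List.length_append, w.2] at h3
          -- Every sequence of [w c] agrees with `w z` in k+1 letters, so the whole cylinder is
          -- coded into the enlarged interval.
          have h3 := Φ.abs_coding_sub_le_of_pre hκ hwz hy (h1.trans h2.symm)
          rw [abs_le] at h3
          change Φ.cod y ∈ Icc (s - 2 * κ ^ k) (t + 2 * κ ^ k)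
          rw [Φ.cod_of_mem hy]
          constructor <;> linarith [hzJ.1, hzJ.2]
        · simp
    _ = _ := by
        rw [ENNReal.tsum_mul_left, ← lintegral_eq_tsum_cyl,
          lintegral_indicator_one (Φ.measurableSet_cod _ _)]

-- Self-similarity at depth `k`, where only those branches are kept whose image can meet the
-- interval.
open Classical in
lemma measure_cod_le_tsum (hvar : Φ.SummableVariations φ) (hν : Φ.IsGibbs φ ν)
    (hgood : ∀ᵐ z ∂ν, Φ.Good z) {θ ρ : ℝ} (hθ : 0 ≤ θ) (hρ : 0 < ρ) (k : ℕ) {s t : ℝ} (hst : s ≤ t) :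
    ν {z | Φ.cod z ∈ Icc s t} ≤ ENNReal.ofReal (max (t - s) ρ ^ θ) *
      ∑' c, (∑' w : Vec 𝒜 k, (if ∃ z, Φ.Good z ∧ z 0 = c ∧ app w.1 z ∈ Φ.shiftSpace ∧
        Φ.cod (app w.1 z) ∈ Icc s t then Φ.Wb φ w.1 c else 0) *
          ENNReal.ofReal (Φ.ell w.1 c ^ (-θ))) * Φ.hold ν θ ρ c := by
  rw [Φ.measure_cod_eq_tsum hvar hν k, ← ENNReal.tsum_mul_left]
  refine ENNReal.tsum_le_tsum fun c => ?_
  rw [← ENNReal.tsum_mul_right, ← ENNReal.tsum_mul_left]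
  refine ENNReal.tsum_le_tsum fun w => ?_
  split_ifs with h
  · exact Φ.lintegral_W_le_hold hgood hθ hρ w.1 c hst
  · rw [zero_mul, zero_mul, mul_zero, nonpos_iff_eq_zero]
    refine lintegral_eq_zero_of_ae_eq_zero ?_
    filter_upwards [ae_restrict_of_ae hgood, ae_restrict_mem (measurableSet_cyl [c])] with z hz hzc
    rw [mem_cyl_singleton] at hzc
    by_cases hw : app w.1 z ∈ Φ.shiftSpace
    · rw [indicator_of_notMem, mul_zero]; · rfl
      exact fun hJ => h ⟨z, hz, hzc, hw, hJ⟩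
    · have : Φ.W φ w.1 z = 0 := by
        by_contra h0
        exact hw ((Φ.W_ne_zero hz.1).1 h0)
      rw [this, zero_mul]; rfl

lemma exists_measure_cod_le (hν : Φ.IsGibbs φ ν)
    [IsProbabilityMeasure ν] (hatoms : ∀ x : ℝ, Φ.proj ν {x} = 0) {ε : ℝ≥0∞} (hε : 0 < ε) :
    ∃ r : ℝ, 0 < r ∧ ∀ s t : ℝ, t - s ≤ r → ν {z | Φ.cod z ∈ Icc s t} ≤ ε := by
  have h1 : Φ.proj ν (Icc 0 1)ᶜ = 0 := by
    rw [Φ.proj_apply hν measurableSet_Icc.compl]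
    have : ∀ᵐ z ∂ν, Φ.cod z ∈ Icc (0 : ℝ) 1 := by
      filter_upwards [Φ.ae_good hν hatoms] with z hz
      rw [Φ.cod_of_mem hz.1]
      exact Φ.I_subset _ hz.2
    exact ae_iff.1 this
  have : IsFiniteMeasure (Φ.proj ν) := by
    unfold proj; infer_instance
  obtain ⟨r, hr, h⟩ := exists_measure_Icc_le_of_noAtoms (Φ.proj ν) hatoms h1 hε
  refine ⟨r, hr, fun s t hst => ?_⟩
  rw [← Φ.proj_apply hν measurableSet_Icc]
  exact h s t hst

-- Short intervals are hit by few branches of length `k`. Absence of atoms makes the total weight of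
-- these branches small over each of finitely many letters, the tail handles the other letters, and
-- a small exponent θ makes the loss ell^(-θ) harmless. Each of the three errors is at most `η`
-- times the sum of the Hölder constants.
open Classical in
lemma Tail.exists_measure_cod_le_mul {γ : ℝ} {q : 𝒜 → ℝ≥0∞} (hT : Φ.Tail φ γ q)
    (hnorm : Φ.IsNormalized φ) (hvar : Φ.SummableVariations φ) (hν : Φ.IsGibbs φ ν)
    [IsProbabilityMeasure ν] (hatoms : ∀ x : ℝ, Φ.proj ν {x} = 0) {η : ℝ≥0∞} (hη : 0 < η)
    (hη1 : η ≠ ∞) :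
    ∃ θ r₀ : ℝ, 0 < θ ∧ θ ≤ γ ∧ 0 < r₀ ∧ ∀ ρ s t : ℝ, 0 < ρ → s ≤ t → t - s ≤ r₀ →
      ν {z | Φ.cod z ∈ Icc s t} ≤
        ENNReal.ofReal (max (t - s) ρ ^ θ) * ((η + η + η) * ∑' c, Φ.hold ν θ ρ c) := by
  obtain ⟨C₀', hC1, hC₀⟩ := Φ.exists_W_distortion hvar
  set C₀ := ENNReal.ofReal C₀' with hC₀def
  have hC0 : C₀ ≠ 0 := by simp [hC₀def]; linarith
  have hCt : C₀ ≠ ∞ := ENNReal.ofReal_ne_top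
  obtain ⟨κ, hκ⟩ := Φ.exists_contr
  have hgood := Φ.ae_good hν hatoms
  -- Outside the finite set `A₀` the tail, multiplied by the distortion constant, sums to at most
  -- `η`.
  obtain ⟨A₀, hA₀⟩ := ((ENNReal.tendsto_tsum_compl_atTop_zero hT.2.1).eventually_le_const
    (ENNReal.div_pos hη.ne' hCt)).exists
  -- The smallest positive mass of a letter of `A₀`; null letters are given the harmless value 1.
  set μ₀ := A₀.inf fun c => if ν (cyl [c]) = 0 then (1 : ℝ≥0∞) else ν (cyl [c]) with hμ₀
  have hμpos : 0 < μ₀ := by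
    rw [hμ₀, Finset.lt_inf_iff ENNReal.zero_lt_top]
    intro c _
    split_ifs with h
    · exact one_pos
    · exact pos_iff_ne_zero.2 h
  obtain ⟨r, hr, hr'⟩ := Φ.exists_measure_cod_le hν hatoms
    (ENNReal.div_pos (ENNReal.mul_pos hη.ne' hμpos.ne').ne' hCt)
  -- With t - s ≤ r/2 and 4κ^k < r/2 the enlarged interval still has length at most `r`.
  obtain ⟨k, hk⟩ := exists_pow_lt_of_lt_one (show 0 < r / 8 by positivity) hκ.2.1
  set D := C₀ * (∑' a, q a) ^ k with hD
  have hDt : D ≠ ∞ := ENNReal.mul_ne_top hCt (ENNReal.pow_ne_top hT.2.1)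
  have hx1 : η / (D + 1) ≠ ∞ := ENNReal.div_ne_top hη1 (by simp)
  have hx0 : η / (D + 1) ≠ 0 := (ENNReal.div_pos hη.ne' (by simp [hDt])).ne'
  -- The largest value allowed for θ/γ: multiplied by the bound `D` for the moment of order γ over
  -- words of length `k`, it stays below `η`.
  set x := (η / (D + 1)).toReal with hx
  have hxpos : 0 < x := ENNReal.toReal_pos hx0 hx1
  have hxD : ENNReal.ofReal x * D ≤ η := by
    rw [hx, ENNReal.ofReal_toReal hx1]
    calc η / (D + 1) * D ≤ η / (D + 1) * (D + 1) := by gcongr; exact le_self_add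
      _ = η := ENNReal.div_mul_cancel (by simp) (by simp [hDt])
  have hγ := hT.1
  have hθ0 : 0 < min γ (γ * x) := lt_min hγ (mul_pos hγ hxpos)
  refine ⟨min γ (γ * x), r / 2, hθ0, min_le_left _ _, half_pos hr,
    fun ρ s t hρ hst hstr => ?_⟩
  set θ := min γ (γ * x) with hθ
  have hθx : θ / γ ≤ x := by rw [div_le_iff₀' hγ]; exact min_le_right _ _
  refine (Φ.measure_cod_le_tsum hvar hν hgood hθ0.le hρ k hst).trans ?_
  gcongr
  set Gs := ∑' c, Φ.hold ν θ ρ c with hGs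
  have hq2 : ∑' c, {c | c ∉ A₀}.indicator q c ≤ η / C₀ := by
    rw [← tsum_subtype]; exact hA₀
  -- The three summands stand for the letters outside `A₀`, the letters of `A₀`, and the excess of
  -- ell^(-θ) over 1.
  calc _ ≤ ∑' c, ({c | c ∉ A₀}.indicator q c * (C₀ * Gs) + η * Φ.hold ν θ ρ c
        + η * Φ.hold ν θ ρ c) := by
        refine ENNReal.tsum_le_tsum fun c => ?_
        by_cases hc : ∃ z ∈ Φ.shiftSpace, z 0 = c
        swap
        · have : ∀ w, Φ.Wb φ w c = 0 := by
            intro w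
            simp only [Wb, ENNReal.iSup_eq_zero]
            exact fun z hz => absurd ⟨z, hz⟩ hc
          simp [this]
        obtain ⟨z₀, hz₀, rfl⟩ := hc
        have hfirst : (∑' w : Vec 𝒜 k, if ∃ z, Φ.Good z ∧ z 0 = z₀ 0 ∧ app w.1 z ∈ Φ.shiftSpace ∧
            Φ.cod (app w.1 z) ∈ Icc s t then Φ.Wb φ w.1 (z₀ 0) else 0) * Φ.hold ν θ ρ (z₀ 0) ≤
            {c | c ∉ A₀}.indicator q (z₀ 0) * (C₀ * Gs) + η * Φ.hold ν θ ρ (z₀ 0) := by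
          by_cases hcA : z₀ 0 ∈ A₀
          · refine le_add_of_nonneg_of_le zero_le ?_
            by_cases h0 : ν (cyl [z₀ 0]) = 0
            · have : Φ.hold ν θ ρ (z₀ 0) = 0 := by
                refine nonpos_iff_eq_zero.1 (Φ.hold_le hρ _ fun s t _ => ?_)
                rw [measure_mono_null inter_subset_left h0]; exact zero_le
              rw [this]; simp
            · refine mul_le_mul_left ?_ _
              have h1 := Φ.tsum_Wb_le hCt hC₀ hvar hν hκ k s t (z₀ 0)
              have h2 := hr' (s - 2 * κ ^ k) (t + 2 * κ ^ k) (by linarith)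
              rw [← ENNReal.mul_le_mul_iff_left h0 (measure_ne_top _ _)]
              refine h1.trans ((mul_le_mul_right h2 C₀).trans ?_)
              rw [ENNReal.mul_div_cancel hC0 hCt]
              gcongr
              have h3 : μ₀ ≤ _ := Finset.inf_le hcA
              rwa [if_neg h0] at h3
          · refine le_add_of_le_of_nonneg ?_ zero_le
            rw [indicator_of_mem (by exact hcA)]
            have h1 : (∑' w : Vec 𝒜 k, if ∃ z, Φ.Good z ∧ z 0 = z₀ 0 ∧ app w.1 z ∈ Φ.shiftSpace ∧
              Φ.cod (app w.1 z) ∈ Icc s t then Φ.Wb φ w.1 (z₀ 0) else 0) ≤ C₀ := by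
              calc _ ≤ ∑' w : Vec 𝒜 k, C₀ * Φ.W φ w.1 z₀ := by
                    refine ENNReal.tsum_le_tsum fun w => ?_
                    split_ifs
                    · exact Φ.Wb_le hC₀ hz₀
                    · exact zero_le
                _ = C₀ := by rw [ENNReal.tsum_mul_left, Φ.tsum_W hnorm hz₀, mul_one]
            calc _ ≤ C₀ * (q (z₀ 0) * Gs) :=
                  mul_le_mul' h1 (hT.hold_le_mul Φ hvar hν hgood hθ0.le (min_le_left _ _) hρ _)
              _ = _ := by ring
        have hsecond : (∑' w : Vec 𝒜 k, Φ.Wb φ w.1 (z₀ 0) * (ENNReal.ofReal x *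
            ENNReal.ofReal (Φ.ell w.1 (z₀ 0) ^ (-γ)))) ≤ η := by
          refine le_trans ?_ hxD
          calc _ ≤ ∑' w : Vec 𝒜 k, ENNReal.ofReal x * (C₀ * (Φ.W φ w.1 z₀ *
                  ENNReal.ofReal (Φ.ell w.1 (z₀ 0) ^ (-γ)))) := by
                refine ENNReal.tsum_le_tsum fun w => ?_
                calc _ ≤ (C₀ * Φ.W φ w.1 z₀) * (ENNReal.ofReal x *
                      ENNReal.ofReal (Φ.ell w.1 (z₀ 0) ^ (-γ))) := by
                      gcongr; exact Φ.Wb_le hC₀ hz₀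
                  _ = _ := by ring
            _ ≤ _ := by
                rw [ENNReal.tsum_mul_left, ENNReal.tsum_mul_left, hD]
                gcongr
                exact hT.tsum_W_mul_le z₀ k
        refine le_trans ?_ (add_le_add hfirst (mul_le_mul_left hsecond _))
        rw [← add_mul, ← ENNReal.tsum_add]
        gcongr with w
        by_cases hw : Φ.AdmW w.1 (z₀ 0)
        · have h1 := rpow_neg_le_one_add (Φ.ell_pos hw) hγ hθ0.le (min_le_left _ _)
          have h2 : ENNReal.ofReal (Φ.ell w.1 (z₀ 0) ^ (-θ)) ≤
              1 + ENNReal.ofReal x * ENNReal.ofReal (Φ.ell w.1 (z₀ 0) ^ (-γ)) := by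
            rw [← ENNReal.ofReal_mul hxpos.le, ← ENNReal.ofReal_one, ← ENNReal.ofReal_add zero_le_one
              (mul_nonneg hxpos.le (Real.rpow_nonneg (Φ.ell_pos hw).le _))]
            refine ENNReal.ofReal_le_ofReal (h1.trans ?_)
            gcongr
            exact Real.rpow_nonneg (Φ.ell_pos hw).le _
          refine (mul_le_mul_right h2 _).trans ?_
          rw [mul_add, mul_one]
          gcongr
          split_ifs
          · exact le_rfl
          · exact zero_le
        · have : Φ.Wb φ w.1 (z₀ 0) = 0 := by
            simp only [Wb, ENNReal.iSup_eq_zero]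
            rintro z ⟨hz, hz0⟩
            by_contra h
            rw [← ne_eq, Φ.W_ne_zero hz, Φ.app_mem_shiftSpace, hz0] at h
            exact hw h.1
          simp [this]
    _ = (∑' c, {c | c ∉ A₀}.indicator q c) * (C₀ * Gs) + η * Gs + η * Gs := by
        rw [ENNReal.tsum_add, ENNReal.tsum_add, ENNReal.tsum_mul_left, ENNReal.tsum_mul_right]
    _ ≤ η / C₀ * (C₀ * Gs) + η * Gs + η * Gs := by gcongr
    _ = _ := by
        rw [← mul_assoc, ENNReal.div_mul_cancel hC0 hCt]; ring

open Classical in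
/-- The Gibbs measure is upper Hölder regular. -/
theorem Tail.frostman {γ : ℝ} {q : 𝒜 → ℝ≥0∞} (hT : Φ.Tail φ γ q)
    (hnorm : Φ.IsNormalized φ) (hvar : Φ.SummableVariations φ) (hν : Φ.IsGibbs φ ν)
    [IsProbabilityMeasure ν] (hatoms : ∀ x : ℝ, Φ.proj ν {x} = 0) :
    ∃ θ C : ℝ, 0 < θ ∧ 0 < C ∧ ∀ s t : ℝ, s ≤ t →
      ν {z | Φ.cod z ∈ Icc s t} ≤ ENNReal.ofReal (C * (t - s) ^ θ) := by
  have hgood := Φ.ae_good hν hatoms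
  obtain ⟨A, hA⟩ := ((ENNReal.tendsto_tsum_compl_atTop_zero hT.2.1).eventually_le_const
    (show (0 : ℝ≥0∞) < 1 / 4 from ENNReal.div_pos one_ne_zero (by simp))).exists
  -- Chosen so that the inequality with 3η, summed over the letters of `A`, contributes at most a
  -- quarter of the total.
  set η : ℝ≥0∞ := 1 / (12 * (A.card + 1)) with hη
  have hηpos : 0 < η := ENNReal.div_pos one_ne_zero
    (ENNReal.mul_ne_top (by simp) (by simp))
  have hηA : (A.card : ℝ≥0∞) * (η + η + η) ≤ 1 / 4 := by
    have h1 : η + η + η = 1 / (4 * (A.card + 1)) := by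
      rw [hη, ← ENNReal.toReal_eq_toReal_iff' (by simp) (by simp)]
      rw [ENNReal.toReal_add (by simp) (by simp), ENNReal.toReal_add (by simp) (by simp)]
      have e : ((A.card : ℝ≥0∞) + 1).toReal = A.card + 1 := by
        rw [ENNReal.toReal_add (by simp) (by simp)]; simp
      simp only [ENNReal.toReal_div, ENNReal.toReal_mul, e, ENNReal.toReal_one, ENNReal.toReal_ofNat]
      field_simp; norm_num
    rw [h1, mul_one_div]
    refine ENNReal.div_le_of_le_mul ?_
    rw [← mul_assoc, ENNReal.div_mul_cancel (by simp) (by simp), one_mul]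
    exact le_self_add
  obtain ⟨θ, r₀, hθ, hθγ, hr₀, hmain⟩ := hT.exists_measure_cod_le_mul Φ hnorm hvar hν hatoms hηpos
    (ENNReal.div_ne_top (by simp) (by simp))
  set R := ENNReal.ofReal (r₀ ^ (-θ)) with hR
  -- Letters of `A` use the renewal inequality, or the trivial bound by `R` for intervals longer
  -- than `r₀`; the other letters use the tail. Each group returns at most a quarter of the finite
  -- total `Gs`, and absorbing both leaves a bound independent of `ρ`.
  have hG : ∀ ρ : ℝ, 0 < ρ → ∑' c, Φ.hold ν θ ρ c ≤ 2 * (A.card * R) := by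
    intro ρ hρ
    have hfin := Φ.tsum_hold_ne_top (ν := ν) hρ hθ
    set Gs := ∑' c, Φ.hold ν θ ρ c with hGs
    have h1 : ∀ c, Φ.hold ν θ ρ c ≤ R + (η + η + η) * Gs := by
      intro c
      refine Φ.hold_le hρ c fun s t hst => ?_
      by_cases hr : t - s ≤ r₀
      · refine (measure_mono inter_subset_right).trans ((hmain ρ s t hρ hst hr).trans ?_)
        gcongr
        exact le_add_self
      · push Not at hr
        refine (prob_le_one).trans ?_
        refine le_trans ?_ (mul_le_mul_right le_self_add _)
        rw [hR, ← ENNReal.ofReal_mul (Real.rpow_nonneg (le_max_of_le_right hρ.le) _),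
          ENNReal.one_le_ofReal, Real.rpow_neg hr₀.le, ← div_eq_mul_inv,
          one_le_div (Real.rpow_pos_of_pos hr₀ _)]
        exact Real.rpow_le_rpow hr₀.le (hr.le.trans (le_max_left _ _)) hθ.le
    have h2 : Gs ≤ A.card * (R + (η + η + η) * Gs) + 1 / 4 * Gs := by
      conv_lhs => rw [hGs, ← ENNReal.sum_add_tsum_compl A]
      gcongr
      · refine (Finset.sum_le_sum fun c _ => h1 c).trans ?_
        rw [Finset.sum_const, nsmul_eq_mul]
      · calc _ ≤ ∑' c : {x // x ∉ A}, q c.1 * Gs := ENNReal.tsum_le_tsum fun c =>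
              hT.hold_le_mul Φ hvar hν hgood hθ.le hθγ hρ c.1
          _ ≤ _ := by
              rw [ENNReal.tsum_mul_right]
              gcongr
    have h3 : Gs ≤ A.card * R + (1 / 4 * Gs + 1 / 4 * Gs) := by
      refine h2.trans ?_
      rw [mul_add, ← mul_assoc, add_assoc]
      gcongr
    have hRt : (A.card : ℝ≥0∞) * R ≠ ∞ := ENNReal.mul_ne_top (by simp) ENNReal.ofReal_ne_top
    rw [← ENNReal.toReal_le_toReal hfin (ENNReal.mul_ne_top (by simp) hRt)]
    have h4 := ENNReal.toReal_mono (ENNReal.add_ne_top.2 ⟨hRt, ENNReal.add_ne_top.2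
      ⟨ENNReal.mul_ne_top (by simp) hfin, ENNReal.mul_ne_top (by simp) hfin⟩⟩) h3
    rw [ENNReal.toReal_add hRt (ENNReal.add_ne_top.2
      ⟨ENNReal.mul_ne_top (by simp) hfin, ENNReal.mul_ne_top (by simp) hfin⟩),
      ENNReal.toReal_add (ENNReal.mul_ne_top (by simp) hfin) (ENNReal.mul_ne_top (by simp) hfin),
      ENNReal.toReal_mul (a := 1 / 4), ENNReal.toReal_div] at h4
    rw [ENNReal.toReal_mul (a := 2)]
    norm_num at h4 ⊢
    linarith
  refine ⟨θ, 2 * (A.card * r₀ ^ (-θ)) + 1, hθ, by positivity, fun s t hst => ?_⟩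
  rcases eq_or_lt_of_le hst with rfl | hlt
  -- A degenerate interval is treated separately, since for the others the truncation level is set
  -- equal to the length t - s.
  · have := hatoms s
    rw [Φ.proj_apply hν (measurableSet_singleton s)] at this
    rw [Icc_self, this]; exact zero_le
  · have hpos : 0 < t - s := sub_pos.2 hlt
    have h1 : ν {z | Φ.cod z ∈ Icc s t} = ∑' c, ν (cyl [c] ∩ {z | Φ.cod z ∈ Icc s t}) := by
      rw [← lintegral_indicator_one (Φ.measurableSet_cod s t), lintegral_eq_tsum_letter]
      refine tsum_congr fun c => ?_
      rw [lintegral_indicator_one (Φ.measurableSet_cod s t),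
        Measure.restrict_apply (Φ.measurableSet_cod s t), inter_comm]
    rw [h1]
    refine (ENNReal.tsum_le_tsum fun c => Φ.measure_le_hold (θ := θ) hpos c hst).trans ?_
    rw [ENNReal.tsum_mul_left, max_self]
    refine (mul_le_mul_right (hG _ hpos) _).trans ?_
    rw [mul_comm (_ + 1), ENNReal.ofReal_mul (Real.rpow_nonneg hpos.le _)]
    gcongr
    rw [ENNReal.ofReal_add (by positivity) zero_le_one, ENNReal.ofReal_mul (by norm_num),
      ENNReal.ofReal_mul (by positivity)]
    simp [hR]

end MarkovIFS

/-! ### Non-concentration from uniform non-integrability -/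

namespace MarkovIFS

variable {𝒜 : Type*} {α : ℝ} (Φ : MarkovIFS 𝒜 α) {φ : (ℕ → 𝒜) → ℝ}

lemma Words.exists_eq_append {N : ℕ} (a : Φ.Words N) {c : 𝒜} (h : a.1.getLast? = some c) :
    ∃ u : List 𝒜, a.1 = u ++ [c] ∧ u.length + 1 = N ∧ Φ.AdmW u c := by
  obtain ⟨u, hu⟩ := List.getLast?_eq_some_iff.1 h
  refine ⟨u, hu, ?_, ?_⟩
  · rw [← a.2.1, hu]; simp
  · rw [← isChain_append_singleton, ← hu]; exact a.2.2

open Classical in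
/-- The probability that a random inverse branch of length `m` has fluctuation in `[t, t + r]`. -/
noncomputable def conc (φ : (ℕ → 𝒜) → ℝ) (m : ℕ) (y : ℕ → 𝒜) (p p' t r : ℝ) : ℝ≥0∞ :=
  ∑' w : Vec 𝒜 m, if Φ.ta w.1 (y 0) p - Φ.ta w.1 (y 0) p' ∈ Icc t (t + r) then Φ.W φ w.1 y else 0

lemma conc_le_one (hnorm : Φ.IsNormalized φ) (m : ℕ) {y : ℕ → 𝒜} (hy : y ∈ Φ.shiftSpace)
    (p p' t r : ℝ) : Φ.conc φ m y p p' t r ≤ 1 := by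
  rw [← Φ.tsum_W hnorm hy m]
  refine ENNReal.tsum_le_tsum fun w => ?_
  split_ifs
  · exact le_rfl
  · exact zero_le

lemma conc_add (m k : ℕ) (y : ℕ → 𝒜) (p p' t r : ℝ) :
    Φ.conc φ (m + k) y p p' t r = ∑' u : Vec 𝒜 k, Φ.W φ u.1 y *
      Φ.conc φ m (app u.1 y) (Φ.G u.1 (y 0) p) (Φ.G u.1 (y 0) p')
        (t - (Φ.ta u.1 (y 0) p - Φ.ta u.1 (y 0) p')) r := by
  classical
  rw [conc, tsum_vec_add m k (fun w => if Φ.ta w (y 0) p - Φ.ta w (y 0) p' ∈ Icc t (t + r) then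
    Φ.W φ w y else 0)]
  refine tsum_congr fun u => ?_
  rw [conc, ← ENNReal.tsum_mul_left]
  refine tsum_congr fun v => ?_
  rw [ta_append, ta_append, W_append, app_zero, mul_ite, mul_zero, mul_comm (Φ.W φ u.1 y)]
  congr 1
  simp only [mem_Icc, eq_iff_iff]
  constructor <;> rintro ⟨h1, h2⟩ <;> constructor <;> linarith

lemma om_le_of_tail {γ : ℝ} {q : 𝒜 → ℝ≥0∞} (hT : Φ.Tail φ γ q) (a : 𝒜) (z : ℕ → 𝒜) :
    Φ.om φ (consSeq a z) ≤ q a := by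
  by_cases h : consSeq a z ∈ Φ.shiftSpace
  · refine le_trans (le_mul_of_one_le_right zero_le ?_) (hT.2.2 a z)
    rw [ENNReal.one_le_ofReal]
    have h1 := (Φ.consSeq_mem_shiftSpace.1 h).1
    have h2 := Φ.ell_le_one (w := [a]) (c := z 0) ⟨h1, trivial⟩
    simp only [ell, mul_one] at h2
    exact Real.one_le_rpow_of_pos_of_le_one_of_nonpos (Φ.ell1_pos h1) h2 (by simpa using hT.1.le)
  · rw [Φ.om_of_notMem h]; exact zero_le

-- The outermost letter `a` contributes at most `q a`, whatever follows it, and the weights of the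
-- remaining letters sum to 1.
open Classical in
lemma tsum_W_head_le {γ : ℝ} {q : 𝒜 → ℝ≥0∞} (hT : Φ.Tail φ γ q) (hnorm : Φ.IsNormalized φ)
    (A : Finset 𝒜) {y : ℕ → 𝒜} (hy : y ∈ Φ.shiftSpace) (L : ℕ) (c : 𝒜) :
    ∑' u : Vec 𝒜 (L + 1), (if u.1.headD c ∈ A then 0 else Φ.W φ u.1 y) ≤
      ∑' a : {a // a ∉ A}, q a := by
  rw [add_comm L 1, tsum_vec_succ' L (fun u => if u.headD c ∈ A then 0 else Φ.W φ u y)]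
  calc _ ≤ ∑' v : Vec 𝒜 L, ∑' a, {a | a ∉ A}.indicator q a * Φ.W φ v.1 y := by
        refine ENNReal.tsum_le_tsum fun v => ENNReal.tsum_le_tsum fun a => ?_
        rw [List.headD_cons]
        by_cases h : a ∈ A
        · rw [if_pos h]; exact bot_le
        · rw [if_neg h, indicator_of_mem (by exact h), W]
          exact mul_le_mul_left (Φ.om_le_of_tail hT a _) _
    _ = _ := by
        simp_rw [ENNReal.tsum_mul_right]
        rw [ENNReal.tsum_mul_left, Φ.tsum_W hnorm hy, mul_one, ← tsum_subtype]
        rfl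

open Classical in
/-- One block of the tree recursion. -/
lemma tsum_W_block_le {γ : ℝ} {q : 𝒜 → ℝ≥0∞} (hT : Φ.Tail φ γ q) (hnorm : Φ.IsNormalized φ)
    (A : Finset 𝒜) (hA : ∑' a : {a // a ∉ A}, q a ≤ 1 / 4) {L : ℕ} {η s : ℝ} (hη : 0 < η)
    (hη1 : η ≤ 1) (hs : 0 < s) (hsγ : s ≤ γ)
    (hsQ : ENNReal.ofReal (s / γ * 2) * (∑' a, q a) ^ (L + 1) ≤ ENNReal.ofReal (η / 4))
    {y : ℕ → 𝒜} (hy : y ∈ Φ.shiftSpace) (u₀ : Vec 𝒜 (L + 1))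
    (hu₀ : y 0 ∈ A → ENNReal.ofReal η ≤ Φ.W φ u₀.1 y) :
    ∑' u : Vec 𝒜 (L + 1), (if u = u₀ then 0 else Φ.W φ u.1 y *
      ENNReal.ofReal (Φ.ell u.1 (y 0) ^ (-s)) *
        ENNReal.ofReal (if u.1.headD (y 0) ∈ A then 1 else 1 + η)) ≤
      ENNReal.ofReal ((1 - η / 4) * (if y 0 ∈ A then 1 else 1 + η)) := by
  have hγ := hT.1
  -- The increments of the two correction factors over 1 are separated: `η` for a head outside `A`,
  -- and a multiple of s/γ for the power of `ell`. The factor 2 there bounds 1 + η.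
  have h1 : ∀ u : Vec 𝒜 (L + 1), (if u = u₀ then 0 else Φ.W φ u.1 y *
      ENNReal.ofReal (Φ.ell u.1 (y 0) ^ (-s)) *
        ENNReal.ofReal (if u.1.headD (y 0) ∈ A then 1 else 1 + η)) ≤
      (if u = u₀ then 0 else Φ.W φ u.1 y) +
      ENNReal.ofReal η * (if u.1.headD (y 0) ∈ A then 0 else Φ.W φ u.1 y) +
      ENNReal.ofReal (s / γ * 2) * (Φ.W φ u.1 y * ENNReal.ofReal (Φ.ell u.1 (y 0) ^ (-γ))) := by
    intro u
    by_cases hu : app u.1 y ∈ Φ.shiftSpace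
    swap
    · have : Φ.W φ u.1 y = 0 := by
        by_contra h; exact hu ((Φ.W_ne_zero hy).1 h)
      simp [this]
    have had := (Φ.app_mem_shiftSpace.1 hu).1
    have h2 := rpow_neg_le_one_add (Φ.ell_pos had) hγ hs.le hsγ
    have hp := Real.rpow_nonneg (Φ.ell_pos had).le (-γ)
    split_ifs with e1 e2 e2
    · exact zero_le
    · exact zero_le
    · rw [mul_zero, add_zero, ENNReal.ofReal_one, mul_one]
      calc _ ≤ Φ.W φ u.1 y * ENNReal.ofReal (1 + s / γ * 2 * Φ.ell u.1 (y 0) ^ (-γ)) := by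
            gcongr
            refine h2.trans ?_
            have : 0 ≤ s / γ * Φ.ell u.1 (y 0) ^ (-γ) := by positivity
            linarith
        _ = _ := by
            rw [ENNReal.ofReal_add zero_le_one (by positivity), ENNReal.ofReal_one,
              ENNReal.ofReal_mul (by positivity)]; ring
    · calc _ ≤ Φ.W φ u.1 y * ENNReal.ofReal (1 + η + s / γ * 2 * Φ.ell u.1 (y 0) ^ (-γ)) := by
            rw [mul_assoc, ← ENNReal.ofReal_mul (Real.rpow_nonneg (Φ.ell_pos had).le _)]
            gcongr
            have : 0 ≤ s / γ * Φ.ell u.1 (y 0) ^ (-γ) := by positivity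
            nlinarith
        _ = _ := by
            rw [ENNReal.ofReal_add (by positivity) (by positivity),
              ENNReal.ofReal_add zero_le_one hη.le, ENNReal.ofReal_one,
              ENNReal.ofReal_mul (by positivity)]; ring
  have hsum : Φ.W φ u₀.1 y + ∑' u : Vec 𝒜 (L + 1), (if u = u₀ then 0 else Φ.W φ u.1 y) = 1 := by
    rw [← Φ.tsum_W hnorm hy (L + 1)]
    convert (ENNReal.tsum_eq_add_tsum_ite (f := fun u : Vec 𝒜 (L + 1) => Φ.W φ u.1 y) u₀).symm
  have hle1 : ∑' u : Vec 𝒜 (L + 1), (if u = u₀ then 0 else Φ.W φ u.1 y) ≤ 1 :=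
    hsum ▸ le_add_self
  have h14 : (1 / 4 : ℝ≥0∞) = ENNReal.ofReal (1 / 4) := by
    rw [ENNReal.ofReal_div_of_pos (by norm_num)]; simp
  calc _ ≤ (∑' u : Vec 𝒜 (L + 1), (if u = u₀ then 0 else Φ.W φ u.1 y)) +
        ENNReal.ofReal η * ENNReal.ofReal (1 / 4) + ENNReal.ofReal (η / 4) := by
        refine (ENNReal.tsum_le_tsum h1).trans ?_
        rw [ENNReal.tsum_add, ENNReal.tsum_add, ENNReal.tsum_mul_left, ENNReal.tsum_mul_left]
        gcongr
        · rw [← h14]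
          exact (Φ.tsum_W_head_le hT hnorm A hy L (y 0)).trans hA
        · exact (mul_le_mul_right (hT.tsum_W_mul_le y (L + 1)) _).trans hsQ
    _ ≤ _ := by
        rw [← ENNReal.ofReal_mul hη.le, add_assoc, ← ENNReal.ofReal_add (by positivity) (by positivity)]
        -- Over a letter of `A` the missing block gains `η` against errors η/4 + η/4. Over other
        -- letters nothing is gained, but 1 + η/2 is still below (1 - η/4)(1 + η).
        split_ifs with hyA
        · have h5 : ∑' u : Vec 𝒜 (L + 1), (if u = u₀ then 0 else Φ.W φ u.1 y) ≤
              ENNReal.ofReal (1 - η) := by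
            rw [ENNReal.ofReal_sub _ hη.le, ENNReal.ofReal_one]
            refine ENNReal.le_sub_of_add_le_left ENNReal.ofReal_ne_top ?_
            rw [← hsum]
            gcongr
            exact hu₀ hyA
          refine (add_le_add_left h5 _).trans ?_
          rw [← ENNReal.ofReal_add (by linarith) (by positivity)]
          exact ENNReal.ofReal_le_ofReal (by linarith)
        · rw [← ENNReal.ofReal_one] at hle1
          refine (add_le_add_left hle1 _).trans ?_
          rw [← ENNReal.ofReal_add (by linarith) (by positivity)]
          exact ENNReal.ofReal_le_ofReal (by nlinarith)

-- Induction over blocks. Of the two subtrees provided by (UNI), at least one misses a window that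
-- is short compared with the distance `d` of the two points to the power α; in the other subtrees
-- `d` shrinks by at most the factor `ell`, which costs ell^(-s) with `s` small. Over an infinite
-- alphabet the weight of the lost block has no uniform lower bound, and the function `V` of the
-- current letter compensates for this: it penalises the letters outside a finite set, which a
-- random branch visits with probability at most 1/4.
open Classical in
lemma UNI.exists_conc_le (hα : 0 < α) (hU : Φ.UNI) {γ : ℝ} {q : 𝒜 → ℝ≥0∞} (hT : Φ.Tail φ γ q)
    (hnorm : Φ.IsNormalized φ) (hvar : Φ.SummableVariations φ) {s₀ : ℝ} (hs₀ : 0 < s₀) :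
    ∃ s C ρ : ℝ, 0 < s ∧ s ≤ s₀ ∧ s ≤ γ ∧ 0 < C ∧ 0 < ρ ∧ ρ < 1 ∧
      ∀ (m : ℕ) (y z z' : ℕ → 𝒜), y ∈ Φ.shiftSpace → Φ.Good z → Φ.Good z' → y 0 = z 0 →
        z' 0 = z 0 → Φ.coding z ≠ Φ.coding z' → ∀ t r : ℝ, 0 ≤ r →
        Φ.conc φ m y (Φ.coding z) (Φ.coding z') t r ≤
          ENNReal.ofReal (C * (r ^ (s / α) * |Φ.coding z - Φ.coding z'| ^ (-s) + ρ ^ m)) := by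
  obtain ⟨c₀, hc₀, hfreq⟩ := hU
  obtain ⟨κ, hκ⟩ := Φ.exists_contr
  obtain ⟨Cd, hCd⟩ := Φ.exists_dist
  set C' := Cd / (1 - κ ^ α) with hC'
  have hκα : κ ^ α < 1 := Real.rpow_lt_one hκ.1.le hκ.2.1 hα
  have hκα0 : 0 < κ ^ α := Real.rpow_pos_of_pos hκ.1 _
  have hC'0 : 0 ≤ C' := div_nonneg hCd.1 (by linarith)
  -- After this many branches the letters prefixed to a block can change the fluctuation by at most
  -- c₀/4 times d^α.
  obtain ⟨n₀, hn₀⟩ := exists_pow_lt_of_lt_one (show 0 < c₀ / (4 * (C' + 1)) by positivity) hκα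
  obtain ⟨N, hN, hNU⟩ := frequently_atTop.1 hfreq (n₀ + 2)
  -- A word of length L + 2 consists of a block of L + 1 branches and the base letter.
  obtain ⟨L, rfl⟩ : ∃ L, N = L + 2 := ⟨N - 2, by omega⟩
  have hD : C' * (κ ^ α) ^ (L + 1) ≤ c₀ / 4 := by
    have h1 : (κ ^ α) ^ (L + 1) ≤ c₀ / (4 * (C' + 1)) :=
      (pow_le_pow_of_le_one hκα0.le hκα.le (by omega)).trans hn₀.le
    calc _ ≤ C' * (c₀ / (4 * (C' + 1))) := by gcongr
      _ = c₀ / 4 * (C' / (C' + 1)) := by field_simp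
      _ ≤ c₀ / 4 * 1 := by
          gcongr
          rw [div_le_one (by positivity)]; linarith
      _ = _ := mul_one _
  have hw : ∀ c : 𝒜, ∃ u v : Vec 𝒜 (L + 1), Φ.AdmW u.1 c ∧ Φ.AdmW v.1 c ∧
      ∀ x ∈ Φ.attractor ∩ Φ.I c, ∀ y ∈ Φ.attractor ∩ Φ.I c, x ≠ y → c₀ * |x - y| ^ α ≤
        |(Φ.ta u.1 c x - Φ.ta u.1 c y) - (Φ.ta v.1 c x - Φ.ta v.1 c y)| := by
    intro c
    obtain ⟨a, b, ha, hb, h⟩ := hNU c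
    obtain ⟨u, hu, hul, hua⟩ := Words.exists_eq_append Φ a ha
    obtain ⟨v, hv, hvl, hva⟩ := Words.exists_eq_append Φ b hb
    refine ⟨⟨u, by omega⟩, ⟨v, by omega⟩, hua, hva, fun x hx y hy hxy => ?_⟩
    have := h x hx y hy hxy
    rwa [X, X, hu, hv, Φ.tau_eq_ta hua hx.2, Φ.tau_eq_ta hua hy.2, Φ.tau_eq_ta hva hx.2,
      Φ.tau_eq_ta hva hy.2] at this
  choose u v hu hv huv using hw
  obtain ⟨A, hA⟩ := ((ENNReal.tendsto_tsum_compl_atTop_zero hT.2.1).eventually_le_const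
    (show (0 : ℝ≥0∞) < 1 / 4 from ENNReal.div_pos one_ne_zero (by simp))).exists
  obtain ⟨C₀', hC1, hC₀⟩ := Φ.exists_W_distortion hvar
  have hlow : ∀ w : List 𝒜, ∀ c, Φ.AdmW w c → ∃ ε : ℝ≥0∞, 0 < ε ∧
      ∀ y ∈ Φ.shiftSpace, y 0 = c → ε ≤ Φ.W φ w y := by
    intro w c hwc
    by_cases hc : ∃ y₀ ∈ Φ.shiftSpace, y₀ 0 = c
    · obtain ⟨y₀, hy₀, rfl⟩ := hc
      refine ⟨Φ.W φ w y₀ / ENNReal.ofReal C₀', ENNReal.div_pos ?_ ENNReal.ofReal_ne_top, ?_⟩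
      · rw [Φ.W_ne_zero hy₀, Φ.app_mem_shiftSpace]; exact ⟨hwc, hy₀⟩
      · intro y hy hy0
        refine ENNReal.div_le_of_le_mul ?_
        rw [mul_comm]
        exact hC₀ w y₀ hy₀ y hy hy0.symm
    · exact ⟨1, one_pos, fun y hy hy0 => absurd ⟨y, hy, hy0⟩ hc⟩
  choose εu hεu0 hεu using fun c => hlow (u c).1 c (hu c)
  choose εv hεv0 hεv using fun c => hlow (v c).1 c (hv c)
  -- A lower bound for the weights of the two blocks, uniform over the finitely many base letters in
  -- `A`.
  set ε := min 1 (A.inf fun c => min (εu c) (εv c)) with hε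
  have hεpos : 0 < ε := lt_min one_pos ((Finset.lt_inf_iff ENNReal.zero_lt_top).2
    fun c _ => lt_min (hεu0 c) (hεv0 c))
  have hε1 : ε ≤ 1 := min_le_left _ _
  have hεt : ε ≠ ∞ := ne_top_of_le_ne_top ENNReal.one_ne_top hε1
  set η := ε.toReal with hη
  have hηpos : 0 < η := ENNReal.toReal_pos hεpos.ne' hεt
  have hη1 : η ≤ 1 := by
    rw [hη, ← ENNReal.toReal_one]; exact ENNReal.toReal_mono ENNReal.one_ne_top hε1
  have hηε : ENNReal.ofReal η = ε := ENNReal.ofReal_toReal hεt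
  have hγ := hT.1
  set Q := (∑' a, q a) ^ (L + 1) with hQ
  have hQt : Q ≠ ∞ := ENNReal.pow_ne_top hT.2.1
  -- The last entry makes 2s/γ times the moment bound for one block at most η/4.
  set s := min (min s₀ γ) (γ * η / (8 * (Q.toReal + 1))) with hs
  have hspos : 0 < s := lt_min (lt_min hs₀ hγ) (by positivity)
  have hsγ : s ≤ γ := (min_le_left _ _).trans (min_le_right _ _)
  have hsQ : ENNReal.ofReal (s / γ * 2) * (∑' a, q a) ^ (L + 1) ≤ ENNReal.ofReal (η / 4) := by
    rw [← hQ, ← ENNReal.ofReal_toReal hQt, ← ENNReal.ofReal_mul (by positivity)]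
    refine ENNReal.ofReal_le_ofReal ?_
    have h1 : s ≤ γ * η / (8 * (Q.toReal + 1)) := min_le_right _ _
    rw [le_div_iff₀ (by positivity)] at h1
    rw [div_mul_eq_mul_div, div_mul_eq_mul_div, div_le_iff₀ hγ]
    nlinarith [hspos, ENNReal.toReal_nonneg (a := Q)]
  set V : 𝒜 → ℝ := fun c => if c ∈ A then 1 else 1 + η with hV
  have hV1 : ∀ c, 1 ≤ V c := by intro c; simp only [hV]; split_ifs <;> linarith
  have hV2 : ∀ c, V c ≤ 2 := by intro c; simp only [hV]; split_ifs <;> linarith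
  set β := 1 - η / 4 with hβ
  have hβ0 : 0 < β := by rw [hβ]; linarith
  have hβ1 : β < 1 := by rw [hβ]; linarith
  set c₁ := c₀ / 4 with hc₁
  have hc₁0 : 0 < c₁ := by positivity
  set Aa := c₁ ^ (-(s / α)) with hAa
  have hAa0 : 0 < Aa := Real.rpow_pos_of_pos hc₁0 _
  have main : ∀ (K m : ℕ), K * (L + 1) ≤ m → ∀ (y z z' : ℕ → 𝒜), y ∈ Φ.shiftSpace → Φ.Good z →
      Φ.Good z' → y 0 = z 0 → z' 0 = z 0 → Φ.coding z ≠ Φ.coding z' → ∀ t r : ℝ, 0 ≤ r →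
        Φ.conc φ m y (Φ.coding z) (Φ.coding z') t r ≤ ENNReal.ofReal
          ((Aa * r ^ (s / α) * |Φ.coding z - Φ.coding z'| ^ (-s) + β ^ K) * V (y 0)) := by
    intro K
    induction K with
    | zero =>
      intro m _ y z z' hy _ _ _ _ _ t r hr
      refine (Φ.conc_le_one hnorm m hy _ _ _ _).trans ?_
      rw [ENNReal.one_le_ofReal, pow_zero]
      have : 0 ≤ Aa * r ^ (s / α) * |Φ.coding z - Φ.coding z'| ^ (-s) := by positivity
      nlinarith [hV1 (y 0)]
    | succ K ih =>
      intro m hm y z z' hy hz hz' hyz hzz hne t r hr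
      obtain ⟨m, rfl⟩ : ∃ k, m = k + (L + 1) := ⟨m - (L + 1), by
        rw [Nat.sub_add_cancel]; nlinarith⟩
      have hm' : K * (L + 1) ≤ m := by nlinarith
      set d := |Φ.coding z - Φ.coding z'| with hd
      have hd0 : 0 < d := abs_pos.2 (sub_ne_zero.2 hne)
      -- If the window is not short compared with d^α, the first term of the bound already exceeds
      -- 1.
      by_cases hrd : c₁ * d ^ α ≤ r
      · refine (Φ.conc_le_one hnorm _ hy _ _ _ _).trans ?_
        rw [ENNReal.one_le_ofReal]
        have h1 : 1 ≤ Aa * r ^ (s / α) * d ^ (-s) := by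
          have h2 : c₁ ^ (s / α) * d ^ s ≤ r ^ (s / α) := by
            refine le_trans (le_of_eq ?_) (Real.rpow_le_rpow (by positivity) hrd
              (by positivity : 0 ≤ s / α))
            rw [Real.mul_rpow hc₁0.le (Real.rpow_nonneg hd0.le _), ← Real.rpow_mul hd0.le,
              mul_div_cancel₀ _ hα.ne']
          have h3 : 0 < c₁ ^ (s / α) := Real.rpow_pos_of_pos hc₁0 _
          have h4 : 0 < d ^ s := Real.rpow_pos_of_pos hd0 _
          rw [hAa, Real.rpow_neg hc₁0.le, Real.rpow_neg hd0.le, mul_assoc, ← div_eq_mul_inv,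
            ← div_eq_inv_mul, div_div, one_le_div (by positivity)]
          linarith
        have h2 : 0 < β ^ (K + 1) := by positivity
        nlinarith [hV1 (y 0)]
      · push Not at hrd
        set p := Φ.coding z with hp
        set p' := Φ.coding z' with hp'
        set c := y 0 with hc
        have hpI : p ∈ Φ.I c := by rw [hyz]; exact hz.2
        have hpI' : p' ∈ Φ.I c := by rw [hyz, ← hzz]; exact hz'.2
        set U : Vec 𝒜 (L + 1) → ℝ≥0∞ := fun w => Φ.conc φ m (app w.1 y) (Φ.G w.1 c p) (Φ.G w.1 c p')
          (t - (Φ.ta w.1 c p - Φ.ta w.1 c p')) r with hUdef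
        -- A subtree that contributes contains a word with fluctuation in the window, and the block
        -- alone accounts for this fluctuation up to c₀/4 times d^α.
        have hnear : ∀ w : Vec 𝒜 (L + 1), Φ.AdmW w.1 c → U w ≠ 0 →
            t - c₀ / 4 * d ^ α ≤ Φ.ta w.1 c p - Φ.ta w.1 c p' ∧
            Φ.ta w.1 c p - Φ.ta w.1 c p' ≤ t + r + c₀ / 4 * d ^ α := by
          intro w hw hne0
          have hwy : app w.1 y ∈ Φ.shiftSpace := Φ.app_mem_shiftSpace.2 ⟨hw, hy⟩
          have h1 : ∃ x : Vec 𝒜 m, ¬ (if Φ.ta x.1 (app w.1 y 0) (Φ.G w.1 c p) -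
              Φ.ta x.1 (app w.1 y 0) (Φ.G w.1 c p') ∈ Icc (t - (Φ.ta w.1 c p - Φ.ta w.1 c p'))
              (t - (Φ.ta w.1 c p - Φ.ta w.1 c p') + r) then Φ.W φ x.1 (app w.1 y) else 0) = 0 := by
            by_contra hcon
            push Not at hcon
            exact hne0 (ENNReal.tsum_eq_zero.2 hcon)
          obtain ⟨x, hx⟩ := h1
          rw [ite_eq_right_iff, not_forall] at hx
          obtain ⟨hx1, hx2⟩ := hx
          have hx3 := (Φ.app_mem_shiftSpace.1 ((Φ.W_ne_zero hwy).1 hx2)).1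
          rw [app_zero] at hx1 hx3
          have h2 := hCd.abs_ta_sub_le hκ hα hx3 (Φ.G_mem hw hpI) (Φ.G_mem hw hpI')
          have h3 := hκ.abs_G_sub_le hw hpI hpI'
          have h4 : C' * |Φ.G w.1 c p - Φ.G w.1 c p'| ^ α ≤ c₀ / 4 * d ^ α := by
            calc _ ≤ C' * (κ ^ (L + 1) * d) ^ α := by
                  gcongr
                  rwa [w.2] at h3
              _ = C' * (κ ^ α) ^ (L + 1) * d ^ α := by
                  rw [Real.mul_rpow (pow_nonneg hκ.1.le _) hd0.le, ← Real.rpow_natCast,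
                    ← Real.rpow_natCast, ← Real.rpow_mul hκ.1.le, ← Real.rpow_mul hκ.1.le,
                    mul_comm α, mul_assoc]
              _ ≤ _ := by gcongr
          rw [abs_le] at h2
          constructor <;> linarith [hx1.1, hx1.2]
        -- If both blocks contributed, their fluctuations would differ by at most r + (c₀/2)d^α,
        -- which is less than c₀d^α, against (UNI).
        have hex : ∃ u₀ : Vec 𝒜 (L + 1), U u₀ = 0 ∧ (c ∈ A → ENNReal.ofReal η ≤ Φ.W φ u₀.1 y) := by
          have hεA : c ∈ A → ε ≤ min (εu c) (εv c) := fun hcA =>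
            (min_le_right _ _).trans (Finset.inf_le hcA)
          by_cases h1 : U (u c) = 0
          · exact ⟨u c, h1, fun hcA => by
              rw [hηε]
              exact ((hεA hcA).trans (min_le_left _ _)).trans (hεu c y hy rfl)⟩
          · by_cases h2 : U (v c) = 0
            · exact ⟨v c, h2, fun hcA => by
                rw [hηε]
                exact ((hεA hcA).trans (min_le_right _ _)).trans (hεv c y hy rfl)⟩
            · exfalso
              have e1 := hnear _ (hu c) h1
              have e2 := hnear _ (hv c) h2
              have e3 := huv c p ⟨Φ.coding_mem_attractor hz.1, hpI⟩ p'
                ⟨Φ.coding_mem_attractor hz'.1, hpI'⟩ hne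
              have e4 : |(Φ.ta (u c).1 c p - Φ.ta (u c).1 c p') -
                  (Φ.ta (v c).1 c p - Φ.ta (v c).1 c p')| < c₀ * d ^ α := by
                have e5 : 0 < c₀ * d ^ α := mul_pos hc₀ (Real.rpow_pos_of_pos hd0 _)
                rw [hc₁] at hrd
                rw [abs_lt]
                constructor <;> linarith [e1.1, e1.2, e2.1, e2.2]
              exact absurd e3 (not_le.2 e4)
        obtain ⟨u₀, hu₀, hu₀A⟩ := hex
        rw [conc_add]
        set B := Aa * r ^ (s / α) * d ^ (-s) + β ^ K with hB
        have hB0 : 0 ≤ B := by positivity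
        calc _ ≤ ∑' w : Vec 𝒜 (L + 1), ENNReal.ofReal B * (if w = u₀ then 0 else Φ.W φ w.1 y *
              ENNReal.ofReal (Φ.ell w.1 c ^ (-s)) * ENNReal.ofReal (V (w.1.headD c))) := by
              refine ENNReal.tsum_le_tsum fun w => ?_
              change Φ.W φ w.1 y * U w ≤ _
              split_ifs with hw0
              · rw [hw0, hu₀, mul_zero]; exact zero_le
              by_cases hw : app w.1 y ∈ Φ.shiftSpace
              swap
              · have : Φ.W φ w.1 y = 0 := by
                  by_contra h; exact hw ((Φ.W_ne_zero hy).1 h)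
                rw [this, zero_mul]; exact zero_le
              have had := (Φ.app_mem_shiftSpace.1 hw).1
              have hwz : app w.1 z ∈ Φ.shiftSpace :=
                Φ.app_mem_shiftSpace.2 ⟨hyz ▸ had, hz.1⟩
              have hwz' : app w.1 z' ∈ Φ.shiftSpace :=
                Φ.app_mem_shiftSpace.2 ⟨by rw [hzz, ← hyz]; exact had, hz'.1⟩
              obtain ⟨g1, g2⟩ := hz.app Φ hwz
              obtain ⟨g1', g2'⟩ := hz'.app Φ hwz'
              rw [← hyz] at g2
              rw [hzz, ← hyz] at g2'
              have hGne : Φ.G w.1 c p ≠ Φ.G w.1 c p' := fun h => hne (Φ.G_injOn had hpI hpI' h)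
              have h1 := ih m hm' (app w.1 y) (app w.1 z) (app w.1 z') hw g1 g1'
                (by rw [app_zero, app_zero, ← hyz]) (by rw [app_zero, app_zero, hzz])
                (by rw [g2, g2']; exact hGne) (t - (Φ.ta w.1 c p - Φ.ta w.1 c p')) r hr
              rw [g2, g2'] at h1
              have hl := Φ.ell_pos had
              have h2 : |Φ.G w.1 c p - Φ.G w.1 c p'| ^ (-s) ≤ Φ.ell w.1 c ^ (-s) * d ^ (-s) := by
                rw [← Real.mul_rpow hl.le hd0.le]
                exact Real.rpow_le_rpow_of_nonpos (mul_pos hl hd0) (Φ.ell_mul_le had hpI hpI')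
                  (by linarith)
              have hl1 : 1 ≤ Φ.ell w.1 c ^ (-s) :=
                Real.one_le_rpow_of_pos_of_le_one_of_nonpos hl (Φ.ell_le_one had) (by linarith)
              calc Φ.W φ w.1 y * U w ≤ Φ.W φ w.1 y *
                    ENNReal.ofReal (B * Φ.ell w.1 c ^ (-s) * V (w.1.headD c)) := by
                    gcongr
                    refine h1.trans (ENNReal.ofReal_le_ofReal ?_)
                    rw [app_zero]
                    refine mul_le_mul_of_nonneg_right ?_ (zero_le_one.trans (hV1 _))
                    rw [hB, add_mul, mul_assoc (Aa * _)]
                    refine add_le_add ?_ (le_mul_of_one_le_right (by positivity) hl1)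
                    refine mul_le_mul_of_nonneg_left (h2.trans_eq (mul_comm _ _)) (by positivity)
                _ = _ := by
                    rw [ENNReal.ofReal_mul (by positivity), ENNReal.ofReal_mul hB0]; ring
          _ ≤ ENNReal.ofReal B * ENNReal.ofReal (β * V c) := by
              rw [ENNReal.tsum_mul_left]
              gcongr
              exact Φ.tsum_W_block_le hT hnorm A hA hηpos hη1 hspos hsγ hsQ hy u₀ hu₀A
          _ ≤ _ := by
              rw [← ENNReal.ofReal_mul hB0, ← mul_assoc]
              refine ENNReal.ofReal_le_ofReal (mul_le_mul_of_nonneg_right ?_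
                (zero_le_one.trans (hV1 _)))
              rw [hB, add_mul, pow_succ]
              exact add_le_add (mul_le_of_le_one_right (by positivity) hβ1.le) le_rfl
  have hL0 : (0 : ℝ) < ((L + 1 : ℕ) : ℝ) := by positivity
  -- One factor β per block of L + 1 letters is the rate ρ per letter, up to one incomplete block.
  set ρ := β ^ ((1 : ℝ) / ((L + 1 : ℕ) : ℝ)) with hρ
  have hρ0 : 0 < ρ := Real.rpow_pos_of_pos hβ0 _
  have hρ1 : ρ < 1 := Real.rpow_lt_one hβ0.le hβ1 (by positivity)
  have hρL : ρ ^ (L + 1) = β := by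
    rw [hρ, ← Real.rpow_natCast, ← Real.rpow_mul hβ0.le, one_div, inv_mul_cancel₀ hL0.ne',
      Real.rpow_one]
  have hpow : ∀ m : ℕ, β ^ (m / (L + 1)) ≤ β⁻¹ * ρ ^ m := by
    intro m
    rw [← div_eq_inv_mul, le_div_iff₀ hβ0, ← hρL, ← pow_mul, ← pow_add]
    refine pow_le_pow_of_le_one hρ0.le hρ1.le ?_
    have := Nat.div_add_mod m (L + 1)
    have h2 := Nat.mod_lt m (Nat.succ_pos L)
    rw [Nat.succ_eq_add_one] at h2
    omega
  refine ⟨s, 2 * max Aa β⁻¹, ρ, hspos, (min_le_left _ _).trans (min_le_left _ _), hsγ,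
    by positivity, hρ0, hρ1, fun m y z z' hy hz hz' hyz hzz hne t r hr => ?_⟩
  refine (main (m / (L + 1)) m (Nat.div_mul_le_self _ _) y z z' hy hz hz' hyz hzz hne t r hr).trans
    (ENNReal.ofReal_le_ofReal ?_)
  set d := |Φ.coding z - Φ.coding z'| with hd
  have h1 : 0 ≤ r ^ (s / α) * d ^ (-s) := by positivity
  calc _ ≤ (max Aa β⁻¹ * (r ^ (s / α) * d ^ (-s)) + max Aa β⁻¹ * ρ ^ m) * 2 := by
        refine mul_le_mul (add_le_add ?_ ?_) (hV2 _) (zero_le_one.trans (hV1 _)) (by positivity)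
        · rw [mul_assoc]; gcongr; exact le_max_left _ _
        · refine (hpow m).trans ?_
          gcongr; exact le_max_right _ _
    _ = _ := by ring

end MarkovIFS

/-! ### Reduction of quantitative non-linearity to a concentration estimate -/

namespace MarkovIFS

variable {𝒜 : Type*} {α : ℝ} (Φ : MarkovIFS 𝒜 α) {φ : (ℕ → 𝒜) → ℝ}

/-- The Lévy concentration function of the fluctuation of a random inverse branch. -/
noncomputable def concS (φ : (ℕ → 𝒜) → ℝ) (m : ℕ) (y : ℕ → 𝒜) (p p' r : ℝ) : ℝ≥0∞ :=
  ⨆ t, Φ.conc φ m y p p' t r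

/-- The branches `g_{de}` and `g_{dz₀}` agree at `π(z) ∈ I_e`. -/
def Compat (d e : 𝒜) (z : ℕ → 𝒜) : Prop :=
  Φ.adm d e ∧ consSeq d z ∈ Φ.shiftSpace ∧ Φ.coding z ∈ Φ.I e ∧
    Φ.g d e (Φ.coding z) = Φ.coding (consSeq d z)

/-- `π(z)` is within `ε` of an end point of `I_e`. -/
def Near (ε : ℝ) (e : 𝒜) (z : ℕ → 𝒜) : Prop :=
  |Φ.cod z - Φ.l e| ≤ ε ∨ |Φ.cod z - Φ.r e| ≤ ε

lemma mem_I_of_not_near {ε x : ℝ} {e : 𝒜} {z : ℕ → 𝒜} (h : ¬ Φ.Near ε e z) (hx : x ∈ Φ.I e)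
    (hxz : |Φ.cod z - x| ≤ ε) : Φ.cod z ∈ Φ.I e := by
  rw [Near, not_or, not_le, not_le] at h
  rw [abs_le] at hxz
  constructor
  · by_contra hc
    push Not at hc
    have := hx.1
    rw [abs_of_nonpos (by linarith)] at h
    linarith [h.1]
  · by_contra hc
    push Not at hc
    have := hx.2
    rw [abs_of_nonneg (a := Φ.cod z - Φ.r e) (by linarith)] at h
    linarith [h.2]

lemma abs_coding_sub_le_of_mem_cylInterval {κ : ℝ} (hκ : Φ.Contr κ) {n : ℕ} {c : List 𝒜}
    (hc : c.length = n + 1) {z : ℕ → 𝒜} (hz : z ∈ Φ.shiftSpace) (hzc : z ∈ cyl c) {x : ℝ}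
    (hx : x ∈ Φ.cylInterval c) : |Φ.coding z - x| ≤ κ ^ n := by
  rw [mem_cyl_iff_pre, hc] at hzc
  rw [← hzc, cylInterval, pre_succ_eq_append, gWord_append_singleton, dom_append_singleton] at hx
  obtain ⟨y, hy, rfl⟩ := hx
  exact Φ.abs_coding_sub_le hκ hz n hy

/-- What `Acts` says about a sequence coding a nearby point. -/
lemma Acts.compat {u : List 𝒜} {d e : 𝒜} {c : List 𝒜} {n : ℕ} (hc : c.length = n + 1) {x : ℝ}
    (h : Φ.Acts (u ++ [d] ++ [e]) c x) (had : Φ.adm d e) {z : ℕ → 𝒜} (hz : Φ.Good z)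
    (hzc : z ∈ cyl c) : x ∈ Φ.I e ∧ (Φ.coding z ∈ Φ.I e → Φ.Compat d e z) := by
  obtain ⟨e', he', f, hf, hx, hch, heq⟩ := h
  rw [List.getLast?_append_of_ne_nil _ (by simp)] at he'
  simp only [List.getLast?_singleton, Option.mem_def, Option.some.injEq] at he'
  subst he'
  rw [mem_cyl_iff_pre, hc] at hzc
  rw [← hzc, pre] at hf
  simp only [List.head?_cons, Option.mem_def, Option.some.injEq] at hf
  subst hf
  refine ⟨hx, fun hzI => ?_⟩
  rw [List.dropLast_concat, isChain_append_singleton, admW_append] at hch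
  have hdz : consSeq d z ∈ Φ.shiftSpace := Φ.consSeq_mem_shiftSpace.2 ⟨hch.2.1, hz.1⟩
  refine ⟨had, hdz, hzI, ?_⟩
  have h1 := heq ⟨hzI, hz.2⟩
  rw [List.dropLast_concat, gWord_append_singleton, gWord_append_singleton, G_append, G_append] at h1
  -- `Acts` only compares the full branches; injectivity of the common outer part `u d` gives the
  -- equality of g_{de} and g_{df}.
  have h2 := Φ.G_injOn hch.1 (Φ.G_mem (w := [d]) (c := e) ⟨had, trivial⟩ hzI)
    (Φ.G_mem (w := [d]) (c := z 0) ⟨hch.2.1, trivial⟩ hz.2) h1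
  rw [Φ.coding_consSeq hz hdz]
  exact h2

-- Away from the end points of I_e, the coded point lies in I_e together with the reference point.
-- The chain rule then splits off the innermost branch of `u d e`, and what remains is the
-- fluctuation of `u` between π(dz) and π(dz'). Moving both reference points to coded points, within
-- κ^(n+1) of each other, costs twice the distortion error on either side of the window.
open Classical in
lemma indicator_le_of_acts {κ C : ℝ} (hα : 0 < α) (hκ : Φ.Contr κ) (hC : Φ.Dist α C) {n : ℕ}
    {u : List 𝒜} {d e : 𝒜} (hude : (u ++ [d] ++ [e]).IsChain Φ.adm) {b c c' : List 𝒜}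
    (hc : c.length = n + 2) (hc' : c'.length = n + 2)
    {z z' : ℕ → 𝒜} (hz : Φ.Good z) (hz' : Φ.Good z') (hzc : z ∈ cyl c) (hzc' : z' ∈ cyl c')
    {x x' : ℝ} (hx : x ∈ Φ.cylInterval c) (hx' : x' ∈ Φ.cylInterval c') (s t : ℝ) {r : ℝ}
    (hr : t - s + 4 * (C / (1 - κ ^ α) * (κ ^ (n + 1)) ^ α) ≤ r) (M : ℝ≥0∞) :
    (if (Φ.Acts (u ++ [d] ++ [e]) c x ∧ Φ.Acts (u ++ [d] ++ [e]) c' x') ∧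
        Φ.Delta (u ++ [d] ++ [e]) b x x' ∈ Icc s t then M else 0) ≤
      (if Φ.Near (κ ^ (n + 1)) e z then M else 0) + (if Φ.Near (κ ^ (n + 1)) e z' then M else 0) +
      (if Φ.Compat d e z ∧ Φ.Compat d e z' then
        (if Φ.ta u d (Φ.coding (consSeq d z)) - Φ.ta u d (Φ.coding (consSeq d z')) ∈
          Icc (Φ.tau b x - Φ.tau b x' - t - 2 * (C / (1 - κ ^ α) * (κ ^ (n + 1)) ^ α) -
            (Φ.ta [d] e (Φ.coding z) - Φ.ta [d] e (Φ.coding z')))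
            (Φ.tau b x - Φ.tau b x' - t - 2 * (C / (1 - κ ^ α) * (κ ^ (n + 1)) ^ α) -
            (Φ.ta [d] e (Φ.coding z) - Φ.ta [d] e (Φ.coding z')) + r) then M else 0) else 0) := by
  by_cases hcond : (Φ.Acts (u ++ [d] ++ [e]) c x ∧ Φ.Acts (u ++ [d] ++ [e]) c' x') ∧
        Φ.Delta (u ++ [d] ++ [e]) b x x' ∈ Icc s t
  swap
  · rw [if_neg hcond]; exact zero_le
  rw [if_pos hcond]
  obtain ⟨⟨ha, ha'⟩, hD⟩ := hcond
  by_cases h1 : Φ.Near (κ ^ (n + 1)) e z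
  · rw [if_pos h1, add_assoc]; exact le_self_add
  by_cases h2 : Φ.Near (κ ^ (n + 1)) e z'
  · rw [if_pos h2, add_right_comm]; exact le_add_self
  rw [isChain_append_singleton] at hude
  have hud := (Φ.admW_append.1 hude)
  obtain ⟨hxe, hcp⟩ := ha.compat Φ hc hud.2.1 hz hzc
  obtain ⟨hxe', hcp'⟩ := ha'.compat Φ hc' hud.2.1 hz' hzc'
  have hd := Φ.abs_coding_sub_le_of_mem_cylInterval hκ hc hz.1 hzc hx
  have hd' := Φ.abs_coding_sub_le_of_mem_cylInterval hκ hc' hz'.1 hzc' hx'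
  have hze : Φ.coding z ∈ Φ.I e := by
    rw [← Φ.cod_of_mem hz.1] at hd ⊢
    exact Φ.mem_I_of_not_near h1 hxe hd
  have hze' : Φ.coding z' ∈ Φ.I e := by
    rw [← Φ.cod_of_mem hz'.1] at hd' ⊢
    exact Φ.mem_I_of_not_near h2 hxe' hd'
  have hk := hcp hze
  have hk' := hcp' hze'
  rw [if_neg h1, if_neg h2, zero_add, zero_add, if_pos ⟨hk, hk'⟩, if_pos]
  have hα0 := hα
  have hq1 : κ ^ α < 1 := Real.rpow_lt_one hκ.1.le hκ.2.1 hα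
  have hCC : 0 ≤ C / (1 - κ ^ α) := div_nonneg hC.1 (by linarith)
  have e1 := hC.abs_ta_sub_le hκ hα hude hxe hze
  have e1' := hC.abs_ta_sub_le hκ hα hude hxe' hze'
  have e2 : C / (1 - κ ^ α) * |x - Φ.coding z| ^ α ≤ C / (1 - κ ^ α) * (κ ^ (n + 1)) ^ α := by
    gcongr; rwa [abs_sub_comm]
  have e2' : C / (1 - κ ^ α) * |x' - Φ.coding z'| ^ α ≤ C / (1 - κ ^ α) * (κ ^ (n + 1)) ^ α := by
    gcongr; rwa [abs_sub_comm]
  have e3 : ∀ {w : ℕ → 𝒜}, Φ.Compat d e w → Φ.ta (u ++ [d]) e (Φ.coding w) =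
      Φ.ta u d (Φ.coding (consSeq d w)) + Φ.ta [d] e (Φ.coding w) := by
    intro w hw
    rw [ta_append, ← hw.2.2.2]; rfl
  rw [e3 hk] at e1
  rw [e3 hk'] at e1'
  have hD' : Φ.Delta (u ++ [d] ++ [e]) b x x' = -(Φ.ta (u ++ [d]) e x - Φ.ta (u ++ [d]) e x') +
      (Φ.tau b x - Φ.tau b x') := by
    rw [← Φ.tau_eq_ta hude hxe, ← Φ.tau_eq_ta hude hxe', Delta, tau, tau, tau, tau]
    ring
  rw [hD'] at hD
  rw [abs_le] at e1 e1'
  constructor <;> linarith [hD.1, hD.2]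

variable [MeasurableSpace 𝒜] [DiscreteMeasurableSpace 𝒜] [Countable 𝒜] {ν : Measure (ℕ → 𝒜)}

open Classical in
/-- The mass of the words whose last vertex interval has an end point near `π(z)`. -/
noncomputable def bdry (ν : Measure (ℕ → 𝒜)) (n : ℕ) (ε : ℝ) (z : ℕ → 𝒜) : ℝ≥0∞ :=
  ∑' e, ∑' v : Vec 𝒜 n, if Φ.Near ε e z then ν (cyl (v.1 ++ [e])) else 0

open Classical in
/-- The averaged concentration function. -/
noncomputable def avgConc (φ : (ℕ → 𝒜) → ℝ) (ν : Measure (ℕ → 𝒜)) (m : ℕ) (r : ℝ)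
    (z z' : ℕ → 𝒜) : ℝ≥0∞ :=
  ∑' e, ∑' d, if Φ.Compat d e z ∧ Φ.Compat d e z' then
    ∫⁻ y in cyl [d, e], Φ.concS φ m y (Φ.coding (consSeq d z)) (Φ.coding (consSeq d z')) r ∂ν else 0

lemma tsum_words_le (n : ℕ) (F : List 𝒜 → ℝ≥0∞) :
    ∑' w : Φ.Words n, F w.1 ≤ ∑' w : Vec 𝒜 n, F w.1 :=
  ENNReal.tsum_comp_le_tsum_of_injective (f := fun w : Φ.Words n => (⟨w.1, w.2.1⟩ : Vec 𝒜 n))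
    (fun a b h => Subtype.ext (congrArg (fun v : Vec 𝒜 n => v.1) h)) (fun w => F w.1)

lemma tsum_measure_cyl [IsProbabilityMeasure ν] (n : ℕ) : ∑' w : Vec 𝒜 n, ν (cyl w.1) = 1 := by
  have := lintegral_eq_tsum_cyl ν n 1
  simp only [Pi.one_apply, lintegral_one, measure_univ, Measure.restrict_apply_univ] at this
  exact this.symm

-- The words are written as `u d e`. Since ν([ude]) is the integral of the weight of `u` over [de],
-- the sum over `u` becomes an integral of concentration functions; the position of the window
-- depends on `b`, and the supremum in `concS` removes it.
open Classical in
lemma tsum_acts_le {κ C : ℝ} (hα : 0 < α) (hκ : Φ.Contr κ) (hC : Φ.Dist α C)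
    (hvar : Φ.SummableVariations φ) (hν : Φ.IsGibbs φ ν) {n : ℕ} {b c c' : List 𝒜}
    (hc : c.length = n + 2) (hc' : c'.length = n + 2)
    {z z' : ℕ → 𝒜} (hz : Φ.Good z) (hz' : Φ.Good z') (hzc : z ∈ cyl c) (hzc' : z' ∈ cyl c')
    {x x' : ℝ} (hx : x ∈ Φ.cylInterval c) (hx' : x' ∈ Φ.cylInterval c') (s t : ℝ) {r : ℝ}
    (hr : t - s + 4 * (C / (1 - κ ^ α) * (κ ^ (n + 1)) ^ α) ≤ r) :
    ∑' a : Φ.Words (n + 2), (if (Φ.Acts a.1 c x ∧ Φ.Acts a.1 c' x') ∧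
        Φ.Delta a.1 b x x' ∈ Icc s t then ν (cyl a.1) else 0) ≤
      Φ.bdry ν (n + 1) (κ ^ (n + 1)) z + Φ.bdry ν (n + 1) (κ ^ (n + 1)) z' +
        Φ.avgConc φ ν n r z z' := by
  calc _ ≤ ∑' a : Φ.Words (n + 2), (if a.1.IsChain Φ.adm ∧ (Φ.Acts a.1 c x ∧ Φ.Acts a.1 c' x') ∧
        Φ.Delta a.1 b x x' ∈ Icc s t then ν (cyl a.1) else 0) := by
        refine ENNReal.tsum_le_tsum fun a => ?_
        simp [a.2.2]
    _ ≤ ∑' a : Vec 𝒜 (n + 1 + 1), (if a.1.IsChain Φ.adm ∧ (Φ.Acts a.1 c x ∧ Φ.Acts a.1 c' x') ∧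
        Φ.Delta a.1 b x x' ∈ Icc s t then ν (cyl a.1) else 0) :=
        Φ.tsum_words_le (n + 2) fun w => if w.IsChain Φ.adm ∧ (Φ.Acts w c x ∧ Φ.Acts w c' x') ∧
          Φ.Delta w b x x' ∈ Icc s t then ν (cyl w) else 0
    _ = ∑' e, ∑' d, ∑' u : Vec 𝒜 n, (if (u.1 ++ [d] ++ [e]).IsChain Φ.adm ∧
          (Φ.Acts (u.1 ++ [d] ++ [e]) c x ∧ Φ.Acts (u.1 ++ [d] ++ [e]) c' x') ∧
        Φ.Delta (u.1 ++ [d] ++ [e]) b x x' ∈ Icc s t then ν (cyl (u.1 ++ [d] ++ [e])) else 0) := by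
        rw [tsum_vec_succ (n + 1) fun w => if w.IsChain Φ.adm ∧ (Φ.Acts w c x ∧ Φ.Acts w c' x') ∧
          Φ.Delta w b x x' ∈ Icc s t then ν (cyl w) else 0]
        refine tsum_congr fun e => ?_
        rw [tsum_vec_succ n fun w : List 𝒜 => if (w ++ [e]).IsChain Φ.adm ∧ (Φ.Acts (w ++ [e]) c x ∧
          Φ.Acts (w ++ [e]) c' x') ∧ Φ.Delta (w ++ [e]) b x x' ∈ Icc s t then
          ν (cyl (w ++ [e])) else 0]
    _ ≤ ∑' e, ∑' d, ∑' u : Vec 𝒜 n,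
        ((if Φ.Near (κ ^ (n + 1)) e z then ν (cyl (u.1 ++ [d] ++ [e])) else 0) +
        (if Φ.Near (κ ^ (n + 1)) e z' then ν (cyl (u.1 ++ [d] ++ [e])) else 0) +
      (if Φ.Compat d e z ∧ Φ.Compat d e z' then
        (if Φ.ta u.1 d (Φ.coding (consSeq d z)) - Φ.ta u.1 d (Φ.coding (consSeq d z')) ∈
          Icc (Φ.tau b x - Φ.tau b x' - t - 2 * (C / (1 - κ ^ α) * (κ ^ (n + 1)) ^ α) -
            (Φ.ta [d] e (Φ.coding z) - Φ.ta [d] e (Φ.coding z')))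
            (Φ.tau b x - Φ.tau b x' - t - 2 * (C / (1 - κ ^ α) * (κ ^ (n + 1)) ^ α) -
            (Φ.ta [d] e (Φ.coding z) - Φ.ta [d] e (Φ.coding z')) + r) then
          ν (cyl (u.1 ++ [d] ++ [e])) else 0) else 0)) := by
        refine ENNReal.tsum_le_tsum fun e => ENNReal.tsum_le_tsum fun d =>
          ENNReal.tsum_le_tsum fun u => ?_
        by_cases hch : (u.1 ++ [d] ++ [e]).IsChain Φ.adm
        · simp only [hch, true_and]
          exact Φ.indicator_le_of_acts hα hκ hC hch hc hc' hz hz' hzc hzc' hx hx' s t hr _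
        · simp only [hch, false_and, if_false]; exact zero_le
    _ ≤ _ := by
        simp_rw [ENNReal.tsum_add]
        refine add_le_add (add_le_add (le_of_eq ?_) (le_of_eq ?_)) ?_
        · refine tsum_congr fun e => ?_
          rw [tsum_vec_succ n fun w : List 𝒜 => if Φ.Near (κ ^ (n + 1)) e z then ν (cyl (w ++ [e])) else 0]
        · refine tsum_congr fun e => ?_
          rw [tsum_vec_succ n fun w : List 𝒜 => if Φ.Near (κ ^ (n + 1)) e z' then ν (cyl (w ++ [e])) else 0]
        · refine ENNReal.tsum_le_tsum fun e => ENNReal.tsum_le_tsum fun d => ?_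
          split_ifs with hcp
          · calc _ ≤ ∑' u : Vec 𝒜 n, ∫⁻ y in cyl [d, e], (if Φ.ta u.1 d (Φ.coding (consSeq d z)) -
                  Φ.ta u.1 d (Φ.coding (consSeq d z')) ∈
                Icc (Φ.tau b x - Φ.tau b x' - t - 2 * (C / (1 - κ ^ α) * (κ ^ (n + 1)) ^ α) -
                  (Φ.ta [d] e (Φ.coding z) - Φ.ta [d] e (Φ.coding z')))
                  (Φ.tau b x - Φ.tau b x' - t - 2 * (C / (1 - κ ^ α) * (κ ^ (n + 1)) ^ α) -
                  (Φ.ta [d] e (Φ.coding z) - Φ.ta [d] e (Φ.coding z')) + r) then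
                  Φ.W φ u.1 y else 0) ∂ν := by
                  refine ENNReal.tsum_le_tsum fun u => ?_
                  split_ifs
                  · rw [List.append_assoc, List.singleton_append, Φ.measure_cyl_append hvar hν]
                  · exact zero_le
              _ = ∫⁻ y in cyl [d, e], ∑' u : Vec 𝒜 n, (if Φ.ta u.1 d (Φ.coding (consSeq d z)) -
                  Φ.ta u.1 d (Φ.coding (consSeq d z')) ∈
                Icc (Φ.tau b x - Φ.tau b x' - t - 2 * (C / (1 - κ ^ α) * (κ ^ (n + 1)) ^ α) -
                  (Φ.ta [d] e (Φ.coding z) - Φ.ta [d] e (Φ.coding z')))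
                  (Φ.tau b x - Φ.tau b x' - t - 2 * (C / (1 - κ ^ α) * (κ ^ (n + 1)) ^ α) -
                  (Φ.ta [d] e (Φ.coding z) - Φ.ta [d] e (Φ.coding z')) + r) then
                  Φ.W φ u.1 y else 0) ∂ν := by
                  rw [lintegral_tsum]
                  intro u
                  split_ifs
                  · exact (Φ.measurable_W hvar u.1).aemeasurable
                  · exact aemeasurable_const
              _ ≤ _ := by
                  refine lintegral_mono_ae ?_
                  filter_upwards [ae_restrict_mem (measurableSet_cyl [d, e])] with y hy
                  have hy0 : y 0 = d := (mem_cyl_cons.1 hy).1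
                  rw [concS]
                  refine le_iSup_of_le (Φ.tau b x - Φ.tau b x' - t -
                    2 * (C / (1 - κ ^ α) * (κ ^ (n + 1)) ^ α) -
                    (Φ.ta [d] e (Φ.coding z) - Φ.ta [d] e (Φ.coding z'))) (le_of_eq ?_)
                  rw [conc, hy0]
          · simp

end MarkovIFS

/-! ### Integration over the pairs of points -/

namespace MarkovIFS

variable {𝒜 : Type*} {α : ℝ} (Φ : MarkovIFS 𝒜 α) {φ : (ℕ → 𝒜) → ℝ}
variable [MeasurableSpace 𝒜] [DiscreteMeasurableSpace 𝒜] [Countable 𝒜] {ν : Measure (ℕ → 𝒜)}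

lemma measurableSet_near (ε : ℝ) (e : 𝒜) : MeasurableSet {z | Φ.Near ε e z} := by
  have h := Φ.measurable_cod
  have h1 : ∀ x : ℝ, MeasurableSet {z | |Φ.cod z - x| ≤ ε} := fun x =>
    measurableSet_le ((h.sub_const x).abs) measurable_const
  exact (h1 _).union (h1 _)

lemma measurable_bdry (n : ℕ) (ε : ℝ) : Measurable (Φ.bdry ν n ε) := by
  classical
  refine Measurable.tsum fun e => Measurable.tsum fun v => ?_
  exact Measurable.ite (Φ.measurableSet_near ε e) measurable_const measurable_const

/-- Each pair of end points has a small neighbourhood in measure by Hölder regularity, uniformly in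
the letter, and the masses of the words with last letter `e` sum to 1 over all words. -/
lemma lintegral_bdry_le [IsProbabilityMeasure ν] {θ C : ℝ} (hC : 0 < C) (hF : ∀ s t : ℝ, s ≤ t →
    ν {z | Φ.cod z ∈ Icc s t} ≤ ENNReal.ofReal (C * (t - s) ^ θ)) (n : ℕ) {ε : ℝ} (hε : 0 ≤ ε) :
    ∫⁻ z, Φ.bdry ν n ε z ∂ν ≤ ENNReal.ofReal (2 * (C * (2 * ε) ^ θ)) := by
  classical
  have h0 : ∀ e, ν {z | Φ.Near ε e z} ≤ ENNReal.ofReal (2 * (C * (2 * ε) ^ θ)) := by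
    intro e
    have h1 : ∀ x : ℝ, ν {z | |Φ.cod z - x| ≤ ε} ≤ ENNReal.ofReal (C * (2 * ε) ^ θ) := by
      intro x
      refine (measure_mono fun z hz => ?_).trans ((hF (x - ε) (x + ε) (by linarith)).trans_eq ?_)
      · have := abs_le.1 (show |Φ.cod z - x| ≤ ε from hz)
        exact ⟨by linarith, by linarith⟩
      · ring_nf
    refine (measure_union_le {z | |Φ.cod z - Φ.l e| ≤ ε} {z | |Φ.cod z - Φ.r e| ≤ ε}).trans ?_
    rw [two_mul, ENNReal.ofReal_add (by positivity) (by positivity)]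
    exact add_le_add (h1 _) (h1 _)
  simp only [bdry]
  rw [lintegral_tsum fun e => (Measurable.tsum fun v => Measurable.ite
    (Φ.measurableSet_near ε e) measurable_const measurable_const).aemeasurable]
  calc _ = ∑' e, ∑' v : Vec 𝒜 n, ν (cyl (v.1 ++ [e])) * ν {z | Φ.Near ε e z} := by
        refine tsum_congr fun e => ?_
        rw [lintegral_tsum fun v => (Measurable.ite
          (Φ.measurableSet_near ε e) measurable_const measurable_const).aemeasurable]
        refine tsum_congr fun v => ?_
        have : (fun z => if Φ.Near ε e z then ν (cyl (v.1 ++ [e])) else 0) =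
            {z | Φ.Near ε e z}.indicator fun _ => ν (cyl (v.1 ++ [e])) := by
          funext z; simp [indicator_apply]
        rw [this, lintegral_indicator_const (Φ.measurableSet_near ε e)]
    _ ≤ ∑' e, ∑' v : Vec 𝒜 n, ν (cyl (v.1 ++ [e])) * ENNReal.ofReal (2 * (C * (2 * ε) ^ θ)) :=
        ENNReal.tsum_le_tsum fun e => ENNReal.tsum_le_tsum fun v => by gcongr; exact h0 e
    _ = 1 * ENNReal.ofReal (2 * (C * (2 * ε) ^ θ)) := by
        simp_rw [ENNReal.tsum_mul_right]
        rw [← tsum_measure_cyl (ν := ν) (n + 1), tsum_vec_succ n fun w => ν (cyl w)]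
    _ = _ := one_mul _

/-- It turns a sum over words with reference points into an integral over sequences: the term of a
word need only be dominated at almost every sequence of its cylinder. Neither `B` nor `F` is assumed
measurable. -/
lemma tsum_words_mul_le [IsProbabilityMeasure ν] {n : ℕ} {B : Φ.Words n → ℝ≥0∞}
    {F : (ℕ → 𝒜) → ℝ≥0∞} (h : ∀ c : Φ.Words n, ∀ᵐ z ∂ν, z ∈ cyl c.1 → B c ≤ F z) :
    ∑' c : Φ.Words n, ν (cyl c.1) * B c ≤ ∫⁻ z, F z ∂ν := by
  calc _ ≤ ∑' c : Φ.Words n, ∫⁻ z in cyl c.1, F z ∂ν := by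
        refine ENNReal.tsum_le_tsum fun c => ?_
        rw [mul_comm, ← setLIntegral_const]
        refine setLIntegral_mono_ae' (measurableSet_cyl _) (h c)
    _ ≤ _ := by
        rw [lintegral_eq_tsum_cyl ν n]
        exact Φ.tsum_words_le n fun w => ∫⁻ z in cyl w, F z ∂ν

-- For fixed `b` the sum over the three other words is bounded by a quantity that does not involve
-- `b`, so the sum over `b` costs a factor 1.
open Classical in
lemma tsum_quadruple_le (hvar : Φ.SummableVariations φ) (hν : Φ.IsGibbs φ ν)
    [IsProbabilityMeasure ν] (hatoms : ∀ x : ℝ, Φ.proj ν {x} = 0) {κ C : ℝ} (hα : 0 < α)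
    (hκ : Φ.Contr κ) (hC : Φ.Dist α C) {n : ℕ} {x : Φ.Words (n + 2) → ℝ}
    (hx : ∀ c, x c ∈ Φ.cylInterval c.1) (s t : ℝ) {r : ℝ}
    (hr : t - s + 4 * (C / (1 - κ ^ α) * (κ ^ (n + 1)) ^ α) ≤ r) :
    (∑' (a : Φ.Words (n + 2)) (b : Φ.Words (n + 2)) (c : Φ.Words (n + 2)) (d : Φ.Words (n + 2)),
      if (Φ.Acts a.1 c.1 (x c) ∧ Φ.Acts a.1 d.1 (x d) ∧
          Φ.Acts b.1 c.1 (x c) ∧ Φ.Acts b.1 d.1 (x d)) ∧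
          Φ.Delta a.1 b.1 (x c) (x d) ∈ Icc s t
      then ν (cyl a.1) * ν (cyl b.1) * ν (cyl c.1) * ν (cyl d.1) else 0) ≤
    2 * ∫⁻ z, Φ.bdry ν (n + 1) (κ ^ (n + 1)) z ∂ν +
      ∫⁻ z, ∫⁻ z', Φ.avgConc φ ν n r z z' ∂ν ∂ν := by
  have hgood := Φ.ae_good hν hatoms
  set K := 2 * ∫⁻ z, Φ.bdry ν (n + 1) (κ ^ (n + 1)) z ∂ν +
      ∫⁻ z, ∫⁻ z', Φ.avgConc φ ν n r z z' ∂ν ∂ν with hK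
  have key : ∀ b : List 𝒜, ∑' c : Φ.Words (n + 2), ν (cyl c.1) * ∑' d : Φ.Words (n + 2),
      ν (cyl d.1) * ∑' a : Φ.Words (n + 2), (if (Φ.Acts a.1 c.1 (x c) ∧ Φ.Acts a.1 d.1 (x d)) ∧
        Φ.Delta a.1 b (x c) (x d) ∈ Icc s t then ν (cyl a.1) else 0) ≤ K := by
    intro b
    have hm := Φ.measurable_bdry (ν := ν) (n + 1) (κ ^ (n + 1))
    calc _ ≤ ∫⁻ z, ∫⁻ z', (Φ.bdry ν (n + 1) (κ ^ (n + 1)) z + Φ.bdry ν (n + 1) (κ ^ (n + 1)) z' +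
        Φ.avgConc φ ν n r z z') ∂ν ∂ν := by
          refine Φ.tsum_words_mul_le fun c => ?_
          filter_upwards [hgood] with z hz hzc
          refine Φ.tsum_words_mul_le fun d => ?_
          filter_upwards [hgood] with z' hz' hzc'
          exact Φ.tsum_acts_le hα hκ hC hvar hν c.2.1 d.2.1 hz hz' hzc hzc' (hx c) (hx d) s t hr
      _ = ∫⁻ z, (Φ.bdry ν (n + 1) (κ ^ (n + 1)) z + ∫⁻ z', Φ.bdry ν (n + 1) (κ ^ (n + 1)) z' ∂ν +
          ∫⁻ z', Φ.avgConc φ ν n r z z' ∂ν) ∂ν := by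
          congr 1; funext z
          have h1 : Measurable fun z' => Φ.bdry ν (n + 1) (κ ^ (n + 1)) z +
              Φ.bdry ν (n + 1) (κ ^ (n + 1)) z' := hm.const_add _
          rw [lintegral_add_left h1, lintegral_add_left measurable_const,
            lintegral_const, measure_univ, mul_one]
      _ = K := by
          have h1 : Measurable fun z => Φ.bdry ν (n + 1) (κ ^ (n + 1)) z +
              ∫⁻ z', Φ.bdry ν (n + 1) (κ ^ (n + 1)) z' ∂ν := hm.add_const _
          rw [lintegral_add_left h1, lintegral_add_left hm, lintegral_const,
            measure_univ, mul_one, hK, two_mul]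
  rw [ENNReal.tsum_comm]
  calc _ ≤ ∑' b : Φ.Words (n + 2), ν (cyl b.1) * ∑' c : Φ.Words (n + 2), ν (cyl c.1) *
      ∑' d : Φ.Words (n + 2),
      ν (cyl d.1) * ∑' a : Φ.Words (n + 2), (if (Φ.Acts a.1 c.1 (x c) ∧ Φ.Acts a.1 d.1 (x d)) ∧
        Φ.Delta a.1 b.1 (x c) (x d) ∈ Icc s t then ν (cyl a.1) else 0) := by
        refine ENNReal.tsum_le_tsum fun b => ?_
        rw [ENNReal.tsum_comm, ← ENNReal.tsum_mul_left]
        refine ENNReal.tsum_le_tsum fun c => ?_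
        rw [ENNReal.tsum_comm, ← ENNReal.tsum_mul_left, ← ENNReal.tsum_mul_left]
        refine ENNReal.tsum_le_tsum fun d => ?_
        rw [← ENNReal.tsum_mul_left, ← ENNReal.tsum_mul_left, ← ENNReal.tsum_mul_left]
        refine ENNReal.tsum_le_tsum fun a => ?_
        split_ifs with h1 h2 h2
        · exact le_of_eq (by ring)
        · exact absurd ⟨⟨h1.1.1, h1.1.2.1⟩, h1.2⟩ h2
        · exact zero_le
        · exact zero_le
    _ ≤ ∑' b : Φ.Words (n + 2), ν (cyl b.1) * K := by
        refine ENNReal.tsum_le_tsum fun b => ?_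
        gcongr
        exact key b.1
    _ ≤ ∫⁻ _, K ∂ν := Φ.tsum_words_mul_le fun c => Eventually.of_forall fun _ _ => le_rfl
    _ = K := by rw [lintegral_const, measure_univ, mul_one]

/-- Quantitative non-linearity follows from a bound for the averaged concentration functions. -/
theorem qnl_of_lintegral_avgConc_le (hvar : Φ.SummableVariations φ) (hν : Φ.IsGibbs φ ν)
    [IsProbabilityMeasure ν] (hatoms : ∀ x : ℝ, Φ.proj ν {x} = 0) (hα : 0 < α) {θ C' : ℝ}
    (hθ : 0 < θ) (hC' : 0 < C') (hF : ∀ s t : ℝ, s ≤ t →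
    ν {z | Φ.cod z ∈ Icc s t} ≤ ENNReal.ofReal (C' * (t - s) ^ θ)) {Θ ρ C : ℝ} (hΘ : 0 < Θ)
    (hΘ1 : Θ < 1) (hρ : 0 < ρ) (hρ1 : ρ < 1) (hC : 0 < C) (h : ∀ (n : ℕ) (r : ℝ), 0 < r →
      ∫⁻ z, ∫⁻ z', Φ.avgConc φ ν n r z z' ∂ν ∂ν ≤ ENNReal.ofReal (C * (r ^ Θ + ρ ^ n))) :
    Φ.QNL fun a => ν (cyl a) := by
  classical
  obtain ⟨κ, hκ⟩ := Φ.exists_contr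
  obtain ⟨Cd, hCd⟩ := Φ.exists_dist
  have hκ0 := hκ.1
  have hκ1 := hκ.2.1
  have hq1 : κ ^ α < 1 := Real.rpow_lt_one hκ.1.le hκ.2.1 hα
  have hCC : 0 ≤ Cd / (1 - κ ^ α) := div_nonneg hCd.1 (by linarith)
  set D := 4 * (Cd / (1 - κ ^ α) + 1) with hD
  have hD0 : 0 < D := by positivity
  -- The three rates of decay: neighbourhoods of end points, the widening of the window by
  -- distortion, and the concentration bound itself.
  set σ := max (max (κ ^ θ) (κ ^ (α * Θ))) ρ with hσ
  have hσ0 : 0 < σ := lt_max_of_lt_right hρ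
  have hσ1 : σ < 1 := max_lt (max_lt (Real.rpow_lt_one hκ0.le hκ1 hθ)
    (Real.rpow_lt_one hκ0.le hκ1 (by positivity))) hρ1
  set M := 4 * (C' * 2 ^ θ) + C * (D ^ Θ + 1) + C with hM
  have hM0 : 0 < M := by positivity
  refine ⟨σ, Θ, M * (σ⁻¹) ^ 2 + σ⁻¹ + M, hσ0, hσ1, hΘ, hΘ1, by positivity, ?_⟩
  intro n hn x hx s t hst
  have hst' : 0 ≤ (t - s) ^ Θ := Real.rpow_nonneg (by linarith) _
  -- Splitting off the last two letters needs n ≥ 2; for n = 1 the sum is at most 1 and the constant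
  -- σ⁻¹ suffices.
  obtain rfl | hn2 : n = 1 ∨ 2 ≤ n := by omega
  · calc _ ≤ ∑' a : Φ.Words 1, ν (cyl a.1) * ∑' b : Φ.Words 1, ν (cyl b.1) *
        ∑' c : Φ.Words 1, ν (cyl c.1) * ∑' d : Φ.Words 1, ν (cyl d.1) * 1 := by
          refine ENNReal.tsum_le_tsum fun a => ?_
          rw [← ENNReal.tsum_mul_left]
          refine ENNReal.tsum_le_tsum fun b => ?_
          rw [← ENNReal.tsum_mul_left, ← ENNReal.tsum_mul_left]
          refine ENNReal.tsum_le_tsum fun c => ?_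
          rw [← ENNReal.tsum_mul_left, ← ENNReal.tsum_mul_left, ← ENNReal.tsum_mul_left]
          refine ENNReal.tsum_le_tsum fun d => ?_
          split_ifs
          · exact le_of_eq (by ring)
          · exact zero_le
      _ ≤ 1 := by
          have h1 : ∀ B : Φ.Words 1 → ℝ≥0∞, (∀ c, B c ≤ 1) → ∑' c, ν (cyl c.1) * B c ≤ 1 := by
            intro B hB
            refine (Φ.tsum_words_mul_le (F := fun _ => 1)
              fun c => Eventually.of_forall fun _ _ => hB c).trans ?_
            simp
          exact h1 _ fun a => h1 _ fun b => h1 _ fun c => h1 _ fun d => le_rfl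
      _ ≤ _ := by
          rw [← ENNReal.ofReal_one]
          refine ENNReal.ofReal_le_ofReal ?_
          have : σ⁻¹ * σ = 1 := inv_mul_cancel₀ hσ0.ne'
          calc (1 : ℝ) = σ⁻¹ * (0 + σ ^ 1) := by rw [pow_one, zero_add, this]
            _ ≤ _ := by
              gcongr
              have : 0 ≤ M * σ⁻¹ ^ 2 := by positivity
              linarith
  · obtain ⟨k, rfl⟩ := Nat.exists_eq_add_of_le' hn2
    have hr : t - s + 4 * (Cd / (1 - κ ^ α) * (κ ^ (k + 1)) ^ α) ≤
        t - s + D * (κ ^ (k + 1)) ^ α := by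
      rw [hD, mul_assoc, add_mul]
      have : 0 < (κ ^ (k + 1)) ^ α := by positivity
      linarith
    have hpos : 0 < D * (κ ^ (k + 1)) ^ α := by positivity
    refine (Φ.tsum_quadruple_le hvar hν hatoms hα hκ hCd hx s t hr).trans ?_
    have hpow : ∀ j : ℕ, σ ^ (k + 1) ≤ σ ^ k := fun _ =>
      pow_le_pow_of_le_one hσ0.le hσ1.le (Nat.le_succ k)
    have hb := Φ.lintegral_bdry_le hC' hF (k + 1) (ε := κ ^ (k + 1)) (by positivity)
    have hI := h k (t - s + D * (κ ^ (k + 1)) ^ α) (by linarith)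
    have e1 : (2 * κ ^ (k + 1)) ^ θ ≤ 2 ^ θ * σ ^ k := by
      rw [Real.mul_rpow (by norm_num) (by positivity), ← Real.rpow_natCast, ← Real.rpow_mul hκ0.le,
        mul_comm _ θ, Real.rpow_mul hκ0.le, Real.rpow_natCast]
      gcongr
      refine le_trans ?_ (hpow 0)
      gcongr
      exact (le_max_left _ _).trans (le_max_left _ _)
    have e2 : (t - s + D * (κ ^ (k + 1)) ^ α) ^ Θ ≤ (t - s) ^ Θ + D ^ Θ * σ ^ k := by
      refine (Real.rpow_add_le_add_rpow (by linarith) hpos.le hΘ.le hΘ1.le).trans ?_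
      rw [Real.mul_rpow hD0.le (by positivity), ← Real.rpow_natCast, ← Real.rpow_mul hκ0.le,
        ← Real.rpow_mul hκ0.le, mul_assoc, mul_comm _ (α * Θ), Real.rpow_mul hκ0.le,
        Real.rpow_natCast]
      gcongr
      refine le_trans ?_ (hpow 0)
      gcongr
      exact (le_max_right _ _).trans (le_max_left _ _)
    have e3 : ρ ^ k ≤ σ ^ k := by gcongr; exact le_max_right _ _
    calc _ ≤ 2 * ENNReal.ofReal (2 * (C' * (2 * κ ^ (k + 1)) ^ θ)) +
          ENNReal.ofReal (C * ((t - s + D * (κ ^ (k + 1)) ^ α) ^ Θ + ρ ^ k)) := by gcongr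
      _ = ENNReal.ofReal (2 * (2 * (C' * (2 * κ ^ (k + 1)) ^ θ)) +
          C * ((t - s + D * (κ ^ (k + 1)) ^ α) ^ Θ + ρ ^ k)) := by
          rw [ENNReal.ofReal_add (by positivity) (by
            have : 0 ≤ t - s + D * (κ ^ (k + 1)) ^ α := by linarith
            positivity), ENNReal.ofReal_mul (p := 2) (by norm_num)]
          simp
      _ ≤ _ := by
          refine ENNReal.ofReal_le_ofReal ?_
          have hs : σ ^ (k + 2) * σ⁻¹ ^ 2 = σ ^ k := by
            rw [pow_add, mul_assoc, ← mul_pow, mul_inv_cancel₀ hσ0.ne', one_pow, mul_one]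
          calc _ ≤ 2 * (2 * (C' * (2 ^ θ * σ ^ k))) +
                C * (((t - s) ^ Θ + D ^ Θ * σ ^ k) + σ ^ k) := by gcongr
            _ ≤ M * (t - s) ^ Θ + M * σ ^ k := by
                have : 0 ≤ (4 * (C' * 2 ^ θ) + C * (D ^ Θ + 1)) * (t - s) ^ Θ := by positivity
                have : 0 ≤ C * σ ^ k := by positivity
                rw [hM]; linarith
            _ = M * (t - s) ^ Θ + M * σ⁻¹ ^ 2 * σ ^ (k + 2) := by rw [← hs]; ring
            _ ≤ _ := by
                have : 0 ≤ (M * σ⁻¹ ^ 2 + σ⁻¹) * (t - s) ^ Θ := by positivity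
                have : 0 ≤ (M + σ⁻¹) * σ ^ (k + 2) := by positivity
                linarith

end MarkovIFS

/-! ### Bounds for the averaged concentration functions, and the conclusion under (UNI) -/

namespace MarkovIFS

variable {𝒜 : Type*} {α : ℝ} {Φ : MarkovIFS 𝒜 α} {φ : (ℕ → 𝒜) → ℝ}

lemma ell1_mul_le {d e : 𝒜} (h : Φ.adm d e) {x y : ℝ} (hx : x ∈ Φ.I e) (hy : y ∈ Φ.I e) :
    Φ.ell1 d e * |x - y| ≤ |Φ.g d e x - Φ.g d e y| := by
  have := Φ.ell_mul_le (w := [d]) (c := e) ⟨h, trivial⟩ hx hy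
  simpa [ell, G, gWord] using this

lemma concS_le_one (hnorm : Φ.IsNormalized φ) (m : ℕ) {y : ℕ → 𝒜} (hy : y ∈ Φ.shiftSpace)
    (p p' r : ℝ) : Φ.concS φ m y p p' r ≤ 1 :=
  iSup_le fun _ => Φ.conc_le_one hnorm m hy _ _ _ _

variable [MeasurableSpace 𝒜] [DiscreteMeasurableSpace 𝒜] [Countable 𝒜] {ν : Measure (ℕ → 𝒜)}

lemma tsum_measure_cyl_two [IsProbabilityMeasure ν] : ∑' e, ∑' d, ν (cyl [d, e]) = 1 := by
  rw [← tsum_measure_cyl (ν := ν) (1 + 1), tsum_vec_succ 1 fun w => ν (cyl w)]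
  refine tsum_congr fun e => ?_
  rw [tsum_vec_one fun w : List 𝒜 => ν (cyl (w ++ [e]))]
  rfl

/-- A bound on the concentration functions gives one on their average. -/
lemma avgConc_le_tsum {n : ℕ} {r : ℝ} {z z' : ℕ → 𝒜} {B : 𝒜 → 𝒜 → ℝ≥0∞}
    (hν : Φ.IsGibbs φ ν) (h : ∀ d e, Φ.Compat d e z → Φ.Compat d e z' → ∀ y ∈ Φ.shiftSpace,
      y 0 = d → Φ.concS φ n y (Φ.coding (consSeq d z)) (Φ.coding (consSeq d z')) r ≤ B d e) :
    Φ.avgConc φ ν n r z z' ≤ ∑' e, ∑' d, ν (cyl [d, e]) * B d e := by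
  classical
  refine ENNReal.tsum_le_tsum fun e => ENNReal.tsum_le_tsum fun d => ?_
  split_ifs with hc
  · rw [mul_comm, ← setLIntegral_const]
    refine setLIntegral_mono_ae' (measurableSet_cyl _) ?_
    filter_upwards [hν.supported] with y hy hyc
    exact h d e hc.1 hc.2 y hy (mem_cyl_cons.1 hyc).1
  · exact zero_le

lemma avgConc_le_one [IsProbabilityMeasure ν] (hnorm : Φ.IsNormalized φ) (hν : Φ.IsGibbs φ ν)
    (n : ℕ) (r : ℝ) (z z' : ℕ → 𝒜) : Φ.avgConc φ ν n r z z' ≤ 1 := by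
  refine (avgConc_le_tsum (B := fun _ _ => 1) hν
    fun d e _ _ y hy _ => concS_le_one hnorm n hy _ _ _).trans_eq ?_
  simp_rw [mul_one]
  exact tsum_measure_cyl_two

/-- It pays for the contraction of the one branch g_{de} that was split off: the pointwise tail
bound is integrated over [e]. -/
lemma Tail.tsum_cyl_mul_le {γ : ℝ} {q : 𝒜 → ℝ≥0∞} (hT : Φ.Tail φ γ q)
    (hvar : Φ.SummableVariations φ) (hν : Φ.IsGibbs φ ν) [IsProbabilityMeasure ν] :
    ∑' e, ∑' d, ν (cyl [d, e]) * ENNReal.ofReal (Φ.ell1 d e ^ (-γ)) ≤ ∑' d, q d := by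
  calc _ ≤ ∑' e, ∑' d, q d * ν (cyl [e]) := by
        refine ENNReal.tsum_le_tsum fun e => ENNReal.tsum_le_tsum fun d => ?_
        rw [← List.singleton_append, Φ.measure_cyl_append hvar hν,
          ← lintegral_mul_const _ (Φ.measurable_W hvar _), ← setLIntegral_const]
        refine setLIntegral_mono' (measurableSet_cyl _) fun y hy => ?_
        rw [mem_cyl_singleton] at hy
        rw [← hy, W_singleton]
        exact hT.2.2 d y
    _ = _ := by
        rw [ENNReal.tsum_comm]
        simp_rw [ENNReal.tsum_mul_left]
        rw [← tsum_vec_one fun w : List 𝒜 => ν (cyl w), tsum_measure_cyl]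
        simp_rw [mul_one]

/-- Pairs at distance at most ϱ have small measure by Hölder regularity, and there the trivial bound
1 is enough. -/
lemma lintegral_avgConc_le_of_pointwise [IsProbabilityMeasure ν] (hν : Φ.IsGibbs φ ν)
    (hatoms : ∀ x : ℝ, Φ.proj ν {x} = 0) {θ C' : ℝ}
    (hF : ∀ s t : ℝ, s ≤ t → ν {z | Φ.cod z ∈ Icc s t} ≤ ENNReal.ofReal (C' * (t - s) ^ θ))
    (hnorm : Φ.IsNormalized φ) {n : ℕ} {r ϱ : ℝ} (hϱ : 0 ≤ ϱ) {B : ℝ≥0∞}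
    (h : ∀ z z', Φ.Good z → Φ.Good z' → ϱ < |Φ.coding z - Φ.coding z'| →
      Φ.avgConc φ ν n r z z' ≤ B) :
    ∫⁻ z, ∫⁻ z', Φ.avgConc φ ν n r z z' ∂ν ∂ν ≤ ENNReal.ofReal (C' * (2 * ϱ) ^ θ) + B := by
  classical
  have hgood := Φ.ae_good hν hatoms
  have h1 : ∀ᵐ z ∂ν, ∫⁻ z', Φ.avgConc φ ν n r z z' ∂ν ≤ ENNReal.ofReal (C' * (2 * ϱ) ^ θ) + B := by
    filter_upwards [hgood] with z hz
    have hm : MeasurableSet {z' | Φ.cod z' ∈ Icc (Φ.coding z - ϱ) (Φ.coding z + ϱ)} :=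
      Φ.measurable_cod measurableSet_Icc
    calc _ ≤ ∫⁻ z', ({z' | Φ.cod z' ∈ Icc (Φ.coding z - ϱ) (Φ.coding z + ϱ)}.indicator 1 z' +
          B) ∂ν := by
          refine lintegral_mono_ae ?_
          filter_upwards [hgood] with z' hz'
          by_cases hd : |Φ.coding z - Φ.coding z'| ≤ ϱ
          · rw [abs_le] at hd
            rw [indicator_of_mem]
            · exact (avgConc_le_one hnorm hν n r z z').trans le_self_add
            · rw [mem_ofPred_eq, Φ.cod_of_mem hz'.1]
              constructor <;> linarith
          · exact (h z z' hz hz' (not_le.1 hd)).trans le_add_self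
      _ = ν {z' | Φ.cod z' ∈ Icc (Φ.coding z - ϱ) (Φ.coding z + ϱ)} + B := by
          rw [lintegral_add_right _ measurable_const, lintegral_indicator_one hm, lintegral_const,
            measure_univ, mul_one]
      _ ≤ _ := by
          gcongr
          refine (hF _ _ (by linarith)).trans_eq ?_
          ring_nf
  calc _ ≤ ∫⁻ _, (ENNReal.ofReal (C' * (2 * ϱ) ^ θ) + B) ∂ν := lintegral_mono_ae h1
    _ = _ := by rw [lintegral_const, measure_univ, mul_one]

lemma lintegral_avgConc_le_one [IsProbabilityMeasure ν] (hnorm : Φ.IsNormalized φ)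
    (hν : Φ.IsGibbs φ ν) (n : ℕ) (r : ℝ) : ∫⁻ z, ∫⁻ z', Φ.avgConc φ ν n r z z' ∂ν ∂ν ≤ 1 := by
  calc _ ≤ ∫⁻ _, ∫⁻ _, 1 ∂ν ∂ν :=
        lintegral_mono fun z => lintegral_mono fun z' => avgConc_le_one hnorm hν n r z z'
    _ = 1 := by simp

/-- The pointwise bound contains a negative power of the distance of π(dz) and π(dz'), while
regularity speaks about π(z) and π(z'). The distances are comparable up to `ell1 d e`, whose
negative power is summable against the masses of [de]. -/
theorem UNI.qnl (hU : Φ.UNI) (hα : 0 < α) {γ : ℝ} {q : 𝒜 → ℝ≥0∞} (hT : Φ.Tail φ γ q)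
    (hnorm : Φ.IsNormalized φ) (hvar : Φ.SummableVariations φ) (hν : Φ.IsGibbs φ ν)
    [IsProbabilityMeasure ν] (hatoms : ∀ x : ℝ, Φ.proj ν {x} = 0) :
    Φ.QNL fun a => ν (cyl a) := by
  obtain ⟨θ, C', hθ, hC', hF⟩ := hT.frostman Φ hnorm hvar hν hatoms
  obtain ⟨s, C₁, ρ, hs, -, hsγ, hC₁, hρ, hρ1, hconc⟩ :=
    hU.exists_conc_le Φ hα hT hnorm hvar one_pos
  set Q := (∑' d, q d).toReal with hQ
  have hQ' : ∑' d, q d = ENNReal.ofReal Q := (ENNReal.ofReal_toReal hT.2.1).symm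
  have hQ0 : 0 ≤ Q := ENNReal.toReal_nonneg
  set Θ := min (min (s / (2 * α)) (θ / (2 * α))) (1 / 2) with hΘ
  have hΘ0 : 0 < Θ := by positivity
  have hΘ1 : Θ < 1 := (min_le_right _ _).trans_lt (by norm_num)
  refine Φ.qnl_of_lintegral_avgConc_le hvar hν hatoms hα hθ hC' hF hΘ0 hΘ1 hρ hρ1
    (C := C' * 2 ^ θ + C₁ * Q + C₁ + 1) (by positivity) fun n r hr => ?_
  have hρn : 0 < ρ ^ n := pow_pos hρ n
  rcases lt_or_ge 1 r with hr1 | hr1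
  · refine (lintegral_avgConc_le_one hnorm hν n r).trans ?_
    rw [← ENNReal.ofReal_one]
    refine ENNReal.ofReal_le_ofReal ?_
    have h1 : 1 ≤ r ^ Θ := Real.one_le_rpow hr1.le hΘ0.le
    have h2 : 0 ≤ C' * 2 ^ θ + C₁ * Q + C₁ := by positivity
    nlinarith
  -- With this threshold both r^(s/α) ϱ^(-s) and ϱ^θ are positive powers of `r`.
  set ϱ := r ^ (1 / (2 * α)) with hϱ
  have hϱ0 : 0 < ϱ := Real.rpow_pos_of_pos hr _
  have hpt := lintegral_avgConc_le_of_pointwise (n := n) (r := r) hν hatoms hF hnorm hϱ0.le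
    (B := ENNReal.ofReal (C₁ * Q * r ^ (s / (2 * α)) + C₁ * ρ ^ n)) fun z z' hz hz' hzz => ?_
  · refine hpt.trans ?_
    rw [← ENNReal.ofReal_add (by positivity) (by positivity)]
    refine ENNReal.ofReal_le_ofReal ?_
    have e1 : (2 * ϱ) ^ θ = 2 ^ θ * r ^ (θ / (2 * α)) := by
      rw [Real.mul_rpow (by norm_num) hϱ0.le, hϱ, ← Real.rpow_mul hr.le]
      congr 2; ring
    have e2 : r ^ (θ / (2 * α)) ≤ r ^ Θ := Real.rpow_le_rpow_of_exponent_ge hr hr1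
      ((min_le_left _ _).trans (min_le_right _ _))
    have e3 : r ^ (s / (2 * α)) ≤ r ^ Θ := Real.rpow_le_rpow_of_exponent_ge hr hr1
      ((min_le_left _ _).trans (min_le_left _ _))
    have e4 : 0 ≤ r ^ Θ := by positivity
    calc _ ≤ C' * (2 ^ θ * r ^ Θ) + (C₁ * Q * r ^ Θ + C₁ * ρ ^ n) := by rw [e1]; gcongr
      _ ≤ _ := by
        have : 0 ≤ (C₁ + 1) * r ^ Θ := by positivity
        have : 0 ≤ (C' * 2 ^ θ + C₁ * Q + 1) * ρ ^ n := by positivity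
        linarith
  · have hB := avgConc_le_tsum (n := n) (r := r) (z := z) (z' := z')
      (B := fun d e => ENNReal.ofReal (C₁ * r ^ (s / (2 * α))) *
        ENNReal.ofReal (Φ.ell1 d e ^ (-γ)) + ENNReal.ofReal (C₁ * ρ ^ n)) hν
      fun d e hc hc' y hy hyd => ?_
    · refine hB.trans ?_
      simp_rw [mul_add, mul_left_comm (ν _), ENNReal.tsum_add, ENNReal.tsum_mul_left,
        ENNReal.tsum_mul_right, tsum_measure_cyl_two, one_mul]
      rw [ENNReal.ofReal_add (by positivity) (by positivity), mul_right_comm,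
        ENNReal.ofReal_mul (p := C₁ * _) (by positivity), ← hQ']
      exact add_le_add (mul_le_mul' le_rfl (hT.tsum_cyl_mul_le hvar hν)) le_rfl
    · have hgz := (hz.app Φ (w := [d]) hc.2.1).1
      have hgz' := (hz'.app Φ (w := [d]) hc'.2.1).1
      have hell := Φ.ell1_pos hc.1
      -- Both points lie in I_e, and `Compat` expresses π(dz) and π(dz') by the same branch g_{de},
      -- so its lower contraction bound applies even if `z` and `z'` begin with different letters.
      have hd : Φ.ell1 d e * ϱ ≤ |Φ.coding (consSeq d z) - Φ.coding (consSeq d z')| := by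
        rw [← hc.2.2.2, ← hc'.2.2.2]
        refine le_trans ?_ (ell1_mul_le hc.1 hc.2.2.1 hc'.2.2.1)
        gcongr
      have hd0 : 0 < Φ.ell1 d e * ϱ := by positivity
      refine iSup_le fun t => ?_
      refine (hconc n y (consSeq d z) (consSeq d z') hy hgz hgz' hyd rfl
        (fun h => by rw [h, sub_self, abs_zero] at hd; linarith) t r hr.le).trans ?_
      rw [← ENNReal.ofReal_mul (by positivity), ← ENNReal.ofReal_add (by positivity) (by positivity)]
      refine ENNReal.ofReal_le_ofReal ?_
      have e1 : |Φ.coding (consSeq d z) - Φ.coding (consSeq d z')| ^ (-s) ≤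
          Φ.ell1 d e ^ (-γ) * ϱ ^ (-s) := by
        refine (Real.rpow_le_rpow_of_nonpos hd0 hd (by linarith)).trans ?_
        rw [Real.mul_rpow hell.le hϱ0.le]
        have h2 := Φ.ell_rpow_neg_mono (w := [d]) (c := e) ⟨hc.1, trivial⟩ hsγ
        simp only [ell, List.headD_nil, mul_one] at h2
        exact mul_le_mul_of_nonneg_right h2 (by positivity)
      have e2 : r ^ (s / α) * ϱ ^ (-s) = r ^ (s / (2 * α)) := by
        rw [hϱ, ← Real.rpow_mul hr.le, ← Real.rpow_add hr]
        congr 1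
        field_simp
        ring
      calc _ ≤ C₁ * (r ^ (s / α) * (Φ.ell1 d e ^ (-γ) * ϱ ^ (-s)) + ρ ^ n) := by gcongr
        _ = C₁ * ((r ^ (s / α) * ϱ ^ (-s)) * Φ.ell1 d e ^ (-γ) + ρ ^ n) := by ring
        _ = _ := by rw [e2]; ring

end MarkovIFS

/-! ### Masses of cylinders and masses of intervals -/

namespace MarkovIFS

variable {𝒜 : Type*} {α : ℝ} {Φ : MarkovIFS 𝒜 α} {φ : (ℕ → 𝒜) → ℝ}
lemma QNL.congr {m m' : List 𝒜 → ℝ≥0∞} (h : Φ.QNL m)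
    (hm : ∀ n, ∀ a : Φ.Words (n + 1), m' a.1 = m a.1) : Φ.QNL m' := by
  obtain ⟨ρ, Θ, C, h1, h2, h3, h4, h5, h⟩ := h
  refine ⟨ρ, Θ, C, h1, h2, h3, h4, h5, fun n hn x hx s t hst => ?_⟩
  obtain ⟨k, rfl⟩ := Nat.exists_eq_add_of_le' hn
  simp_rw [hm]
  exact h _ hn x hx s t hst

variable [MeasurableSpace 𝒜] [DiscreteMeasurableSpace 𝒜] [Countable 𝒜] {ν : Measure (ℕ → 𝒜)}

lemma measurableSet_cylInterval {n : ℕ} (a : Φ.Words (n + 1)) :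
    MeasurableSet (Φ.cylInterval a.1) := by
  obtain ⟨u, c, h⟩ : ∃ u c, a.1 = u ++ [c] :=
    List.eq_nil_or_concat'  a.1 |>.resolve_left fun h => by simpa [h] using a.2.1
  have hch := a.2.2
  rw [h, isChain_append_singleton] at hch
  rw [h, cylInterval, gWord_append_singleton, dom_append_singleton]
  exact ((isPreconnected_Ioo (a := Φ.l c) (b := Φ.r c)).image _
    (Φ.continuousOn_G hch)).ordConnected.measurableSet

lemma ae_good_shift (hvar : Φ.SummableVariations φ) (hν : Φ.IsGibbs φ ν)
    (hatoms : ∀ x : ℝ, Φ.proj ν {x} = 0) (n : ℕ) : ∀ᵐ z ∂ν, Φ.Good fun k => z (k + n) := by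
  induction n with
  | zero => simpa using Φ.ae_good hν hatoms
  | succ n ih =>
    filter_upwards [Φ.ae_shiftSeq hvar hν ih] with z hz
    simpa only [shiftSeq, Nat.add_assoc] using hz

lemma coding_mem_cylInterval {n : ℕ} {z : ℕ → 𝒜} (hz : z ∈ Φ.shiftSpace)
    (h : Φ.Good fun k => z (k + n)) : Φ.coding z ∈ Φ.cylInterval (pre (n + 1) z) := by
  have h1 := h.app Φ (w := pre n z) (by rwa [app_pre])
  rw [app_pre] at h1
  rw [h1.2, pre_succ_eq_append, cylInterval, gWord_append_singleton, dom_append_singleton, zero_add]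
  exact mem_image_of_mem _ (by simpa using h.2)

/-- Almost surely π(z) lies in the open interval of each of its own prefixes, because no shift of
`z` codes an end point. By disjointness it lies in no other interval of the same generation. -/
lemma NoOverlap.proj_cylInterval (hno : Φ.NoOverlap) (hvar : Φ.SummableVariations φ)
    (hν : Φ.IsGibbs φ ν) (hatoms : ∀ x : ℝ, Φ.proj ν {x} = 0) {n : ℕ} (a : Φ.Words (n + 1)) :
    Φ.proj ν (Φ.cylInterval a.1) = ν (cyl a.1) := by
  rw [Φ.proj_apply hν (measurableSet_cylInterval a)]
  refine measure_congr ?_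
  filter_upwards [ae_good_shift hvar hν hatoms n, hν.supported] with z hz hzS
  have h1 := coding_mem_cylInterval hzS hz
  refine propext (Iff.trans (b := pre (n + 1) z = a.1) ⟨fun h => ?_, fun h => ?_⟩ ?_)
  · by_contra hne
    have hw : (pre (n + 1) z).IsChain Φ.adm := by
      rw [pre_succ_eq_append, isChain_append_singleton]; exact Φ.admW_pre hzS n
    refine Set.disjoint_left.1 (hno (n + 1) ⟨pre (n + 1) z, length_pre _ _, hw⟩ a
      fun h => hne (congrArg Subtype.val h)) h1 ?_
    rw [← Φ.cod_of_mem hzS]; exact h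
  · change Φ.cod z ∈ _
    rw [Φ.cod_of_mem hzS, ← h]; exact h1
  · have h2 := mem_cyl_iff_pre (w := a.1) (z := z)
    rw [a.2.1] at h2
    exact h2.symm

end MarkovIFS

/-! ### The geometric potential -/

namespace MarkovIFS

variable {𝒜 : Type*} {α : ℝ} {Φ : MarkovIFS 𝒜 α} {φ : (ℕ → 𝒜) → ℝ}

lemma dimH_attractor_ne_top : dimH Φ.attractor ≠ ∞ :=
  ((dimH_mono (subset_univ _)).trans_lt (Real.dimH_univ.trans_lt ENNReal.one_lt_top)).ne

lemma logDeriv_eq (hα : 0 < α) {a b : 𝒜} (h : Φ.adm a b) {x : ℝ} (hx : x ∈ Φ.I b) :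
    Φ.logDeriv a b x = Real.log |deriv (Φ.g a b) x| := by
  obtain ⟨C, hC⟩ := Φ.exists_dist
  have hne : (𝓝[Φ.I b] x).NeBot := mem_closure_iff_nhdsWithin_neBot.1 (subset_closure hx)
  refine Tendsto.limUnder_eq ?_
  rw [tendsto_iff_dist_tendsto_zero]
  have h1 : Tendsto (fun y : ℝ => C * |y - x| ^ α) (𝓝[Φ.I b] x) (𝓝 0) := by
    have : Continuous fun y : ℝ => C * |y - x| ^ α :=
      continuous_const.mul ((continuous_abs.comp (continuous_id.sub continuous_const)).rpow_const
        fun _ => Or.inr hα.le)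
    have h2 := this.tendsto x
    simp only [sub_self, abs_zero, Real.zero_rpow hα.ne', mul_zero] at h2
    exact h2.mono_left nhdsWithin_le_nhds
  refine squeeze_zero' (Eventually.of_forall fun _ => dist_nonneg) ?_ h1
  filter_upwards [self_mem_nhdsWithin] with y hy
  exact hC.2 a b h y hy x hx

/-- The weights of the geometric potential. -/
lemma W_eq_exp (hα : 0 < α) {P : ℝ} {u : (ℕ → 𝒜) → ℝ} (hu : ∀ z ∈ Φ.shiftSpace,
      φ z = Φ.dim * Φ.logDeriv (z 0) (z 1) (Φ.coding (shiftSeq z)) + u z - u (shiftSeq z) - P)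
    {z : ℕ → 𝒜} (hz : Φ.Good z) {w : List 𝒜} (h : app w z ∈ Φ.shiftSpace) :
    Φ.W φ w z = ENNReal.ofReal (Real.exp
      (-(Φ.dim * Φ.ta w (z 0) (Φ.coding z)) + u (app w z) - u z - P * w.length)) := by
  induction w with
  | nil => simp [W, ta, app]
  | cons a w ih =>
    have h1 := Φ.consSeq_mem_shiftSpace.1 h
    have h2 := hz.app Φ h1.2
    rw [W, ih h1.2, Φ.om_of_mem h, ← ENNReal.ofReal_mul (Real.exp_pos _).le, ← Real.exp_add,
      hu _ h]
    have e1 : shiftSeq (app (a :: w) z) = app w z := rfl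
    have e2 : app (a :: w) z 1 = app w z 0 := rfl
    have e3 : app (a :: w) z 0 = a := rfl
    rw [e1, e2, e3, logDeriv_eq hα h1.1 h2.1.2, h2.2, app_zero, ta, List.length_cons]
    congr 2
    push_cast
    ring

variable [MeasurableSpace 𝒜] [DiscreteMeasurableSpace 𝒜] [Countable 𝒜] {ν : Measure (ℕ → 𝒜)}

/-- The mass distribution principle. -/
lemma le_dim_of_measure_Icc_le (hν : Φ.IsGibbs φ ν) [IsProbabilityMeasure ν] {d C : ℝ}
    (hd : 0 < d) (hC : 0 < C)
    (h : ∀ s t : ℝ, s ≤ t → ν {z | Φ.cod z ∈ Icc s t} ≤ ENNReal.ofReal (C * (t - s) ^ d)) :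
    d ≤ Φ.dim := by
  have h1 : ENNReal.ofReal C⁻¹ • Φ.proj ν ≤ μH[d] := by
    refine Measure.le_hausdorffMeasure d _ 1 one_pos fun s hs => ?_
    rcases s.eq_empty_or_nonempty with rfl | hne
    · simp
    have hb : Bornology.IsBounded s :=
      Metric.isBounded_iff_ediam_ne_top.2 (hs.trans_lt ENNReal.one_lt_top).ne
    have hbb : BddBelow s ∧ BddAbove s := ⟨hb.bddBelow, hb.bddAbove⟩
    have hle : sInf s ≤ sSup s := csInf_le_csSup hne hbb.1 hbb.2 
    rw [Real.ediam_eq hb, ENNReal.ofReal_rpow_of_nonneg (by linarith) hd.le, Measure.smul_apply,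
      smul_eq_mul]
    calc _ ≤ ENNReal.ofReal C⁻¹ * ENNReal.ofReal (C * (sSup s - sInf s) ^ d) := by
          gcongr
          refine (measure_mono (subset_Icc_csInf_csSup hbb.1 hbb.2)).trans ?_
          rw [Φ.proj_apply hν measurableSet_Icc]
          exact h _ _ hle
      _ = _ := by
          rw [← ENNReal.ofReal_mul (by positivity), ← mul_assoc, inv_mul_cancel₀ hC.ne', one_mul]
  -- A measurable hull is used, so that measurability of the attractor plays no part.
  have h2 : 1 ≤ Φ.proj ν Φ.attractor := by
    have hs := subset_toMeasurable (Φ.proj ν) Φ.attractor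
    rw [← measure_toMeasurable, Φ.proj_apply hν (measurableSet_toMeasurable _ _),
      ← measure_univ (μ := ν)]
    refine measure_mono_ae ?_
    filter_upwards [hν.supported] with z hz _
    refine hs ?_
    rw [Φ.cod_of_mem hz]
    exact Φ.coding_mem_attractor hz
  have h3 : μH[d] Φ.attractor ≠ 0 := by
    refine (lt_of_lt_of_le ?_ (h1 Φ.attractor)).ne'
    rw [Measure.smul_apply, smul_eq_mul]
    exact ENNReal.mul_pos (by simpa using hC) (one_pos.trans_le h2).ne'
  have h4 := le_dimH_of_hausdorffMeasure_ne_zero (d := ⟨d, hd.le⟩) h3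
  have h5 := ENNReal.toReal_mono dimH_attractor_ne_top h4
  exact h5

end MarkovIFS

/-! ### Stopping cylinders -/

section Stopping

variable {𝒜 : Type*} [MeasurableSpace 𝒜] {ν : Measure (ℕ → 𝒜)} {T T' : ℝ≥0∞} {z z' : ℕ → 𝒜}

/-- The first time at which the mass of the cylinder of `z` is at most `T`. -/
noncomputable def stopLen (ν : Measure (ℕ → 𝒜)) (T : ℝ≥0∞) (z : ℕ → 𝒜) : ℕ :=
  sInf {n | ν (cyl (pre n z)) ≤ T}

/-- The cylinder of `z` at the first time at which its mass is at most `T`. -/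
noncomputable def stopWord (ν : Measure (ℕ → 𝒜)) (T : ℝ≥0∞) (z : ℕ → 𝒜) : List 𝒜 :=
  pre (stopLen ν T z) z

lemma lt_of_lt_stopLen {n : ℕ} (h : n < stopLen ν T z) : T < ν (cyl (pre n z)) :=
  not_le.1 (Nat.notMem_of_lt_sInf h)

lemma stopLen_le_of_pre (hT : ν (cyl (stopWord ν T z)) ≤ T)
    (h : pre (stopLen ν T z) z = pre (stopLen ν T z) z') : stopLen ν T z' ≤ stopLen ν T z := by
  refine Nat.sInf_le ?_
  rw [mem_ofPred_eq, ← h]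
  exact hT

lemma mem_cyl_stop : z ∈ cyl (stopWord ν T z) := mem_cyl_pre _ _

lemma pre_eq_of_le {n k : ℕ} (hnk : k ≤ n) (h : pre n z = pre n z') : pre k z = pre k z' := by
  obtain ⟨j, rfl⟩ := Nat.exists_eq_add_of_le hnk
  have h1 := congrArg (List.take k) h
  rw [MarkovIFS.pre_add, MarkovIFS.pre_add] at h1
  simpa using h1

lemma mem_cyl_stop_iff : z' ∈ cyl (stopWord ν T z) ↔ pre (stopLen ν T z) z' = pre (stopLen ν T z) z := by
  rw [mem_cyl_iff_pre, stopWord, length_pre]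

/-- Whether the stopping time has been reached depends only on the letters read so far. Hence
stopping cylinders are equal or disjoint, and those for a smaller threshold refine those for a
larger one. -/
lemma stopLen_eq_of_mem (hT : ∀ z, ν (cyl (stopWord ν T z)) ≤ T) (h : z' ∈ cyl (stopWord ν T z)) :
    stopLen ν T z' = stopLen ν T z := by
  rw [mem_cyl_stop_iff] at h
  have h1 := stopLen_le_of_pre (hT z) h.symm
  exact le_antisymm h1 (stopLen_le_of_pre (hT z') (pre_eq_of_le h1 h))

lemma stop_eq_iff (hT : ∀ z, ν (cyl (stopWord ν T z)) ≤ T) :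
    stopWord ν T z' = stopWord ν T z ↔ z' ∈ cyl (stopWord ν T z) := by
  refine ⟨fun h => h ▸ mem_cyl_stop, fun h => ?_⟩
  rw [stopWord, stopLen_eq_of_mem hT h, mem_cyl_stop_iff.1 h, stopWord]

lemma stopLen_anti (hT : ∀ z, ν (cyl (stopWord ν T z)) ≤ T) (h : T ≤ T') :
    stopLen ν T' z ≤ stopLen ν T z :=
  Nat.sInf_le ((hT z).trans h)

lemma stop_eq_of_le (hT : ∀ z, ν (cyl (stopWord ν T z)) ≤ T) (hT' : ∀ z, ν (cyl (stopWord ν T' z)) ≤ T')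
    (h : T ≤ T') (hz : stopWord ν T z' = stopWord ν T z) : stopWord ν T' z' = stopWord ν T' z := by
  rw [stop_eq_iff hT, mem_cyl_stop_iff] at hz
  rw [stop_eq_iff hT', mem_cyl_stop_iff]
  exact pre_eq_of_le (stopLen_anti hT h) hz

lemma one_le_stopLen [IsProbabilityMeasure ν] (hT : ∀ z, ν (cyl (stopWord ν T z)) ≤ T) (h : T < 1) :
    1 ≤ stopLen ν T z := by
  by_contra hc
  have h0 : stopLen ν T z = 0 := by omega
  have h1 := hT z
  rw [stopWord, h0] at h1
  have h2 : cyl (pre 0 z) = univ := eq_univ_of_forall fun y => by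
    rw [mem_cyl_iff_pre, length_pre]; rfl
  rw [h2, measure_univ] at h1
  exact absurd h (not_lt.2 h1)

variable [DiscreteMeasurableSpace 𝒜] [Countable 𝒜]

lemma measurableSet_stop_eq (hT : ∀ z, ν (cyl (stopWord ν T z)) ≤ T) (w : List 𝒜) :
    MeasurableSet {z | stopWord ν T z = w} := by
  by_cases h : ∃ z, stopWord ν T z = w
  · obtain ⟨z, rfl⟩ := h
    have : {z' | stopWord ν T z' = stopWord ν T z} = cyl (stopWord ν T z) := ext fun z' => stop_eq_iff hT
    rw [this]
    exact measurableSet_cyl _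
  · have : {z | stopWord ν T z = w} = ∅ := eq_empty_of_forall_notMem fun z hz => h ⟨z, hz⟩
    rw [this]
    exact MeasurableSet.empty

/-- Functions of the stopping cylinder are measurable. -/
lemma measurable_of_stop {β : Type*} [MeasurableSpace β] (hT : ∀ z, ν (cyl (stopWord ν T z)) ≤ T)
    {f : (ℕ → 𝒜) → β} (hf : ∀ z z', stopWord ν T z' = stopWord ν T z → f z' = f z) : Measurable f := by
  intro s _
  have : f ⁻¹' s = ⋃ w ∈ stopWord ν T '' (f ⁻¹' s), {z | stopWord ν T z = w} := by
    ext z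
    simp only [mem_preimage, mem_iUnion, mem_image, mem_ofPred_eq, exists_prop]
    refine ⟨fun h => ⟨_, ⟨z, h, rfl⟩, rfl⟩, ?_⟩
    rintro ⟨w, ⟨y, hy, h1⟩, h2⟩
    rw [hf y z (h2.trans h1.symm)]
    exact hy
  rw [this]
  exact MeasurableSet.biUnion (to_countable _) fun w _ => measurableSet_stop_eq hT w

/-- It suffices to compare the two integrals on single stopping cylinders. A threshold below 1
forces at least one letter to be read, so that each of them lies inside or outside [d]; those
without a point satisfying `p` are null. -/
lemma lintegral_le_of_stop [IsProbabilityMeasure ν] (hT : ∀ z, ν (cyl (stopWord ν T z)) ≤ T)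
    (hT1 : T < 1) {p : (ℕ → 𝒜) → Prop} (hp : ∀ᵐ z ∂ν, p z) {d : 𝒜} {f g : (ℕ → 𝒜) → ℝ≥0∞}
    (h : ∀ z, p z → z 0 = d → ∫⁻ x in cyl (stopWord ν T z), f x ∂ν ≤ ∫⁻ x in cyl (stopWord ν T z), g x ∂ν) :
    ∫⁻ x in cyl [d], f x ∂ν ≤ ∫⁻ x in cyl [d], g x ∂ν := by
  have hU : (⋃ w, {z | stopWord ν T z = w} ∩ cyl [d]) = cyl [d] := by
    ext z; simp
  have hm : ∀ w, MeasurableSet ({z | stopWord ν T z = w} ∩ cyl [d]) :=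
    fun w => (measurableSet_stop_eq hT w).inter (measurableSet_cyl _)
  have hd : Pairwise (Function.onFun Disjoint fun w => {z | stopWord ν T z = w} ∩ cyl [d]) := by
    intro w w' hww
    refine Set.disjoint_left.2 fun z h1 h2 => hww ?_
    exact h1.1.symm.trans h2.1
  rw [← hU, lintegral_iUnion hm hd, lintegral_iUnion hm hd]
  refine ENNReal.tsum_le_tsum fun w => ?_
  by_cases hex : ∃ z ∈ {z | stopWord ν T z = w} ∩ cyl [d], p z
  · obtain ⟨z, ⟨hzw, hzd⟩, hz⟩ := hex
    rw [mem_cyl_singleton] at hzd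
    have hs : {z | stopWord ν T z = w} ∩ cyl [d] = cyl (stopWord ν T z) := by
      ext y
      rw [mem_inter_iff, mem_ofPred_eq, ← (show stopWord ν T z = w from hzw), stop_eq_iff hT,
        and_iff_left_iff_imp]
      intro hy
      rw [mem_cyl_stop_iff] at hy
      have h1 := pre_eq_of_le (one_le_stopLen hT hT1) hy
      rw [mem_cyl_singleton, ← hzd]
      simpa [pre] using h1
    rw [hs]
    exact h z hz hzd
  · have h0 : ν ({z | stopWord ν T z = w} ∩ cyl [d]) = 0 := by
      refine measure_mono_null (t := {z | ¬ p z}) (fun z hz hpz => hex ⟨z, hz, hpz⟩) hp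
    rw [Measure.restrict_eq_zero.2 h0]
    simp

end Stopping

/-! ### Typical sequences and finiteness of the stopping time -/

namespace MarkovIFS

variable {𝒜 : Type*} {α : ℝ} {Φ : MarkovIFS 𝒜 α} {φ : (ℕ → 𝒜) → ℝ}
variable [MeasurableSpace 𝒜] {ν : Measure (ℕ → 𝒜)}

/-- All shifts of `z` code interior points and all cylinders of `z` have positive mass. -/
def Typ (Φ : MarkovIFS 𝒜 α) (ν : Measure (ℕ → 𝒜)) (z : ℕ → 𝒜) : Prop :=
  (∀ n, Φ.Good fun k => z (k + n)) ∧ ∀ n, ν (cyl (pre n z)) ≠ 0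

lemma Typ.good {z : ℕ → 𝒜} (h : Φ.Typ ν z) : Φ.Good z := h.1 0

lemma Typ.mem {z : ℕ → 𝒜} (h : Φ.Typ ν z) : z ∈ Φ.shiftSpace := h.good.1

variable [DiscreteMeasurableSpace 𝒜] [Countable 𝒜]

lemma ae_typ (hvar : Φ.SummableVariations φ) (hν : Φ.IsGibbs φ ν)
    (hatoms : ∀ x : ℝ, Φ.proj ν {x} = 0) : ∀ᵐ z ∂ν, Φ.Typ ν z := by
  have h1 : ∀ᵐ z ∂ν, ∀ w : {w : List 𝒜 // ν (cyl w) = 0}, z ∉ cyl w.1 :=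
    ae_all_iff.2 fun w => measure_eq_zero_iff_ae_notMem.1 w.2
  filter_upwards [ae_all_iff.2 fun n => ae_good_shift hvar hν hatoms n, h1] with z hz hz1
  exact ⟨hz, fun n h => hz1 ⟨_, h⟩ (mem_cyl_pre n z)⟩

lemma measure_singleton_eq_zero (hν : Φ.IsGibbs φ ν) (hatoms : ∀ x : ℝ, Φ.proj ν {x} = 0)
    (z : ℕ → 𝒜) : ν {z} = 0 := by
  have h := hatoms (Φ.cod z)
  rw [Φ.proj_apply hν (measurableSet_singleton _)] at h
  exact measure_mono_null (fun y hy => by rw [mem_singleton_iff.1 hy]; rfl) h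

/-- The cylinders decrease to the single sequence `z`, which is null because π(z) is not an atom.
Consequently the stopping time is attained for every positive threshold. -/
lemma tendsto_measure_cyl_pre [IsProbabilityMeasure ν] (hν : Φ.IsGibbs φ ν)
    (hatoms : ∀ x : ℝ, Φ.proj ν {x} = 0) (z : ℕ → 𝒜) :
    Tendsto (fun n => ν (cyl (pre n z))) atTop (𝓝 0) := by
  have h : ⋂ n, cyl (pre n z) = {z} := by
    refine Subset.antisymm (fun y hy => ?_)
      (fun y hy => by rw [mem_singleton_iff.1 hy]; exact mem_iInter.2 fun n => mem_cyl_pre n z)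
    rw [mem_singleton_iff]
    funext n
    have h1 := mem_iInter.1 hy (n + 1)
    rw [mem_cyl_iff_pre, length_pre, pre_succ_eq_append, pre_succ_eq_append] at h1
    simpa using (List.append_inj' h1 rfl).2
  rw [← measure_singleton_eq_zero hν hatoms z, ← h]
  refine tendsto_measure_iInter_atTop (fun n => (measurableSet_cyl _).nullMeasurableSet) ?_
    ⟨0, measure_ne_top _ _⟩
  intro m n hmn y hy
  rw [mem_cyl_iff_pre, length_pre] at hy ⊢
  exact pre_eq_of_le hmn hy

lemma measure_cyl_stop_le [IsProbabilityMeasure ν] (hν : Φ.IsGibbs φ ν)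
    (hatoms : ∀ x : ℝ, Φ.proj ν {x} = 0) {T : ℝ≥0∞} (hT : 0 < T) (z : ℕ → 𝒜) :
    ν (cyl (stopWord ν T z)) ≤ T :=
  Nat.sInf_mem (s := {n | ν (cyl (pre n z)) ≤ T})
    ((tendsto_measure_cyl_pre hν hatoms z).eventually_le_const hT).exists

end MarkovIFS

lemma exists_pos_le_of_ne_zero {ι : Type*} [Finite ι] (f : ι → ℝ≥0∞) :
    ∃ c : ℝ, 0 < c ∧ c ≤ 1 ∧ ∀ i, f i ≠ 0 → ENNReal.ofReal c ≤ f i := by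
  have := Fintype.ofFinite ι
  set m := Finset.univ.inf fun i => if f i = 0 then (1 : ℝ≥0∞) else min 1 (f i) with hm
  have h1 : 0 < min 1 m := by
    refine lt_min one_pos ?_
    rw [hm, Finset.lt_inf_iff ENNReal.zero_lt_top]
    intro i _
    split_ifs with h
    · exact one_pos
    · exact lt_min one_pos (pos_iff_ne_zero.2 h)
  have h2 : min 1 m ≠ ∞ := ((min_le_left _ _).trans_lt ENNReal.one_lt_top).ne
  refine ⟨(min 1 m).toReal, ENNReal.toReal_pos h1.ne' h2, ?_, fun i hi => ?_⟩
  · rw [← ENNReal.toReal_one]; exact ENNReal.toReal_mono ENNReal.one_ne_top (min_le_left _ _)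
  · rw [ENNReal.ofReal_toReal h2]
    refine (min_le_right _ _).trans ((Finset.inf_le (Finset.mem_univ i)).trans ?_)
    rw [if_neg hi]
    exact min_le_right _ _

namespace MarkovIFS

variable {𝒜 : Type*} {α : ℝ} {Φ : MarkovIFS 𝒜 α} {φ : (ℕ → 𝒜) → ℝ}
variable [MeasurableSpace 𝒜] {ν : Measure (ℕ → 𝒜)} [DiscreteMeasurableSpace 𝒜] [Finite 𝒜]

lemma measure_cyl_cons_ne_zero (hvar : Φ.SummableVariations φ) (hν : Φ.IsGibbs φ ν) {u v : List 𝒜}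
    (h : ν (cyl (u ++ v)) ≠ 0) : ν (cyl v) ≠ 0 := by
  intro h0
  rw [Φ.measure_cyl_append hvar hν, Measure.restrict_eq_zero.2 h0] at h
  simp at h

/-- The masses of successive cylinders are comparable. -/
lemma exists_le_measure_cyl_succ (hvar : Φ.SummableVariations φ)
    (hν : Φ.IsGibbs φ ν) [IsProbabilityMeasure ν] : ∃ c : ℝ, 0 < c ∧ c ≤ 1 ∧
      ∀ z, Φ.Typ ν z → ∀ n, ENNReal.ofReal c * ν (cyl (pre n z)) ≤ ν (cyl (pre (n + 1) z)) := by
  obtain ⟨C₀, hC₀1, hC₀⟩ := Φ.exists_W_distortion hvar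
  obtain ⟨c, hc0, hc1, hc⟩ := exists_pos_le_of_ne_zero fun p : 𝒜 × 𝒜 => ν (cyl [p.1, p.2])
  have hC : 0 < C₀ := by linarith
  have hcc : c / (C₀ * C₀) ≤ c := div_le_self hc0.le (by nlinarith)
  refine ⟨c / (C₀ * C₀), by positivity, hcc.trans hc1, fun z hz n => ?_⟩
  rcases n with _ | n
  -- The empty word has no last letter; its mass is at most 1, and two letters already carry mass at
  -- least `c`.
  · have h1 : ν (cyl (pre (0 + 1) z)) ≠ 0 := hz.2 _
    have h2 : ENNReal.ofReal c ≤ ν (cyl (pre 2 z)) := hc (z 0, z 1) (hz.2 2)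
    calc _ ≤ ENNReal.ofReal c * 1 := by
          gcongr
          exact prob_le_one
      _ ≤ ν (cyl (pre 2 z)) := by rw [mul_one]; exact h2
      _ ≤ _ := by
          refine measure_mono fun y hy => ?_
          rw [mem_cyl_iff_pre, length_pre] at hy ⊢
          exact pre_eq_of_le (by norm_num) hy
  · set x : ℕ → 𝒜 := fun k => z (k + n) with hx
    have hxg := hz.1 n
    have hx0 : x 0 = z n := by simp [hx]
    have e1 : pre (n + 1) z = pre n z ++ [x 0] := by rw [pre_succ_eq_append, hx0]
    have e2 : pre (n + 1 + 1) z = pre n z ++ [x 0, z (n + 1)] := by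
      rw [pre_succ_eq_append, pre_succ_eq_append, hx0]; simp
    have h1 := Φ.measure_cyl_le (ν := ν) (C₀ := ENNReal.ofReal C₀) hC₀ hvar hν (pre n z) hxg.1
    have h2 : ν (cyl [x 0, z (n + 1)]) ≠ 0 := by
      have := hz.2 (n + 1 + 1)
      rw [e2] at this
      exact measure_cyl_cons_ne_zero hvar hν this
    have h3 := hc (x 0, z (n + 1)) h2
    have h4 : Φ.W φ (pre n z) x * ν (cyl [x 0, z (n + 1)]) ≤
        ENNReal.ofReal C₀ * ν (cyl (pre n z ++ [x 0, z (n + 1)])) := by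
      rw [Φ.measure_cyl_append hvar hν, ← setLIntegral_const,
        ← lintegral_const_mul _ (Φ.measurable_W hvar _)]
      refine setLIntegral_mono_ae' (measurableSet_cyl _) ?_
      filter_upwards [hν.supported] with y hy hyc
      exact hC₀ _ _ hxg.1 _ hy (mem_cyl_cons.1 hyc).1.symm
    rw [e1, e2]
    have e3 : ENNReal.ofReal (c / (C₀ * C₀)) =
        ENNReal.ofReal (C₀⁻¹) * ENNReal.ofReal (C₀⁻¹) * ENNReal.ofReal c := by
      rw [← ENNReal.ofReal_mul (by positivity), ← ENNReal.ofReal_mul (by positivity)]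
      congr 1
      field_simp
    have e4 : ENNReal.ofReal C₀⁻¹ * ENNReal.ofReal C₀ = 1 := by
      rw [← ENNReal.ofReal_mul (by positivity), inv_mul_cancel₀ hC.ne', ENNReal.ofReal_one]
    rw [e3]
    calc _ ≤ ENNReal.ofReal (C₀⁻¹) * ENNReal.ofReal (C₀⁻¹) * ν (cyl [x 0, z (n + 1)]) *
          (ENNReal.ofReal C₀ * Φ.W φ (pre n z) x * 1) := by
          gcongr
          exact h1.trans (by gcongr; exact prob_le_one)
      _ = (ENNReal.ofReal (C₀⁻¹) * ENNReal.ofReal C₀) * (ENNReal.ofReal (C₀⁻¹) *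
          (Φ.W φ (pre n z) x * ν (cyl [x 0, z (n + 1)]))) := by ring
      _ ≤ (ENNReal.ofReal (C₀⁻¹) * ENNReal.ofReal C₀) * (ENNReal.ofReal (C₀⁻¹) *
          (ENNReal.ofReal C₀ * ν (cyl (pre n z ++ [x 0, z (n + 1)])))) := by gcongr
      _ = _ := by rw [← mul_assoc (ENNReal.ofReal C₀⁻¹), e4, one_mul, one_mul]

/-- One letter before stopping the mass still exceeds `T`, and successive cylinders have comparable
masses. -/
lemma le_measure_cyl_stop [IsProbabilityMeasure ν] {c : ℝ} (hc : ∀ z, Φ.Typ ν z → ∀ n,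
    ENNReal.ofReal c * ν (cyl (pre n z)) ≤ ν (cyl (pre (n + 1) z))) {T : ℝ≥0∞} (hT1 : T < 1)
    (hT : ∀ z, ν (cyl (stopWord ν T z)) ≤ T) {z : ℕ → 𝒜} (hz : Φ.Typ ν z) :
    ENNReal.ofReal c * T ≤ ν (cyl (stopWord ν T z)) := by
  have h1 := one_le_stopLen (z := z) hT hT1
  obtain ⟨k, hk⟩ := Nat.exists_eq_add_of_le' h1
  rw [stopWord, hk]
  refine le_trans ?_ (hc z hz k)
  gcongr
  exact (lt_of_lt_stopLen (z := z) (by omega)).le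

end MarkovIFS

/-! ### The pressure of the geometric potential -/

namespace MarkovIFS

variable {𝒜 : Type*} {α : ℝ} {Φ : MarkovIFS 𝒜 α} {φ : (ℕ → 𝒜) → ℝ}

lemma cylInterval_pre_subset {z : ℕ → 𝒜} (hz : z ∈ Φ.shiftSpace) {j n : ℕ} (h : j ≤ n) :
    Φ.cylInterval (pre (n + 1) z) ⊆ Φ.cylInterval (pre (j + 1) z) := by
  obtain ⟨i, rfl⟩ := Nat.exists_eq_add_of_le h
  rw [pre_succ_eq_append, pre_succ_eq_append, cylInterval, cylInterval, gWord_append_singleton,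
    gWord_append_singleton, dom_append_singleton, dom_append_singleton]
  rintro _ ⟨x, hx, rfl⟩
  have h1 := Φ.admW_pre (Φ.shift_mem_shiftSpace hz j) i
  have h2 : (pre i fun k => z (k + j)).headD (z (i + j)) = z j := by
    cases i <;> simp [pre]
  rw [pre_add, G_append, add_comm j i, h2]
  refine mem_image_of_mem _ ?_
  have h3 := Φ.G_mem h1 (x := x) (by rwa [add_comm i j])
  rwa [h2] at h3

lemma ordConnected_cylInterval {w : List 𝒜} {c : 𝒜} (h : Φ.AdmW w c) :
    (Φ.cylInterval (w ++ [c])).OrdConnected := by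
  rw [cylInterval, gWord_append_singleton, dom_append_singleton]
  exact ((isPreconnected_Ioo (a := Φ.l c) (b := Φ.r c)).image _ (Φ.continuousOn_G h)).ordConnected

lemma exists_mem_I_far (c : 𝒜) (x : ℝ) : ∃ y ∈ Φ.I c, (Φ.r c - Φ.l c) / 4 ≤ |x - y| := by
  have h := Φ.l_lt_r c
  by_cases hx : x ≤ (Φ.l c + Φ.r c) / 2
  · refine ⟨(Φ.l c + 3 * Φ.r c) / 4, ⟨by linarith, by linarith⟩, ?_⟩
    rw [abs_of_nonpos (by linarith)]
    linarith
  · refine ⟨(3 * Φ.l c + Φ.r c) / 4, ⟨by linarith, by linarith⟩, ?_⟩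
    rw [abs_of_nonneg (by linarith)]
    linarith

lemma exp_neg_mul_ta_le {κ β C : ℝ} (hκ : Φ.Contr κ) (hβ : 0 < β) (hC : Φ.Dist β C) {w : List 𝒜}
    {c : 𝒜} (h : Φ.AdmW w c) {x y : ℝ} (hx : x ∈ Φ.I c) (hy : y ∈ Φ.I c) :
    Real.exp (-(β * Φ.ta w c x)) ≤
      Real.exp (β * (C / (1 - κ ^ β))) * Real.exp (-(β * Φ.ta w c y)) := by
  rw [← Real.exp_add]
  refine Real.exp_le_exp.2 ?_
  have h1 := hC.abs_ta_sub_le hκ hβ h hy hx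
  have hq1 : κ ^ β < 1 := Real.rpow_lt_one hκ.1.le hκ.2.1 hβ
  have hCC : 0 ≤ C / (1 - κ ^ β) := div_nonneg hC.1 (by linarith)
  have h2 : C / (1 - κ ^ β) * |y - x| ^ β ≤ C / (1 - κ ^ β) * 1 := by
    gcongr
    exact Real.rpow_le_one (abs_nonneg _) (Φ.abs_sub_le_one hy hx) hβ.le
  have h3 := (abs_le.1 (h1.trans h2)).2
  nlinarith

variable [MeasurableSpace 𝒜] {ν : Measure (ℕ → 𝒜)} [DiscreteMeasurableSpace 𝒜] [Finite 𝒜]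

lemma exists_le_length : ∃ ι : ℝ, 0 < ι ∧ ∀ c, ι ≤ Φ.r c - Φ.l c := by
  obtain ⟨ι, h0, -, h⟩ := exists_pos_le_of_ne_zero fun c => ENNReal.ofReal (Φ.r c - Φ.l c)
  refine ⟨ι, h0, fun c => ?_⟩
  have hc := Φ.l_lt_r c
  have := h c (by simpa using hc)
  rwa [ENNReal.ofReal_le_ofReal_iff (by linarith)] at this

lemma pow_le_measure_cyl [IsProbabilityMeasure ν] {c : ℝ} {z : ℕ → 𝒜} (hc : ∀ n,
    ENNReal.ofReal c * ν (cyl (pre n z)) ≤ ν (cyl (pre (n + 1) z))) (n : ℕ) :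
    ENNReal.ofReal c ^ n ≤ ν (cyl (pre n z)) := by
  induction n with
  | zero =>
    have h2 : cyl (pre 0 z) = univ := eq_univ_of_forall fun y => by
      rw [mem_cyl_iff_pre, length_pre]; rfl
    rw [h2, measure_univ, pow_zero]
  | succ n ih =>
    rw [pow_succ']
    exact le_trans (by gcongr) (hc n)

/-- Cut both words down to the shorter length. The two prefixes differ, as otherwise the stopping
words would agree, so the absence of overlaps separates the larger intervals. -/
lemma disjoint_cylInterval_stop (hno : Φ.NoOverlap) [IsProbabilityMeasure ν] {T : ℝ≥0∞}
    (hT : ∀ z, ν (cyl (stopWord ν T z)) ≤ T) (hT1 : T < 1) {z z' : ℕ → 𝒜} (hz : z ∈ Φ.shiftSpace)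
    (hz' : z' ∈ Φ.shiftSpace) (h : stopWord ν T z ≠ stopWord ν T z') :
    Disjoint (Φ.cylInterval (stopWord ν T z)) (Φ.cylInterval (stopWord ν T z')) := by
  wlog hle : stopLen ν T z ≤ stopLen ν T z' generalizing z z'
  · exact (this hz' hz h.symm (by omega)).symm
  obtain ⟨k, hk⟩ := Nat.exists_eq_add_of_le' (one_le_stopLen (z := z) hT hT1)
  obtain ⟨k', hk'⟩ := Nat.exists_eq_add_of_le' (one_le_stopLen (z := z') hT hT1)
  have hw : ∀ {y : ℕ → 𝒜}, y ∈ Φ.shiftSpace → (pre (k + 1) y).IsChain Φ.adm := fun hy => by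
    rw [pre_succ_eq_append, isChain_append_singleton]; exact Φ.admW_pre hy k
  refine Disjoint.mono_right (b := Φ.cylInterval (stopWord ν T z')) (c := Φ.cylInterval (pre (k + 1) z')) ?_ ?_
  · rw [stopWord, hk']
    exact cylInterval_pre_subset hz' (by omega)
  · rw [stopWord, hk]
    refine hno (k + 1) ⟨pre (k + 1) z, length_pre _ _, hw hz⟩
      ⟨pre (k + 1) z', length_pre _ _, hw hz'⟩ fun he => h ?_
    have he' := congrArg Subtype.val he
    refine ((stop_eq_iff hT).2 ?_).symm
    rw [mem_cyl_stop_iff, hk]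
    exact he'.symm

/-- If the intervals of the stopping cylinders have length at least `r`, then intervals of length `r`
have mass at most `3 T`. -/
lemma measure_Icc_le_of_stop (hno : Φ.NoOverlap) [IsProbabilityMeasure ν]
    (htyp : ∀ᵐ z ∂ν, Φ.Typ ν z) {T r : ℝ} (hr : 0 < r)
    (hT : ∀ z, ν (cyl (stopWord ν (ENNReal.ofReal T) z)) ≤ ENNReal.ofReal T) (hT1 : T < 1)
    (h : ∀ z, Φ.Typ ν z → ∃ x ∈ Φ.cylInterval (stopWord ν (ENNReal.ofReal T) z), r ≤ |Φ.coding z - x|)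
    (s : ℝ) : ν {z | Φ.cod z ∈ Icc s (s + r)} ≤ ENNReal.ofReal (3 * T) := by
  have hT1' : ENNReal.ofReal T < 1 := by rwa [ENNReal.ofReal_lt_one]
  set 𝒬 : Set (List 𝒜) := stopWord ν (ENNReal.ofReal T) '' {z | Φ.Typ ν z ∧ Φ.cod z ∈ Icc s (s + r)}
    with h𝒬
  have hcon : ∀ z : ℕ → 𝒜, ∃ k, stopWord ν (ENNReal.ofReal T) z = pre k z ++ [z k] := fun z => by
    obtain ⟨k, hk⟩ := Nat.exists_eq_add_of_le' (one_le_stopLen (z := z) hT hT1')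
    exact ⟨k, by rw [stopWord, hk, pre_succ_eq_append]⟩
  have hord : ∀ z, Φ.Typ ν z → (Φ.cylInterval (stopWord ν (ENNReal.ofReal T) z)).OrdConnected := by
    intro z hz
    obtain ⟨k, hk⟩ := hcon z
    rw [hk]
    exact ordConnected_cylInterval (Φ.admW_pre hz.mem k)
  have hmem : ∀ z, Φ.Typ ν z → Φ.coding z ∈ Φ.cylInterval (stopWord ν (ENNReal.ofReal T) z) := by
    intro z hz
    obtain ⟨k, hk⟩ := hcon z
    rw [hk, ← pre_succ_eq_append]
    exact coding_mem_cylInterval hz.mem (hz.1 k)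
  have hvol : ∀ w ∈ 𝒬, ENNReal.ofReal r ≤ volume (Φ.cylInterval w ∩ Icc (s - r) (s + 2 * r)) := by
    rintro _ ⟨z, ⟨hz, hzs⟩, rfl⟩
    obtain ⟨x, hx, hxr⟩ := h z hz
    rw [Φ.cod_of_mem hz.mem] at hzs
    -- The interval contains π(z) in [s, s+r] and a point at distance at least `r`, hence a piece of
    -- length `r` inside [s-r, s+2r]. By disjointness at most three stopping cylinders meet [s,
    -- s+r].
    obtain ⟨a, ha⟩ : ∃ a, Icc a (a + r) ⊆ Φ.cylInterval (stopWord ν (ENNReal.ofReal T) z) ∩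
        Icc (s - r) (s + 2 * r) := by
      rcases le_abs.1 hxr with h1 | h1
      · refine ⟨Φ.coding z - r, fun y hy => ⟨(hord z hz).out hx (hmem z hz) ⟨?_, ?_⟩, ?_, ?_⟩⟩ <;>
          linarith [hy.1, hy.2, hzs.1, hzs.2]
      · refine ⟨Φ.coding z, fun y hy => ⟨(hord z hz).out (hmem z hz) hx ⟨?_, ?_⟩, ?_, ?_⟩⟩ <;>
          linarith [hy.1, hy.2, hzs.1, hzs.2]
    refine le_trans ?_ (measure_mono ha)
    rw [Real.volume_Icc]
    ring_nf; exact le_rfl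
  have hsum : ∑' w : 𝒬, ENNReal.ofReal r ≤ ENNReal.ofReal (3 * r) := by
    calc _ ≤ ∑' w : 𝒬, volume (Φ.cylInterval w.1 ∩ Icc (s - r) (s + 2 * r)) :=
          ENNReal.tsum_le_tsum fun w => hvol w.1 w.2
      _ = volume (⋃ w ∈ 𝒬, Φ.cylInterval w ∩ Icc (s - r) (s + 2 * r)) := by
          rw [measure_biUnion (to_countable _)]
          · rintro _ ⟨z, hz, rfl⟩ _ ⟨z', hz', rfl⟩ hne
            exact (disjoint_cylInterval_stop hno hT hT1' hz.1.mem hz'.1.mem hne).mono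
              inter_subset_left inter_subset_left
          · rintro _ ⟨z, hz, rfl⟩
            exact (hord z hz.1).measurableSet.inter measurableSet_Icc
      _ ≤ volume (Icc (s - r) (s + 2 * r)) :=
          measure_mono (iUnion₂_subset fun w _ => inter_subset_right)
      _ = _ := by rw [Real.volume_Icc]; ring_nf
  have hr' : ENNReal.ofReal r ≠ 0 := by simpa using hr
  have hcount : ∑' _ : 𝒬, (1 : ℝ≥0∞) ≤ 3 := by
    have h1 : ENNReal.ofReal r * ∑' _ : 𝒬, (1 : ℝ≥0∞) ≤ ENNReal.ofReal r * 3 := by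
      rw [← ENNReal.tsum_mul_left, mul_one]
      refine hsum.trans_eq ?_
      rw [mul_comm, ENNReal.ofReal_mul hr.le]
      simp
    exact (ENNReal.mul_le_mul_iff_right hr' ENNReal.ofReal_ne_top).1 h1
  calc _ ≤ ν (⋃ w ∈ 𝒬, cyl w) := by
        refine measure_mono_ae ?_
        filter_upwards [htyp] with z hz hzs
        exact mem_iUnion₂.2 ⟨_, ⟨z, ⟨hz, hzs⟩, rfl⟩, mem_cyl_stop⟩
    _ ≤ ∑' w : 𝒬, ν (cyl w.1) := measure_biUnion_le _ (to_countable _) _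
    _ ≤ ∑' w : 𝒬, ENNReal.ofReal T * 1 := by
        refine ENNReal.tsum_le_tsum fun w => ?_
        obtain ⟨z, -, hw⟩ := w.2
        rw [mul_one, ← hw]
        exact hT z
    _ ≤ ENNReal.ofReal T * 3 := by rw [ENNReal.tsum_mul_left]; gcongr
    _ = _ := by rw [mul_comm, ENNReal.ofReal_mul (by norm_num)]; simp

/-- Without overlaps the pressure of the geometric potential is not positive. -/
theorem NoOverlap.pressure_nonpos (hno : Φ.NoOverlap) (hα : 0 < α) {κ C : ℝ} (hκ : Φ.Contr κ)
    (hC : Φ.Dist Φ.dim C) (hδ : 0 < Φ.dim) (hvar : Φ.SummableVariations φ) (hν : Φ.IsGibbs φ ν)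
    [IsProbabilityMeasure ν] (hatoms : ∀ x : ℝ, Φ.proj ν {x} = 0) {P B : ℝ} {u : (ℕ → 𝒜) → ℝ}
    (hB : ∀ z ∈ Φ.shiftSpace, |u z| ≤ B) (hu : ∀ z ∈ Φ.shiftSpace,
      φ z = Φ.dim * Φ.logDeriv (z 0) (z 1) (Φ.coding (shiftSeq z)) + u z - u (shiftSeq z) - P) :
    P ≤ 0 := by
  by_contra hP
  push Not at hP
  obtain ⟨C₀, hC₀1, hC₀⟩ := Φ.exists_W_distortion hvar
  obtain ⟨c₁, hc0, hc1, hc⟩ := exists_le_measure_cyl_succ hvar hν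
  obtain ⟨ι, hι, hιc⟩ := Φ.exists_le_length
  have htyp := ae_typ hvar hν hatoms
  set δ := Φ.dim with hδd
  set D := Real.exp (δ * (C / (1 - κ ^ δ))) with hD
  have hD0 : 0 < D := Real.exp_pos _
  have hlog : Real.log c₁ ≤ 0 := Real.log_nonpos hc0.le hc1
  -- If P were positive, the factor e^(-Pn) in the mass of a cylinder would be at most a power T^τ
  -- of its mass, up to a constant, since masses decay at most like c₁^n. The 1 in the denominator
  -- keeps it positive when c₁ = 1.
  set τ := min (1 / 2) (P / (1 - Real.log c₁)) with hτ
  have hτ0 : 0 < τ := lt_min (by norm_num) (div_pos hP (by linarith))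
  have hτ1 : τ ≤ 1 / 2 := min_le_left _ _
  have hτP : Real.exp (-P) ≤ c₁ ^ τ := by
    rw [Real.rpow_def_of_pos hc0]
    refine Real.exp_le_exp.2 ?_
    have := min_le_right (1 / 2) (P / (1 - Real.log c₁))
    rw [← hτ, le_div_iff₀ (by linarith)] at this
    linarith
  have hC₀0 : 0 < C₀ := by linarith
  set c₂ := c₁ / (C₀ * Real.exp (2 * B) * Real.exp P) with hc₂
  have hc₂0 : 0 < c₂ := by positivity
  -- The mass `T` is comparable with e^(-Pn) times |g'|^δ, so |g'|^δ is at least of order T^(1-τ):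
  -- the intervals of the stopping cylinders are longer than their mass would suggest.
  have key : ∀ T : ℝ, 0 < T → T < 1 → ∀ z, Φ.Typ ν z →
      ∃ x ∈ Φ.cylInterval (stopWord ν (ENNReal.ofReal T) z),
        (c₂ / D * T ^ (1 - τ)) ^ (1 / δ) * (ι / 4) ≤ |Φ.coding z - x| := by
    intro T hT0 hT1 z hz
    have hT : ∀ z, ν (cyl (stopWord ν (ENNReal.ofReal T) z)) ≤ ENNReal.ofReal T :=
      measure_cyl_stop_le hν hatoms (by simpa using hT0)
    have hT1' : ENNReal.ofReal T < 1 := by rwa [ENNReal.ofReal_lt_one]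
    have h1 := le_measure_cyl_stop hc hT1' hT hz
    obtain ⟨n, hn⟩ := Nat.exists_eq_add_of_le' (one_le_stopLen (z := z) hT hT1')
    have h2 : ENNReal.ofReal c₁ ^ (n + 1) ≤ ENNReal.ofReal T := by
      refine (pow_le_measure_cyl (hc z hz) (n + 1)).trans ?_
      rw [← hn]; exact hT z
    rw [← ENNReal.ofReal_pow hc0.le, ENNReal.ofReal_le_ofReal_iff hT0.le] at h2
    have hs : stopWord ν (ENNReal.ofReal T) z = pre n z ++ [z n] := by
      rw [stopWord, hn, pre_succ_eq_append]
    have hx := hz.1 n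
    set x : ℕ → 𝒜 := fun k => z (k + n) with hxd
    have hx0 : x 0 = z n := by simp [hxd]
    have hadm := Φ.admW_pre hz.mem n
    have happ : app (pre n z) x = z := app_pre n z
    have hcod := (hx.app Φ (w := pre n z) (by rw [happ]; exact hz.mem)).2
    rw [happ, hx0] at hcod
    have hxI : Φ.coding x ∈ Φ.I (z n) := hx0 ▸ hx.2
    have h3 := Φ.measure_cyl_le (ν := ν) (C₀ := ENNReal.ofReal C₀) hC₀ hvar hν (pre n z) hx.1
    rw [hx0, W_eq_exp hα hu hx (by rw [happ]; exact hz.mem), happ, hx0, length_pre] at h3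
    rw [hs, ← ENNReal.ofReal_mul hc0.le] at h1
    have h4 : c₁ * T ≤ C₀ * Real.exp
        (-(δ * Φ.ta (pre n z) (z n) (Φ.coding x)) + u z - u x - P * n) := by
      rw [← ENNReal.ofReal_le_ofReal_iff (by positivity), ENNReal.ofReal_mul (p := C₀) hC₀0.le]
      exact h1.trans (h3.trans (mul_le_of_le_one_right' prob_le_one))
    have h5 : Real.exp (-(δ * Φ.ta (pre n z) (z n) (Φ.coding x)) + u z - u x - P * n) ≤
        Real.exp (-(δ * Φ.ta (pre n z) (z n) (Φ.coding x))) * Real.exp (2 * B) *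
          (Real.exp P * T ^ τ) := by
      have e1 : Real.exp (-P) ^ (n + 1) ≤ T ^ τ := by
        calc _ ≤ (c₁ ^ τ) ^ (n + 1) := by gcongr
          _ = (c₁ ^ (n + 1)) ^ τ := by
            rw [← Real.rpow_natCast, ← Real.rpow_natCast, ← Real.rpow_mul hc0.le,
              ← Real.rpow_mul hc0.le, mul_comm]
          _ ≤ _ := by gcongr
      calc _ ≤ Real.exp (-(δ * Φ.ta (pre n z) (z n) (Φ.coding x)) + 2 * B + P +
            ((n + 1 : ℕ) : ℝ) * -P) := by
            refine Real.exp_le_exp.2 ?_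
            have e2 := (abs_le.1 (hB z hz.mem)).2
            have e3 := (abs_le.1 (hB x hx.1)).1
            push_cast
            linarith
        _ = Real.exp (-(δ * Φ.ta (pre n z) (z n) (Φ.coding x))) * Real.exp (2 * B) *
            (Real.exp P * Real.exp (-P) ^ (n + 1)) := by
            rw [Real.exp_add, Real.exp_add, Real.exp_add, Real.exp_nat_mul, mul_assoc, mul_assoc]
        _ ≤ _ := by gcongr
    have h6 : c₂ * T ^ (1 - τ) ≤ Real.exp (-(δ * Φ.ta (pre n z) (z n) (Φ.coding x))) := by
      have e1 : T ^ (1 - τ) * T ^ τ = T := by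
        rw [← Real.rpow_add hT0]; simp
      have e2 : c₂ * (C₀ * Real.exp (2 * B) * Real.exp P) = c₁ := by
        rw [hc₂]; field_simp
      have e3 : 0 < C₀ * Real.exp (2 * B) * Real.exp P * T ^ τ := by positivity
      refine le_of_mul_le_mul_right ?_ e3
      calc _ = (c₂ * (C₀ * Real.exp (2 * B) * Real.exp P)) * (T ^ (1 - τ) * T ^ τ) := by ring
        _ = c₁ * T := by rw [e1, e2]
        _ ≤ C₀ * (Real.exp (-(δ * Φ.ta (pre n z) (z n) (Φ.coding x))) * Real.exp (2 * B) *
          (Real.exp P * T ^ τ)) := h4.trans (by gcongr)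
        _ = _ := by ring
    obtain ⟨y, hy, hyx⟩ := exists_mem_I_far (Φ := Φ) (z n) (Φ.coding x)
    obtain ⟨ξ, hξ, hξe⟩ := Φ.exists_abs_G_sub hadm hxI hy
    refine ⟨Φ.G (pre n z) (z n) y, ?_, ?_⟩
    · rw [hs, cylInterval, gWord_append_singleton, dom_append_singleton]
      exact mem_image_of_mem _ hy
    · rw [hcod, hξe]
      have h7 := exp_neg_mul_ta_le hκ hδ hC hadm hxI hξ
      have h8 : c₂ / D * T ^ (1 - τ) ≤ Real.exp (-(δ * Φ.ta (pre n z) (z n) ξ)) := by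
        rw [div_mul_eq_mul_div, div_le_iff₀ hD0, mul_comm _ D]
        exact h6.trans h7
      have h9 : Real.exp (-Φ.ta (pre n z) (z n) ξ) =
          Real.exp (-(δ * Φ.ta (pre n z) (z n) ξ)) ^ (1 / δ) := by
        rw [← Real.exp_mul]; congr 1; field_simp
      rw [h9]
      gcongr
      exact le_trans (by linarith [hιc (z n)]) hyx
  have hτ2 : 0 < 1 - τ := by linarith
  -- Solves the lower bound in `key`, set equal to `r`, for the threshold: T = K r^(δ/(1-τ)).
  set K := ((4 / ι) ^ δ * (D / c₂)) ^ (1 / (1 - τ)) with hK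
  have hK0 : 0 < K := by positivity
  have hdim := le_dim_of_measure_Icc_le (d := δ / (1 - τ)) (C := 3 * K) hν (by positivity)
    (by positivity) fun s t hst => ?_
  -- Hölder regularity of exponent δ/(1-τ) > δ would make the dimension of the attractor larger than
  -- δ.
  · rw [← hδd, div_le_iff₀ hτ2] at hdim
    nlinarith
  · rcases hst.eq_or_lt with rfl | hst
    · have h0 : ν {z | Φ.cod z ∈ Icc s s} = 0 := by
        rw [← Φ.proj_apply hν measurableSet_Icc, Icc_self]; exact hatoms s
      rw [h0]; exact zero_le
    set r := t - s with hr
    have hr0 : 0 < r := by linarith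
    have hT0 : 0 < K * r ^ (δ / (1 - τ)) := by positivity
    rw [mul_assoc]
    rcases lt_or_ge (K * r ^ (δ / (1 - τ))) 1 with hT1 | hT1
    · have e1 : t = s + r := by rw [hr]; ring
      rw [e1]
      refine measure_Icc_le_of_stop hno htyp hr0
        (measure_cyl_stop_le hν hatoms (by simpa using hT0)) hT1 (fun z hz => ?_) s
      obtain ⟨x, hx, hxr⟩ := key _ hT0 hT1 z hz
      refine ⟨x, hx, le_trans (le_of_eq ?_) hxr⟩
      have e2 : (K * r ^ (δ / (1 - τ))) ^ (1 - τ) = (4 / ι) ^ δ * (D / c₂) * r ^ δ := by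
        rw [Real.mul_rpow hK0.le (by positivity), hK, ← Real.rpow_mul (by positivity),
          ← Real.rpow_mul hr0.le, one_div_mul_cancel hτ2.ne', div_mul_cancel₀ _ hτ2.ne',
          Real.rpow_one]
      have e3 : c₂ / D * ((4 / ι) ^ δ * (D / c₂) * r ^ δ) = (4 / ι * r) ^ δ := by
        rw [Real.mul_rpow (by positivity) hr0.le]; field_simp
      rw [e2, e3, ← Real.rpow_mul (by positivity), mul_one_div_cancel hδ.ne', Real.rpow_one]
      field_simp
    · refine prob_le_one.trans ?_
      rw [← ENNReal.ofReal_one]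
      exact ENNReal.ofReal_le_ofReal (by linarith)

end MarkovIFS

/-! ### Regular systems -/

namespace MarkovIFS

variable {𝒜 : Type*} {α : ℝ} {Φ : MarkovIFS 𝒜 α} {φ : (ℕ → 𝒜) → ℝ}
variable [MeasurableSpace 𝒜] {ν : Measure (ℕ → 𝒜)}

/-- Quantitative form of measure non-linearity, with a single constant `M`. -/
structure Regular (Φ : MarkovIFS 𝒜 α) (φ : (ℕ → 𝒜) → ℝ) (ν : Measure (ℕ → 𝒜)) (δ M : ℝ) :
    Prop where
  pos : 0 < δ
  one_le : 1 ≤ M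
  holder : ∀ w c, Φ.AdmW w c → ∀ x ∈ Φ.I c, ∀ y ∈ Φ.I c,
    |Φ.ta w c x - Φ.ta w c y| ≤ M * |x - y| ^ δ
  dist : ∀ w c, Φ.AdmW w c → ∀ x ∈ Φ.I c, ∀ y ∈ Φ.I c,
    Real.exp (-(δ * Φ.ta w c x)) ≤ M * Real.exp (-(δ * Φ.ta w c y))
  lower : ∀ w c, Φ.AdmW w c → ∀ x ∈ Φ.I c, M⁻¹ ^ w.length ≤ Real.exp (-(δ * Φ.ta w c x))
  weight : ∀ w z, Φ.Good z → app w z ∈ Φ.shiftSpace →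
    ENNReal.ofReal (Real.exp (-(δ * Φ.ta w (z 0) (Φ.coding z)))) ≤ ENNReal.ofReal M * Φ.W φ w z
  diam : ∀ z z' n, Φ.Typ ν z → Φ.Typ ν z' → z' ∈ cyl (pre (n + 1) z) →
    ENNReal.ofReal (|Φ.coding z - Φ.coding z'| ^ δ) ≤ ENNReal.ofReal M * ν (cyl (pre (n + 1) z))
  succ : ∀ z, Φ.Typ ν z → ∀ n,
    ENNReal.ofReal M⁻¹ * ν (cyl (pre n z)) ≤ ν (cyl (pre (n + 1) z))
  om_ge : ∀ z ∈ Φ.shiftSpace, ENNReal.ofReal M⁻¹ ≤ Φ.om φ z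
  nonlin : ∀ L, 1 ≤ L → ∀ c, ∃ a b : Vec 𝒜 L, Φ.AdmW a.1 c ∧ Φ.AdmW b.1 c ∧
    ∀ x₀ ∈ Φ.attractor ∩ Φ.I c, ∀ s t : ℝ, s ≤ t →
      ν {z | Φ.cod z ∈ Φ.I c ∧ (Φ.ta a.1 c (Φ.cod z) - Φ.ta a.1 c x₀) -
        (Φ.ta b.1 c (Φ.cod z) - Φ.ta b.1 c x₀) ∈ Icc s t} ≤ ENNReal.ofReal (M * (t - s))

variable [DiscreteMeasurableSpace 𝒜]

lemma measure_cod_mem_le [Countable 𝒜] (hν : Φ.IsGibbs φ ν) (s : Set ℝ) :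
    ν {z | Φ.cod z ∈ s} ≤ Φ.proj ν s := by
  rw [← measure_toMeasurable s, Φ.proj_apply hν (measurableSet_toMeasurable _ _)]
  exact measure_mono fun z hz => subset_toMeasurable _ _ hz

variable [Finite 𝒜]

lemma exists_le_om (hvar : Φ.SummableVariations φ) :
    ∃ c : ℝ, 0 < c ∧ ∀ z ∈ Φ.shiftSpace, ENNReal.ofReal c ≤ Φ.om φ z := by
  obtain ⟨v, -, hv⟩ := hvar
  obtain ⟨c, hc0, -, hc⟩ := exists_pos_le_of_ne_zero fun p : 𝒜 × 𝒜 =>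
    ⨅ z : {z // z ∈ Φ.shiftSpace ∧ z 0 = p.1 ∧ z 1 = p.2}, Φ.om φ z.1
  refine ⟨c, hc0, fun z hz => (hc (z 0, z 1) ?_).trans (iInf_le _ (⟨z, hz, rfl, rfl⟩ : {y // y ∈ Φ.shiftSpace ∧ y 0 = z 0 ∧ y 1 = z 1}))⟩
  have h1 : ENNReal.ofReal (Real.exp (φ z - v 2)) ≤
      ⨅ y : {y // y ∈ Φ.shiftSpace ∧ y 0 = z 0 ∧ y 1 = z 1}, Φ.om φ y.1 := by
    refine le_iInf fun y => ?_
    rw [Φ.om_of_mem y.2.1]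
    refine ENNReal.ofReal_le_ofReal (Real.exp_le_exp.2 ?_)
    have := (abs_le.1 (hv 2 le_rfl z hz y.1 y.2.1 fun i hi => ?_)).2
    · linarith
    · interval_cases i
      · exact y.2.2.1.symm
      · exact y.2.2.2.symm
  exact (lt_of_lt_of_le (by simpa using Real.exp_pos _) h1).ne'

lemma exists_pow_le_ell : ∃ ℓ : ℝ, 0 < ℓ ∧ ℓ ≤ 1 ∧ ∀ w c, Φ.AdmW w c → ℓ ^ w.length ≤ Φ.ell w c := by
  obtain ⟨ℓ, h0, h1, h⟩ := exists_pos_le_of_ne_zero fun p : 𝒜 × 𝒜 =>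
    ENNReal.ofReal (Φ.ell1 p.1 p.2)
  refine ⟨ℓ, h0, h1, fun w c hw => ?_⟩
  induction w with
  | nil => simp [ell]
  | cons a w ih =>
    have hp := Φ.ell1_pos hw.1
    have h2 := h (a, w.headD c) (by simpa using hp)
    rw [ENNReal.ofReal_le_ofReal_iff hp.le] at h2
    rw [List.length_cons, pow_succ', ell]
    exact mul_le_mul h2 (ih hw.2) (by positivity) hp.le

/-- Decay of the diameters of the cylinders in terms of their masses. -/
lemma exists_diam_le {δ H D : ℝ} (hδ : 0 < δ) (hH : 0 ≤ H) (hD : 0 ≤ D)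
    (hdist : ∀ w c, Φ.AdmW w c → ∀ x ∈ Φ.I c, ∀ y ∈ Φ.I c,
      Real.exp (-(δ * Φ.ta w c x)) ≤ D * Real.exp (-(δ * Φ.ta w c y)))
    (hweight : ∀ w z, Φ.Good z → app w z ∈ Φ.shiftSpace →
      ENNReal.ofReal (Real.exp (-(δ * Φ.ta w (z 0) (Φ.coding z)))) ≤ ENNReal.ofReal H * Φ.W φ w z)
    (hvar : Φ.SummableVariations φ) (hν : Φ.IsGibbs φ ν) :
    ∃ C : ℝ, 0 < C ∧ ∀ z z' n, Φ.Typ ν z → Φ.Typ ν z' → z' ∈ cyl (pre (n + 1) z) →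
      ENNReal.ofReal (|Φ.coding z - Φ.coding z'| ^ δ) ≤
        ENNReal.ofReal C * ν (cyl (pre (n + 1) z)) := by
  obtain ⟨C₀, hC₀1, hC₀⟩ := Φ.exists_W_distortion hvar
  obtain ⟨c, hc0, -, hc⟩ := exists_pos_le_of_ne_zero fun a : 𝒜 => ν (cyl [a])
  refine ⟨D * H * C₀ * c⁻¹ + 1, by positivity, fun z z' n hz hz' hzz => ?_⟩
  have hx := hz.1 n
  have hx' := hz'.1 n
  set x : ℕ → 𝒜 := fun k => z (k + n) with hxd
  set x' : ℕ → 𝒜 := fun k => z' (k + n) with hxd'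
  have hx0 : x 0 = z n := by simp [hxd]
  rw [mem_cyl_iff_pre, length_pre, pre_succ_eq_append, pre_succ_eq_append] at hzz
  obtain ⟨hp, hn⟩ := List.append_inj' hzz rfl
  have hx0' : x' 0 = z n := by simpa [hxd'] using hn
  have hadm := Φ.admW_pre hz.mem n
  have happ : app (pre n z) x = z := app_pre n z
  have happ' : app (pre n z) x' = z' := by rw [← hp]; exact app_pre n z'
  have hcod := (hx.app Φ (w := pre n z) (by rw [happ]; exact hz.mem)).2
  have hcod' := (hx'.app Φ (w := pre n z) (by rw [happ']; exact hz'.mem)).2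
  rw [happ, hx0] at hcod
  rw [happ', hx0'] at hcod'
  have hxI : Φ.coding x ∈ Φ.I (z n) := hx0 ▸ hx.2
  have hxI' : Φ.coding x' ∈ Φ.I (z n) := hx0' ▸ hx'.2
  obtain ⟨ξ, hξ, hξe⟩ := Φ.exists_abs_G_sub hadm hxI hxI'
  -- Both points are images under the branch of the common prefix, of two points at distance at most
  -- 1.
  have h1 : |Φ.coding z - Φ.coding z'| ^ δ ≤
      D * Real.exp (-(δ * Φ.ta (pre n z) (z n) (Φ.coding x))) := by
    refine le_trans ?_ (hdist _ _ hadm ξ hξ _ hxI)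
    rw [hcod, hcod', hξe]
    calc _ ≤ (Real.exp (-Φ.ta (pre n z) (z n) ξ) * 1) ^ δ := by
          gcongr
          exact Φ.abs_sub_le_one hxI hxI'
      _ = _ := by rw [mul_one, ← Real.exp_mul]; congr 1; ring
  have h2 := hweight (pre n z) x hx (by rw [happ]; exact hz.mem)
  rw [hx0] at h2
  have h3 : ν (cyl [z n]) ≠ 0 := by
    have := hz.2 (n + 1)
    rw [pre_succ_eq_append] at this
    exact measure_cyl_cons_ne_zero hvar hν this
  have h4 : Φ.W φ (pre n z) x * ν (cyl [z n]) ≤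
      ENNReal.ofReal C₀ * ν (cyl (pre n z ++ [z n])) := by
    rw [Φ.measure_cyl_append hvar hν, ← setLIntegral_const,
      ← lintegral_const_mul _ (Φ.measurable_W hvar _)]
    refine setLIntegral_mono_ae' (measurableSet_cyl _) ?_
    filter_upwards [hν.supported] with y hy hyc
    exact hC₀ _ _ hx.1 _ hy (hx0.trans (mem_cyl_singleton.1 hyc).symm)
  rw [pre_succ_eq_append]
  have h5 : ENNReal.ofReal c⁻¹ * ENNReal.ofReal c = 1 := by
    rw [← ENNReal.ofReal_mul (by positivity), inv_mul_cancel₀ hc0.ne', ENNReal.ofReal_one]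
  calc _ ≤ ENNReal.ofReal (D * Real.exp (-(δ * Φ.ta (pre n z) (z n) (Φ.coding x)))) :=
        ENNReal.ofReal_le_ofReal h1
    _ ≤ ENNReal.ofReal D * (ENNReal.ofReal H * Φ.W φ (pre n z) x) := by
        rw [ENNReal.ofReal_mul hD]; gcongr
    _ = ENNReal.ofReal D * ENNReal.ofReal H * ENNReal.ofReal c⁻¹ *
          (Φ.W φ (pre n z) x * ENNReal.ofReal c) := by
        rw [mul_comm (Φ.W φ _ _), ← mul_assoc, ← mul_assoc, mul_assoc _ (ENNReal.ofReal c⁻¹), h5,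
          mul_one]
    _ ≤ ENNReal.ofReal D * ENNReal.ofReal H * ENNReal.ofReal c⁻¹ *
          (ENNReal.ofReal C₀ * ν (cyl (pre n z ++ [z n]))) := by
        refine mul_le_mul' le_rfl (le_trans ?_ h4)
        gcongr
        exact hc _ h3
    _ = ENNReal.ofReal (D * H * C₀ * c⁻¹) * ν (cyl (pre n z ++ [z n])) := by
        rw [ENNReal.ofReal_mul (by positivity), ENNReal.ofReal_mul (by positivity),
          ENNReal.ofReal_mul hD]
        ring
    _ ≤ _ := by gcongr; linarith

/-- Everything that the cancellation argument uses is collected with a single constant. Finiteness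
of the alphabet bounds the one-step weights, the contraction rates and the ratios of successive
masses from below. -/
theorem MNL.exists_regular (hM : Φ.MNL φ ν) (hα : 0 < α) (hnorm : Φ.IsNormalized φ)
    (hvar : Φ.SummableVariations φ) (hν : Φ.IsGibbs φ ν) [IsProbabilityMeasure ν]
    (hatoms : ∀ x : ℝ, Φ.proj ν {x} = 0) : ∃ δ M, Φ.Regular φ ν δ M := by
  obtain ⟨⟨C, hC⟩, ⟨P, ⟨u, B, hu⟩, hP⟩, Cn, hCn, hnl⟩ := hM
  obtain ⟨κ, hκ⟩ := Φ.exists_contr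
  obtain ⟨γ, q, hT⟩ := Φ.exists_tail_of_finite hnorm
  obtain ⟨θ, C', hθ, hC', hF⟩ := hT.frostman Φ hnorm hvar hν hatoms
  -- Positivity of the dimension comes from the Hölder regularity of `ν` through the mass
  -- distribution principle; no separate hypothesis is needed.
  have hδ : 0 < Φ.dim := hθ.trans_le (le_dim_of_measure_Icc_le hν hθ hC' hF)
  have hCd : Φ.Dist Φ.dim |C| := by
    refine ⟨abs_nonneg _, fun a b h x hx y hy => (hC a b h x hx y hy).trans ?_⟩
    gcongr
    exact le_abs_self C
  have hB : ∀ z ∈ Φ.shiftSpace, |u z| ≤ B := fun z hz => (hu z hz).1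
  have hu' := fun z hz => (hu z hz).2
  -- Only the inequality |g'|^δ ≤ const · weight is needed, and for it the sign of the pressure is
  -- enough.
  have hP0 : P ≤ 0 := by
    rcases hP with rfl | hno
    · exact le_rfl
    · exact hno.pressure_nonpos hα hκ hCd hδ hvar hν hatoms hB hu'
  set δ := Φ.dim with hδd
  have hq1 : κ ^ δ < 1 := Real.rpow_lt_one hκ.1.le hκ.2.1 hδ
  set H := |C| / (1 - κ ^ δ) with hH
  have hH0 : 0 ≤ H := div_nonneg (abs_nonneg _) (by linarith)
  set D := Real.exp (δ * H) with hD
  set Bw := Real.exp (2 * B) with hBw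
  have hdist : ∀ w c, Φ.AdmW w c → ∀ x ∈ Φ.I c, ∀ y ∈ Φ.I c,
      Real.exp (-(δ * Φ.ta w c x)) ≤ D * Real.exp (-(δ * Φ.ta w c y)) :=
    fun w c h x hx y hy => exp_neg_mul_ta_le hκ hδ hCd h hx hy
  have hweight : ∀ w z, Φ.Good z → app w z ∈ Φ.shiftSpace →
      ENNReal.ofReal (Real.exp (-(δ * Φ.ta w (z 0) (Φ.coding z)))) ≤
        ENNReal.ofReal Bw * Φ.W φ w z := by
    intro w z hz h
    rw [W_eq_exp hα hu' hz h, ← ENNReal.ofReal_mul (Real.exp_pos _).le, ← Real.exp_add]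
    refine ENNReal.ofReal_le_ofReal (Real.exp_le_exp.2 ?_)
    have e1 := (abs_le.1 (hB _ h)).1
    have e2 := (abs_le.1 (hB _ hz.1)).2
    have e3 : 0 ≤ -P * w.length := mul_nonneg (by linarith) (by positivity)
    linarith
  obtain ⟨C₁, hC₁0, hC₁⟩ := exists_diam_le hδ (Real.exp_pos _).le (Real.exp_pos _).le
    hdist hweight hvar hν
  obtain ⟨c₁, hc0, -, hc⟩ := exists_le_measure_cyl_succ hvar hν
  obtain ⟨c₂, hc20, hc2⟩ := exists_le_om hvar
  obtain ⟨ℓ, hℓ0, hℓ1, hℓ⟩ := Φ.exists_pow_le_ell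
  have hD0 : 0 < D := Real.exp_pos _
  have hBw0 : 0 < Bw := Real.exp_pos _
  have hℓδ : 0 < ℓ ^ δ := Real.rpow_pos_of_pos hℓ0 _
  set M := 1 + H + D + Bw + C₁ + c₁⁻¹ + c₂⁻¹ + (ℓ ^ δ)⁻¹ + Cn with hM
  have i1 : 0 < c₁⁻¹ := by positivity
  have i2 : 0 < c₂⁻¹ := by positivity
  have i3 : 0 < (ℓ ^ δ)⁻¹ := by positivity
  have hM1 : 1 ≤ M := by linarith
  have hinv : ∀ {x : ℝ}, 0 < x → x⁻¹ ≤ M → M⁻¹ ≤ x := fun hx h => by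
    have := inv_anti₀ (inv_pos.2 hx) h
    rwa [inv_inv] at this
  refine ⟨δ, M, hδ, hM1, ?_, ?_, ?_, ?_, ?_, ?_, ?_, ?_⟩
  · intro w c h x hx y hy
    refine (hCd.abs_ta_sub_le hκ hδ h hx hy).trans ?_
    rw [← hH]
    gcongr
    linarith
  · intro w c h x hx y hy
    refine (hdist w c h x hx y hy).trans ?_
    gcongr
    linarith
  · intro w c h x hx
    have h1 : Φ.ell w c ≤ Real.exp (-Φ.ta w c x) := Φ.ell_le h hx
    have h2 := (hℓ w c h).trans h1
    calc M⁻¹ ^ w.length ≤ (ℓ ^ δ) ^ w.length := by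
          have := hinv hℓδ (by linarith)
          gcongr
      _ = (ℓ ^ w.length) ^ δ := by
          rw [← Real.rpow_natCast, ← Real.rpow_natCast, ← Real.rpow_mul hℓ0.le,
            ← Real.rpow_mul hℓ0.le, mul_comm]
      _ ≤ Real.exp (-Φ.ta w c x) ^ δ := by gcongr
      _ = _ := by rw [← Real.exp_mul]; congr 1; ring
  · intro w z hz h
    refine (hweight w z hz h).trans ?_
    gcongr
    linarith
  · intro z z' n hz hz' h
    refine (hC₁ z z' n hz hz' h).trans ?_
    gcongr
    linarith
  · intro z hz n
    refine le_trans ?_ (hc z hz n)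
    gcongr
    exact hinv hc0 (by linarith)
  · intro z hz
    refine le_trans ?_ (hc2 z hz)
    exact ENNReal.ofReal_le_ofReal (hinv hc20 (by linarith))
  · intro L hL c
    -- A word of length L + 1 is a block of L branches followed by its base letter.
    obtain ⟨a, b, ha, hb, hab⟩ := hnl L hL c
    obtain ⟨v, hva, hvL, hv⟩ := Words.exists_eq_append Φ a ha
    obtain ⟨w, hwb, hwL, hw⟩ := Words.exists_eq_append Φ b hb
    refine ⟨⟨v, by omega⟩, ⟨w, by omega⟩, hv, hw, fun x₀ hx₀ s t hst => ?_⟩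
    refine le_trans ?_ ((hab x₀ hx₀ s t hst).trans (ENNReal.ofReal_le_ofReal ?_))
    · refine le_trans (measure_mono fun z hz => ?_) (measure_cod_mem_le hν _)
      refine ⟨hz.1, ?_⟩
      rw [hva, hwb, X, X, Φ.tau_eq_ta hv hz.1, Φ.tau_eq_ta hv hx₀.2, Φ.tau_eq_ta hw hz.1,
        Φ.tau_eq_ta hw hx₀.2]
      exact hz.2
    · have : 0 ≤ t - s := by linarith
      gcongr
      linarith

end MarkovIFS

/-! ### One step of the cancellation argument -/

/-- Quantitative strict convexity: ‖Af + Bg‖² falls short of (A+B)(A‖f‖² + B‖g‖²) by exactly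
AB‖f-g‖², and AB ≥ min(A,B)(A+B)/2. -/
lemma norm_add_le_of_far {f g : ℂ} (hf : ‖f‖ ≤ 1) (hg : ‖g‖ ≤ 1) {A B t : ℝ} (hA : 0 ≤ A)
    (hB : 0 ≤ B) (ht : 0 ≤ t) (ht1 : t ≤ 1 / 2) (h : ‖f‖ ≤ 7 / 8 ∨ t ≤ ‖f - g‖) :
    ‖A * f + B * g‖ ≤ A + B - t ^ 2 / 4 * min A B := by
  have hm0 : 0 ≤ min A B := le_min hA hB
  have hmA := min_le_left A B
  have hmB := min_le_right A B
  rcases h with h | h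
  · calc _ ≤ A * ‖f‖ + B * ‖g‖ := by
          refine (norm_add_le _ _).trans_eq ?_
          rw [norm_mul, norm_mul, Complex.norm_of_nonneg hA, Complex.norm_of_nonneg hB]
      _ ≤ A * (7 / 8) + B * 1 := by gcongr
      _ ≤ _ := by
        have h1 : t ^ 2 / 4 * min A B ≤ 1 / 8 * min A B := by
          have ht2 : t ^ 2 ≤ 1 / 4 := by nlinarith
          exact mul_le_mul_of_nonneg_right (by linarith) hm0
        linarith
  · have key : ‖A * f + B * g‖ ^ 2 + A * B * ‖f - g‖ ^ 2 =
        (A + B) * (A * ‖f‖ ^ 2 + B * ‖g‖ ^ 2) := by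
      simp only [Complex.sq_norm, Complex.normSq_apply, Complex.add_re, Complex.add_im,
        Complex.sub_re, Complex.sub_im, Complex.mul_re, Complex.mul_im, Complex.ofReal_re,
        Complex.ofReal_im]
      ring
    have h1 : ‖f‖ ^ 2 ≤ 1 := pow_le_one₀ (norm_nonneg _) hf
    have h2 : ‖g‖ ^ 2 ≤ 1 := pow_le_one₀ (norm_nonneg _) hg
    have h3 : t ^ 2 ≤ ‖f - g‖ ^ 2 := by gcongr
    have hAB : min A B * (A + B) ≤ 2 * (A * B) := by
      rcases le_total A B with hle | hle
      · rw [min_eq_left hle]; nlinarith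
      · rw [min_eq_right hle]; nlinarith
    have ht2 : t ^ 2 ≤ 1 := by nlinarith
    have h4 : 0 ≤ A + B - t ^ 2 / 4 * min A B := by nlinarith
    refine abs_le_of_sq_le_sq' ?_ h4 |>.2
    have h5 : (A + B) * (A * ‖f‖ ^ 2 + B * ‖g‖ ^ 2) ≤ (A + B) * (A * 1 + B * 1) := by gcongr
    have h6 : A * B * t ^ 2 ≤ A * B * ‖f - g‖ ^ 2 := by gcongr
    have h7 : t ^ 2 * (min A B * (A + B)) ≤ t ^ 2 * (2 * (A * B)) := by gcongr
    nlinarith [sq_nonneg (t ^ 2 / 4 * min A B)]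

/-- Reduce `u` modulo 2π to [-π, π], where the chord is bounded below by Jordan's inequality for the
sine. -/
lemma exists_int_of_norm_exp_sub_one_le {u s : ℝ} (h : ‖Complex.exp (Complex.I * u) - 1‖ ≤ s) :
    ∃ j : ℤ, |u - 2 * Real.pi * j| ≤ 2 * s := by
  have hpi := Real.pi_pos
  refine ⟨round (u / (2 * Real.pi)), ?_⟩
  set j := round (u / (2 * Real.pi)) with hj
  set v := u - 2 * Real.pi * j with hv
  have h1 : |v| ≤ Real.pi := by
    have h2 := abs_sub_round (u / (2 * Real.pi))
    rw [← hj] at h2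
    have h3 : v = 2 * Real.pi * (u / (2 * Real.pi) - j) := by rw [hv]; field_simp
    rw [h3, abs_mul, abs_of_pos (by positivity : 0 < 2 * Real.pi)]
    nlinarith
  have h2 : Complex.exp (Complex.I * u) = Complex.exp (Complex.I * v) := by
    rw [Complex.exp_eq_exp_iff_exists_int]
    refine ⟨j, ?_⟩
    rw [hv]; push_cast; ring
  rw [h2, Complex.norm_exp_I_mul_ofReal_sub_one, Real.norm_eq_abs, abs_mul] at h
  have h4 : |v / 2| ≤ Real.pi / 2 := by rw [abs_div, abs_two]; linarith
  have h5 := Real.mul_abs_le_abs_sin h4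
  rw [abs_div, abs_two] at h5
  rw [abs_two] at h
  have h6 : 2 / Real.pi * (|v| / 2) = |v| / Real.pi := by field_simp
  rw [h6, div_le_iff₀ hpi] at h5
  have h7 : |v| ≤ s / 2 * Real.pi := h5.trans (by gcongr; linarith)
  have hs : 0 ≤ s := le_trans (by positivity) h
  have := Real.pi_le_four
  nlinarith

/-- A dichotomy. If one of the two distinguished values is small compared with the quadratic mean,
the values are spread out and Jensen's inequality is strict by the variance. Otherwise both are
comparable with the mean, and the subtracted minimum is a fixed proportion of it. -/
lemma sq_sum_sub_min_le {ι : Type*} [Fintype ι] {e h : ι → ℝ} (he : ∀ i, 0 ≤ e i)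
    (he1 : ∑ i, e i = 1) (hh : ∀ i, 0 ≤ h i) {α β : ι} {m c : ℝ} (hm : 0 < m) (hm1 : m ≤ 1)
    (hα : m ≤ e α) (hβ : m ≤ e β) (hc : 0 ≤ c) (hc1 : c ≤ 1) :
    (∑ i, e i * h i - c * min (e α * h α) (e β * h β)) ^ 2 ≤
      (1 - c * m / 16) * ∑ i, e i * h i ^ 2 := by
  set H := ∑ i, e i * h i with hH
  set V := ∑ i, e i * h i ^ 2 with hV
  have hV0 : 0 ≤ V := Finset.sum_nonneg fun i _ => mul_nonneg (he i) (sq_nonneg _)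
  have hH0 : 0 ≤ H := Finset.sum_nonneg fun i _ => mul_nonneg (he i) (hh i)
  have hvar : ∑ i, e i * (h i - H) ^ 2 = V - H ^ 2 := by
    have : ∀ i, e i * (h i - H) ^ 2 = e i * h i ^ 2 - 2 * H * (e i * h i) + H ^ 2 * e i :=
      fun i => by ring
    simp_rw [this, Finset.sum_add_distrib, Finset.sum_sub_distrib, ← Finset.mul_sum, he1]
    rw [← hH]; ring
  have hone : ∀ i, e i * (h i - H) ^ 2 ≤ V - H ^ 2 := fun i => by
    rw [← hvar]
    exact Finset.single_le_sum (f := fun i => e i * (h i - H) ^ 2)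
      (fun j _ => mul_nonneg (he j) (sq_nonneg _)) (Finset.mem_univ i)
  set S := Real.sqrt V with hS
  have hS0 : 0 ≤ S := Real.sqrt_nonneg _
  have hSV : S ^ 2 = V := Real.sq_sqrt hV0
  have hHS : H ≤ S := by
    refine Real.le_sqrt_of_sq_le ?_
    have := hone α
    have : 0 ≤ e α * (h α - H) ^ 2 := mul_nonneg (he _) (sq_nonneg _)
    linarith
  set q := min (e α * h α) (e β * h β) with hq
  have hq0 : 0 ≤ q := le_min (mul_nonneg (he _) (hh _)) (mul_nonneg (he _) (hh _))
  have hqH : q ≤ H := (min_le_left _ _).trans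
    (Finset.single_le_sum (f := fun i => e i * h i) (fun j _ => mul_nonneg (he j) (hh j))
      (Finset.mem_univ α))
  have hcq : c * q ≤ H := (mul_le_of_le_one_left hq0 hc1).trans hqH
  have hcm : c * m ≤ m := mul_le_of_le_one_left hm.le hc1
  -- Here `h i` is below S/2. Either the mean `H` is itself below 3S/4, or `h i` deviates from it by
  -- S/4 and contributes at least m(S/4)² to the variance.
  have small : ∀ i, m ≤ e i → h i < S / 2 → (H - c * q) ^ 2 ≤ (1 - c * m / 16) * V := by
    intro i hi hlt
    have h0 : (H - c * q) ^ 2 ≤ H ^ 2 := by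
      have : 0 ≤ c * q := mul_nonneg hc hq0
      nlinarith
    refine h0.trans ?_
    rcases le_total H (3 / 4 * S) with h1 | h1
    · have : H ^ 2 ≤ (3 / 4 * S) ^ 2 := by gcongr
      nlinarith
    · have h2 : (S / 4) ^ 2 ≤ (h i - H) ^ 2 := by nlinarith
      have h3 : m * (S / 4) ^ 2 ≤ e i * (h i - H) ^ 2 :=
        mul_le_mul hi h2 (by positivity) (he i)
      have h4 := hone i
      nlinarith
  by_cases h1 : h α < S / 2
  · exact small α hα h1
  by_cases h2 : h β < S / 2
  · exact small β hβ h2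
  push Not at h1 h2
  have h3 : m * (S / 2) ≤ q := le_min (mul_le_mul hα h1 (by positivity) (he _))
    (mul_le_mul hβ h2 (by positivity) (he _))
  have h4 : H - c * q ≤ S * (1 - c * m / 2) := by nlinarith
  have h5 : 0 ≤ H - c * q := by linarith
  have h6 : 0 ≤ c * m := by positivity
  calc (H - c * q) ^ 2 ≤ (S * (1 - c * m / 2)) ^ 2 := by gcongr
    _ = (1 - c * m / 2) ^ 2 * V := by rw [mul_pow, hSV]; ring
    _ ≤ _ := by
      gcongr
      nlinarith

section Step

variable {𝒜 : Type*} [MeasurableSpace 𝒜] [DiscreteMeasurableSpace 𝒜] [Countable 𝒜]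
  {ν : Measure (ℕ → 𝒜)} [IsProbabilityMeasure ν]

open Classical in
/-- Improving a majorant of a sum `∑ Z_u` on the stopping cylinders where two terms do not
align. -/
theorem exists_improved_majorant {T T' : ℝ≥0∞} (hT : ∀ z, ν (cyl (stopWord ν T z)) ≤ T)
    (hT' : ∀ z, ν (cyl (stopWord ν T' z)) ≤ T') (hTT : T' ≤ T) (hT1 : T < 1)
    {p : (ℕ → 𝒜) → Prop} (hp : ∀ᵐ z ∂ν, p z) {d : 𝒜} {ι : Type*} [Fintype ι] {e : ι → ℝ}
    (he : ∀ i, 0 ≤ e i) (he1 : ∑ i, e i = 1) {h : ι → (ℕ → 𝒜) → ℝ} (hh : ∀ i x, 0 ≤ h i x)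
    (hconst : ∀ i x x', stopWord ν T x' = stopWord ν T x → h i x' = h i x) {Z : ι → (ℕ → 𝒜) → ℂ}
    (hZ : ∀ i x, p x → x 0 = d → ‖Z i x‖ ≤ e i * h i x) {α β : ι} (hαβ : α ≠ β) {m c : ℝ}
    (hm : 0 < m) (hm1 : m ≤ 1) (hα : m ≤ e α) (hβ : m ≤ e β) (hc : 0 ≤ c) (hc1 : c ≤ 1 / 2)
    (hbad : ∀ x₀, p x₀ → x₀ 0 = d → 0 < h α x₀ → 0 < h β x₀ →
      2 * ν {x | p x ∧ x ∈ cyl (stopWord ν T x₀) ∧ ∃ y, p y ∧ y 0 = d ∧ stopWord ν T' y = stopWord ν T' x ∧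
        e α * h α x₀ + e β * h β x₀ - c * min (e α * h α x₀) (e β * h β x₀) < ‖Z α y + Z β y‖} ≤
      ν (cyl (stopWord ν T x₀))) :
    ∃ g : (ℕ → 𝒜) → ℝ, (∀ x, ∑ i, e i * h i x ≤ 2 * g x) ∧
      (∀ x x', stopWord ν T' x' = stopWord ν T' x → g x' = g x) ∧
      (∀ x, p x → x 0 = d → ‖∑ i, Z i x‖ ≤ g x) ∧
      ∫⁻ x in cyl [d], ENNReal.ofReal (g x ^ 2) ∂ν ≤ ENNReal.ofReal (1 - c * m / 32) *
        ∑ i, ENNReal.ofReal (e i) * ∫⁻ x in cyl [d], ENNReal.ofReal (h i x ^ 2) ∂ν := by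
  set A : (ℕ → 𝒜) → ℝ := fun x => e α * h α x with hA
  set B : (ℕ → 𝒜) → ℝ := fun x => e β * h β x with hB
  set H : (ℕ → 𝒜) → ℝ := fun x => ∑ i, e i * h i x with hH
  -- The improved bound is required at all typical points of the finer stopping cylinder, so that
  -- `good`, and with it the new majorant, is constant there.
  set good : (ℕ → 𝒜) → Prop := fun x => ∀ y, p y → y 0 = d → stopWord ν T' y = stopWord ν T' x →
    ‖Z α y + Z β y‖ ≤ A x + B x - c * min (A x) (B x) with hgood
  set g : (ℕ → 𝒜) → ℝ := fun x => H x - if good x then c * min (A x) (B x) else 0 with hg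
  have hconst' : ∀ i x x', stopWord ν T' x' = stopWord ν T' x → h i x' = h i x := fun i x x' hx =>
    hconst i x x' (stop_eq_of_le hT' hT hTT hx)
  have hA0 : ∀ x, 0 ≤ A x := fun x => mul_nonneg (he _) (hh _ _)
  have hB0 : ∀ x, 0 ≤ B x := fun x => mul_nonneg (he _) (hh _ _)
  have hmin0 : ∀ x, 0 ≤ min (A x) (B x) := fun x => le_min (hA0 x) (hB0 x)
  have hABH : ∀ x, A x + B x + ∑ i ∈ (Finset.univ.erase α).erase β, e i * h i x = H x := by
    intro x
    simp only [hH, hA, hB]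
    rw [← Finset.add_sum_erase _ _ (Finset.mem_univ α), ← Finset.add_sum_erase _ _
      (Finset.mem_erase.2 ⟨hαβ.symm, Finset.mem_univ β⟩), add_assoc]
  have hrest : ∀ x, 0 ≤ ∑ i ∈ (Finset.univ.erase α).erase β, e i * h i x := fun x =>
    Finset.sum_nonneg fun i _ => mul_nonneg (he i) (hh i x)
  have hH0 : ∀ x, 0 ≤ H x := fun x => by
    have := hABH x; have := hrest x; have := hA0 x; have := hB0 x; linarith
  have hgoodc : ∀ x x', stopWord ν T' x' = stopWord ν T' x → (good x' ↔ good x) := by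
    intro x x' hx
    simp only [hgood, hA, hB]
    rw [hconst' α x x' hx, hconst' β x x' hx, hx]
  have hgc : ∀ x x', stopWord ν T' x' = stopWord ν T' x → g x' = g x := by
    intro x x' hx
    simp only [hg, hH, hA, hB]
    simp_rw [fun i => hconst' i x x' hx]
    rw [if_congr (hgoodc x x' hx) rfl rfl]
  have hgH : ∀ x, g x ≤ H x := fun x => by
    simp only [hg]
    split_ifs
    · have := mul_nonneg hc (hmin0 x); linarith
    · linarith
  have hg2 : ∀ x, H x ≤ 2 * g x := by
    intro x
    simp only [hg]
    have := hABH x; have := hrest x; have := hA0 x; have := hB0 x; have := hmin0 x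
    have := min_le_left (A x) (B x)
    split_ifs
    · nlinarith
    · linarith
  have hg0 : ∀ x, 0 ≤ g x := fun x => by linarith [hg2 x, hH0 x]
  refine ⟨g, hg2, hgc, fun x hx hxd => ?_, ?_⟩
  · have e1 : ∑ i, Z i x = Z α x + Z β x + ∑ i ∈ (Finset.univ.erase α).erase β, Z i x := by
      rw [← Finset.add_sum_erase _ _ (Finset.mem_univ α), ← Finset.add_sum_erase _ _
        (Finset.mem_erase.2 ⟨hαβ.symm, Finset.mem_univ β⟩), add_assoc]
    have e2 : ‖∑ i ∈ (Finset.univ.erase α).erase β, Z i x‖ ≤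
        ∑ i ∈ (Finset.univ.erase α).erase β, e i * h i x :=
      norm_sum_le_of_le _ fun i _ => hZ i x hx hxd
    rw [e1]
    refine (norm_add_le _ _).trans ?_
    simp only [hg]
    have := hABH x
    split_ifs with hgd
    · have := hgd x hx hxd rfl
      linarith
    · have := norm_add_le (Z α x) (Z β x)
      have := hZ α x hx hxd
      have := hZ β x hx hxd
      simp only [hA, hB] at *
      linarith
  set V : (ℕ → 𝒜) → ℝ := fun x => ∑ i, e i * h i x ^ 2 with hV
  have hV0 : ∀ x, 0 ≤ V x := fun x => Finset.sum_nonneg fun i _ => mul_nonneg (he i) (sq_nonneg _)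
  have hgV : ∀ x, g x ^ 2 ≤ V x := by
    intro x
    have h1 := sq_sum_sub_min_le he he1 (fun i => hh i x) (c := 0) hm hm1 hα hβ le_rfl zero_le_one
    have h2 : g x ^ 2 ≤ H x ^ 2 := pow_le_pow_left₀ (hg0 x) (hgH x) 2
    simp only [hH] at h2
    simp only [zero_mul, sub_zero, zero_div, one_mul] at h1
    exact h2.trans h1
  have hgV' : ∀ x, good x → g x ^ 2 ≤ (1 - c * m / 16) * V x := by
    intro x hx
    simp only [hg, if_pos hx]
    exact sq_sum_sub_min_le he he1 (fun i => hh i x) hm hm1 hα hβ hc (by linarith)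
  have hcm : c * m ≤ 1 / 2 := (mul_le_mul hc1 hm1 hm.le (by norm_num)).trans (by norm_num)
  have hcm0 : 0 ≤ c * m := by positivity
  have hgm : MeasurableSet {x | ¬ good x} := by
    have h1 : Measurable fun x => ¬ good x := measurable_of_stop hT' fun x x' hx => by
      rw [eq_iff_iff, hgoodc x x' hx]
    exact measurableSet_setOf.2 h1
  have hkey : ∫⁻ x in cyl [d], ENNReal.ofReal (g x ^ 2) ∂ν ≤
      ∫⁻ x in cyl [d], ENNReal.ofReal (1 - c * m / 32) * ENNReal.ofReal (V x) ∂ν := by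
    refine lintegral_le_of_stop hT hT1 hp fun x₀ hx₀ hx₀d => ?_
    set Q := cyl (stopWord ν T x₀) with hQ
    have hQm : MeasurableSet Q := measurableSet_cyl _
    have hVQ : ∀ x ∈ Q, V x = V x₀ := by
      intro x hx
      simp only [hV]
      simp_rw [fun i => hconst i x₀ x ((stop_eq_iff hT).2 hx)]
    -- If one of the two majorants vanishes, nothing has to be subtracted and the triangle
    -- inequality makes every point good.
    have hbadQ : 2 * ν ({x | ¬ good x} ∩ Q) ≤ ν Q := by
      by_cases hpos : 0 < h α x₀ ∧ 0 < h β x₀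
      · refine le_trans ?_ (hbad x₀ hx₀ hx₀d hpos.1 hpos.2)
        refine mul_le_mul' le_rfl (measure_mono_ae ?_)
        filter_upwards [hp] with x hx hxb
        refine ⟨hx, hxb.2, ?_⟩
        have h1 : ¬ good x := hxb.1
        simp only [hgood, not_forall, not_le] at h1
        obtain ⟨y, hy, hyd, hyx, hlt⟩ := h1
        refine ⟨y, hy, hyd, hyx, ?_⟩
        have h2 := (stop_eq_iff hT).2 hxb.2
        simp only [hA, hB] at hlt
        rwa [hconst α x₀ x h2, hconst β x₀ x h2] at hlt
      · have h0 : {x | ¬ good x} ∩ Q = ∅ := by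
          refine eq_empty_of_forall_notMem fun x hx => hx.1 fun y hy hyd hyx => ?_
          have h2 := (stop_eq_iff hT).2 hx.2
          have h3 : min (A x) (B x) = 0 := by
            simp only [hA, hB]
            rw [hconst α x₀ x h2, hconst β x₀ x h2]
            rw [not_and_or, not_lt, not_lt] at hpos
            rcases hpos with h4 | h4
            · rw [le_antisymm h4 (hh _ _), mul_zero]
              exact min_eq_left (mul_nonneg (he _) (hh _ _))
            · rw [le_antisymm h4 (hh _ _), mul_zero]
              exact min_eq_right (mul_nonneg (he _) (hh _ _))
          rw [h3, mul_zero, sub_zero]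
          refine (norm_add_le _ _).trans (add_le_add ?_ ?_)
          · change ‖Z α y‖ ≤ e α * h α x
            rw [← hconst' α x y hyx]; exact hZ α y hy hyd
          · change ‖Z β y‖ ≤ e β * h β x
            rw [← hconst' β x y hyx]; exact hZ β y hy hyd
        rw [h0, measure_empty, mul_zero]
        exact zero_le
    -- The gain cm/16 is realised on at least half of the cylinder, where the old majorants are
    -- constant; this leaves cm/32.
    calc ∫⁻ x in Q, ENNReal.ofReal (g x ^ 2) ∂ν
        ≤ ∫⁻ x in Q, (ENNReal.ofReal ((1 - c * m / 16) * V x₀) +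
          {x | ¬ good x}.indicator (fun _ => ENNReal.ofReal (c * m / 32 * V x₀) * 2) x) ∂ν := by
          refine setLIntegral_mono' hQm fun x hx => ?_
          by_cases hgd : good x
          · rw [indicator_of_notMem (by simpa using hgd), add_zero, ← hVQ x hx]
            exact ENNReal.ofReal_le_ofReal (hgV' x hgd)
          · rw [indicator_of_mem (by simpa using hgd), ← hVQ x hx]
            have h1 := hV0 x
            have e1 : (2 : ℝ≥0∞) = ENNReal.ofReal 2 := by simp
            rw [e1, ← ENNReal.ofReal_mul (by positivity), ← ENNReal.ofReal_add
              (mul_nonneg (by linarith) h1) (by positivity)]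
            refine ENNReal.ofReal_le_ofReal ((hgV x).trans_eq ?_)
            ring
      _ = ENNReal.ofReal ((1 - c * m / 16) * V x₀) * ν Q +
          ENNReal.ofReal (c * m / 32 * V x₀) * (2 * ν ({x | ¬ good x} ∩ Q)) := by
          rw [lintegral_add_left measurable_const, setLIntegral_const,
            lintegral_indicator_const hgm, Measure.restrict_apply hgm, mul_assoc]
      _ ≤ ENNReal.ofReal ((1 - c * m / 16) * V x₀) * ν Q +
          ENNReal.ofReal (c * m / 32 * V x₀) * ν Q := by gcongr
      _ = ENNReal.ofReal (1 - c * m / 32) * ENNReal.ofReal (V x₀) * ν Q := by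
          have h1 := hV0 x₀
          rw [← add_mul, ← ENNReal.ofReal_add (mul_nonneg (by linarith) h1) (by positivity),
            ← ENNReal.ofReal_mul (by linarith)]
          congr 2; ring
      _ = ∫⁻ x in Q, ENNReal.ofReal (1 - c * m / 32) * ENNReal.ofReal (V x) ∂ν := by
          rw [← setLIntegral_const]
          refine setLIntegral_congr_fun hQm fun x hx => ?_
          simp only [hVQ x hx]
  refine hkey.trans_eq ?_
  have hmeas : ∀ i, Measurable fun x => ENNReal.ofReal (h i x ^ 2) := fun i =>
    measurable_of_stop hT fun x x' hx => by rw [hconst i x x' hx]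
  have hsum : ∀ x, ENNReal.ofReal (V x) =
      ∑ i, ENNReal.ofReal (e i) * ENNReal.ofReal (h i x ^ 2) := by
    intro x
    simp only [hV]
    rw [ENNReal.ofReal_sum_of_nonneg fun i _ => mul_nonneg (he i) (sq_nonneg _)]
    exact Finset.sum_congr rfl fun i _ => ENNReal.ofReal_mul (he i)
  simp_rw [hsum]
  rw [lintegral_const_mul _ (Finset.measurable_sum _ fun i _ => (hmeas i).const_mul _),
    lintegral_finsetSum _ fun i _ => (hmeas i).const_mul _]
  simp_rw [fun i => lintegral_const_mul (μ := ν.restrict (cyl [d])) (ENNReal.ofReal (e i)) (hmeas i)]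

end Step

/-! ### Oscillatory sums over random inverse branches -/

lemma norm_exp_sub_exp_le (u v : ℝ) :
    ‖Complex.exp (Complex.I * u) - Complex.exp (Complex.I * v)‖ ≤ |u - v| := by
  have h : Complex.exp (Complex.I * u) - Complex.exp (Complex.I * v) =
      Complex.exp (Complex.I * v) * (Complex.exp (Complex.I * ((u - v : ℝ) : ℂ)) - 1) := by
    rw [mul_sub, ← Complex.exp_add, mul_one]
    congr 2
    push_cast; ring
  rw [h, norm_mul, mul_comm Complex.I (v : ℂ), Complex.norm_exp_ofReal_mul_I, one_mul]
  exact Real.norm_exp_I_mul_ofReal_sub_one_le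

lemma norm_exp_I_mul (u : ℝ) : ‖Complex.exp (Complex.I * u)‖ = 1 := by
  rw [mul_comm, Complex.norm_exp_ofReal_mul_I]

/-- If two oscillating terms nearly coincide at two points and their amplitudes barely change
between these points, the relative phase barely changes modulo 2π. The errors add up to 6t, and
division by ‖f‖ ≥ 3/4 gives 8t. -/
lemma norm_exp_sub_one_le_of_align {a a' b b' t : ℝ} {f f' g g' : ℂ}
    (h : ‖Complex.exp (Complex.I * a) * f - Complex.exp (Complex.I * b) * g‖ ≤ 2 * t)
    (h' : ‖Complex.exp (Complex.I * a') * f' - Complex.exp (Complex.I * b') * g'‖ ≤ 2 * t)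
    (hf : ‖f - f'‖ ≤ t) (hg : ‖g - g'‖ ≤ t) (hf0 : 3 / 4 ≤ ‖f‖) :
    ‖Complex.exp (Complex.I * (((a - a') - (b - b') : ℝ) : ℂ)) - 1‖ ≤ 8 * t := by
  have key : ∀ (a b : ℝ) (f g : ℂ), ‖Complex.exp (Complex.I * a) * f - Complex.exp (Complex.I * b) * g‖
      = ‖Complex.exp (Complex.I * ((a - b : ℝ) : ℂ)) * f - g‖ := by
    intro a b f g
    have : Complex.exp (Complex.I * a) * f - Complex.exp (Complex.I * b) * g =
        Complex.exp (Complex.I * b) * (Complex.exp (Complex.I * ((a - b : ℝ) : ℂ)) * f - g) := by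
      rw [mul_sub, ← mul_assoc, ← Complex.exp_add]
      congr 3
      push_cast; ring
    rw [this, norm_mul, norm_exp_I_mul, one_mul]
  rw [key] at h h'
  set D := Complex.exp (Complex.I * ((a - b : ℝ) : ℂ)) with hD
  set D' := Complex.exp (Complex.I * ((a' - b' : ℝ) : ℂ)) with hD'
  have hD1 : ‖D'‖ = 1 := norm_exp_I_mul _
  have e1 : ‖D - D'‖ = ‖Complex.exp (Complex.I * (((a - a') - (b - b') : ℝ) : ℂ)) - 1‖ := by
    have : D - D' = D' * (Complex.exp (Complex.I * (((a - a') - (b - b') : ℝ) : ℂ)) - 1) := by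
      rw [mul_sub, mul_one, hD', ← Complex.exp_add, hD]
      congr 2
      push_cast; ring
    rw [this, norm_mul, hD1, one_mul]
  rw [← e1]
  have e2 : (D - D') * f = (D * f - g) + (g - g') - (D' * f' - g') - D' * (f - f') := by ring
  have e3 : ‖(D - D') * f‖ ≤ 2 * t + t + 2 * t + 1 * t := by
    rw [e2]
    refine (norm_sub_le _ _).trans (add_le_add ((norm_sub_le _ _).trans (add_le_add
      ((norm_add_le _ _).trans (add_le_add h hg)) h')) ?_)
    rw [norm_mul, hD1]
    gcongr
  rw [norm_mul] at e3
  nlinarith [norm_nonneg (D - D')]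

noncomputable instance {𝒜 : Type*} [Finite 𝒜] (m : ℕ) : Fintype (Vec 𝒜 m) :=
  (List.finite_length_eq 𝒜 m).fintype

namespace MarkovIFS

variable {𝒜 : Type*} {α : ℝ} {Φ : MarkovIFS 𝒜 α} {φ : (ℕ → 𝒜) → ℝ}

/-- `-log` of the derivative of the branch of `u` at the image of `p` under the branch of `w c`. -/
noncomputable def phase (Φ : MarkovIFS 𝒜 α) (u w : List 𝒜) (c : 𝒜) (p : ℝ) : ℝ :=
  Φ.ta u (w.headD c) (Φ.G w c p)

/-- The characteristic function of the fluctuation of a random inverse branch of length `k`,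
evaluated at the image under the branch of `w`. -/
noncomputable def psi [Finite 𝒜] (Φ : MarkovIFS 𝒜 α) (φ : (ℕ → 𝒜) → ℝ) (y : ℕ → 𝒜) (b p' : ℝ)
    (k : ℕ) (w : List 𝒜) (p : ℝ) : ℂ :=
  ∑ v : Vec 𝒜 k, ((Φ.W φ v.1 (app w y)).toReal : ℂ) *
    Complex.exp (Complex.I * ((b * (Φ.phase v.1 w (y 0) p - Φ.phase v.1 w (y 0) p') : ℝ) : ℂ))

lemma phase_append (v u w : List 𝒜) (c : 𝒜) (p : ℝ) :
    Φ.phase (v ++ u) w c p = Φ.phase v (u ++ w) c p + Φ.phase u w c p := by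
  rw [phase, phase, phase, ta_append, headD_append, G_append]

lemma admW_of_W_ne_zero {u w : List 𝒜} {y : ℕ → 𝒜} (hy : app w y ∈ Φ.shiftSpace)
    (h : Φ.W φ u (app w y) ≠ 0) : Φ.AdmW u (w.headD (y 0)) := by
  have := (Φ.app_mem_shiftSpace.1 ((Φ.W_ne_zero hy).1 h)).1
  rwa [app_zero] at this

variable [Finite 𝒜]

/-- The weights depend on `y` alone and not on the point `p`. The recursion is therefore an average
of oscillating terms with constant probability weights, and there is no transfer operator to
renormalise. -/
lemma psi_add (y : ℕ → 𝒜) (b p' : ℝ) (k L : ℕ) (w : List 𝒜) (p : ℝ) :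
    Φ.psi φ y b p' (k + L) w p = ∑ u : Vec 𝒜 L, ((Φ.W φ u.1 (app w y)).toReal : ℂ) *
      Complex.exp (Complex.I *
        ((b * (Φ.phase u.1 w (y 0) p - Φ.phase u.1 w (y 0) p') : ℝ) : ℂ)) *
      Φ.psi φ y b p' k (u.1 ++ w) p := by
  rw [psi, ← (vecSplit k L).sum_comp, Fintype.sum_prod_type]
  refine Finset.sum_congr rfl fun u _ => ?_
  rw [psi, Finset.mul_sum]
  refine Finset.sum_congr rfl fun v _ => ?_
  change ((Φ.W φ (v.1 ++ u.1) (app w y)).toReal : ℂ) * Complex.exp (Complex.I *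
    ((b * (Φ.phase (v.1 ++ u.1) w (y 0) p - Φ.phase (v.1 ++ u.1) w (y 0) p') : ℝ) : ℂ)) = _
  rw [W_append, phase_append, phase_append, ENNReal.toReal_mul, app_append, mul_mul_mul_comm,
    ← Complex.exp_add]
  push_cast
  ring_nf

lemma sum_W_toReal (hnorm : Φ.IsNormalized φ) {z : ℕ → 𝒜} (hz : z ∈ Φ.shiftSpace) (m : ℕ) :
    ∑ v : Vec 𝒜 m, (Φ.W φ v.1 z).toReal = 1 := by
  rw [← ENNReal.toReal_sum fun v _ => Φ.W_ne_top, ← tsum_fintype (L := .unconditional _),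
    Φ.tsum_W hnorm hz, ENNReal.toReal_one]

lemma norm_psi_le_one (hnorm : Φ.IsNormalized φ) {y : ℕ → 𝒜} {w : List 𝒜}
    (hy : app w y ∈ Φ.shiftSpace) (b p' : ℝ) (k : ℕ) (p : ℝ) : ‖Φ.psi φ y b p' k w p‖ ≤ 1 := by
  rw [← sum_W_toReal hnorm hy k]
  refine norm_sum_le_of_le _ fun v _ => ?_
  rw [norm_mul, norm_exp_I_mul, mul_one, Complex.norm_of_nonneg ENNReal.toReal_nonneg]

variable [MeasurableSpace 𝒜] {ν : Measure (ℕ → 𝒜)} {δ M : ℝ}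

/-- After the branch of `w` distances to the power δ shrink by |g_w'|^δ. So frequency `b` acts on
the original points with effective frequency |b| exp(-δ ta). -/
lemma Regular.abs_phase_sub_le (R : Φ.Regular φ ν δ M) {u w : List 𝒜} {c : 𝒜}
    (hu : Φ.AdmW u (w.headD c)) (hw : Φ.AdmW w c) {p' x x' : ℝ} (hp' : p' ∈ Φ.I c)
    (hx : x ∈ Φ.I c) (hx' : x' ∈ Φ.I c) : |Φ.phase u w c x - Φ.phase u w c x'| ≤
      M ^ 2 * Real.exp (-(δ * Φ.ta w c p')) * |x - x'| ^ δ := by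
  have hM := R.one_le
  refine (R.holder u _ hu _ (Φ.G_mem hw hx) _ (Φ.G_mem hw hx')).trans ?_
  obtain ⟨ξ, hξ, he⟩ := Φ.exists_abs_G_sub hw hx hx'
  rw [he, Real.mul_rpow (Real.exp_pos _).le (abs_nonneg _), ← Real.exp_mul]
  have h1 := R.dist w c hw ξ hξ p' hp'
  have h2 : -Φ.ta w c ξ * δ = -(δ * Φ.ta w c ξ) := by ring
  rw [h2]
  calc _ ≤ M * (M * Real.exp (-(δ * Φ.ta w c p')) * |x - x'| ^ δ) := by gcongr
    _ = _ := by ring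

lemma Regular.norm_psi_sub_le (R : Φ.Regular φ ν δ M) (hnorm : Φ.IsNormalized φ) {y : ℕ → 𝒜}
    (hyS : y ∈ Φ.shiftSpace) {w : List 𝒜} (hw : Φ.AdmW w (y 0)) {p' x x' : ℝ}
    (hp' : p' ∈ Φ.I (y 0)) (hx : x ∈ Φ.I (y 0)) (hx' : x' ∈ Φ.I (y 0)) (b : ℝ) (k : ℕ) :
    ‖Φ.psi φ y b p' k w x - Φ.psi φ y b p' k w x'‖ ≤
      M ^ 2 * (|b| * Real.exp (-(δ * Φ.ta w (y 0) p'))) * |x - x'| ^ δ := by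
  have hy : app w y ∈ Φ.shiftSpace := Φ.app_mem_shiftSpace.2 ⟨hw, hyS⟩
  rw [psi, psi, ← Finset.sum_sub_distrib]
  set K := M ^ 2 * (|b| * Real.exp (-(δ * Φ.ta w (y 0) p'))) * |x - x'| ^ δ with hK
  calc _ ≤ ∑ v : Vec 𝒜 k, (Φ.W φ v.1 (app w y)).toReal * K := by
        refine norm_sum_le_of_le _ fun v _ => ?_
        by_cases h0 : Φ.W φ v.1 (app w y) = 0
        · simp [h0]
        rw [← mul_sub, norm_mul, Complex.norm_of_nonneg ENNReal.toReal_nonneg]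
        gcongr
        refine (norm_exp_sub_exp_le _ _).trans ?_
        have h1 := R.abs_phase_sub_le (admW_of_W_ne_zero hy h0) hw hp' hx hx'
        have h2 : b * (Φ.phase v.1 w (y 0) x - Φ.phase v.1 w (y 0) p') -
            b * (Φ.phase v.1 w (y 0) x' - Φ.phase v.1 w (y 0) p') =
            b * (Φ.phase v.1 w (y 0) x - Φ.phase v.1 w (y 0) x') := by ring
        rw [h2, abs_mul]
        calc _ ≤ |b| * (M ^ 2 * Real.exp (-(δ * Φ.ta w (y 0) p')) * |x - x'| ^ δ) := by gcongr
          _ = _ := by rw [hK]; ring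
    _ = K := by rw [← Finset.sum_mul, sum_W_toReal hnorm hy, one_mul]

lemma Regular.W_ge (R : Φ.Regular φ ν δ M) {z : ℕ → 𝒜} {u : List 𝒜} (h : app u z ∈ Φ.shiftSpace) :
    M⁻¹ ^ u.length ≤ (Φ.W φ u z).toReal := by
  have hM : 0 ≤ M⁻¹ := inv_nonneg.2 (zero_le_one.trans R.one_le)
  rw [← ENNReal.ofReal_le_iff_le_toReal Φ.W_ne_top]
  induction u with
  | nil => simp [W]
  | cons a u ih =>
    rw [W, List.length_cons, pow_succ', ENNReal.ofReal_mul hM]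
    exact mul_le_mul' (R.om_ge _ h) (ih (Φ.consSeq_mem_shiftSpace.1 h).2)

variable [DiscreteMeasurableSpace 𝒜]

lemma Regular.abs_coding_sub_rpow_le (R : Φ.Regular φ ν δ M) [IsProbabilityMeasure ν] {T : ℝ}
    (hT0 : 0 ≤ T) (hT1 : T < 1)
    (hT : ∀ z, ν (cyl (stopWord ν (ENNReal.ofReal T) z)) ≤ ENNReal.ofReal T) {x x' : ℕ → 𝒜}
    (hx : Φ.Typ ν x) (hx' : Φ.Typ ν x')
    (h : stopWord ν (ENNReal.ofReal T) x' = stopWord ν (ENNReal.ofReal T) x) :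
    |Φ.coding x - Φ.coding x'| ^ δ ≤ M * T := by
  have hM : 0 ≤ M := zero_le_one.trans R.one_le
  have hT1' : ENNReal.ofReal T < 1 := by rwa [ENNReal.ofReal_lt_one]
  obtain ⟨n, hn⟩ := Nat.exists_eq_add_of_le' (one_le_stopLen (z := x) hT hT1')
  have h1 := (stop_eq_iff hT).1 h
  rw [stopWord, hn] at h1
  have h2 := R.diam x x' n hx hx' h1
  rw [← ENNReal.ofReal_le_ofReal_iff (by positivity), ENNReal.ofReal_mul hM]
  refine h2.trans ?_
  gcongr
  rw [← hn]
  exact hT x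

/-- Events seen through the branch of `w` have at most proportionally larger mass. -/
lemma Regular.measure_app_mem_le (R : Φ.Regular φ ν δ M) (hvar : Φ.SummableVariations φ)
    (hν : Φ.IsGibbs φ ν) {w : List 𝒜} {c : 𝒜} (hw : Φ.AdmW w c) {p' : ℝ} (hp' : p' ∈ Φ.I c)
    (S : Set (ℕ → 𝒜)) : ν {x | Φ.Good x ∧ x 0 = c ∧ app w x ∈ S} ≤
      ENNReal.ofReal (M ^ 2 / Real.exp (-(δ * Φ.ta w c p'))) * ν S := by
  have hM : 0 < M := zero_lt_one.trans_le R.one_le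
  set Λ := Real.exp (-(δ * Φ.ta w c p')) with hΛ
  have hΛ0 : 0 < Λ := Real.exp_pos _
  have hSm := measurableSet_toMeasurable ν S
  set S' := toMeasurable ν S with hS'
  have hf : Measurable fun x => Φ.W φ w x * S'.indicator 1 (app w x) :=
    (Φ.measurable_W hvar w).mul ((measurable_one.indicator hSm).comp (measurable_app w))
  -- Markov's inequality for the weight of `w`, which is at least Λ/M² on the set in question; this
  -- needs no measurability of that set.
  have h1 : ENNReal.ofReal (Λ / M ^ 2) * ν {x | Φ.Good x ∧ x 0 = c ∧ app w x ∈ S} ≤ ν S := by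
    calc _ ≤ ENNReal.ofReal (Λ / M ^ 2) * ν {x | ENNReal.ofReal (Λ / M ^ 2) ≤
          Φ.W φ w x * S'.indicator 1 (app w x)} := by
          refine mul_le_mul' le_rfl (measure_mono fun x hx => ?_)
          obtain ⟨hxg, hxc, hxS⟩ := hx
          have happ : app w x ∈ Φ.shiftSpace := Φ.app_mem_shiftSpace.2 ⟨hxc ▸ hw, hxg.1⟩
          rw [mem_ofPred_eq, indicator_of_mem (subset_toMeasurable _ _ hxS), Pi.one_apply, mul_one]
          have h2 := R.weight w x hxg happ
          rw [hxc] at h2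
          have h3 := R.dist w c hw p' hp' _ (hxc ▸ hxg.2)
          have h4 : ENNReal.ofReal M⁻¹ * ENNReal.ofReal M = 1 := by
            rw [← ENNReal.ofReal_mul (by positivity), inv_mul_cancel₀ hM.ne', ENNReal.ofReal_one]
          calc _ ≤ ENNReal.ofReal (M⁻¹ * Real.exp (-(δ * Φ.ta w c (Φ.coding x)))) := by
                refine ENNReal.ofReal_le_ofReal ?_
                rw [div_le_iff₀ (by positivity)]
                refine h3.trans_eq ?_
                field_simp
            _ ≤ ENNReal.ofReal M⁻¹ * (ENNReal.ofReal M * Φ.W φ w x) := by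
                rw [ENNReal.ofReal_mul (by positivity)]
                gcongr
            _ = _ := by rw [← mul_assoc, h4, one_mul]
      _ ≤ ∫⁻ x, Φ.W φ w x * S'.indicator 1 (app w x) ∂ν := mul_meas_ge_le_lintegral hf _
      _ = ∫⁻ x in cyl w, S'.indicator 1 x ∂ν :=
          (Φ.conformal_word hvar hν (measurable_one.indicator hSm) w).symm
      _ ≤ ∫⁻ x, S'.indicator 1 x ∂ν := setLIntegral_le_lintegral _ _
      _ = ν S := by rw [lintegral_indicator_one hSm, measure_toMeasurable]
  have h5 : ENNReal.ofReal (M ^ 2 / Λ) * ENNReal.ofReal (Λ / M ^ 2) = 1 := by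
    rw [← ENNReal.ofReal_mul (by positivity), div_mul_div_comm, mul_comm, div_self (by positivity),
      ENNReal.ofReal_one]
  calc _ = ENNReal.ofReal (M ^ 2 / Λ) * (ENNReal.ofReal (Λ / M ^ 2) *
        ν {x | Φ.Good x ∧ x 0 = c ∧ app w x ∈ S}) := by rw [← mul_assoc, h5, one_mul]
    _ ≤ _ := by gcongr

/-- The set of points at which two branches are in phase has small mass. -/
lemma Regular.measure_align_le (R : Φ.Regular φ ν δ M) (hvar : Φ.SummableVariations φ)
    (hν : Φ.IsGibbs φ ν) {w : List 𝒜} {c : 𝒜} (hw : Φ.AdmW w c) {p' : ℝ} (hp' : p' ∈ Φ.I c)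
    {u v : List 𝒜} (huv : ∀ x₀ ∈ Φ.attractor ∩ Φ.I (w.headD c), ∀ s t : ℝ, s ≤ t →
      ν {z | Φ.cod z ∈ Φ.I (w.headD c) ∧
        (Φ.ta u (w.headD c) (Φ.cod z) - Φ.ta u (w.headD c) x₀) -
        (Φ.ta v (w.headD c) (Φ.cod z) - Φ.ta v (w.headD c) x₀) ∈ Icc s t} ≤
        ENNReal.ofReal (M * (t - s))) {b : ℝ} (hb : b ≠ 0) {x₁ : ℕ → 𝒜} (hx₁ : Φ.Good x₁)
    (hx₁c : x₁ 0 = c) {r s : ℝ} (hs : 0 ≤ s) {J : ℕ} (hJ : r + 2 * s ≤ 2 * Real.pi * J) :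
    ν {x | Φ.Good x ∧ x 0 = c ∧
      |b * ((Φ.phase u w c (Φ.coding x) - Φ.phase u w c (Φ.coding x₁)) -
        (Φ.phase v w c (Φ.coding x) - Φ.phase v w c (Φ.coding x₁)))| ≤ r ∧
      ‖Complex.exp (Complex.I * ((b * ((Φ.phase u w c (Φ.coding x) - Φ.phase u w c (Φ.coding x₁)) -
        (Φ.phase v w c (Φ.coding x) - Φ.phase v w c (Φ.coding x₁))) : ℝ) : ℂ)) - 1‖ ≤ s} ≤
      ENNReal.ofReal ((2 * J + 1) *
        (M ^ 2 / Real.exp (-(δ * Φ.ta w c p')) * (M * (4 * s / |b|)))) := by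
  have hM : 0 < M := zero_lt_one.trans_le R.one_le
  have hb0 : 0 < |b| := abs_pos.2 hb
  have hcod : ∀ {x : ℕ → 𝒜}, Φ.Good x → x 0 = c → app w x ∈ Φ.shiftSpace ∧
      Φ.coding (app w x) = Φ.G w c (Φ.coding x) := by
    intro x hx hxc
    have h1 : app w x ∈ Φ.shiftSpace := Φ.app_mem_shiftSpace.2 ⟨hxc ▸ hw, hx.1⟩
    exact ⟨h1, by rw [(hx.app Φ h1).2, hxc]⟩
  set x₀ := Φ.G w c (Φ.coding x₁) with hx₀
  have hx₀F : x₀ ∈ Φ.attractor ∩ Φ.I (w.headD c) := by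
    refine ⟨?_, Φ.G_mem hw (hx₁c ▸ hx₁.2)⟩
    rw [hx₀, ← (hcod hx₁ hx₁c).2]
    exact Φ.coding_mem_attractor (hcod hx₁ hx₁c).1
  set S : ℤ → Set (ℕ → 𝒜) := fun j => {z | Φ.cod z ∈ Φ.I (w.headD c) ∧
        (Φ.ta u (w.headD c) (Φ.cod z) - Φ.ta u (w.headD c) x₀) -
        (Φ.ta v (w.headD c) (Φ.cod z) - Φ.ta v (w.headD c) x₀) ∈
        Icc (2 * Real.pi * j / b - 2 * s / |b|) (2 * Real.pi * j / b + 2 * s / |b|)} with hS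
  have hSj : ∀ j, ν {x | Φ.Good x ∧ x 0 = c ∧ app w x ∈ S j} ≤ ENNReal.ofReal
      (M ^ 2 / Real.exp (-(δ * Φ.ta w c p')) * (M * (4 * s / |b|))) := by
    intro j
    refine (R.measure_app_mem_le hvar hν hw hp' (S j)).trans ?_
    rw [ENNReal.ofReal_mul (by positivity)]
    gcongr
    have h0 : 0 ≤ 2 * s / |b| := by positivity
    refine (huv x₀ hx₀F _ _ (by linarith)).trans_eq ?_
    congr 2; ring
  calc _ ≤ ν (⋃ j ∈ Finset.Icc (-(J : ℤ)) J, {x | Φ.Good x ∧ x 0 = c ∧ app w x ∈ S j}) := by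
        refine measure_mono fun x hx => ?_
        obtain ⟨hxg, hxc, hxr, hxs⟩ := hx
        obtain ⟨j, hj⟩ := exists_int_of_norm_exp_sub_one_le hxs
        have hpi := Real.pi_pos
        -- The phase difference is at most `r` and within 2s of 2πj, so only 2J + 1 values of `j`
        -- can occur. For each of them the density bound applies to a window of length 4s/|b|.
        have hjJ : |(j : ℝ)| ≤ J := by
          have h1 : |2 * Real.pi * (j : ℝ)| ≤ r + 2 * s := by
            have h2 := abs_sub_abs_le_abs_sub (2 * Real.pi * (j : ℝ))
              (b * ((Φ.phase u w c (Φ.coding x) - Φ.phase u w c (Φ.coding x₁)) -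
                (Φ.phase v w c (Φ.coding x) - Φ.phase v w c (Φ.coding x₁))))
            rw [abs_sub_comm] at h2
            linarith
          rw [abs_mul, abs_of_pos (by positivity : 0 < 2 * Real.pi)] at h1
          exact le_of_mul_le_mul_left (h1.trans hJ) (by positivity)
        rw [abs_le] at hjJ
        refine mem_iUnion₂.2 ⟨j, Finset.mem_Icc.2 ⟨by exact_mod_cast hjJ.1, by exact_mod_cast hjJ.2⟩,
          hxg, hxc, ?_⟩
        have h3 := hcod hxg hxc
        rw [hS, mem_ofPred_eq, Φ.cod_of_mem h3.1, h3.2]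
        refine ⟨Φ.G_mem hw (hxc ▸ hxg.2), ?_⟩
        set V := (Φ.phase u w c (Φ.coding x) - Φ.phase u w c (Φ.coding x₁)) -
                (Φ.phase v w c (Φ.coding x) - Φ.phase v w c (Φ.coding x₁)) with hV
        have h4 : |V - 2 * Real.pi * j / b| ≤ 2 * s / |b| := by
          rw [le_div_iff₀ hb0, ← abs_mul]
          refine le_trans (le_of_eq ?_) hj
          congr 1
          field_simp
        rw [abs_le] at h4
        change V ∈ _
        exact ⟨by linarith, by linarith⟩
    _ ≤ ∑ j ∈ Finset.Icc (-(J : ℤ)) J, ν {x | Φ.Good x ∧ x 0 = c ∧ app w x ∈ S j} :=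
        measure_biUnion_finset_le _ _
    _ ≤ ∑ j ∈ Finset.Icc (-(J : ℤ)) J, ENNReal.ofReal
        (M ^ 2 / Real.exp (-(δ * Φ.ta w c p')) * (M * (4 * s / |b|))) :=
        Finset.sum_le_sum fun j _ => hSj j
    _ = _ := by
        rw [Finset.sum_const, Int.card_Icc, nsmul_eq_mul,
          ENNReal.ofReal_mul (p := 2 * (J : ℝ) + 1) (by positivity)]
        congr 1
        have : ((J : ℤ) + 1 - -(J : ℤ)).toNat = 2 * J + 1 := by omega
        rw [this, ← ENNReal.ofReal_natCast]
        push_cast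
        rfl

end MarkovIFS

/-! ### Alignment of two branches on a stopping cylinder -/

namespace MarkovIFS

variable {𝒜 : Type*} {α : ℝ} {Φ : MarkovIFS 𝒜 α} {φ : (ℕ → 𝒜) → ℝ}
variable [Finite 𝒜] [MeasurableSpace 𝒜] [DiscreteMeasurableSpace 𝒜] {ν : Measure (ℕ → 𝒜)} {δ M : ℝ}

/-- The two words of the non-linearity condition are distinct. -/
lemma Regular.words_ne (R : Φ.Regular φ ν δ M) (hvar : Φ.SummableVariations φ)
    (hν : Φ.IsGibbs φ ν) (hgood : ∀ᵐ z ∂ν, Φ.Good z) {w : List 𝒜} {c : 𝒜} (hw : Φ.AdmW w c)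
    {p' : ℝ} (hp' : p' ∈ Φ.I c) (hc : ν (cyl [c]) ≠ 0)
    {u v : List 𝒜} (huv : ∀ x₀ ∈ Φ.attractor ∩ Φ.I (w.headD c), ∀ s t : ℝ, s ≤ t →
      ν {z | Φ.cod z ∈ Φ.I (w.headD c) ∧
        (Φ.ta u (w.headD c) (Φ.cod z) - Φ.ta u (w.headD c) x₀) -
        (Φ.ta v (w.headD c) (Φ.cod z) - Φ.ta v (w.headD c) x₀) ∈ Icc s t} ≤
        ENNReal.ofReal (M * (t - s))) : u ≠ v := by
  rintro rfl
  obtain ⟨x₁, hx₁, hx₁c⟩ : ∃ x₁, Φ.Good x₁ ∧ x₁ 0 = c := by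
    by_contra hne
    push Not at hne
    refine hc (measure_mono_null (t := {z | ¬ Φ.Good z}) (fun z hz hg => ?_) hgood)
    exact hne z hg (mem_cyl_singleton.1 hz)
  -- Equal words would be in phase everywhere, but with zero tolerance the aligned set is null.
  have h := R.measure_align_le hvar hν hw hp' huv (b := 1) one_ne_zero hx₁ hx₁c (r := 0) (s := 0)
    le_rfl (J := 0) (by simp)
  simp only [mul_zero, zero_div, ENNReal.ofReal_zero] at h
  refine hc (measure_mono_null_ae ?_ (le_antisymm h zero_le))
  filter_upwards [hgood] with z hz hzc
  refine ⟨hz, mem_cyl_singleton.1 hzc, ?_, ?_⟩ <;> simp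

/-- The scale of cancellation for a system with constant `M`. -/
noncomputable def cancel (M : ℝ) : ℝ := 1 / (512 * M ^ 7)

/-- The ratio of successive scales for a system with constant `M`. -/
noncomputable def ratio (M : ℝ) : ℝ := cancel M / (10 * M ^ 3)

lemma cancel_pos (hM : 1 ≤ M) : 0 < cancel M := by unfold cancel; positivity

lemma ratio_pos (hM : 1 ≤ M) : 0 < ratio M := div_pos (cancel_pos hM) (by positivity)

lemma cancel_le (hM : 1 ≤ M) : cancel M ≤ 1 / 512 := by
  have h7 : 1 ≤ M ^ 7 := one_le_pow₀ hM
  unfold cancel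
  gcongr
  linarith

/-- This fixes the balance of scales: on the finer cylinders each oscillating term moves by at most
5M³`ratio`, half of the tolerance `cancel`. -/
lemma ratio_mul (hM : 1 ≤ M) : 10 * M ^ 3 * ratio M = cancel M := by
  unfold ratio; field_simp

lemma ratio_le (hM : 1 ≤ M) : ratio M ≤ 1 / 4 := by
  have h3 : 1 ≤ M ^ 3 := one_le_pow₀ hM
  have h1 := ratio_mul hM
  have h2 := cancel_le hM
  have h4 := (ratio_pos hM).le
  nlinarith

/-- Points of the same stopping cylinder at which the two branches are aligned. -/
lemma Regular.measure_bad_le (R : Φ.Regular φ ν δ M) [IsProbabilityMeasure ν]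
    (hvar : Φ.SummableVariations φ) (hν : Φ.IsGibbs φ ν)
    {w : List 𝒜} {c : 𝒜} (hw : Φ.AdmW w c) {p' : ℝ} (hp' : p' ∈ Φ.I c)
    {u v : List 𝒜} (hu : Φ.AdmW u (w.headD c)) (hv : Φ.AdmW v (w.headD c))
    (huv : ∀ x₀ ∈ Φ.attractor ∩ Φ.I (w.headD c), ∀ s t : ℝ, s ≤ t →
      ν {z | Φ.cod z ∈ Φ.I (w.headD c) ∧
        (Φ.ta u (w.headD c) (Φ.cod z) - Φ.ta u (w.headD c) x₀) -
        (Φ.ta v (w.headD c) (Φ.cod z) - Φ.ta v (w.headD c) x₀) ∈ Icc s t} ≤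
        ENNReal.ofReal (M * (t - s))) {b T : ℝ} (hT0 : 0 < T) (hT1 : T < 1)
    (hbT : |b| * Real.exp (-(δ * Φ.ta w c p')) * T = 1)
    (hT : ∀ z, ν (cyl (stopWord ν (ENNReal.ofReal T) z)) ≤ ENNReal.ofReal T)
    (hT' : ∀ z, ν (cyl (stopWord ν (ENNReal.ofReal (ratio M * T)) z)) ≤ ENNReal.ofReal (ratio M * T))
    {f g : (ℕ → 𝒜) → ℂ} {A B : ℝ} (hA : 0 < A) (hB : 0 < B) {x₀ : ℕ → 𝒜} (hx₀ : Φ.Typ ν x₀)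
    (hf1 : ∀ x, Φ.Typ ν x → x 0 = c → x ∈ cyl (stopWord ν (ENNReal.ofReal T) x₀) → ‖f x‖ ≤ 1)
    (hg1 : ∀ x, Φ.Typ ν x → x 0 = c → x ∈ cyl (stopWord ν (ENNReal.ofReal T) x₀) → ‖g x‖ ≤ 1)
    (hf : ∀ x x', Φ.Typ ν x → Φ.Typ ν x' → x 0 = c → x' 0 = c →
      x ∈ cyl (stopWord ν (ENNReal.ofReal T) x₀) → x' ∈ cyl (stopWord ν (ENNReal.ofReal T) x₀) →
      ‖f x - f x'‖ ≤ 4 * M ^ 2 * ratio M * (|b| * Real.exp (-(δ * Φ.ta w c p'))) *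
        |Φ.coding x - Φ.coding x'| ^ δ)
    (hg : ∀ x x', Φ.Typ ν x → Φ.Typ ν x' → x 0 = c → x' 0 = c →
      x ∈ cyl (stopWord ν (ENNReal.ofReal T) x₀) → x' ∈ cyl (stopWord ν (ENNReal.ofReal T) x₀) →
      ‖g x - g x'‖ ≤ 4 * M ^ 2 * ratio M * (|b| * Real.exp (-(δ * Φ.ta w c p'))) *
        |Φ.coding x - Φ.coding x'| ^ δ) :
    2 * ν {x | (Φ.Typ ν x ∧ x 0 = c) ∧ x ∈ cyl (stopWord ν (ENNReal.ofReal T) x₀) ∧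
      ∃ y, Φ.Typ ν y ∧ y 0 = c ∧
        stopWord ν (ENNReal.ofReal (ratio M * T)) y = stopWord ν (ENNReal.ofReal (ratio M * T)) x ∧
        A + B - cancel M ^ 2 / 4 * min A B <
        ‖A * (Complex.exp (Complex.I * ((b * (Φ.phase u w c (Φ.coding y) - Φ.phase u w c p') : ℝ) :
          ℂ)) * f y) + B * (Complex.exp (Complex.I *
          ((b * (Φ.phase v w c (Φ.coding y) - Φ.phase v w c p') : ℝ) : ℂ)) * g y)‖} ≤
      ν (cyl (stopWord ν (ENNReal.ofReal T) x₀)) := by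
  have hM := R.one_le
  set Λ := Real.exp (-(δ * Φ.ta w c p')) with hΛ
  have hΛ0 : 0 < Λ := Real.exp_pos _
  set t := cancel M with ht
  set ε := ratio M with hε
  have ht0 : 0 < t := cancel_pos hM
  have ht1 : t ≤ 1 / 512 := cancel_le hM
  have hε0 : 0 < ε := ratio_pos hM
  have hεt : 10 * M ^ 3 * ε = t := ratio_mul hM
  have hε4 : ε ≤ 1 / 4 := ratio_le hM
  have hb0 : 0 < |b| := by
    rcases (abs_nonneg b).eq_or_lt with h | h
    · rw [← h] at hbT; simp at hbT
    · exact h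
  have hM3 : 1 ≤ M ^ 3 := one_le_pow₀ hM
  set E : List 𝒜 → (ℕ → 𝒜) → ℝ := fun u y => b * (Φ.phase u w c (Φ.coding y) - Φ.phase u w c p')
    with hE
  have hT'1 : ε * T < 1 := by nlinarith
  have hTT : ENNReal.ofReal (ε * T) ≤ ENNReal.ofReal T :=
    ENNReal.ofReal_le_ofReal (mul_le_of_le_one_left hT0.le (by linarith))
  set Q := cyl (stopWord ν (ENNReal.ofReal T) x₀) with hQ
  have hEsub : ∀ u, Φ.AdmW u (w.headD c) → ∀ x x', Φ.Typ ν x → Φ.Typ ν x' → x 0 = c → x' 0 = c →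
      |E u x - E u x'| ≤ M ^ 2 * (|b| * Λ) * |Φ.coding x - Φ.coding x'| ^ δ := by
    intro u hu x x' hx hx' hxc hxc'
    have h1 := R.abs_phase_sub_le hu hw hp' (hxc ▸ hx.good.2) (hxc' ▸ hx'.good.2)
    have h2 : E u x - E u x' = b * (Φ.phase u w c (Φ.coding x) - Φ.phase u w c (Φ.coding x')) := by
      simp only [hE]; ring
    rw [h2, abs_mul]
    calc _ ≤ |b| * (M ^ 2 * Λ * |Φ.coding x - Φ.coding x'| ^ δ) := by gcongr
      _ = _ := by ring
  have hdiam : ∀ x x', Φ.Typ ν x → Φ.Typ ν x' → x ∈ Q → x' ∈ Q →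
      |b| * Λ * |Φ.coding x - Φ.coding x'| ^ δ ≤ M := by
    intro x x' hx hx' hxQ hxQ'
    have h1 := R.abs_coding_sub_rpow_le hT0.le hT1 hT hx hx'
      (((stop_eq_iff hT).2 hxQ').trans ((stop_eq_iff hT).2 hxQ).symm)
    calc _ ≤ |b| * Λ * (M * T) := by gcongr
      _ = M * (|b| * Λ * T) := by ring
      _ = M := by rw [hbT, mul_one]
  have hdiam' : ∀ x x', Φ.Typ ν x → Φ.Typ ν x' →
      stopWord ν (ENNReal.ofReal (ε * T)) x' = stopWord ν (ENNReal.ofReal (ε * T)) x →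
      |b| * Λ * |Φ.coding x - Φ.coding x'| ^ δ ≤ M * ε := by
    intro x x' hx hx' hxx
    have h1 := R.abs_coding_sub_rpow_le (by positivity) hT'1 hT' hx hx' hxx
    calc _ ≤ |b| * Λ * (M * (ε * T)) := by gcongr
      _ = M * ε * (|b| * Λ * T) := by ring
      _ = M * ε := by rw [hbT, mul_one]
  -- On a finer cylinder the exponential moves by at most M³ε, and the amplitude by at most 4M³ε
  -- because ε ≤ 1.
  have hosc : ∀ (u : List 𝒜) (f : (ℕ → 𝒜) → ℂ), Φ.AdmW u (w.headD c) →
      (∀ x, Φ.Typ ν x → x 0 = c → x ∈ Q → ‖f x‖ ≤ 1) →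
      (∀ x x', Φ.Typ ν x → Φ.Typ ν x' → x 0 = c → x' 0 = c → x ∈ Q → x' ∈ Q →
        ‖f x - f x'‖ ≤ 4 * M ^ 2 * ε * (|b| * Λ) * |Φ.coding x - Φ.coding x'| ^ δ) →
      ∀ x x', Φ.Typ ν x → Φ.Typ ν x' → x 0 = c → x' 0 = c → x ∈ Q → x' ∈ Q →
        stopWord ν (ENNReal.ofReal (ε * T)) x' = stopWord ν (ENNReal.ofReal (ε * T)) x →
        ‖Complex.exp (Complex.I * (E u x : ℂ)) * f x -
          Complex.exp (Complex.I * (E u x' : ℂ)) * f x'‖ ≤ t / 2 := by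
    intro u f hu hf1 hf x x' hx hx' hxc hxc' hxQ hxQ' hxx
    have h1 : Complex.exp (Complex.I * (E u x : ℂ)) * f x -
        Complex.exp (Complex.I * (E u x' : ℂ)) * f x' =
        (Complex.exp (Complex.I * (E u x : ℂ)) - Complex.exp (Complex.I * (E u x' : ℂ))) * f x +
        Complex.exp (Complex.I * (E u x' : ℂ)) * (f x - f x') := by ring
    have h2 := hdiam' x x' hx hx' hxx
    have h3 := (hEsub u hu x x' hx hx' hxc hxc')
    have h4 := hf x x' hx hx' hxc hxc' hxQ hxQ'
    rw [h1]
    calc _ ≤ |E u x - E u x'| * 1 + 1 * ‖f x - f x'‖ := by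
          refine (norm_add_le _ _).trans (add_le_add ?_ ?_)
          · rw [norm_mul]
            exact mul_le_mul (norm_exp_sub_exp_le _ _) (hf1 x hx hxc hxQ) (norm_nonneg _)
              (abs_nonneg _)
          · rw [norm_mul, norm_exp_I_mul]
      _ ≤ M ^ 2 * (|b| * Λ * |Φ.coding x - Φ.coding x'| ^ δ) +
          4 * M ^ 2 * ε * (|b| * Λ * |Φ.coding x - Φ.coding x'| ^ δ) := by
          rw [mul_one, one_mul]
          exact add_le_add (h3.trans_eq (by ring)) (h4.trans_eq (by ring))
      _ ≤ M ^ 2 * (M * ε) + 4 * M ^ 2 * 1 * (M * ε) := by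
          gcongr
          linarith
      _ = t / 2 := by rw [← hεt]; ring
  set S := {x | (Φ.Typ ν x ∧ x 0 = c) ∧ x ∈ Q ∧
      ∃ y, Φ.Typ ν y ∧ y 0 = c ∧
        stopWord ν (ENNReal.ofReal (ε * T)) y = stopWord ν (ENNReal.ofReal (ε * T)) x ∧
        A + B - t ^ 2 / 4 * min A B <
        ‖A * (Complex.exp (Complex.I * (E u y : ℂ)) * f y) +
          B * (Complex.exp (Complex.I * (E v y : ℂ)) * g y)‖} with hS
  change 2 * ν S ≤ ν Q
  -- Failure of the improved bound at some `y` of the finer cylinder means, by `norm_add_le_of_far`,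
  -- that the two terms nearly coincide at `y` and are not small. By `hosc` this passes to `x`.
  have halign : ∀ x ∈ S, 3 / 4 ≤ ‖f x‖ ∧ ‖Complex.exp (Complex.I * (E u x : ℂ)) * f x -
      Complex.exp (Complex.I * (E v x : ℂ)) * g x‖ ≤ 2 * t := by
    rintro x ⟨⟨hx, hxc⟩, hxQ, y, hy, hyc, hyx, hlt⟩
    have hyQ : y ∈ Q := by
      refine (stop_eq_iff hT).1 ?_
      rw [← (stop_eq_iff hT).2 hxQ]
      exact stop_eq_of_le hT' hT hTT hyx
    have h1 : ¬ (‖Complex.exp (Complex.I * (E u y : ℂ)) * f y‖ ≤ 7 / 8 ∨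
        t ≤ ‖Complex.exp (Complex.I * (E u y : ℂ)) * f y -
          Complex.exp (Complex.I * (E v y : ℂ)) * g y‖) := by
      intro h
      refine absurd (norm_add_le_of_far ?_ ?_ hA.le hB.le ht0.le (by linarith) h) (not_le.2 hlt)
      · rw [norm_mul, norm_exp_I_mul, one_mul]; exact hf1 y hy hyc hyQ
      · rw [norm_mul, norm_exp_I_mul, one_mul]; exact hg1 y hy hyc hyQ
    rw [not_or, not_le, not_le] at h1
    have h2 := hosc u f hu hf1 hf x y hx hy hxc hyc hxQ hyQ hyx
    have h3 := hosc v g hv hg1 hg x y hx hy hxc hyc hxQ hyQ hyx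
    constructor
    · have h4 := norm_sub_norm_le (Complex.exp (Complex.I * (E u y : ℂ)) * f y)
        (Complex.exp (Complex.I * (E u x : ℂ)) * f x)
      rw [norm_sub_rev, norm_mul (Complex.exp (Complex.I * (E u x : ℂ))), norm_exp_I_mul,
        one_mul] at h4
      linarith [h1.1]
    · have h4 : Complex.exp (Complex.I * (E u x : ℂ)) * f x -
          Complex.exp (Complex.I * (E v x : ℂ)) * g x =
          (Complex.exp (Complex.I * (E u x : ℂ)) * f x - Complex.exp (Complex.I * (E u y : ℂ)) * f y)
          + (Complex.exp (Complex.I * (E u y : ℂ)) * f y -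
            Complex.exp (Complex.I * (E v y : ℂ)) * g y) -
          (Complex.exp (Complex.I * (E v x : ℂ)) * g x -
            Complex.exp (Complex.I * (E v y : ℂ)) * g y) := by ring
      rw [h4]
      refine (norm_sub_le _ _).trans ((add_le_add ((norm_add_le _ _).trans
        (add_le_add h2 h1.2.le)) h3).trans ?_)
      linarith
  rcases S.eq_empty_or_nonempty with hSe | ⟨x₁, hx₁⟩
  · rw [hSe, measure_empty, mul_zero]; exact zero_le
  have hx₁' := hx₁
  obtain ⟨⟨hx₁t, hx₁c⟩, hx₁Q, -⟩ := hx₁'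
  -- On the coarse cylinder each phase varies by at most M³, hence their difference by 2M³; this
  -- bounds the number of full turns.
  set J := ⌈M ^ 3⌉₊ + 1 with hJ
  have hJ1 : M ^ 3 ≤ ⌈M ^ 3⌉₊ := Nat.le_ceil _
  have hJ2 : (⌈M ^ 3⌉₊ : ℝ) < M ^ 3 + 1 := Nat.ceil_lt_add_one (by positivity)
  have hJr : 2 * M ^ 3 + 2 * (8 * t) ≤ 2 * Real.pi * J := by
    have h3 := Real.pi_gt_three
    have : (J : ℝ) = ⌈M ^ 3⌉₊ + 1 := by rw [hJ]; push_cast; ring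
    rw [this]
    nlinarith
  have hmain := R.measure_align_le hvar hν hw hp' huv (b := b) (abs_pos.1 hb0) hx₁t.good hx₁c
    (s := 8 * t) (by positivity) hJr
  have hSle : ν S ≤ ENNReal.ofReal ((2 * J + 1) * (M ^ 2 / Λ * (M * (4 * (8 * t) / |b|)))) := by
    refine le_trans (measure_mono fun x hx => ?_) hmain
    have hx' := hx
    obtain ⟨⟨hxt, hxc⟩, hxQ, -⟩ := hx'
    have hV : b * ((Φ.phase u w c (Φ.coding x) - Φ.phase u w c (Φ.coding x₁)) -
        (Φ.phase v w c (Φ.coding x) - Φ.phase v w c (Φ.coding x₁))) =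
        (E u x - E u x₁) - (E v x - E v x₁) := by simp only [hE]; ring
    refine ⟨hxt.good, hxc, ?_, ?_⟩
    · rw [hV]
      have h1 := hdiam x x₁ hxt hx₁t hxQ hx₁Q
      have h2 := hEsub u hu x x₁ hxt hx₁t hxc hx₁c
      have h3 := hEsub v hv x x₁ hxt hx₁t hxc hx₁c
      have h4 : M ^ 2 * (|b| * Λ) * |Φ.coding x - Φ.coding x₁| ^ δ ≤ M ^ 3 := by
        calc _ = M ^ 2 * (|b| * Λ * |Φ.coding x - Φ.coding x₁| ^ δ) := by ring
          _ ≤ M ^ 2 * M := by gcongr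
          _ = _ := by ring
      refine (abs_sub _ _).trans ?_
      linarith
    · rw [hV]
      have hff : ∀ f : (ℕ → 𝒜) → ℂ, (∀ x x', Φ.Typ ν x → Φ.Typ ν x' → x 0 = c → x' 0 = c → x ∈ Q →
          x' ∈ Q → ‖f x - f x'‖ ≤ 4 * M ^ 2 * ε * (|b| * Λ) * |Φ.coding x - Φ.coding x'| ^ δ) →
          ‖f x - f x₁‖ ≤ t := by
        intro f hf
        refine (hf x x₁ hxt hx₁t hxc hx₁c hxQ hx₁Q).trans ?_
        calc _ = 4 * M ^ 2 * ε * (|b| * Λ * |Φ.coding x - Φ.coding x₁| ^ δ) := by ring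
          _ ≤ 4 * M ^ 2 * ε * M := by
            gcongr
            exact hdiam x x₁ hxt hx₁t hxQ hx₁Q
          _ ≤ 10 * M ^ 3 * ε := by
            have : 0 ≤ M ^ 3 * ε := by positivity
            nlinarith
          _ = t := hεt
      exact norm_exp_sub_one_le_of_align (halign x hx).2 (halign x₁ hx₁).2 (hff f hf) (hff g hg)
        (halign x hx).1
  have hQle := le_measure_cyl_stop R.succ (T := ENNReal.ofReal T)
    (by rwa [ENNReal.ofReal_lt_one]) hT hx₀
  refine le_trans ?_ hQle
  calc 2 * ν S ≤ ENNReal.ofReal 2 * ENNReal.ofReal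
        ((2 * J + 1) * (M ^ 2 / Λ * (M * (4 * (8 * t) / |b|)))) := by
        have : (2 : ℝ≥0∞) = ENNReal.ofReal 2 := by simp
        rw [this]
        gcongr
    _ ≤ ENNReal.ofReal M⁻¹ * ENNReal.ofReal T := by
        rw [← ENNReal.ofReal_mul (by positivity), ← ENNReal.ofReal_mul (by positivity)]
        refine ENNReal.ofReal_le_ofReal ?_
        have hTe : T = 1 / (|b| * Λ) := by
          rw [eq_div_iff (by positivity), mul_comm]; exact hbT
        have hJ7 : 2 * (J : ℝ) + 1 ≤ 7 * M ^ 3 := by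
          have : (J : ℝ) = ⌈M ^ 3⌉₊ + 1 := by rw [hJ]; push_cast; ring
          rw [this]; linarith
        -- The factor 2 · 7 · 32 = 448 is below the 512 in `cancel`, so twice the aligned mass is at
        -- most the lower bound M⁻¹T for the mass of the cylinder.
        calc _ ≤ 2 * (7 * M ^ 3 * (M ^ 2 / Λ * (M * (4 * (8 * t) / |b|)))) := by gcongr
          _ = 448 * M ^ 7 * t * (M⁻¹ * T) := by rw [hTe]; field_simp; ring
          _ ≤ 1 * (M⁻¹ * T) := by
            gcongr
            rw [ht, cancel]
            rw [mul_one_div, div_le_one (by positivity)]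
            have : 0 < M ^ 7 := by positivity
            linarith
          _ = _ := one_mul _

end MarkovIFS

/-! ### Majorants on stopping cylinders and one step of the recursion -/

namespace MarkovIFS

variable {𝒜 : Type*} {α : ℝ} {Φ : MarkovIFS 𝒜 α} {φ : (ℕ → 𝒜) → ℝ}
variable [MeasurableSpace 𝒜] {ν : Measure (ℕ → 𝒜)} {δ M : ℝ}

/-- On `[c]`, `h` is a majorant of `F` which is constant on the stopping cylinders of mass `T`, and
controls the `δ`-Hölder oscillation of `F` there. -/
structure Majorant (Φ : MarkovIFS 𝒜 α) (ν : Measure (ℕ → 𝒜)) (δ : ℝ) (c : 𝒜) (E T : ℝ)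
    (F : ℝ → ℂ) (h : (ℕ → 𝒜) → ℝ) : Prop where
  nonneg : ∀ x, 0 ≤ h x
  const : ∀ x x', stopWord ν (ENNReal.ofReal T) x' = stopWord ν (ENNReal.ofReal T) x → h x' = h x
  norm_le : ∀ x, Φ.Typ ν x → x 0 = c → ‖F (Φ.coding x)‖ ≤ h x
  norm_sub_le : ∀ x x', Φ.Typ ν x → Φ.Typ ν x' → x 0 = c → x' 0 = c →
    stopWord ν (ENNReal.ofReal T) x' = stopWord ν (ENNReal.ofReal T) x →
    ‖F (Φ.coding x) - F (Φ.coding x')‖ ≤ E * |Φ.coding x - Φ.coding x'| ^ δ * h x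

variable [DiscreteMeasurableSpace 𝒜]

lemma Majorant.mono [Countable 𝒜] [IsProbabilityMeasure ν] (hν : Φ.IsGibbs φ ν)
    (hatoms : ∀ x : ℝ, Φ.proj ν {x} = 0) {c : 𝒜} {E E' T T' : ℝ} {F : ℝ → ℂ} {h : (ℕ → 𝒜) → ℝ}
    (H : Φ.Majorant ν δ c E T F h) (hE : E ≤ E') (hT' : 0 < T') (hT : T' ≤ T) :
    Φ.Majorant ν δ c E' T' F h := by
  have key : ∀ {x x' : ℕ → 𝒜}, stopWord ν (ENNReal.ofReal T') x' = stopWord ν (ENNReal.ofReal T') x →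
      stopWord ν (ENNReal.ofReal T) x' = stopWord ν (ENNReal.ofReal T) x := fun hxx =>
    stop_eq_of_le (measure_cyl_stop_le hν hatoms (ENNReal.ofReal_pos.2 hT'))
      (measure_cyl_stop_le hν hatoms (ENNReal.ofReal_pos.2 (hT'.trans_le hT)))
      (ENNReal.ofReal_le_ofReal hT) hxx
  refine ⟨H.nonneg, fun x x' hxx => H.const x x' (key hxx), H.norm_le,
    fun x x' hx hx' hc hc' hxx => (H.norm_sub_le x x' hx hx' hc hc' (key hxx)).trans ?_⟩
  have := H.nonneg x
  gcongr

variable [Finite 𝒜]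

/-- At effective frequency `X` the exponentials vary by O(1) on cylinders of mass 1/X, while the
inner sums, whose frequency is smaller by the factor `ratio`, hardly vary there relative to their
majorants. The inner sums thus act as constant amplitudes, and the two words of (MNL) produce the
gain. -/
lemma Regular.exists_majorant_step (R : Φ.Regular φ ν δ M) [IsProbabilityMeasure ν]
    (hnorm : Φ.IsNormalized φ) (hvar : Φ.SummableVariations φ) (hν : Φ.IsGibbs φ ν)
    (hatoms : ∀ x : ℝ, Φ.proj ν {x} = 0) {y : ℕ → 𝒜} (hyS : y ∈ Φ.shiftSpace)
    (hy : ν (cyl [y 0]) ≠ 0) {p' : ℝ} (hp' : p' ∈ Φ.I (y 0)) {w : List 𝒜} (hw : Φ.AdmW w (y 0))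
    {b X : ℝ} (hX : |b| * Real.exp (-(δ * Φ.ta w (y 0) p')) = X) (hX1 : 1 < X) {k L : ℕ}
    (hL : 1 ≤ L) {J : ℝ≥0∞}
    (hmaj : ∀ u : Vec 𝒜 L, Φ.AdmW u.1 (w.headD (y 0)) → ∃ h,
      Φ.Majorant ν δ (y 0) (4 * M ^ 2 * ratio M * X) X⁻¹ (Φ.psi φ y b p' k (u.1 ++ w)) h ∧
      ∫⁻ x in cyl [y 0], ENNReal.ofReal (h x ^ 2) ∂ν ≤ J) :
    ∃ h, Φ.Majorant ν δ (y 0) (4 * M ^ 2 * X) (ratio M * X⁻¹) (Φ.psi φ y b p' (k + L) w) h ∧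
      ∫⁻ x in cyl [y 0], ENNReal.ofReal (h x ^ 2) ∂ν ≤
        ENNReal.ofReal (1 - cancel M ^ 2 / 4 * M⁻¹ ^ L / 32) * J := by
  have hM := R.one_le
  have hX0 : 0 < X := by linarith
  set c := y 0 with hc
  set T := X⁻¹ with hTdef
  have hT0 : 0 < T := by positivity
  have hT1 : T < 1 := inv_lt_one_of_one_lt₀ hX1
  have hr0 := ratio_pos hM
  have hr1 := ratio_le hM
  have hT := measure_cyl_stop_le hν hatoms (ENNReal.ofReal_pos.2 hT0)
  have hT' := measure_cyl_stop_le hν hatoms (ENNReal.ofReal_pos.2 (mul_pos hr0 hT0))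
  have hTT : ENNReal.ofReal (ratio M * T) ≤ ENNReal.ofReal T :=
    ENNReal.ofReal_le_ofReal (mul_le_of_le_one_left hT0.le (by linarith))
  have hT1' : ENNReal.ofReal T < 1 := by rwa [ENNReal.ofReal_lt_one]
  have hgood : ∀ᵐ z ∂ν, Φ.Good z := (ae_typ hvar hν hatoms).mono fun z hz => hz.good
  have happ : app w y ∈ Φ.shiftSpace := Φ.app_mem_shiftSpace.2 ⟨hw, hyS⟩
  set e : Vec 𝒜 L → ℝ := fun u => (Φ.W φ u.1 (app w y)).toReal with he
  have he0 : ∀ u, 0 ≤ e u := fun u => ENNReal.toReal_nonneg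
  have he1 : ∑ u, e u = 1 := sum_W_toReal hnorm happ L
  have headm : ∀ u, e u ≠ 0 → Φ.AdmW u.1 (w.headD c) := fun u hu =>
    admW_of_W_ne_zero happ fun h0 => hu ((congrArg ENNReal.toReal h0).trans ENNReal.toReal_zero)
  choose h₀ hh₀ hJ₀ using hmaj
  classical
  -- Words that are not admissible have weight zero, so the value 0 of the majorant is never used.
  set h : Vec 𝒜 L → (ℕ → 𝒜) → ℝ := fun u =>
    if hu : Φ.AdmW u.1 (w.headD c) then h₀ u hu else 0 with hh
  have hmaj : ∀ u, Φ.AdmW u.1 (w.headD c) →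
      Φ.Majorant ν δ c (4 * M ^ 2 * ratio M * X) T (Φ.psi φ y b p' k (u.1 ++ w)) (h u) := by
    intro u hu
    simp only [hh, dif_pos hu]
    exact hh₀ u hu
  have hJ : ∀ u, ∫⁻ x in cyl [c], ENNReal.ofReal (h u x ^ 2) ∂ν ≤ J := by
    intro u
    simp only [hh]
    split_ifs with hu
    · exact hJ₀ u hu
    · simp
  have hnn : ∀ u x, 0 ≤ h u x := by
    intro u x
    simp only [hh]
    split_ifs with hu
    · exact (hh₀ u hu).nonneg x
    · simp
  have hconst : ∀ u x x', stopWord ν (ENNReal.ofReal T) x' = stopWord ν (ENNReal.ofReal T) x →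
      h u x' = h u x := by
    intro u x x' hxx
    simp only [hh]
    split_ifs with hu
    · exact (hh₀ u hu).const x x' hxx
    · simp
  set U : Vec 𝒜 L → (ℕ → 𝒜) → ℂ := fun u x => Complex.exp (Complex.I *
    ((b * (Φ.phase u.1 w c (Φ.coding x) - Φ.phase u.1 w c p') : ℝ) : ℂ)) with hU
  set P : Vec 𝒜 L → (ℕ → 𝒜) → ℂ := fun u x => Φ.psi φ y b p' k (u.1 ++ w) (Φ.coding x) with hP
  have hZ : ∀ u x, Φ.Typ ν x → x 0 = c → ‖(e u : ℂ) * U u x * P u x‖ ≤ e u * h u x := by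
    intro u x hx hxc
    by_cases hu : e u = 0
    · simp [hu]
    · rw [norm_mul, norm_mul, hU, norm_exp_I_mul, mul_one, Complex.norm_of_nonneg (he0 u)]
      exact mul_le_mul_of_nonneg_left ((hmaj u (headm u hu)).norm_le x hx hxc) (he0 u)
  obtain ⟨u, v, hu, hv, huv⟩ := R.nonlin L hL (w.headD c)
  have hne : u ≠ v := fun huv' =>
    R.words_ne hvar hν hgood hw hp' hy (u := u.1) (v := v.1) huv (by rw [huv'])
  have hmge : ∀ u : Vec 𝒜 L, Φ.AdmW u.1 (w.headD c) → M⁻¹ ^ L ≤ e u := by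
    intro u hu
    have h1 := R.W_ge (u := u.1) (z := app w y)
      (Φ.app_mem_shiftSpace.2 ⟨by rw [app_zero]; exact hu, happ⟩)
    rwa [u.2] at h1
  have hbad : ∀ x₀, Φ.Typ ν x₀ → x₀ 0 = c → 0 < h u x₀ → 0 < h v x₀ →
      2 * ν {x | Φ.Typ ν x ∧ x ∈ cyl (stopWord ν (ENNReal.ofReal T) x₀) ∧ ∃ y, Φ.Typ ν y ∧ y 0 = c ∧
        stopWord ν (ENNReal.ofReal (ratio M * T)) y = stopWord ν (ENNReal.ofReal (ratio M * T)) x ∧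
        e u * h u x₀ + e v * h v x₀ - cancel M ^ 2 / 4 * min (e u * h u x₀) (e v * h v x₀) <
          ‖(e u : ℂ) * U u y * P u y + (e v : ℂ) * U v y * P v y‖} ≤
      ν (cyl (stopWord ν (ENNReal.ofReal T) x₀)) := by
    intro x₀ hx₀ hx₀c hu0 hv0
    have hm0 : 0 < M⁻¹ ^ L := by positivity
    have h1 : ∀ u : Vec 𝒜 L, Φ.AdmW u.1 (w.headD c) → 0 < h u x₀ →
        ∀ x, Φ.Typ ν x → x 0 = c → x ∈ cyl (stopWord ν (ENNReal.ofReal T) x₀) →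
          ‖P u x / h u x₀‖ ≤ 1 := by
      intro u hu hu0 x hx hxc hxx
      rw [norm_div, Complex.norm_of_nonneg hu0.le, div_le_one hu0,
        ← hconst u x₀ x ((stop_eq_iff hT).2 hxx)]
      exact (hmaj u hu).norm_le x hx hxc
    have h2 : ∀ u : Vec 𝒜 L, Φ.AdmW u.1 (w.headD c) → 0 < h u x₀ →
        ∀ x x', Φ.Typ ν x → Φ.Typ ν x' → x 0 = c → x' 0 = c →
          x ∈ cyl (stopWord ν (ENNReal.ofReal T) x₀) → x' ∈ cyl (stopWord ν (ENNReal.ofReal T) x₀) →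
          ‖P u x / h u x₀ - P u x' / h u x₀‖ ≤ 4 * M ^ 2 * ratio M *
            (|b| * Real.exp (-(δ * Φ.ta w c p'))) * |Φ.coding x - Φ.coding x'| ^ δ := by
      intro u hu hu0 x x' hx hx' hxc hxc' hxx hxx'
      rw [← sub_div, norm_div, Complex.norm_of_nonneg hu0.le, div_le_iff₀ hu0,
        ← hconst u x₀ x ((stop_eq_iff hT).2 hxx), hX]
      exact (hmaj u hu).norm_sub_le x x' hx hx' hxc hxc'
        (((stop_eq_iff hT).2 hxx').trans ((stop_eq_iff hT).2 hxx).symm)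
    have h3 := R.measure_bad_le hvar hν hw hp' hu hv huv hT0 hT1
      (by rw [hX, hTdef, mul_inv_cancel₀ hX0.ne']) hT hT'
      (mul_pos (hm0.trans_le (hmge u hu)) hu0) (mul_pos (hm0.trans_le (hmge v hv)) hv0) hx₀
      (h1 u hu hu0) (h1 v hv hv0) (h2 u hu hu0) (h2 v hv hv0)
    refine le_trans (mul_le_mul' le_rfl (measure_mono ?_)) h3
    rintro x ⟨hx, hxx, z, hz, hzc, hzx, hlt⟩
    have hxc : x 0 = c := by
      have h4 := mem_cyl_stop_iff.1 hxx
      have h5 := pre_eq_of_le (one_le_stopLen hT hT1') h4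
      rw [← hx₀c]
      simpa [pre] using h5
    refine ⟨⟨hx, hxc⟩, hxx, z, hz, hzc, hzx, hlt.trans_eq ?_⟩
    have hu0' : (h u x₀ : ℂ) ≠ 0 := Complex.ofReal_ne_zero.2 hu0.ne'
    have hv0' : (h v x₀ : ℂ) ≠ 0 := Complex.ofReal_ne_zero.2 hv0.ne'
    congr 1
    simp only [hU]
    push_cast
    field_simp
  have hcan := cancel_le hM
  have hcan0 := cancel_pos hM
  obtain ⟨g, hg1, hg2, hg3, hg4⟩ := exists_improved_majorant hT hT' hTT hT1'
    (ae_typ hvar hν hatoms) (d := c) he0 he1 hnn hconst hZ hne (m := M⁻¹ ^ L)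
    (c := cancel M ^ 2 / 4) (by positivity) (pow_le_one₀ (by positivity) (inv_le_one_of_one_le₀ hM))
    (hmge u hu) (hmge v hv) (by positivity) (by nlinarith) hbad
  refine ⟨g, ⟨fun x => ?_, hg2, fun x hx hxc => ?_, fun x x' hx hx' hxc hxc' hxx => ?_⟩,
    hg4.trans (mul_le_mul' le_rfl ?_)⟩
  · have h1 : 0 ≤ ∑ u, e u * h u x := Finset.sum_nonneg fun u _ => mul_nonneg (he0 u) (hnn u x)
    linarith [hg1 x]
  · rw [psi_add]
    exact hg3 x hx hxc
  · set D := |Φ.coding x - Φ.coding x'| ^ δ with hD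
    have hD0 : 0 ≤ D := by positivity
    have hxT : stopWord ν (ENNReal.ofReal T) x' = stopWord ν (ENNReal.ofReal T) x :=
      stop_eq_of_le hT' hT hTT hxx
    rw [psi_add, psi_add, ← Finset.sum_sub_distrib]
    -- Since 4 `ratio` ≤ 1, exponential and amplitude together contribute the constant 2M²X. The new
    -- majorant is at least half the average of the old ones, which yields the constant 4 that the
    -- induction carries.
    calc _ ≤ ∑ u, e u * (2 * M ^ 2 * X * D * h u x) := by
          refine norm_sum_le_of_le _ fun u _ => ?_
          by_cases hu : e u = 0
          · have : (Φ.W φ u.1 (app w y)).toReal = 0 := hu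
            simp [this, hu]
          have hua := headm u hu
          have e1 : (e u : ℂ) * U u x * P u x - (e u : ℂ) * U u x' * P u x' =
              (e u : ℂ) * ((U u x - U u x') * P u x + U u x' * (P u x - P u x')) := by ring
          change ‖(e u : ℂ) * U u x * P u x - (e u : ℂ) * U u x' * P u x'‖ ≤ _
          rw [e1, norm_mul, Complex.norm_of_nonneg (he0 u)]
          refine mul_le_mul_of_nonneg_left ?_ (he0 u)
          have h1 : ‖U u x - U u x'‖ ≤ M ^ 2 * X * D := by
            refine (norm_exp_sub_exp_le _ _).trans ?_
            have h2 := R.abs_phase_sub_le hua hw hp' (hxc ▸ hx.good.2) (hxc' ▸ hx'.good.2)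
            have h3 : b * (Φ.phase u.1 w c (Φ.coding x) - Φ.phase u.1 w c p') -
              b * (Φ.phase u.1 w c (Φ.coding x') - Φ.phase u.1 w c p') =
              b * (Φ.phase u.1 w c (Φ.coding x) - Φ.phase u.1 w c (Φ.coding x')) := by ring
            rw [h3, abs_mul]
            calc _ ≤ |b| * (M ^ 2 * Real.exp (-(δ * Φ.ta w c p')) * D) := by gcongr
              _ = _ := by rw [← hX]; ring
          have h2 : ‖P u x‖ ≤ h u x := (hmaj u hua).norm_le x hx hxc
          have h3 : ‖P u x - P u x'‖ ≤ 4 * M ^ 2 * ratio M * X * D * h u x :=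
            (hmaj u hua).norm_sub_le x x' hx hx' hxc hxc' hxT
          have h4 := hnn u x
          calc _ ≤ M ^ 2 * X * D * h u x + 1 * (4 * M ^ 2 * ratio M * X * D * h u x) := by
                refine (norm_add_le _ _).trans (add_le_add ?_ ?_)
                · rw [norm_mul]; gcongr
                · rw [norm_mul, hU, norm_exp_I_mul]; gcongr
            _ = M ^ 2 * X * D * h u x * (1 + 4 * ratio M) := by ring
            _ ≤ M ^ 2 * X * D * h u x * 2 := by gcongr; linarith
            _ = _ := by ring
      _ = 2 * M ^ 2 * X * D * ∑ u, e u * h u x := by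
          rw [Finset.mul_sum]
          exact Finset.sum_congr rfl fun u _ => by ring
      _ ≤ 2 * M ^ 2 * X * D * (2 * g x) := by gcongr; exact hg1 x
      _ = _ := by ring
  -- A convex combination of the old squared norms.
  · calc _ ≤ ∑ u, ENNReal.ofReal (e u) * J := by gcongr with u; exact hJ u
      _ = J := by
        rw [← Finset.sum_mul, ← ENNReal.ofReal_sum_of_nonneg fun u _ => he0 u, he1,
          ENNReal.ofReal_one, one_mul]

end MarkovIFS

/-! ### Iteration and mean-square decay -/

namespace MarkovIFS

variable {𝒜 : Type*} {α : ℝ} {Φ : MarkovIFS 𝒜 α} {φ : (ℕ → 𝒜) → ℝ}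
variable [MeasurableSpace 𝒜] {ν : Measure (ℕ → 𝒜)} {δ M : ℝ}

lemma Regular.exists_contraction_length (R : Φ.Regular φ ν δ M) : ∃ L, 1 ≤ L ∧
    ∀ (u : Vec 𝒜 L) (w : List 𝒜) (c : 𝒜), Φ.AdmW u.1 (w.headD c) → Φ.AdmW w c → ∀ p ∈ Φ.I c,
      Real.exp (-(δ * Φ.ta (u.1 ++ w) c p)) ≤ ratio M * Real.exp (-(δ * Φ.ta w c p)) := by
  obtain ⟨κ, hκ⟩ := Φ.exists_contr
  have hκδ : κ ^ δ < 1 := Real.rpow_lt_one hκ.1.le hκ.2.1 R.pos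
  obtain ⟨n, hn⟩ := exists_pow_lt_of_lt_one (ratio_pos R.one_le) hκδ
  have hκ0 : 0 ≤ κ ^ δ := Real.rpow_nonneg hκ.1.le _
  refine ⟨n + 1, by omega, fun u w c hu hw p hp => ?_⟩
  rw [ta_append, mul_add, neg_add, Real.exp_add]
  refine mul_le_mul_of_nonneg_right ?_ (Real.exp_pos _).le
  have h1 := hκ.exp_neg_ta_le hu (Φ.G_mem hw hp)
  have h2 : -(δ * Φ.ta u.1 (w.headD c) (Φ.G w c p)) = -Φ.ta u.1 (w.headD c) (Φ.G w c p) * δ := by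
    ring
  rw [h2, Real.exp_mul]
  calc _ ≤ (κ ^ u.1.length) ^ δ := Real.rpow_le_rpow (Real.exp_pos _).le h1 R.pos.le
    _ = (κ ^ δ) ^ (n + 1) := by
      rw [u.2, ← Real.rpow_natCast, ← Real.rpow_mul hκ.1.le, mul_comm, Real.rpow_mul hκ.1.le,
        Real.rpow_natCast]
    _ ≤ (κ ^ δ) ^ n := pow_le_pow_of_le_one hκ0 hκδ.le (by omega)
    _ ≤ _ := hn.le

variable [DiscreteMeasurableSpace 𝒜] [Finite 𝒜]

/-- Each block multiplies the squared norm by a fixed factor below 1. The step needs effective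
frequency above 1, so that the threshold 1/X is below 1; by the lower bound M⁻¹ per letter, `hb`
secures this for all K blocks. -/
lemma Regular.exists_majorant (R : Φ.Regular φ ν δ M) [IsProbabilityMeasure ν]
    (hnorm : Φ.IsNormalized φ) (hvar : Φ.SummableVariations φ) (hν : Φ.IsGibbs φ ν)
    (hatoms : ∀ x : ℝ, Φ.proj ν {x} = 0) {L : ℕ} (hL : 1 ≤ L)
    (hcontr : ∀ (u : Vec 𝒜 L) (w : List 𝒜) (c : 𝒜), Φ.AdmW u.1 (w.headD c) → Φ.AdmW w c →
      ∀ p ∈ Φ.I c,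
      Real.exp (-(δ * Φ.ta (u.1 ++ w) c p)) ≤ ratio M * Real.exp (-(δ * Φ.ta w c p)))
    {y : ℕ → 𝒜} (hyS : y ∈ Φ.shiftSpace)
    (hy : ν (cyl [y 0]) ≠ 0) {p' : ℝ} (hp' : p' ∈ Φ.I (y 0)) {b : ℝ} (k K : ℕ) (w : List 𝒜)
    (hw : Φ.AdmW w (y 0)) (hb : 1 < |b| * M⁻¹ ^ (w.length + K * L)) :
    ∃ h, Φ.Majorant ν δ (y 0) (4 * M ^ 2 * (|b| * Real.exp (-(δ * Φ.ta w (y 0) p'))))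
        (ratio M * (|b| * Real.exp (-(δ * Φ.ta w (y 0) p')))⁻¹)
        (Φ.psi φ y b p' (k + K * L) w) h ∧
      ∫⁻ x in cyl [y 0], ENNReal.ofReal (h x ^ 2) ∂ν ≤
        ENNReal.ofReal (1 - cancel M ^ 2 / 4 * M⁻¹ ^ L / 32) ^ K := by
  have hM := R.one_le
  have hM' : M⁻¹ ≤ 1 := inv_le_one_of_one_le₀ hM
  have hM0 : 0 < M⁻¹ := by positivity
  have hr0 := ratio_pos hM
  have hb0 : 0 < |b| := by
    rcases (abs_nonneg b).eq_or_lt with h | h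
    · rw [← h] at hb; simp at hb; linarith
    · exact h
  induction K generalizing w with
  | zero =>
    have happ : app w y ∈ Φ.shiftSpace := Φ.app_mem_shiftSpace.2 ⟨hw, hyS⟩
    refine ⟨fun _ => 1, ⟨fun _ => zero_le_one, fun _ _ _ => rfl,
      fun x _ _ => norm_psi_le_one hnorm happ _ _ _ _, fun x x' hx hx' hc hc' _ => ?_⟩, ?_⟩
    · refine (R.norm_psi_sub_le hnorm hyS hw hp' (hc ▸ hx.good.2) (hc' ▸ hx'.good.2) _ _).trans ?_
      rw [mul_one]
      gcongr
      nlinarith [sq_nonneg M]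
    · simp only [one_pow, ENNReal.ofReal_one, lintegral_const, Measure.restrict_apply_univ, one_mul,
        pow_zero]
      exact prob_le_one
  | succ K ih =>
    have hX1 : 1 < |b| * Real.exp (-(δ * Φ.ta w (y 0) p')) := by
      refine hb.trans_le ?_
      gcongr
      exact (pow_le_pow_of_le_one hM0.le hM' (by omega)).trans (R.lower w _ hw p' hp')
    have hk : k + (K + 1) * L = k + K * L + L := by ring
    rw [hk, pow_succ' _ K]
    refine R.exists_majorant_step hnorm hvar hν hatoms hyS hy hp' hw rfl hX1 hL fun u hu => ?_
    have huw : Φ.AdmW (u.1 ++ w) (y 0) := Φ.admW_append.2 ⟨hu, hw⟩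
    obtain ⟨h, hh, hJ⟩ := ih (u.1 ++ w) huw (by
      have e : (u.1 ++ w).length + K * L = w.length + (K + 1) * L := by
        rw [List.length_append, u.2]; ring
      rwa [e])
    have hc := hcontr u w (y 0) hu hw p' hp'
    -- A longer word has effective frequency at most `ratio` times X: its majorant oscillates less
    -- and is constant on cylinders coarser than those of mass 1/X.
    refine ⟨h, hh.mono hν hatoms ?_ (by positivity) ?_, hJ⟩
    · calc _ ≤ 4 * M ^ 2 * (|b| * (ratio M * Real.exp (-(δ * Φ.ta w (y 0) p')))) := by gcongr
        _ = _ := by ring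
    · rw [← div_eq_mul_inv, le_div_iff₀ (by positivity), inv_mul_eq_div, div_le_iff₀ (by positivity)]
      calc _ ≤ |b| * (ratio M * Real.exp (-(δ * Φ.ta w (y 0) p'))) := by gcongr
        _ = _ := by ring

/-- The number of steps is limited both by the frequency and by the length of the words. The smaller
limit is taken, and each of them accounts for one summand. -/
lemma exists_min_pow_le {q s : ℝ} (hq : 1 < q) (hs : 0 < s) (hs1 : s < 1) {L : ℕ} (hL : 1 ≤ L) :
    ∃ C ε ρ : ℝ, 1 ≤ C ∧ 0 < ε ∧ ε ≤ 1 ∧ 0 < ρ ∧ ρ < 1 ∧ ∀ x : ℝ, 1 < x → ∀ m : ℕ,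
      ∃ K, q ^ K ≤ x ∧ K * L ≤ m ∧ s ^ K ≤ C * (x ^ (-ε) + ρ ^ m) := by
  have hlq : 0 < Real.log q := Real.log_pos hq
  have hls : Real.log s < 0 := Real.log_neg hs hs1
  set ε := min 1 (-Real.log s / Real.log q) with hε
  have hε0 : 0 < ε := lt_min one_pos (div_pos (by linarith) hlq)
  have hL0 : (0 : ℝ) < L := by exact_mod_cast hL
  have hqs : s ≤ q ^ (-ε) := by
    rw [← Real.log_le_log_iff hs (by positivity), Real.log_rpow (by linarith)]
    have h1 : ε ≤ -Real.log s / Real.log q := min_le_right _ _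
    rw [le_div_iff₀ hlq] at h1
    linarith
  refine ⟨s⁻¹, ε, s ^ ((L : ℝ)⁻¹), (one_le_inv₀ hs).2 hs1.le, hε0, min_le_left _ _,
    Real.rpow_pos_of_pos hs _, Real.rpow_lt_one hs.le hs1 (by positivity), fun x hx m => ?_⟩
  obtain ⟨n, hn1, hn2⟩ := exists_nat_pow_near hx.le hq
  have hx0 : 0 < x := by linarith
  refine ⟨min n (m / L), ?_, ?_, ?_⟩
  · exact (pow_le_pow_right₀ hq.le (min_le_left _ _)).trans hn1
  · exact (Nat.mul_le_mul_right L (min_le_right _ _)).trans (Nat.div_mul_le_self m L)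
  · have h1 : s ^ n ≤ s⁻¹ * x ^ (-ε) := by
      rw [inv_mul_eq_div, le_div_iff₀ hs, ← pow_succ]
      calc s ^ (n + 1) ≤ (q ^ (-ε)) ^ (n + 1) := by gcongr
        _ = (q ^ (n + 1)) ^ (-ε) := by
          rw [← Real.rpow_natCast, ← Real.rpow_mul (by linarith), mul_comm,
            Real.rpow_mul (by linarith), Real.rpow_natCast]
        _ ≤ x ^ (-ε) := Real.rpow_le_rpow_of_nonpos hx0 hn2.le (by linarith)
    have h2 : s ^ (m / L) ≤ s⁻¹ * (s ^ ((L : ℝ)⁻¹)) ^ m := by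
      rw [inv_mul_eq_div, le_div_iff₀ hs, ← pow_succ, ← Real.rpow_natCast, ← Real.rpow_natCast,
        ← Real.rpow_mul hs.le]
      refine Real.rpow_le_rpow_of_exponent_ge hs hs1.le ?_
      rw [inv_mul_eq_div, div_le_iff₀ hL0]
      have h3 := Nat.lt_div_mul_add (a := m) (b := L) (by omega)
      have h4 : (m : ℝ) ≤ ((m / L : ℕ) : ℝ) * L + L := by exact_mod_cast h3.le
      push_cast
      linarith
    rw [mul_add]
    have h5 : 0 ≤ s⁻¹ * x ^ (-ε) := by positivity
    have h6 : 0 ≤ s⁻¹ * (s ^ ((L : ℝ)⁻¹)) ^ m := by positivity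
    rcases le_total n (m / L) with h | h
    · rw [min_eq_left h]; linarith
    · rw [min_eq_right h]; linarith

/-- Decay of the characteristic functions of the fluctuations in mean square. -/
theorem Regular.exists_lintegral_norm_psi_sq_le (R : Φ.Regular φ ν δ M) [IsProbabilityMeasure ν]
    (hnorm : Φ.IsNormalized φ) (hvar : Φ.SummableVariations φ) (hν : Φ.IsGibbs φ ν)
    (hatoms : ∀ x : ℝ, Φ.proj ν {x} = 0) : ∃ C ε ρ : ℝ, 1 ≤ C ∧ 0 < ε ∧ ε ≤ 1 ∧ 0 < ρ ∧ ρ < 1 ∧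
      ∀ y ∈ Φ.shiftSpace, ν (cyl [y 0]) ≠ 0 → ∀ p' ∈ Φ.I (y 0), ∀ b : ℝ, 1 < |b| → ∀ m : ℕ,
        ∫⁻ x in cyl [y 0], ENNReal.ofReal (‖Φ.psi φ y b p' m [] (Φ.coding x)‖ ^ 2) ∂ν ≤
          ENNReal.ofReal (C * (|b| ^ (-ε) + ρ ^ m)) := by
  have hM := R.one_le
  obtain ⟨L, hL, hcontr⟩ := R.exists_contraction_length
  have hcan0 := cancel_pos hM
  have hcan := cancel_le hM
  have hML : M⁻¹ ^ L ≤ 1 := pow_le_one₀ (by positivity) (inv_le_one_of_one_le₀ hM)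
  have hML0 : 0 < M⁻¹ ^ L := by positivity
  set s := 1 - cancel M ^ 2 / 4 * M⁻¹ ^ L / 32 with hs
  have hη : 0 < cancel M ^ 2 / 4 * M⁻¹ ^ L / 32 := by positivity
  have hη1 : cancel M ^ 2 / 4 * M⁻¹ ^ L / 32 < 1 := by
    have : cancel M ^ 2 / 4 * M⁻¹ ^ L ≤ 1 * 1 := by gcongr; nlinarith
    linarith
  -- The base (M + 1)^L instead of M^L exceeds 1 even if M = 1, and it makes the frequency condition
  -- strict.
  obtain ⟨C, ε, ρ, hC, hε, hε1, hρ, hρ1, h⟩ := exists_min_pow_le (q := (M + 1) ^ L) (s := s)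
    (one_lt_pow₀ (by linarith) (by omega)) (by linarith) (by linarith) hL
  refine ⟨C, ε, ρ, hC, hε, hε1, hρ, hρ1, fun y hyS hy p' hp' b hb m => ?_⟩
  obtain ⟨K, hK1, hK2, hK3⟩ := h |b| hb m
  obtain ⟨k, rfl⟩ := Nat.exists_eq_add_of_le' hK2
  have hbK : 1 < |b| * M⁻¹ ^ (([] : List 𝒜).length + K * L) := by
    rw [List.length_nil, zero_add, inv_pow, ← div_eq_mul_inv, lt_div_iff₀ (by positivity), one_mul]
    rcases Nat.eq_zero_or_pos K with h0 | h0
    · subst h0; simpa using hb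
    · refine lt_of_lt_of_le ?_ hK1
      rw [← pow_mul, mul_comm L K]
      exact pow_lt_pow_left₀ (by linarith) (by linarith) (Nat.mul_pos h0 hL).ne'
  obtain ⟨g, hg, hJ⟩ := R.exists_majorant hnorm hvar hν hatoms hL hcontr hyS hy hp' k K [] trivial
    hbK
  calc _ ≤ ∫⁻ x in cyl [y 0], ENNReal.ofReal (g x ^ 2) ∂ν := by
        refine setLIntegral_mono_ae' (measurableSet_cyl _) ?_
        filter_upwards [ae_typ hvar hν hatoms] with x hx hxc
        have := hg.norm_le x hx (mem_cyl_singleton.1 hxc)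
        gcongr
    _ ≤ _ := hJ
    _ ≤ _ := by
      rw [← ENNReal.ofReal_pow (by linarith)]
      exact ENNReal.ofReal_le_ofReal hK3

end MarkovIFS

/-! ### From characteristic functions to concentration functions -/

lemma integral_exp_gaussianReal (r x : ℝ) :
    ∫ b, Complex.exp (Complex.I * ((b * x : ℝ) : ℂ))
      ∂(ProbabilityTheory.gaussianReal 0 (Real.toNNReal (r⁻¹ ^ 2))) =
      (Real.exp (-((r⁻¹ * x) ^ 2 / 2)) : ℂ) := by
  have h := ProbabilityTheory.charFun_gaussianReal (μ := 0) (v := Real.toNNReal (r⁻¹ ^ 2)) x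
  rw [charFun_apply_real] at h
  have h1 : ∀ b : ℝ, Complex.exp (Complex.I * ((b * x : ℝ) : ℂ)) = Complex.exp (x * b * Complex.I) := by
    intro b; congr 1; push_cast; ring
  simp_rw [h1, h, Real.coe_toNNReal _ (sq_nonneg r⁻¹)]
  push_cast
  congr 1
  ring

/-- With standard deviation 1/r the density is at most r/2, so low frequencies carry little mass. -/
lemma gaussianReal_abs_le {r B : ℝ} (hr : 0 < r) (hB : 0 ≤ B) :
    ProbabilityTheory.gaussianReal 0 (Real.toNNReal (r⁻¹ ^ 2)) {b | |b| ≤ B} ≤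
      ENNReal.ofReal (r * B) := by
  have hv : Real.toNNReal (r⁻¹ ^ 2) ≠ 0 := by
    rw [Ne, Real.toNNReal_eq_zero, not_le]; positivity
  have hset : {b : ℝ | |b| ≤ B} = Icc (-B) B := by
    ext b; simp [abs_le]
  rw [hset, ProbabilityTheory.gaussianReal_apply 0 hv]
  have hpdf : ∀ b, ProbabilityTheory.gaussianPDF 0 (Real.toNNReal (r⁻¹ ^ 2)) b ≤
      ENNReal.ofReal (r / 2) := by
    intro b
    rw [ProbabilityTheory.gaussianPDF]
    refine ENNReal.ofReal_le_ofReal ?_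
    rw [ProbabilityTheory.gaussianPDFReal, Real.coe_toNNReal _ (sq_nonneg r⁻¹)]
    have h1 : 2 * r⁻¹ ≤ Real.sqrt (2 * Real.pi * r⁻¹ ^ 2) := by
      refine Real.le_sqrt_of_sq_le ?_
      have := Real.pi_gt_three
      have : 0 < r⁻¹ ^ 2 := by positivity
      nlinarith
    calc _ ≤ (2 * r⁻¹)⁻¹ * 1 := by
          gcongr
          refine Real.exp_le_one_iff.2 ?_
          exact div_nonpos_of_nonpos_of_nonneg (by simp [sq_nonneg]) (by positivity)
      _ = r / 2 := by field_simp
  calc _ ≤ ∫⁻ _ in Icc (-B) B, ENNReal.ofReal (r / 2) := lintegral_mono fun b => hpdf b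
    _ = ENNReal.ofReal (r * B) := by
      rw [setLIntegral_const, Real.volume_Icc, ← ENNReal.ofReal_mul (by positivity)]
      congr 1; ring

/-! ### Gaussian smoothing of the window -/

namespace MarkovIFS

variable {𝒜 : Type*} {α : ℝ} {Φ : MarkovIFS 𝒜 α} {φ : (ℕ → 𝒜) → ℝ} [Finite 𝒜]

/-- The characteristic function of the fluctuation of a random inverse branch of length `m`. -/
noncomputable def chi (Φ : MarkovIFS 𝒜 α) (φ : (ℕ → 𝒜) → ℝ) (y : ℕ → 𝒜) (p : ℝ) (m : ℕ)
    (b x : ℝ) : ℂ :=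
  ∑ v : Vec 𝒜 m, ((Φ.W φ v.1 y).toReal : ℂ) * Complex.exp (Complex.I *
    ((b * (Φ.tau (v.1 ++ [y 0]) x - Φ.tau (v.1 ++ [y 0]) p) : ℝ) : ℂ))

/-- `psi` is built from compositions, whose behaviour off the intervals is uncontrolled. `chi` uses
the derivative of the whole branch, which is a measurable function in any case; the two agree where
they matter. -/
lemma chi_eq_psi {y : ℕ → 𝒜} (hy : y ∈ Φ.shiftSpace) {p x : ℝ} (hp : p ∈ Φ.I (y 0))
    (hx : x ∈ Φ.I (y 0)) (m : ℕ) (b : ℝ) : Φ.chi φ y p m b x = Φ.psi φ y b p m [] x := by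
  refine Finset.sum_congr rfl fun v _ => ?_
  by_cases h0 : Φ.W φ v.1 y = 0
  · rw [h0, show Φ.W φ v.1 (app [] y) = 0 from h0]; simp
  · have hv : Φ.AdmW v.1 (y 0) := admW_of_W_ne_zero (w := []) hy h0
    rw [tau_eq_ta _ hv hx, tau_eq_ta _ hv hp]
    rfl

lemma measurable_chi (y : ℕ → 𝒜) (p : ℝ) (m : ℕ) :
    Measurable fun q : ℝ × ℝ => Φ.chi φ y p m q.1 q.2 := by
  have ht : ∀ w, Measurable (Φ.tau w) := fun w =>
    (Real.measurable_log.comp (measurable_deriv _).abs).neg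
  refine Finset.measurable_sum _ fun v _ => measurable_const.mul
    (Complex.measurable_exp.comp (measurable_const.mul (Complex.measurable_ofReal.comp ?_)))
  exact measurable_fst.mul (((ht _).comp measurable_snd).sub_const _)

lemma norm_chi_le_one (hnorm : Φ.IsNormalized φ) {y : ℕ → 𝒜} (hy : y ∈ Φ.shiftSpace) (p : ℝ)
    (m : ℕ) (b x : ℝ) : ‖Φ.chi φ y p m b x‖ ≤ 1 := by
  rw [← sum_W_toReal hnorm hy m]
  refine norm_sum_le_of_le _ fun v _ => ?_
  rw [norm_mul, norm_exp_I_mul, mul_one, Complex.norm_of_nonneg ENNReal.toReal_nonneg]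

/-- The indicator of a window of length `r` is at most `e` times a Gaussian of width `r` around its
centre, which is the Fourier transform of a Gaussian law of width 1/r. The centre enters only
through a factor of modulus 1, so the bound is uniform in the window. -/
lemma concS_le_lintegral_chi {y : ℕ → 𝒜} (hy : y ∈ Φ.shiftSpace) {p p' : ℝ}
    (hp : p ∈ Φ.I (y 0)) (hp' : p' ∈ Φ.I (y 0)) (m : ℕ) {r : ℝ} (hr : 0 < r) :
    Φ.concS φ m y p p' r ≤ ENNReal.ofReal (Real.exp 1) * ∫⁻ b, ‖Φ.chi φ y p m b p'‖ₑ
      ∂(ProbabilityTheory.gaussianReal 0 (Real.toNNReal (r⁻¹ ^ 2))) := by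
  classical
  refine iSup_le fun t => ?_
  set γ := ProbabilityTheory.gaussianReal 0 (Real.toNNReal (r⁻¹ ^ 2)) with hγ
  set e : Vec 𝒜 m → ℝ := fun v => (Φ.W φ v.1 y).toReal with he
  set x : Vec 𝒜 m → ℝ := fun v => Φ.tau (v.1 ++ [y 0]) p' - Φ.tau (v.1 ++ [y 0]) p with hx
  have he0 : ∀ v, 0 ≤ e v := fun v => ENNReal.toReal_nonneg
  set S := ∑ v, e v * Real.exp (-((r⁻¹ * (x v + (t + r / 2))) ^ 2 / 2)) with hS
  have h1 : Φ.conc φ m y p p' t r ≤ ENNReal.ofReal (Real.exp 1 * S) := by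
    rw [conc, tsum_fintype, hS, Finset.mul_sum, ENNReal.ofReal_sum_of_nonneg fun v _ =>
      mul_nonneg (Real.exp_pos _).le (mul_nonneg (he0 v) (Real.exp_pos _).le)]
    refine Finset.sum_le_sum fun v _ => ?_
    split_ifs with hv
    · by_cases h0 : Φ.W φ v.1 y = 0
      · rw [h0]; exact zero_le
      have hadm : Φ.AdmW v.1 (y 0) := admW_of_W_ne_zero (w := []) hy h0
      rw [← ENNReal.ofReal_toReal (Φ.W_ne_top (φ := φ) (w := v.1) (z := y))]
      refine ENNReal.ofReal_le_ofReal ?_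
      have h2 : |r⁻¹ * (x v + (t + r / 2))| ≤ 1 := by
        have h3 : |x v + (t + r / 2)| ≤ r := by
          simp only [hx]
          rw [tau_eq_ta _ hadm hp, tau_eq_ta _ hadm hp', abs_le]
          constructor <;> linarith [hv.1, hv.2]
        rw [abs_mul, abs_of_pos (inv_pos.2 hr), inv_mul_eq_div, div_le_one hr]
        exact h3
      have h4 : (r⁻¹ * (x v + (t + r / 2))) ^ 2 ≤ 1 := by
        rw [← sq_abs]; exact pow_le_one₀ (abs_nonneg _) h2
      calc (Φ.W φ v.1 y).toReal = e v * 1 := (mul_one _).symm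
        _ ≤ e v * Real.exp (1 + -((r⁻¹ * (x v + (t + r / 2))) ^ 2 / 2)) := by
          have := he0 v
          gcongr
          exact Real.one_le_exp (by linarith)
        _ = _ := by rw [Real.exp_add]; ring
    · exact zero_le
  have h2 : (S : ℂ) = ∫ b, Complex.exp (Complex.I * ((b * (t + r / 2) : ℝ) : ℂ)) *
      Φ.chi φ y p m b p' ∂γ := by
    have h3 : ∀ b : ℝ, Complex.exp (Complex.I * ((b * (t + r / 2) : ℝ) : ℂ)) * Φ.chi φ y p m b p' =
        ∑ v, (e v : ℂ) * Complex.exp (Complex.I * ((b * (x v + (t + r / 2)) : ℝ) : ℂ)) := by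
      intro b
      rw [chi, Finset.mul_sum]
      refine Finset.sum_congr rfl fun v _ => ?_
      rw [mul_left_comm, ← Complex.exp_add]
      congr 2
      simp only [hx]
      push_cast; ring
    have hint : ∀ c : ℝ, Integrable (fun b : ℝ => Complex.exp (Complex.I * ((b * c : ℝ) : ℂ))) γ := by
      intro c
      refine Integrable.of_bound (C := 1) (Continuous.aestronglyMeasurable (by fun_prop))
        (ae_of_all _ fun b => (norm_exp_I_mul _).le)
    simp_rw [h3]
    rw [integral_finsetSum _ fun v _ => (hint _).const_mul _]
    simp_rw [integral_const_mul, hγ, integral_exp_gaussianReal, hS]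
    push_cast
    rfl
  have h3 : ENNReal.ofReal S ≤ ∫⁻ b, ‖Φ.chi φ y p m b p'‖ₑ ∂γ := by
    calc ENNReal.ofReal S ≤ ‖(S : ℂ)‖ₑ := by
          rw [← ofReal_norm, Complex.norm_real]
          exact ENNReal.ofReal_le_ofReal (le_abs_self S)
      _ ≤ ∫⁻ b, ‖Complex.exp (Complex.I * ((b * (t + r / 2) : ℝ) : ℂ)) *
          Φ.chi φ y p m b p'‖ₑ ∂γ := by
          rw [h2]; exact enorm_integral_le_lintegral_enorm _
      _ = _ := by
          refine lintegral_congr fun b => ?_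
          rw [enorm_mul, ← ofReal_norm, norm_exp_I_mul, ENNReal.ofReal_one, one_mul]
  refine h1.trans ?_
  rw [ENNReal.ofReal_mul (Real.exp_pos _).le]
  gcongr

variable [MeasurableSpace 𝒜] [DiscreteMeasurableSpace 𝒜] {ν : Measure (ℕ → 𝒜)} {δ M : ℝ}

/-- The averaged characteristic functions of the fluctuations are small in mean. -/
lemma Regular.exists_lintegral_chi_le (R : Φ.Regular φ ν δ M) [IsProbabilityMeasure ν]
    (hnorm : Φ.IsNormalized φ) (hvar : Φ.SummableVariations φ) (hν : Φ.IsGibbs φ ν)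
    (hatoms : ∀ x : ℝ, Φ.proj ν {x} = 0) : ∃ C Θ ρ : ℝ, 0 < C ∧ 0 < Θ ∧ Θ < 1 ∧ 0 < ρ ∧ ρ < 1 ∧
      ∀ y ∈ Φ.shiftSpace, ν (cyl [y 0]) ≠ 0 → ∀ p ∈ Φ.I (y 0), ∀ r : ℝ, 0 < r → r ≤ 1 → ∀ m : ℕ,
        ∫⁻ z in cyl [y 0], ∫⁻ b, ‖Φ.chi φ y p m b (Φ.cod z)‖ₑ
          ∂(ProbabilityTheory.gaussianReal 0 (Real.toNNReal (r⁻¹ ^ 2))) ∂ν ≤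
          ENNReal.ofReal (C * (r ^ Θ + ρ ^ m)) := by
  obtain ⟨C, ε, ρ, hC, hε, hε1, hρ, hρ1, h⟩ :=
    R.exists_lintegral_norm_psi_sq_le hnorm hvar hν hatoms
  have hsρ : Real.sqrt ρ < 1 := by rw [Real.sqrt_lt' one_pos]; simpa using hρ1
  refine ⟨1 + 2 * C, ε / 4, Real.sqrt ρ, by positivity, by positivity, by linarith,
    Real.sqrt_pos.2 hρ, hsρ, fun y hy hy0 p hp r hr hr1 m => ?_⟩
  set γ := ProbabilityTheory.gaussianReal 0 (Real.toNNReal (r⁻¹ ^ 2)) with hγ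
  set D := C * (r ^ (ε / 2) + ρ ^ m) with hD
  have hD0 : 0 < D := by positivity
  -- The value that balances the two terms in s ≤ a + s²/a, which passes from the mean square to the
  -- mean.
  set a := Real.sqrt D with ha
  have ha0 : 0 < a := Real.sqrt_pos.2 hD0
  have haD : a * a = D := Real.mul_self_sqrt hD0.le
  have hmeas := measurable_chi (Φ := Φ) (φ := φ) y p m
  have hm2 : Measurable (Function.uncurry fun (z : ℕ → 𝒜) (b : ℝ) =>
      ‖Φ.chi φ y p m b (Φ.cod z)‖ₑ) :=
    (hmeas.comp (measurable_snd.prodMk (Φ.measurable_cod.comp measurable_fst))).enorm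
  rw [lintegral_lintegral_swap hm2.aemeasurable]
  have hone : ∀ b, ∫⁻ z in cyl [y 0], ‖Φ.chi φ y p m b (Φ.cod z)‖ₑ ∂ν ≤ 1 := by
    intro b
    calc _ ≤ ∫⁻ z in cyl [y 0], 1 ∂ν := by
          refine lintegral_mono fun z => ?_
          rw [← ofReal_norm, ← ENNReal.ofReal_one]
          exact ENNReal.ofReal_le_ofReal (norm_chi_le_one hnorm hy p m b _)
      _ ≤ 1 := by
          rw [setLIntegral_const, one_mul]; exact prob_le_one
  -- Frequencies below r^(-1/2) are discarded at the cost of their Gaussian mass r · r^(-1/2); the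
  -- decay is used for the others.
  have hlarge : ∀ b : ℝ, r ^ (-(1 / 2) : ℝ) < |b| →
      ∫⁻ z in cyl [y 0], ‖Φ.chi φ y p m b (Φ.cod z)‖ₑ ∂ν ≤ ENNReal.ofReal (2 * a) := by
    intro b hb
    have hr2 : 1 ≤ r ^ (-(1 / 2) : ℝ) := Real.one_le_rpow_of_pos_of_le_one_of_nonpos hr hr1 (by norm_num)
    have hb1 : 1 < |b| := hr2.trans_lt hb
    have h1 : ∫⁻ z in cyl [y 0], ENNReal.ofReal (‖Φ.chi φ y p m b (Φ.cod z)‖ ^ 2) ∂ν ≤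
        ENNReal.ofReal D := by
      calc _ = ∫⁻ z in cyl [y 0], ENNReal.ofReal (‖Φ.psi φ y b p m [] (Φ.coding z)‖ ^ 2) ∂ν := by
            refine setLIntegral_congr_fun_ae (measurableSet_cyl _) ?_
            filter_upwards [Φ.ae_good hν hatoms] with z hz hzc
            rw [Φ.cod_of_mem hz.1, chi_eq_psi hy hp (mem_cyl_singleton.1 hzc ▸ hz.2)]
        _ ≤ _ := h y hy hy0 p hp b hb1 m
        _ ≤ _ := by
            refine ENNReal.ofReal_le_ofReal ?_
            have h2 : |b| ^ (-ε) ≤ r ^ (ε / 2) := by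
              refine (Real.rpow_le_rpow_of_nonpos (by positivity) hb.le (by linarith)).trans_eq ?_
              rw [← Real.rpow_mul hr.le]
              congr 1; ring
            rw [hD]
            gcongr
    calc _ ≤ ∫⁻ z in cyl [y 0], (ENNReal.ofReal a + ENNReal.ofReal a⁻¹ *
          ENNReal.ofReal (‖Φ.chi φ y p m b (Φ.cod z)‖ ^ 2)) ∂ν := by
          refine lintegral_mono fun z => ?_
          rw [← ofReal_norm, ← ENNReal.ofReal_mul (by positivity),
            ← ENNReal.ofReal_add (by positivity) (by positivity)]
          refine ENNReal.ofReal_le_ofReal ?_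
          set s := ‖Φ.chi φ y p m b (Φ.cod z)‖ with hs
          have hs0 : 0 ≤ s := norm_nonneg _
          rcases le_total s a with h3 | h3
          · have : 0 ≤ a⁻¹ * s ^ 2 := by positivity
            linarith
          · have : s ≤ a⁻¹ * s ^ 2 := by
              rw [inv_mul_eq_div, le_div_iff₀ ha0]; nlinarith
            linarith
      _ ≤ ENNReal.ofReal a * 1 + ENNReal.ofReal a⁻¹ * ENNReal.ofReal D := by
          rw [lintegral_add_left measurable_const, setLIntegral_const,
            lintegral_const_mul' _ _ ENNReal.ofReal_ne_top]
          gcongr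
          exact prob_le_one
      _ = ENNReal.ofReal (2 * a) := by
          rw [mul_one, ← ENNReal.ofReal_mul (by positivity),
            ← ENNReal.ofReal_add ha0.le (by positivity)]
          congr 1
          rw [← haD]; field_simp; ring
  have hset : MeasurableSet {b : ℝ | |b| ≤ r ^ (-(1 / 2) : ℝ)} :=
    measurableSet_le measurable_norm measurable_const
  calc _ ≤ ∫⁻ b, ({b : ℝ | |b| ≤ r ^ (-(1 / 2) : ℝ)}.indicator 1 b + ENNReal.ofReal (2 * a)) ∂γ := by
        refine lintegral_mono fun b => ?_
        by_cases hb : |b| ≤ r ^ (-(1 / 2) : ℝ)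
        · rw [indicator_of_mem (show b ∈ {b : ℝ | |b| ≤ r ^ (-(1 / 2) : ℝ)} from hb)]
          exact (hone b).trans le_self_add
        · exact (hlarge b (not_le.1 hb)).trans le_add_self
    _ = γ {b : ℝ | |b| ≤ r ^ (-(1 / 2) : ℝ)} + ENNReal.ofReal (2 * a) := by
        rw [lintegral_add_right _ measurable_const, lintegral_indicator_one hset, lintegral_const,
          measure_univ, mul_one]
    _ ≤ ENNReal.ofReal (r * r ^ (-(1 / 2) : ℝ)) + ENNReal.ofReal (2 * a) := by
        gcongr
        exact gaussianReal_abs_le hr (by positivity)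
    _ ≤ _ := by
        rw [← ENNReal.ofReal_add (by positivity) (by positivity)]
        refine ENNReal.ofReal_le_ofReal ?_
        have h1 : r * r ^ (-(1 / 2) : ℝ) ≤ r ^ (ε / 4) := by
          nth_rewrite 1 [← Real.rpow_one r]
          rw [← Real.rpow_add hr]
          exact Real.rpow_le_rpow_of_exponent_ge hr hr1 (by linarith)
        have h2 : a ≤ C * (r ^ (ε / 4) + Real.sqrt ρ ^ m) := by
          rw [ha]
          refine Real.sqrt_le_iff.2 ⟨by positivity, ?_⟩
          have e1 : (r ^ (ε / 4)) ^ 2 = r ^ (ε / 2) := by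
            rw [← Real.rpow_natCast, ← Real.rpow_mul hr.le]
            congr 1; push_cast; ring
          have e2 : (Real.sqrt ρ ^ m) ^ 2 = ρ ^ m := by
            rw [← pow_mul, mul_comm, pow_mul, Real.sq_sqrt hρ.le]
          have e3 : 0 ≤ r ^ (ε / 4) * Real.sqrt ρ ^ m := by positivity
          have e4 : C ≤ C ^ 2 := by nlinarith
          have e5 : 0 ≤ r ^ (ε / 2) + ρ ^ m := by positivity
          calc D = C * (r ^ (ε / 2) + ρ ^ m) := hD
            _ ≤ C ^ 2 * (r ^ (ε / 2) + ρ ^ m) := by gcongr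
            _ ≤ C ^ 2 * (r ^ (ε / 4) + Real.sqrt ρ ^ m) ^ 2 := by
              gcongr
              rw [add_sq, e1, e2]
              linarith
            _ = _ := by ring
        have h3 : 0 ≤ Real.sqrt ρ ^ m := by positivity
        linarith

end MarkovIFS

/-! ### Averaging over the second point, and the conclusion under (MNL) -/

namespace MarkovIFS

variable {𝒜 : Type*} {α : ℝ} {Φ : MarkovIFS 𝒜 α} {φ : (ℕ → 𝒜) → ℝ}

lemma concS_le_mul {C₀ : ℝ≥0∞} {y y' : ℕ → 𝒜} (h : ∀ w : List 𝒜, Φ.W φ w y ≤ C₀ * Φ.W φ w y')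
    (h0 : y 0 = y' 0) (m : ℕ) (p p' r : ℝ) :
    Φ.concS φ m y p p' r ≤ C₀ * Φ.concS φ m y' p p' r := by
  classical
  refine iSup_le fun t => le_trans ?_ (mul_le_mul' le_rfl (le_iSup _ t))
  rw [conc, conc, ← ENNReal.tsum_mul_left, h0]
  refine ENNReal.tsum_le_tsum fun w => ?_
  split_ifs
  · exact h w.1
  · exact zero_le

variable [MeasurableSpace 𝒜] [DiscreteMeasurableSpace 𝒜] [Finite 𝒜] {ν : Measure (ℕ → 𝒜)} {δ M : ℝ}

/-- The mean-square bound averages over points of [d], whereas π(dz') with `z'` distributed by `ν`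
is needed. Since the weight of the letter `d` is at least M⁻¹, conformality turns the average over
`z'` into an integral over [d]. -/
lemma Regular.lintegral_avgConc_le (R : Φ.Regular φ ν δ M) [IsProbabilityMeasure ν]
    (hvar : Φ.SummableVariations φ) (hν : Φ.IsGibbs φ ν)
    (hatoms : ∀ x : ℝ, Φ.proj ν {x} = 0) {C₀ : ℝ} (hC₀ : ∀ w : List 𝒜, ∀ z ∈ Φ.shiftSpace,
      ∀ z' ∈ Φ.shiftSpace, z 0 = z' 0 → Φ.W φ w z ≤ ENNReal.ofReal C₀ * Φ.W φ w z')
    {m : ℕ} {r : ℝ} (hr : 0 < r) {B : ℝ≥0∞}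
    (hB : ∀ y ∈ Φ.shiftSpace, ν (cyl [y 0]) ≠ 0 → ∀ p ∈ Φ.I (y 0),
      ∫⁻ z in cyl [y 0], ∫⁻ b, ‖Φ.chi φ y p m b (Φ.cod z)‖ₑ
        ∂(ProbabilityTheory.gaussianReal 0 (Real.toNNReal (r⁻¹ ^ 2))) ∂ν ≤ B)
    {z : ℕ → 𝒜} (hz : Φ.Good z) : ∫⁻ z', Φ.avgConc φ ν m r z z' ∂ν ≤
      ENNReal.ofReal C₀ * (ENNReal.ofReal (Real.exp 1) * (ENNReal.ofReal M * B)) := by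
  classical
  have hM : 0 < M := zero_lt_one.trans_le R.one_le
  have hMM : ENNReal.ofReal M * ENNReal.ofReal M⁻¹ = 1 := by
    rw [← ENNReal.ofReal_mul hM.le, mul_inv_cancel₀ hM.ne', ENNReal.ofReal_one]
  -- One base sequence is fixed for every letter, and bounded distortion replaces all others by it.
  -- If no admissible sequence begins with `d`, the value is irrelevant.
  have hex : ∀ d : 𝒜, ∃ y : ℕ → 𝒜, (∃ y ∈ Φ.shiftSpace, y 0 = d) → y ∈ Φ.shiftSpace ∧ y 0 = d := by
    intro d
    by_cases h : ∃ y ∈ Φ.shiftSpace, y 0 = d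
    · obtain ⟨y, hy⟩ := h; exact ⟨y, fun _ => hy⟩
    · exact ⟨z, fun h' => absurd h' h⟩
  choose Y hY using hex
  set H : 𝒜 → (ℕ → 𝒜) → ℝ≥0∞ := fun d x =>
    ∫⁻ b, ‖Φ.chi φ (Y d) (Φ.coding (consSeq d z)) m b (Φ.cod x)‖ₑ
      ∂(ProbabilityTheory.gaussianReal 0 (Real.toNNReal (r⁻¹ ^ 2))) with hH
  have hHm : ∀ d, Measurable (H d) := fun d =>
    Measurable.lintegral_prod_right' (f := fun q : (ℕ → 𝒜) × ℝ =>
      ‖Φ.chi φ (Y d) (Φ.coding (consSeq d z)) m q.2 (Φ.cod q.1)‖ₑ)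
      (((measurable_chi (Y d) _ m).comp
        (measurable_snd.prodMk (Φ.measurable_cod.comp measurable_fst))).enorm)
  -- The weight of `d` is inserted so that conformality can be applied. The cut-off discards letters
  -- that cannot precede `z`, for which π(dz) has no meaning.
  set F : 𝒜 → (ℕ → 𝒜) → ℝ≥0∞ := fun d z' => if consSeq d z ∈ Φ.shiftSpace then
    Φ.W φ [d] z' * H d (app [d] z') else 0 with hF
  have hFm : ∀ d, Measurable (F d) := by
    intro d
    simp only [hF]
    split_ifs
    · exact (Φ.measurable_W hvar _).mul ((hHm d).comp (measurable_app _))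
    · exact measurable_const
  have hFB : ∀ d, ∫⁻ z', F d z' ∂ν ≤ B := by
    intro d
    simp only [hF]
    split_ifs with hd
    · rw [← Φ.conformal_word hvar hν (hHm d) [d]]
      obtain ⟨hYS, hY0⟩ := hY d ⟨_, hd, rfl⟩
      by_cases h0 : ν (cyl [d]) = 0
      · rw [Measure.restrict_eq_zero.2 h0]; simp
      · have hp := (hz.app Φ (w := [d]) hd).1.2
        have := hB (Y d) hYS (by rwa [hY0]) (Φ.coding (consSeq d z)) (by rw [hY0]; exact hp)
        rwa [hY0] at this
    · simp
  set c := ENNReal.ofReal C₀ * (ENNReal.ofReal (Real.exp 1) * ENNReal.ofReal M) with hc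
  have hpt : ∀ᵐ z' ∂ν, Φ.avgConc φ ν m r z z' ≤ ∑' e, ∑' d, ν (cyl [d, e]) * (c * F d z') := by
    filter_upwards [Φ.ae_good hν hatoms] with z' hz'
    refine avgConc_le_tsum hν fun d e hcp hcp' y hy hyd => ?_
    obtain ⟨hYS, hY0⟩ := hY d ⟨y, hy, hyd⟩
    have hp := (hz.app Φ (w := [d]) hcp.2.1).1
    have hp' := (hz'.app Φ (w := [d]) hcp'.2.1).1
    refine (concS_le_mul (fun w => hC₀ w y hy (Y d) hYS (hyd.trans hY0.symm))
      (hyd.trans hY0.symm) m _ _ r).trans ?_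
    rw [hc, mul_assoc, mul_assoc]
    gcongr
    refine (concS_le_lintegral_chi hYS (by rw [hY0]; exact hp.2) (by rw [hY0]; exact hp'.2) m
      hr).trans ?_
    gcongr
    simp only [hF]
    rw [if_pos hcp.2.1, W_singleton]
    have h1 : H d (app [d] z') = ∫⁻ b, ‖Φ.chi φ (Y d) (Φ.coding (consSeq d z)) m b
        (Φ.coding (consSeq d z'))‖ₑ
        ∂(ProbabilityTheory.gaussianReal 0 (Real.toNNReal (r⁻¹ ^ 2))) := by
      simp only [hH]
      rw [Φ.cod_of_mem hp'.1]
      rfl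
    rw [h1]
    calc _ = ENNReal.ofReal M * (ENNReal.ofReal M⁻¹ * ∫⁻ b, ‖Φ.chi φ (Y d)
          (Φ.coding (consSeq d z)) m b (Φ.coding (consSeq d z'))‖ₑ
          ∂(ProbabilityTheory.gaussianReal 0 (Real.toNNReal (r⁻¹ ^ 2)))) := by
          rw [← mul_assoc, hMM, one_mul]
      _ ≤ _ := by
          gcongr
          exact R.om_ge _ hcp'.2.1
  calc _ ≤ ∫⁻ z', ∑' e, ∑' d, ν (cyl [d, e]) * (c * F d z') ∂ν := lintegral_mono_ae hpt
    _ = ∑' e, ∑' d, ν (cyl [d, e]) * (c * ∫⁻ z', F d z' ∂ν) := by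
        have hm : ∀ e d, Measurable fun z' => ν (cyl [d, e]) * (c * F d z') := fun e d =>
          ((hFm d).const_mul _).const_mul _
        rw [lintegral_tsum fun e => (Measurable.tsum fun d => hm e d).aemeasurable]
        refine tsum_congr fun e => ?_
        rw [lintegral_tsum fun d => (hm e d).aemeasurable]
        refine tsum_congr fun d => ?_
        rw [lintegral_const_mul _ ((hFm d).const_mul _), lintegral_const_mul _ (hFm d)]
    _ ≤ ∑' e, ∑' d, ν (cyl [d, e]) * (c * B) := by
        refine ENNReal.tsum_le_tsum fun e => ENNReal.tsum_le_tsum fun d => ?_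
        gcongr
        exact hFB d
    _ = _ := by
        simp_rw [ENNReal.tsum_mul_right]
        rw [tsum_measure_cyl_two, one_mul, hc]
        simp only [mul_assoc]

theorem MNL.qnl (hM : Φ.MNL φ ν) (hα : 0 < α)
    (hnorm : Φ.IsNormalized φ) (hvar : Φ.SummableVariations φ) (hν : Φ.IsGibbs φ ν)
    [IsProbabilityMeasure ν] (hatoms : ∀ x : ℝ, Φ.proj ν {x} = 0) :
    Φ.QNL fun a => ν (cyl a) := by
  obtain ⟨γ, q, hT⟩ := Φ.exists_tail_of_finite hnorm
  obtain ⟨θ, C', hθ, hC', hF⟩ := hT.frostman Φ hnorm hvar hν hatoms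
  obtain ⟨δ, M, R⟩ := hM.exists_regular hα hnorm hvar hν hatoms
  obtain ⟨C₀, hC₀1, hC₀⟩ := Φ.exists_W_distortion hvar
  obtain ⟨C, Θ, ρ, hC, hΘ, hΘ1, hρ, hρ1, h⟩ := R.exists_lintegral_chi_le hnorm hvar hν hatoms
  have hM1 := R.one_le
  refine Φ.qnl_of_lintegral_avgConc_le hvar hν hatoms hα hθ hC' hF hΘ hΘ1 hρ hρ1
    (C := 1 + C₀ * (Real.exp 1 * (M * C))) (by positivity) fun n r hr => ?_
  have hρn : 0 < ρ ^ n := pow_pos hρ n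
  have hK : 0 ≤ C₀ * (Real.exp 1 * (M * C)) := by positivity
  have hrΘ : 0 < r ^ Θ := by positivity
  rcases lt_or_ge 1 r with hr1 | hr1
  · refine (lintegral_avgConc_le_one hnorm hν n r).trans ?_
    rw [← ENNReal.ofReal_one]
    refine ENNReal.ofReal_le_ofReal ?_
    have h1 : 1 ≤ r ^ Θ := Real.one_le_rpow hr1.le hΘ.le
    nlinarith
  · calc _ ≤ ∫⁻ _, ENNReal.ofReal C₀ * (ENNReal.ofReal (Real.exp 1) * (ENNReal.ofReal M *
          ENNReal.ofReal (C * (r ^ Θ + ρ ^ n)))) ∂ν := by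
          refine lintegral_mono_ae ?_
          filter_upwards [Φ.ae_good hν hatoms] with z hz
          exact R.lintegral_avgConc_le hvar hν hatoms hC₀ hr
            (fun y hy hy0 p hp => h y hy hy0 p hp r hr hr1 n) hz
      _ = ENNReal.ofReal (C₀ * (Real.exp 1 * (M * (C * (r ^ Θ + ρ ^ n))))) := by
          rw [lintegral_const, measure_univ, mul_one, ENNReal.ofReal_mul (p := C₀) (by linarith),
            ENNReal.ofReal_mul (p := Real.exp 1) (Real.exp_pos _).le, ENNReal.ofReal_mul (p := M) (by linarith)]
      _ ≤ _ := by
          refine ENNReal.ofReal_le_ofReal ?_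
          nlinarith

end MarkovIFS

theorem mainTheorem2 {𝒜 : Type*} [Countable 𝒜] [MeasurableSpace 𝒜] [DiscreteMeasurableSpace 𝒜]
    {α : ℝ} (hα : 0 < α) (hα1 : α ≤ 1) (Φ : MarkovIFS 𝒜 α)
    (φ : (ℕ → 𝒜) → ℝ) (hnorm : Φ.IsNormalized φ) (hvar : Φ.SummableVariations φ)
    (ν : Measure (ℕ → 𝒜)) [IsProbabilityMeasure ν] (hν : Φ.IsGibbs φ ν)
    (hatoms : ∀ x : ℝ, Φ.proj ν {x} = 0)
    (h : ((Finite 𝒜 ∨ Φ.LightTail φ) ∧ Φ.UNI) ∨ (Finite 𝒜 ∧ Φ.MNL φ ν)) :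
    Φ.QNL (fun a => ν (cyl a)) ∧
      (Φ.NoOverlap → Φ.QNL (fun a => Φ.proj ν (Φ.cylInterval a))) := by
  have h1 : Φ.QNL (fun a => ν (cyl a)) := by
    rcases h with ⟨hfin, hU⟩ | ⟨hfin, hM⟩
    · obtain ⟨γ, q, hT⟩ : ∃ γ q, Φ.Tail φ γ q := by
        rcases hfin with hfin | hL
        · exact Φ.exists_tail_of_finite hnorm
        · exact hL.exists_tail Φ
      exact hU.qnl hα hT hnorm hvar hν hatoms
    · exact hM.qnl hα hnorm hvar hν hatoms
  exact ⟨h1, fun hno => h1.congr fun n a => hno.proj_cylInterval hvar hν hatoms a⟩
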